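/- **Setting.** Let $\rho,k,\gamma$ be real functions on $[0,\infty)$, extended evenly to $\mathbb R$ and denoted by the same letters. Assume that $\rho,k\in C^1[0,\infty)$ are positive, $\rho k\in C^2[0,\infty)$, $(\rho k)'(0)=0$, and $\sigma(x)=\int_0^x\sqrt{\rho/k}\,d\xi\to+\infty$ as $x\to+\infty$. Put $$Q_1=\sqrt{k/\rho}\,\frac{(k\rho)'}{4k\rho},\qquad Q_2=\sqrt{k/\rho}\,Q_1'+Q_1^2,\qquad q=Q_2-\gamma,$$ and assume $q\in L^\infty(0,\infty)\cap C^1[0,\infty)$ and $\sqrt{\rho/k}\,q\,\sigma\in L^1(0,\infty)$. Let $r=q\circ\sigma^{-1}$, $\sigma_0(x)=\int_x^\infty|r|\,d\xi$, $R=\int_0^\infty\xi|r(\xi)|\,d\xi$. *Spaces.* $\mathbb D\varphi=\sqrt{k/\rho}\,\varphi'+Q_1\varphi$ (with $\varphi'$ in the distributional sense); $\mathbb H^1$ is the space of all $\varphi\in L^2_\rho(\mathbb R)$ with $\mathbb D\varphi\in L^2_\rho(\mathbb R)$, with the norm $([\![\varphi]\!]^1)^2=\|\varphi\|_{L^2_\rho}^2+\|\mathbb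 D\varphi\|_{L^2_\rho}^2$, where $L^2_\rho=L^2(\mathbb R,\rho\,dx)$; $\mathbb H^{-1}$ is its dual, in which $f\in L^2_\rho$ acts by $\langle\langle f,\varphi\rangle\rangle=\int f\varphi\rho\,dx$, $\mathbb D^2f$ (for $f\in\mathbb H^1$) by $-\langle\langle\mathbb Df,\mathbb D\varphi\rangle\rangle$, and $\delta$ by $\varphi(0)$. Hats denote the subspaces of even elements. For $\rho=k=1$ these spaces are $H^1$ (with norm $\|\cdot\|^1$), $H^{-1}$. *Systems.* For $u\in L^\infty(0,T)$ and $W^0\in\widehat{\mathbb H}^1$, a solution of $$W_t=\mathbb D^2W-qW-2\sqrt{(\rho k)(0)}\,u\,\delta\ \text{ on }\mathbb R\times(0,T),\qquad W(\cdot,0)=W^0, \tag{1}$$ is a map $W:[0,T]\to\widehat{\mathbb H}^1$ with $W(\cdot,0)=W^0$ that is absolutely continuous as an $\mathbb H^{-1}$-valued map and whose $\mathbb H^{-1}$-norm derivative exists and equals the right-hand side for a.e. $t\in(0,T)$. The constant-coefficient system is the case $\rho=k=1$, $\gamma=0$: $$Z_t=Z_{\xi\xi}-2u\,\delta,\qquad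 Z(\cdot,0)=Z^0. \tag{2}$$ *Operators.* Let $\Omega=\{y_2>y_1>0\}$. The kernel $K\in C^2(\Omega)\cap C(\overline\Omega)$ is the unique solution of $$K_{y_1y_1}-K_{y_2y_2}=r(y_1)K\ \text{ on }\Omega,\qquad K(y,y)=\tfrac12\int_y^\infty r\,d\xi\ (y>0),\qquad \lim_{y_1+y_2\to\infty}K=0$$ (if $r(\lambda)\to0$ as $\lambda\to\infty$, then also $K_{y_1},K_{y_2}\to0$ as $y_1+y_2\to\infty$), and $L\in C^2(\Omega)\cap C(\overline\Omega)$ is the unique solution of $L(y_1,y_2)+K(y_1,y_2)+\int_{y_1}^{y_2}L(y_1,\xi)K(\xi,y_2)\,d\xi=0$ on $\Omega$. Put $\mathbf S\psi=(\rho k)^{-1/4}\,(\psi\circ\sigma)$, $\mathbf S^{-1}\varphi=(\sqrt[4]{\rho k}\,\varphi)\circ\sigma^{-1}$, and $$\widehat{\mathbf T}_rg(\lambda)=g(\lambda)+\int_{|\lambda|}^\infty K(|\lambda|,\xi)g(\xi)\,d\xi,\qquad \widehat{\mathbf T}_r^{-1}f(\xi)=f(\xi)+\int_{|\xi|}^\infty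 L(|\xi|,\lambda)f(\lambda)\,d\lambda,$$ $\widehat{\mathbb T}=\mathbf S\widehat{\mathbf T}_r$ and $\widehat{\mathbb T}^{-1}=\widehat{\mathbf T}_r^{-1}\mathbf S^{-1}$. **Theorem.** The kernels $K,L$ exist, are unique, and satisfy: $K(y,\cdot),L(y,\cdot)\in L^2(y,\infty)$ for $y\ge0$; the one-sided derivatives $K_{y_1}(0,x),L_{y_1}(0,x)$ exist for $x>0$, $K_{y_1}(0,\cdot)\in L^1(0,\infty)\cap L^2(0,\infty)$ and $L_{y_1}(0,\cdot)\in L^2(0,\infty)$; and there is a constant $M_1>0$ with $$|K_{y_1}(y_1,y_2)|\le\tfrac14\left|r\left(\tfrac{y_1+y_2}2\right)\right|+M_1\sigma_0\left(\tfrac{y_1+y_2}2\right)\quad\text{on }\Omega. \tag{3}$$ There is a constant $E_2>0$ and, for every $M_1>0$ satisfying (3), a constant $E_3>0$ ($E_2$ and $E_3$ depend on neither $T$, $u^{\rho k\gamma}$, $W$ nor $W^0$), such that the following holds for every $T>0$. Let $W$ be a solution of (1) with $u=u^{\rho k\gamma}\in L^\infty(0,T)$ and $W^0\in\widehat{\mathbb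 H}^1$, and let $Z(\cdot,t)=\widehat{\mathbb T}^{-1}W(\cdot,t)$, $t\in[0,T]$, $Z^0=\widehat{\mathbb T}^{-1}W^0$ (so that $\widehat{\mathbb T}Z(\cdot,t)=W(\cdot,t)$ and $\widehat{\mathbb T}Z^0=W^0$). Then: 1. $Z$ is a solution of (2) with the control $u=u^{110}\in L^\infty(0,T)$, $$u^{110}(t)=\sqrt[4]{(\rho k)(0)}\,u^{\rho k\gamma}(t)+\tfrac12\sqrt[4]{(\rho k)(0)}\,W(0^+,t)\int_0^\infty r\,d\mu+\int_0^\infty L_{y_1}(0,x)\,(\mathbf S^{-1}W)(x,t)\,dx .$$ 2. $u^{110}$ is the unique solution in $L^\infty(0,T)$ of $v(t)=f(t)+\int_0^tP(t-\xi)v(\xi)\,d\xi$ for a.e. $t\in(0,T)$, where, with $h_t(x)=\frac{e^{-x^2/(4t)}}{\sqrt{4\pi t}}$, $$f(t)=\sqrt[4]{(\rho k)(0)}\,u^{\rho k\gamma}(t)+\tfrac12\int_0^\infty r\,d\mu\int_{-\infty}^\infty h_t(x)Z^0(x)\,dx-\int_0^\infty K_{y_1}(0,x)\,(h_t*Z^0)(x)\,dx,$$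 $$P(t)=\frac1{\sqrt{\pi t}}\left(\int_0^\infty K_{y_1}(0,x)e^{-x^2/(4t)}dx-\tfrac12\int_0^\infty r\,d\mu\right),\qquad |P(t)|\le\frac{\sigma_0(0)+2M_1R}{\sqrt{\pi t}}\quad(t>0).$$ 3. $\|Z(\cdot,t)\|^1\le E_2[\![W(\cdot,t)]\!]^1$ for $t\in[0,T]$, and $$\|u^{110}\|_{L^\infty(0,T)}\le G_1(T)\left(\|u^{\rho k\gamma}\|_{L^\infty(0,T)}+E_3[\![W^0]\!]^1\right),$$ $$G_1(T)=\sqrt[4]{(\rho k)(0)}\;e^{(\sigma_0(0)+2M_1R)^2T}\left(1+2\sqrt{\tfrac T\pi}\,\big(\sigma_0(0)+2M_1R\big)\right).$$ -/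

import Mathlib

open MeasureTheory Set Filter Topology
open scoped ENNReal

noncomputable section

namespace NeumannHeat

/-! ### Coefficients. The functions `ρ k γ : ℝ → ℝ` stand for the even extensions to `ℝ`
of the coefficients given on `[0, +∞)`. -/

/-- `σ(x) = ∫₀ˣ √(ρ/k)`. -/
def sigmaFn (ρ k : ℝ → ℝ) (x : ℝ) : ℝ := ∫ ξ in (0 : ℝ)..x, √(ρ ξ / k ξ)

/-- The inverse function `σ⁻¹` (`σ` is a bijection of `ℝ` for admissible coefficients). -/
def sigmaInv (ρ k : ℝ → ℝ) : ℝ → ℝ := Function.invFun (sigmaFn ρ k)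

/-- `Q₁(ρ,k) = √(k/ρ) (kρ)' / (4kρ)`. -/
def Q1 (ρ k : ℝ → ℝ) (x : ℝ) : ℝ :=
  √(k x / ρ x) * deriv (fun y => k y * ρ y) x / (4 * k x * ρ x)

/-- `Q₂(ρ,k) = √(k/ρ) Q₁' + Q₁²`. -/
def Q2 (ρ k : ℝ → ℝ) (x : ℝ) : ℝ := √(k x / ρ x) * deriv (Q1 ρ k) x + Q1 ρ k x ^ 2

/-- `q = Q₂(ρ,k) - γ`. -/
def pot (ρ k γ : ℝ → ℝ) (x : ℝ) : ℝ := Q2 ρ k x - γ x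

/-- `r = q ∘ σ⁻¹`. -/
def rFn (ρ k γ : ℝ → ℝ) (l : ℝ) : ℝ := pot ρ k γ (sigmaInv ρ k l)

/-- `⁴√((ρk)(0))`. -/
def c0 (ρ k : ℝ → ℝ) : ℝ := (ρ 0 * k 0) ^ (1 / 4 : ℝ)

/-- The standing assumptions on the coefficients. -/
structure Admissible (ρ k γ : ℝ → ℝ) : Prop where
  even_rho : ∀ x, ρ (-x) = ρ x
  even_k : ∀ x, k (-x) = k x
  even_gamma : ∀ x, γ (-x) = γ x
  smooth_rho : ContDiffOn ℝ 1 ρ (Ici 0)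
  smooth_k : ContDiffOn ℝ 1 k (Ici 0)
  pos_rho : ∀ x, 0 ≤ x → 0 < ρ x
  pos_k : ∀ x, 0 ≤ x → 0 < k x
  smooth_rho_k : ContDiffOn ℝ 2 (fun x => ρ x * k x) (Ici 0)
  deriv_zero : derivWithin (fun x => ρ x * k x) (Ici 0) 0 = 0
  sigma_tendsto : Tendsto (sigmaFn ρ k) atTop atTop
  pot_bounded : MemLp (pot ρ k γ) ∞ (volume.restrict (Ioi 0))
  pot_smooth : ContDiffOn ℝ 1 (pot ρ k γ) (Ici 0)
  pot_integrable :
    IntegrableOn (fun x => √(ρ x / k x) * pot ρ k γ x * sigmaFn ρ k x) (Ioi 0)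

/-! ### The modified Sobolev space `ℍ¹`, its dual `ℍ⁻¹`, and the control system -/

/-- `g` is the derivative of `f` in the sense of distributions on `ℝ`. -/
structure HasWeakDeriv (f g : ℝ → ℝ) : Prop where
  locInt : LocallyIntegrable f
  locInt_deriv : LocallyIntegrable g
  parts : ∀ η : ℝ → ℝ, ContDiff ℝ ((⊤ : ℕ∞) : WithTop ℕ∞) η → HasCompactSupport η →
    ∫ x, f x * deriv η x = - ∫ x, g x * η x

lemma HasWeakDeriv.zero : HasWeakDeriv (fun _ => 0) (fun _ => 0) where
  locInt := locallyIntegrable_const 0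
  locInt_deriv := locallyIntegrable_const 0
  parts := by simp

lemma integrable_mul_of_compact {f η : ℝ → ℝ} (hf : LocallyIntegrable f)
    (hη : Continuous η) (hc : HasCompactSupport η) : Integrable (fun x => f x * η x) := by
  simpa [mul_comm, smul_eq_mul] using
    hf.integrable_smul_left_of_hasCompactSupport hη hc

lemma HasWeakDeriv.add {f g f' g' : ℝ → ℝ} (h : HasWeakDeriv f g) (h' : HasWeakDeriv f' g') :
    HasWeakDeriv (fun x => f x + f' x) (fun x => g x + g' x) where
  locInt := h.locInt.add h'.locInt
  locInt_deriv := h.locInt_deriv.add h'.locInt_deriv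
  parts := by
    intro η hη hc
    have hd : Continuous (deriv η) := hη.continuous_deriv (by exact_mod_cast le_top)
    simp only [add_mul]
    rw [integral_add (integrable_mul_of_compact h.locInt hd hc.deriv)
        (integrable_mul_of_compact h'.locInt hd hc.deriv),
      integral_add (integrable_mul_of_compact h.locInt_deriv hη.continuous hc)
        (integrable_mul_of_compact h'.locInt_deriv hη.continuous hc),
      h.parts η hη hc, h'.parts η hη hc]
    ring

lemma HasWeakDeriv.smul {f g : ℝ → ℝ} (h : HasWeakDeriv f g) (c : ℝ) :
    HasWeakDeriv (fun x => c * f x) (fun x => c * g x) where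
  locInt := h.locInt.smul c
  locInt_deriv := h.locInt_deriv.smul c
  parts := by
    intro η hη hc
    simp only [mul_assoc, integral_const_mul]
    rw [h.parts η hη hc]
    ring

/-- The measure `ρ dx`. -/
def wMeasure (ρ : ℝ → ℝ) : Measure ℝ := volume.withDensity (fun x => ENNReal.ofReal (ρ x))

/-- The space `L²_ρ(ℝ)`. -/
abbrev L2w (ρ : ℝ → ℝ) : Type := Lp ℝ 2 (wMeasure ρ)

/-- The space `ℍ¹` of all `φ ∈ L²_ρ(ℝ)` such that `𝔻 φ = √(k/ρ) φ' + Q₁ φ ∈ L²_ρ(ℝ)`.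
It is realised as the set of pairs `(φ, 𝔻 φ)`; the norm inherited from the `ℓ²`-product is
`(‖φ‖² + ‖𝔻 φ‖²)^(1/2)`. For `ρ = k = 1` it is the Sobolev space `H¹`. -/
def H1 (ρ k : ℝ → ℝ) : Submodule ℝ (WithLp 2 (L2w ρ × L2w ρ)) where
  carrier := {p | ∃ f g : ℝ → ℝ, HasWeakDeriv f g ∧ ⇑p.fst =ᵐ[wMeasure ρ] f ∧
    ⇑p.snd =ᵐ[wMeasure ρ] fun x => √(k x / ρ x) * g x + Q1 ρ k x * f x}
  zero_mem' := by
    refine ⟨_, _, HasWeakDeriv.zero, ?_, ?_⟩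
    · exact Lp.coeFn_zero _ _ _
    · filter_upwards [Lp.coeFn_zero ℝ 2 (wMeasure ρ)] with x hx
      rw [WithLp.zero_snd, hx]
      simp
  add_mem' := by
    rintro a b ⟨f, g, h, h1, h2⟩ ⟨f', g', h', h1', h2'⟩
    refine ⟨_, _, h.add h', ?_, ?_⟩
    · filter_upwards [Lp.coeFn_add a.fst b.fst, h1, h1'] with x hx e1 e2
      rw [WithLp.add_fst, hx, Pi.add_apply, e1, e2]
    · filter_upwards [Lp.coeFn_add a.snd b.snd, h2, h2'] with x hx e1 e2
      rw [WithLp.add_snd, hx, Pi.add_apply, e1, e2]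
      ring
  smul_mem' := by
    rintro c a ⟨f, g, h, h1, h2⟩
    refine ⟨_, _, h.smul c, ?_, ?_⟩
    · filter_upwards [Lp.coeFn_smul c a.fst, h1] with x hx e1
      rw [WithLp.smul_fst, hx, Pi.smul_apply, e1, smul_eq_mul]
    · filter_upwards [Lp.coeFn_smul c a.snd, h2] with x hx e1
      rw [WithLp.smul_snd, hx, Pi.smul_apply, e1, smul_eq_mul]
      ring

/-- `φ ∈ ℍ¹` as an element of `L²_ρ(ℝ)`. -/
def valL {ρ k : ℝ → ℝ} (φ : H1 ρ k) : L2w ρ := φ.1.fst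

/-- `𝔻 φ ∈ L²_ρ(ℝ)` for `φ ∈ ℍ¹`. -/
def derL {ρ k : ℝ → ℝ} (φ : H1 ρ k) : L2w ρ := φ.1.snd

/-- `φ ∈ ℍ¹` is even. -/
def IsEven {ρ k : ℝ → ℝ} (φ : H1 ρ k) : Prop := (fun x => valL φ (-x)) =ᵐ[volume] valL φ

/-- The continuous representative of a function that has one. -/
def contRep (f : ℝ → ℝ) : ℝ → ℝ :=
  Classical.epsilon fun g : ℝ → ℝ => Continuous g ∧ g =ᵐ[volume] f

/-- The dual space `ℍ⁻¹` with its norm. -/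
abbrev HNeg (ρ k : ℝ → ℝ) : Type := StrongDual ℝ (H1 ρ k)

/-- The embedding `ℍ¹ ⊂ L²_ρ ⊂ ℍ⁻¹`, `⟨⟨f, φ⟩⟩ = ∫ f φ ρ dx`. -/
def toNeg {ρ k : ℝ → ℝ} (f : H1 ρ k) : HNeg ρ k :=
  (innerSL ℝ (valL f)).comp ((WithLp.fstL 2 ℝ (L2w ρ) (L2w ρ)).comp (H1 ρ k).subtypeL)

/-- The value `⟨⟨𝔻² f - q f - 2 √((ρk)(0)) a δ, φ⟩⟩`, where `⟨⟨𝔻² f, φ⟩⟩ = -⟨⟨𝔻 f, 𝔻 φ⟩⟩`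
and `⟨⟨δ, φ⟩⟩ = φ(0)`. -/
def rhs (ρ k γ : ℝ → ℝ) (f : H1 ρ k) (a : ℝ) (φ : H1 ρ k) : ℝ :=
  - (∫ x, derL f x * derL φ x ∂(wMeasure ρ))
    - (∫ x, pot ρ k γ x * valL f x * valL φ x ∂(wMeasure ρ))
    - 2 * √(ρ 0 * k 0) * a * contRep (valL φ) 0

/-- `W` is a solution of `W_t = 𝔻² W - q W - 2 √((ρk)(0)) u δ` on `ℝ × (0,T)`, `W(·,0) = W⁰`,
with `W : [0,T] → ℍ¹` even and `W_t` with values in `ℍ⁻¹`: as an `ℍ⁻¹`-valued function, `W` is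
absolutely continuous on `[0,T]`, and its derivative in the norm of `ℍ⁻¹` exists and equals the
right-hand side for a.e. `t`. -/
structure IsSolution (ρ k γ : ℝ → ℝ) (T : ℝ) (u : ℝ → ℝ) (W0 : H1 ρ k) (W : ℝ → H1 ρ k) :
    Prop where
  even : ∀ t ∈ Icc 0 T, IsEven (W t)
  init : W 0 = W0
  absCont : AbsolutelyContinuousOnInterval (fun t => toNeg (W t)) 0 T
  eqn : ∀ᵐ t ∂(volume.restrict (Ioo 0 T)), ∃ V : HNeg ρ k,
    HasDerivAt (fun s => toNeg (W s)) V t ∧ ∀ φ : H1 ρ k, V φ = rhs ρ k γ (W t) (u t) φ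

/-! ### The transformation operators -/

/-- `Ω = {y₂ > y₁ > 0}`. -/
def Om : Set (ℝ × ℝ) := {p | 0 < p.1 ∧ p.1 < p.2}

/-- The closure of `Ω`. -/
def OmBar : Set (ℝ × ℝ) := {p | 0 ≤ p.1 ∧ p.1 ≤ p.2}

/-- The filter `y₁ + y₂ → ∞` on `Ω`. -/
def OmAtTop : Filter (ℝ × ℝ) := comap (fun p => p.1 + p.2) atTop ⊓ 𝓟 Om

/-- `K` is the transformation kernel of the potential `r`. -/
structure IsTransformationKernel (r : ℝ → ℝ) (K : ℝ → ℝ → ℝ) : Prop where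
  smooth : ContDiffOn ℝ 2 (fun p : ℝ × ℝ => K p.1 p.2) Om
  cont : ContinuousOn (fun p : ℝ × ℝ => K p.1 p.2) OmBar
  wave : ∀ y₁ y₂, 0 < y₁ → y₁ < y₂ →
    iteratedDeriv 2 (fun y => K y y₂) y₁ - iteratedDeriv 2 (fun y => K y₁ y) y₂ = r y₁ * K y₁ y₂
  diag : ∀ y, 0 < y → K y y = 1 / 2 * ∫ ξ in Ioi y, r ξ
  decay : Tendsto (fun p : ℝ × ℝ => K p.1 p.2) OmAtTop (𝓝 0)

/-- `L` is the kernel of the inverse operator. -/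
structure IsInverseKernel (K L : ℝ → ℝ → ℝ) : Prop where
  smooth : ContDiffOn ℝ 2 (fun p : ℝ × ℝ => L p.1 p.2) Om
  cont : ContinuousOn (fun p : ℝ × ℝ => L p.1 p.2) OmBar
  eqn : ∀ y₁ y₂, 0 < y₁ → y₁ < y₂ →
    L y₁ y₂ + K y₁ y₂ + ∫ ξ in y₁..y₂, L y₁ ξ * K ξ y₂ = 0

/-- The transformation kernel `K` of `r`. -/
def kerK (r : ℝ → ℝ) : ℝ → ℝ → ℝ := Classical.epsilon (IsTransformationKernel r)

/-- The inverse kernel `L` of `r`. -/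
def kerL (r : ℝ → ℝ) : ℝ → ℝ → ℝ := Classical.epsilon (IsInverseKernel (kerK r))

/-- The one-sided derivative `N_{y₁}(0, x)`. -/
def d1zero (N : ℝ → ℝ → ℝ) (x : ℝ) : ℝ := derivWithin (fun y => N y x) (Ici 0) 0

/-- `S ψ = (ψ ∘ σ) / ⁴√(ρk)`. -/
def opS (ρ k : ℝ → ℝ) (ψ : ℝ → ℝ) (x : ℝ) : ℝ :=
  ψ (sigmaFn ρ k x) / (ρ x * k x) ^ (1 / 4 : ℝ)

/-- `S⁻¹ φ = (⁴√(ρk) φ) ∘ σ⁻¹`. -/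
def opSinv (ρ k : ℝ → ℝ) (φ : ℝ → ℝ) (l : ℝ) : ℝ :=
  (ρ (sigmaInv ρ k l) * k (sigmaInv ρ k l)) ^ (1 / 4 : ℝ) * φ (sigmaInv ρ k l)

/-- `g(λ) + ∫_{|λ|}^∞ N(|λ|, ξ) g(ξ) dξ`. -/
def opKer (N : ℝ → ℝ → ℝ) (g : ℝ → ℝ) (l : ℝ) : ℝ := g l + ∫ ξ in Ioi |l|, N |l| ξ * g ξ

/-- The transformation operator `T̂ = S T_r`. -/
def opT (ρ k γ : ℝ → ℝ) (g : ℝ → ℝ) : ℝ → ℝ := opS ρ k (opKer (kerK (rFn ρ k γ)) g)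

/-- The inverse operator `T̂⁻¹ = T_r⁻¹ S⁻¹`. -/
def opTinv (ρ k γ : ℝ → ℝ) (f : ℝ → ℝ) : ℝ → ℝ := opKer (kerL (rFn ρ k γ)) (opSinv ρ k f)

/-! ### Constants, the control of the transformed system, and its Volterra equation -/

/-- `σ₀(x) = ∫ₓ^∞ |r|`. -/
def sigma0 (r : ℝ → ℝ) (x : ℝ) : ℝ := ∫ ξ in Ioi x, |r ξ|

/-- `R = ∫₀^∞ ξ |r(ξ)| dξ`. -/
def Rconst (r : ℝ → ℝ) : ℝ := ∫ ξ in Ioi (0 : ℝ), ξ * |r ξ|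

/-- `|K_{y₁}(y₁,y₂)| ≤ |r((y₁+y₂)/2)|/4 + M₁ σ₀((y₁+y₂)/2)` on `Ω`. -/
def KernelDerivBound (r : ℝ → ℝ) (M₁ : ℝ) : Prop :=
  ∀ y₁ y₂, 0 < y₁ → y₁ < y₂ →
    |deriv (fun y => kerK r y y₂) y₁| ≤
      1 / 4 * |r ((y₁ + y₂) / 2)| + M₁ * sigma0 r ((y₁ + y₂) / 2)

/-- `G₁(T)`. -/
def G1 (ρ k γ : ℝ → ℝ) (M₁ T : ℝ) : ℝ :=
  c0 ρ k * Real.exp ((sigma0 (rFn ρ k γ) 0 + 2 * M₁ * Rconst (rFn ρ k γ)) ^ 2 * T) *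
    (1 + 2 * √(T / Real.pi) * (sigma0 (rFn ρ k γ) 0 + 2 * M₁ * Rconst (rFn ρ k γ)))

/-- `L^∞(0,T)`. -/
def MemLinf (T : ℝ) (u : ℝ → ℝ) : Prop := MemLp u ∞ (volume.restrict (Ioo 0 T))

/-- The norm of `L^∞(0,T)`. -/
def linfNorm (T : ℝ) (u : ℝ → ℝ) : ℝ := (eLpNorm u ∞ (volume.restrict (Ioo 0 T))).toReal

/-- The control `u¹¹⁰`; `W(0⁺,t)` is the value at `0` of the continuous representative. -/
def control110 (ρ k γ : ℝ → ℝ) (u : ℝ → ℝ) (W : ℝ → H1 ρ k) (t : ℝ) : ℝ :=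
  c0 ρ k * u t
    + 1 / 2 * c0 ρ k * contRep (valL (W t)) 0 * (∫ μ in Ioi (0 : ℝ), rFn ρ k γ μ)
    + ∫ x in Ioi (0 : ℝ), d1zero (kerL (rFn ρ k γ)) x * opSinv ρ k (valL (W t)) x

/-- The heat kernel `e^{-x²/(4t)} / √(4πt)`. -/
def heatKer (t x : ℝ) : ℝ := Real.exp (-(x ^ 2 / (4 * t))) / √(4 * Real.pi * t)

/-- The free term of the Volterra equation for `u¹¹⁰`. -/
def volF (ρ k γ : ℝ → ℝ) (u : ℝ → ℝ) (Z0 : ℝ → ℝ) (t : ℝ) : ℝ :=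
  c0 ρ k * u t
    + 1 / 2 * (∫ μ in Ioi (0 : ℝ), rFn ρ k γ μ) * (∫ x, heatKer t x * Z0 x)
    - ∫ x in Ioi (0 : ℝ), d1zero (kerK (rFn ρ k γ)) x * ∫ y, heatKer t (x - y) * Z0 y

/-- The kernel of the Volterra equation for `u¹¹⁰`. -/
def volP (ρ k γ : ℝ → ℝ) (t : ℝ) : ℝ :=
  1 / √(Real.pi * t) *
    ((∫ x in Ioi (0 : ℝ), d1zero (kerK (rFn ρ k γ)) x * Real.exp (-(x ^ 2 / (4 * t))))
      - 1 / 2 * ∫ μ in Ioi (0 : ℝ), rFn ρ k γ μ)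

/-- `v(t) = f(t) + ∫₀ᵗ P(t-ξ) v(ξ) dξ` for a.e. `t ∈ (0,T)`. -/
def SolvesVolterra (T : ℝ) (f P v : ℝ → ℝ) : Prop :=
  ∀ᵐ t ∂(volume.restrict (Ioo 0 T)), v t = f t + ∫ ξ in (0 : ℝ)..t, P (t - ξ) * v ξ

end NeumannHeat

end

open NeumannHeat

open MeasureTheory Set Filter Topology
open scoped ENNReal

noncomputable section

namespace NeumannHeat

/-! The product of `√(ρ/k)` and `Q₁` is the logarithmic derivative of `⁴√(ρk)`, and `√(ρk) = ρ/σ'`.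
Hence `S` is an isometry of `H¹(ℝ)` onto `ℍ¹` that carries `d/dλ` to `𝔻`. With `w = S⁻¹W`, system
(1) becomes, in weak form, `w_t = w'' - r w - 2 c₀ u δ` with `c₀ = ⁴√((ρk)(0))`, and only the
potential `r` has to be removed. The predicate `Rep` records this passage; constant coefficients are
a special case of it.

Kernels. In the coordinates `u = (y₁+y₂)/2`, `v = (y₂-y₁)/2` the problem for `K` reads `H_uv =
-r(u-v) H`, `H(u,0) = ½∫_u^∞ r`, `H → 0`. It is equivalent to an integral equation that is a
contraction in an exponentially weighted sup norm (`exists_isGoursat`). Iterating the same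
inequality with the weight `exp(2∫σ₀)` (`goursat_apriori`) gives `|K| ≤ Cσ₀` and then (3); together
with the rectangle identity it also gives uniqueness (`WaveOn.eq_zero`). The kernel `L` is the
Volterra resolvent of `K` and inherits the bounds through a Gronwall inequality
(`Resolvent.regKernel`).

Transformation. Integrating by parts twice and using the wave equation of `K`, one finds that `1+K`
intertwines `d²/dλ²` and `d²/dλ² - r`, up to a boundary term `(K(0,0)Z(0) - ∫K_{y₁}(0,x)Z(x)dx)
Φ(0)` (`KernelPair.intertwining`). Rewritten through `w`, this boundary term is exactly the
correction in `u¹¹⁰` (`boundary_term`). The inverse transform is the dual of a bounded map `1+L*`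
between the test spaces, so absolute continuity and derivatives in the dual norm carry over
(`transform_isSolution`). This is assertion 1.

Volterra equation. Left in terms of `Z`, the same boundary term can be computed from Duhamel's
formula for the heat equation, obtained by testing the solution with heat kernels and letting the
regularization tend to zero (`IsSolution.duhamel`, `IsSolution.volterra`). This is the equation of
assertion 2. Its kernel is `O(t^{-1/2})`, and the convolution of `t^{-1/2}` with itself is the
constant `π`; inserting the inequality into itself once therefore leaves a Gronwall inequality
(`volterra_bound`). That bound gives uniqueness, the estimate of `u¹¹⁰`, and the boundedness of
`u¹¹⁰`, of which only integrability is known beforehand. -/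

/-! ### Primitives of locally integrable functions -/

/-- `f` is a primitive of the locally integrable function `g`. -/
structure IsPrim (f g : ℝ → ℝ) : Prop where
  loc : LocallyIntegrable g
  eq : ∀ x, f x = f 0 + ∫ t in (0 : ℝ)..x, g t

lemma locallyIntegrable_intervalIntegrable {g : ℝ → ℝ} (hg : LocallyIntegrable g) (a b : ℝ) :
    IntervalIntegrable g volume a b :=
  intervalIntegrable_iff.mpr <|
    (hg.integrableOn_isCompact isCompact_uIcc).mono_set uIoc_subset_uIcc

namespace IsPrim

variable {f g f₁ g₁ f₂ g₂ : ℝ → ℝ}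

lemma intervalIntegrable (h : IsPrim f g) (a b : ℝ) : IntervalIntegrable g volume a b :=
  locallyIntegrable_intervalIntegrable h.loc a b

lemma integral_eq (h : IsPrim f g) (a b : ℝ) : ∫ t in a..b, g t = f b - f a := by
  rw [h.eq b, h.eq a, ← intervalIntegral.integral_interval_sub_left
    (h.intervalIntegrable 0 b) (h.intervalIntegrable 0 a)]
  ring

lemma of_integral (hg : LocallyIntegrable g) (c a : ℝ) :
    IsPrim (fun x => c + ∫ t in a..x, g t) g where
  loc := hg
  eq x := by
    have := intervalIntegral.integral_add_adjacent_intervals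
      (locallyIntegrable_intervalIntegrable hg a 0) (locallyIntegrable_intervalIntegrable hg 0 x)
    simp only [← this]
    ring

lemma funext_eq (h : IsPrim f g) (a : ℝ) : f = fun x => f a + ∫ t in a..x, g t := by
  funext x
  rw [h.integral_eq]
  ring

lemma continuous (h : IsPrim f g) : Continuous f := by
  rw [h.funext_eq 0]
  exact continuous_const.add
    (intervalIntegral.continuous_primitive (fun a b => h.intervalIntegrable a b) 0)

lemma ac (h : IsPrim f g) (a b : ℝ) : AbsolutelyContinuousOnInterval f a b := by
  have h1 := (h.intervalIntegrable a b).absolutelyContinuousOnInterval_intervalIntegral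
    (c := a) left_mem_uIcc
  have h2 : AbsolutelyContinuousOnInterval (fun _ : ℝ => f a) a b :=
    (contDiff_const.contDiffOn).absolutelyContinuousOnInterval
  rw [h.funext_eq a]
  exact h2.add h1

lemma ae_hasDerivAt (h : IsPrim f g) : ∀ᵐ x, HasDerivAt f (g x) x := by
  filter_upwards [LocallyIntegrable.ae_hasDerivAt_integral h.loc] with x hx
  have := (hx 0).const_add (f 0)
  rwa [← h.funext_eq 0] at this

lemma add (h₁ : IsPrim f₁ g₁) (h₂ : IsPrim f₂ g₂) :
    IsPrim (fun x => f₁ x + f₂ x) (fun x => g₁ x + g₂ x) where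
  loc := h₁.loc.add h₂.loc
  eq x := by
    rw [intervalIntegral.integral_add (h₁.intervalIntegrable _ _) (h₂.intervalIntegrable _ _),
      h₁.eq x, h₂.eq x]
    ring

lemma const_mul (h : IsPrim f g) (c : ℝ) : IsPrim (fun x => c * f x) (fun x => c * g x) where
  loc := h.loc.smul c
  eq x := by
    rw [intervalIntegral.integral_const_mul, h.eq x]
    ring

lemma of_hasDerivAt (h : ∀ x, HasDerivAt f (g x) x) (hg : Continuous g) : IsPrim f g where
  loc := hg.locallyIntegrable
  eq x := by
    rw [intervalIntegral.integral_eq_sub_of_hasDerivAt (fun y _ => h y)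
      (hg.intervalIntegrable _ _)]
    ring

lemma locallyIntegrable_mul_continuous (hg : LocallyIntegrable g) (hf : Continuous f) :
    LocallyIntegrable (fun x => g x * f x) := by
  rw [← locallyIntegrableOn_univ] at hg ⊢
  exact hg.mul_continuousOn hf.continuousOn isOpen_univ.isLocallyClosed

lemma mul (h₁ : IsPrim f₁ g₁) (h₂ : IsPrim f₂ g₂) :
    IsPrim (fun x => f₁ x * f₂ x) (fun x => g₁ x * f₂ x + f₁ x * g₂ x) where
  loc := by
    refine (locallyIntegrable_mul_continuous h₁.loc h₂.continuous).add ?_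
    simpa [mul_comm] using locallyIntegrable_mul_continuous h₂.loc h₁.continuous
  eq x := by
    have h := (h₁.ac 0 x).integral_deriv_mul_eq_sub (h₂.ac 0 x)
    have : ∫ t in (0 : ℝ)..x, g₁ t * f₂ t + f₁ t * g₂ t = f₁ x * f₂ x - f₁ 0 * f₂ 0 := by
      rw [← h]
      refine intervalIntegral.integral_congr_ae ?_
      filter_upwards [h₁.ae_hasDerivAt, h₂.ae_hasDerivAt] with t e1 e2 _
      rw [e1.deriv, e2.deriv]
    rw [this]
    ring

lemma hasWeakDeriv (h : IsPrim f g) : HasWeakDeriv f g where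
  locInt := h.continuous.locallyIntegrable
  locInt_deriv := h.loc
  parts := by
    intro η hη hc
    have hd : Continuous (deriv η) := hη.continuous_deriv (by exact_mod_cast le_top)
    have hη' : IsPrim η (deriv η) := of_hasDerivAt
      (fun x => (hη.differentiable (by simp)).differentiableAt.hasDerivAt) hd
    obtain ⟨R, hR⟩ := hc.isCompact.isBounded.subset_ball 0
    have hz : ∀ x, R ≤ |x| → η x = 0 := fun x hx => by
      by_contra hne
      have := hR (subset_tsupport η hne)
      rw [Metric.mem_ball, Real.dist_eq, sub_zero] at this
      linarith
    have hz' : ∀ x, R ≤ |x| → deriv η x = 0 := fun x hx => by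
      by_contra hne
      have := hR (support_deriv_subset hne)
      rw [Metric.mem_ball, Real.dist_eq, sub_zero] at this
      linarith
    -- `|R|` keeps the interval ordered even when the ball is empty and `R` negative; the product `f
    -- η` vanishes at both ends.
    have hm := (h.mul hη').integral_eq (-|R|) |R|
    have e1 : f |R| * η |R| = 0 := by rw [hz _ (by simp [le_abs_self]), mul_zero]
    have e2 : f (-|R|) * η (-|R|) = 0 := by rw [hz _ (by simp [le_abs_self]), mul_zero]
    rw [e1, e2, sub_zero, intervalIntegral.integral_eq_integral_of_support_subset,
      integral_add (integrable_mul_of_compact h.loc hη.continuous hc)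
        (integrable_mul_of_compact h.continuous.locallyIntegrable hd hc.deriv)] at hm
    · linarith
    · intro x hx
      by_contra hne
      apply hx
      have : R ≤ |x| := by
        rw [mem_Ioc, not_and_or, not_lt, not_le] at hne
        rcases hne with h1 | h1
        · exact (le_abs_self R).trans ((by linarith : |R| ≤ -x).trans (neg_le_abs x))
        · exact (le_abs_self R).trans (h1.le.trans (le_abs_self x))
      simp [hz x this, hz' x this]

end IsPrim

/-- A smooth compactly supported function of integral zero is the derivative of such a function. -/
lemma exists_compact_primitive {χ : ℝ → ℝ} (hχ : ContDiff ℝ ((⊤ : ℕ∞) : WithTop ℕ∞) χ)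
    (hc : HasCompactSupport χ) (h0 : ∫ x, χ x = 0) :
    ∃ ψ : ℝ → ℝ, ContDiff ℝ ((⊤ : ℕ∞) : WithTop ℕ∞) ψ ∧ HasCompactSupport ψ ∧ deriv ψ = χ := by
  obtain ⟨R, hR⟩ := hc.isCompact.isBounded.subset_ball 0
  have hz : ∀ x, R ≤ |x| → χ x = 0 := fun x hx => by
    by_contra hne
    have := hR (subset_tsupport χ hne)
    rw [Metric.mem_ball, Real.dist_eq, sub_zero] at this
    linarith
  have hd : ∀ x, HasDerivAt (fun x => ∫ t in (-|R|)..x, χ t) (χ x) x := fun x =>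
    intervalIntegral.integral_hasDerivAt_right (hχ.continuous.intervalIntegrable _ _)
      (hχ.continuous.stronglyMeasurableAtFilter _ _) hχ.continuous.continuousAt
  have hder : deriv (fun x => ∫ t in (-|R|)..x, χ t) = χ := funext fun x => (hd x).deriv
  refine ⟨_, ?_, ?_, hder⟩
  · rw [contDiff_infty_iff_deriv, hder]
    exact ⟨fun x => (hd x).differentiableAt, hχ⟩
  · refine HasCompactSupport.intro (isCompact_Icc (a := -|R|) (b := |R|)) fun x hx => ?_
    rw [mem_Icc, not_and_or, not_le, not_le] at hx
    rcases hx with hx | hx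
    · rw [intervalIntegral.integral_symm, neg_eq_zero]
      refine (intervalIntegral.integral_congr (g := fun _ => 0) fun t ht => ?_).trans (by simp)
      rw [uIcc_of_le hx.le] at ht
      exact hz t ((le_abs_self R).trans ((by linarith [ht.2] : |R| ≤ -t).trans (neg_le_abs t)))
    · rw [intervalIntegral.integral_eq_integral_of_support_subset, h0]
      intro t ht
      by_contra hne
      apply ht
      refine hz t ?_
      rw [mem_Ioc, not_and_or, not_lt, not_le] at hne
      rcases hne with h1 | h1
      · exact (le_abs_self R).trans ((by linarith : |R| ≤ -t).trans (neg_le_abs t))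
      · exact (le_abs_self R).trans ((hx.trans h1).le.trans (le_abs_self t))

/-- The du Bois-Reymond argument: with `e` a bump of integral one, `φ - (∫φ) e` has mean zero, hence
is the derivative of a test function and is annihilated by `f`. So `f - ∫ f e` is orthogonal to
every `φ`. -/
lemma HasWeakDeriv.ae_eq_const {f : ℝ → ℝ} (h : HasWeakDeriv f (fun _ => 0)) :
    ∃ c, f =ᵐ[volume] fun _ => c := by
  let b : ContDiffBump (0 : ℝ) := default
  set e := b.normed volume with he
  have hes : ContDiff ℝ ((⊤ : ℕ∞) : WithTop ℕ∞) e := b.contDiff_normed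
  have hec : HasCompactSupport e := b.hasCompactSupport_normed
  refine ⟨∫ x, f x * e x, ?_⟩
  have hloc : LocallyIntegrable (fun x => f x - ∫ x, f x * e x) :=
    h.locInt.sub (locallyIntegrable_const _)
  have := ae_eq_zero_of_integral_contDiff_smul_eq_zero hloc ?_
  · filter_upwards [this] with x hx
    linarith
  intro φ hφ hφc
  have hφi : Integrable φ := hφ.continuous.integrable_of_hasCompactSupport hφc
  have hei : Integrable e := hes.continuous.integrable_of_hasCompactSupport hec
  obtain ⟨ψ, hψ, hψc, hd⟩ := exists_compact_primitive
    (χ := fun x => φ x - (∫ y, φ y) * e x) (hφ.sub (contDiff_const.mul hes))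
    (hφc.sub hec.mul_left) (by
      rw [integral_sub hφi (hei.const_mul _), integral_const_mul, he, b.integral_normed]
      ring)
  have hp := h.parts ψ hψ hψc
  rw [hd] at hp
  have e1 : ∫ x, f x * (φ x - (∫ y, φ y) * e x) =
      (∫ x, f x * φ x) - (∫ y, φ y) * ∫ x, f x * e x := by
    rw [← integral_const_mul, ← integral_sub (integrable_mul_of_compact h.locInt hφ.continuous hφc)
      ((integrable_mul_of_compact h.locInt hes.continuous hec).const_mul _)]
    congr 1
    funext x
    ring
  have e2 : ∫ x, φ x • (f x - ∫ x, f x * e x) =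
      (∫ x, f x * φ x) - (∫ y, φ y) * ∫ x, f x * e x := by
    rw [← integral_mul_const, ← integral_sub (integrable_mul_of_compact h.locInt hφ.continuous hφc)
      (hφi.mul_const _)]
    congr 1
    funext x
    rw [smul_eq_mul]
    ring
  rw [e2, ← e1, hp]
  simp

/-- Subtracting the primitive of `g` leaves a function with zero weak derivative, which is constant.
This replaces distributional derivatives by absolutely continuous representatives everywhere below.
-/
lemma HasWeakDeriv.exists_isPrim {f g : ℝ → ℝ} (h : HasWeakDeriv f g) :
    ∃ f₀, f =ᵐ[volume] f₀ ∧ IsPrim f₀ g := by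
  have h1 := IsPrim.of_integral h.locInt_deriv 0 0
  have h2 := h.add (h1.hasWeakDeriv.smul (-1))
  obtain ⟨c, hc⟩ := HasWeakDeriv.ae_eq_const (f := fun x => f x + -1 * (0 + ∫ t in (0:ℝ)..x, g t))
    (by convert h2 using 2; ring)
  refine ⟨_, ?_, IsPrim.of_integral h.locInt_deriv c 0⟩
  filter_upwards [hc] with x hx
  linarith

lemma IsPrim.ae_eq_of_ae_eq {f₁ f₂ g₁ g₂ : ℝ → ℝ} (h₁ : IsPrim f₁ g₁) (h₂ : IsPrim f₂ g₂)
    (h : f₁ =ᵐ[volume] f₂) : f₁ = f₂ ∧ g₁ =ᵐ[volume] g₂ := by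
  have e : f₁ = f₂ := Continuous.ae_eq_iff_eq volume h₁.continuous h₂.continuous |>.mp h
  refine ⟨e, ?_⟩
  filter_upwards [h₁.ae_hasDerivAt, h₂.ae_hasDerivAt] with x a b
  rw [e] at a
  exact a.unique b

/-- An even function that is a primitive on the half line is a primitive of an odd function. -/
lemma IsPrim.of_even {f g : ℝ → ℝ} (hf : ∀ x, f (-x) = f x) (hg : ∀ x, g (-x) = -g x)
    (hloc : LocallyIntegrable g) (h : ∀ x, 0 ≤ x → f x = f 0 + ∫ t in (0 : ℝ)..x, g t) :
    IsPrim f g where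
  loc := hloc
  eq x := by
    rcases le_total 0 x with hx | hx
    · exact h x hx
    · have := h (-x) (by linarith)
      rw [hf] at this
      rw [this]
      congr 1
      have e := intervalIntegral.integral_comp_neg (a := 0) (b := x) g
      rw [neg_zero] at e
      rw [intervalIntegral.integral_symm, ← e, ← intervalIntegral.integral_neg]
      simp [hg]

/-! ### Square integrable functions with square integrable derivative -/

/-- `f` belongs to `H¹(ℝ)`, is absolutely continuous, and `g` is its derivative. -/
structure Sob (f g : ℝ → ℝ) : Prop where
  prim : IsPrim f g
  memLp : MemLp f 2
  memLp_deriv : MemLp g 2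

lemma memLp_mul_integrable {μ : Measure ℝ} {f g : ℝ → ℝ} (hf : MemLp f 2 μ) (hg : MemLp g 2 μ) :
    Integrable (fun x => f x * g x) μ := hf.integrable_mul hg

lemma memLp_sq_integrable {μ : Measure ℝ} {f : ℝ → ℝ} (hf : MemLp f 2 μ) :
    Integrable (fun x => f x ^ 2) μ := hf.integrable_sq

/-- The Cauchy–Schwarz inequality for square integrable functions. -/
lemma abs_integral_mul_le {μ : Measure ℝ} {f g : ℝ → ℝ} (hf : MemLp f 2 μ) (hg : MemLp g 2 μ) :
    ∫ x, |f x| * |g x| ∂μ ≤ √(∫ x, f x ^ 2 ∂μ) * √(∫ x, g x ^ 2 ∂μ) := by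
  have := integral_mul_le_Lp_mul_Lq_of_nonneg (μ := μ) (p := 2) (q := 2)
    Real.HolderConjugate.two_two (f := fun x => |f x|) (g := fun x => |g x|)
    (Eventually.of_forall fun x => abs_nonneg _) (Eventually.of_forall fun x => abs_nonneg _)
    (by rw [ENNReal.ofReal_ofNat]; exact hf.abs) (by rw [ENNReal.ofReal_ofNat]; exact hg.abs)
  simpa [Real.sqrt_eq_rpow] using this

/-- An integrable function on a half line tends to zero along a sequence going to infinity. -/
lemma exists_seq_tendsto_zero {p : ℝ → ℝ} (hp : IntegrableOn p (Ioi 0)) :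
    ∀ ε > 0, ∀ X : ℝ, ∃ x ≥ X, |p x| < ε := by
  intro ε hε X
  by_contra! hcon
  have h1 : IntegrableOn (fun _ : ℝ => ε) (Ioi (max X 0)) := by
    refine Integrable.mono' (hp.mono_set (Ioi_subset_Ioi (le_max_right X 0))).abs
      aestronglyMeasurable_const ?_
    filter_upwards [self_mem_ae_restrict measurableSet_Ioi] with x hx
    rw [Real.norm_of_nonneg hε.le]
    exact hcon x ((le_max_left _ _).trans hx.le)
  rw [integrableOn_const_iff] at h1
  simp [hε.ne'] at h1

/-- Integrability of `q` makes `p` converge at infinity, and integrability of `p` forces the limit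
to be zero, so only the boundary term at `a` survives. -/
lemma IsPrim.integral_Ioi {p q : ℝ → ℝ} (h : IsPrim p q) (a : ℝ) (hp : IntegrableOn p (Ioi 0))
    (hq : IntegrableOn q (Ioi a)) : ∫ x in Ioi a, q x = -p a := by
  have h1 := intervalIntegral_tendsto_integral_Ioi a hq tendsto_id
  simp only [id_eq, h.integral_eq] at h1
  have h2 : Tendsto p atTop (𝓝 (p a + ∫ x in Ioi a, q x)) := by
    simpa using h1.const_add (p a)
  have h3 : p a + ∫ x in Ioi a, q x = 0 := by
    by_contra hne
    have hpos := abs_pos.mpr hne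
    have h4 : ∀ᶠ x in atTop, |p a + ∫ x in Ioi a, q x| / 2 < |p x| :=
      h2.abs.eventually (lt_mem_nhds (by linarith))
    obtain ⟨X, hX⟩ := eventually_atTop.mp h4
    obtain ⟨x, hx, hlt⟩ := exists_seq_tendsto_zero hp _ (half_pos hpos) X
    exact (hX x hx).not_gt hlt
  linarith

namespace Sob

variable {f g f₁ g₁ f₂ g₂ : ℝ → ℝ}

lemma continuous (h : Sob f g) : Continuous f := h.prim.continuous

lemma add (h₁ : Sob f₁ g₁) (h₂ : Sob f₂ g₂) :
    Sob (fun x => f₁ x + f₂ x) (fun x => g₁ x + g₂ x) :=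
  ⟨h₁.prim.add h₂.prim, h₁.memLp.add h₂.memLp, h₁.memLp_deriv.add h₂.memLp_deriv⟩

lemma const_mul (h : Sob f g) (c : ℝ) : Sob (fun x => c * f x) (fun x => c * g x) :=
  ⟨h.prim.const_mul c, h.memLp.const_mul c, h.memLp_deriv.const_mul c⟩

lemma integrable_mul_deriv (h₁ : Sob f₁ g₁) (h₂ : Sob f₂ g₂) :
    Integrable (fun x => g₁ x * f₂ x + f₁ x * g₂ x) :=
  (memLp_mul_integrable h₁.memLp_deriv h₂.memLp).add
    (memLp_mul_integrable h₁.memLp h₂.memLp_deriv)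

lemma integral_Ioi (h₁ : Sob f₁ g₁) (h₂ : Sob f₂ g₂) (a : ℝ) :
    ∫ x in Ioi a, (g₁ x * f₂ x + f₁ x * g₂ x) = -(f₁ a * f₂ a) :=
  (h₁.prim.mul h₂.prim).integral_Ioi a (memLp_mul_integrable h₁.memLp h₂.memLp).integrableOn
    (h₁.integrable_mul_deriv h₂).integrableOn

lemma comp_neg (h : Sob f g) : Sob (fun x => f (-x)) (fun x => -g (-x)) where
  prim := by
    refine ⟨?_, fun x => ?_⟩
    · intro x
      have h1 := (memLp_deriv h).comp_measurePreserving (Measure.measurePreserving_neg volume)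
      exact ((h1.locallyIntegrable (by norm_num)).neg) x
    · rw [intervalIntegral.integral_neg, intervalIntegral.integral_comp_neg, neg_zero,
        h.prim.integral_eq]
      ring
  memLp := h.memLp.comp_measurePreserving (Measure.measurePreserving_neg volume)
  memLp_deriv := (h.memLp_deriv.comp_measurePreserving (Measure.measurePreserving_neg volume)).neg

/-- Integration by parts on the real line. -/
lemma integral_parts (h₁ : Sob f₁ g₁) (h₂ : Sob f₂ g₂) :
    ∫ x, (g₁ x * f₂ x + f₁ x * g₂ x) = 0 := by
  have e1 := h₁.integral_Ioi h₂ 0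
  have e2 := h₁.comp_neg.integral_Ioi h₂.comp_neg 0
  have e3 := integral_comp_neg_Ioi (0 : ℝ) (fun x => g₁ x * f₂ x + f₁ x * g₂ x)
  rw [← intervalIntegral.integral_Iic_add_Ioi (h₁.integrable_mul_deriv h₂).integrableOn
    (h₁.integrable_mul_deriv h₂).integrableOn (b := 0), e1]
  rw [neg_zero] at e3 e2
  rw [← e3]
  have e4 : ∫ x in Ioi (0 : ℝ), (g₁ (-x) * f₂ (-x) + f₁ (-x) * g₂ (-x)) =
      - ∫ x in Ioi (0 : ℝ), (-g₁ (-x) * f₂ (-x) + f₁ (-x) * -g₂ (-x)) := by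
    rw [← integral_neg]
    congr 1
    funext x
    ring
  rw [e4, e2]
  ring

/-- The embedding of `H¹` into bounded functions with constant one: `f(a)² = -∫_a^∞ 2 f f'`, and
`-2ff' ≤ f² + f'²`. -/
lemma sq_le (h : Sob f g) (a : ℝ) : f a ^ 2 ≤ (∫ x, f x ^ 2) + ∫ x, g x ^ 2 := by
  have e := h.integral_Ioi h a
  have hi : Integrable (fun x => f x ^ 2 + g x ^ 2) :=
    (memLp_sq_integrable h.memLp).add (memLp_sq_integrable h.memLp_deriv)
  have h1 : f a ^ 2 ≤ ∫ x in Ioi a, (f x ^ 2 + g x ^ 2) := by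
    have : f a ^ 2 = ∫ x in Ioi a, -(g x * f x + f x * g x) := by
      rw [integral_neg, e]; ring
    rw [this]
    refine integral_mono (h.integrable_mul_deriv h).neg.integrableOn hi.integrableOn fun x => ?_
    simp only
    nlinarith [sq_nonneg (f x + g x)]
  refine h1.trans ?_
  rw [← integral_add (memLp_sq_integrable h.memLp) (memLp_sq_integrable h.memLp_deriv)]
  exact setIntegral_le_integral hi (Eventually.of_forall fun x => by positivity)

/-- The even part of an element of `H¹(ℝ)`. -/
lemma even_part (h : Sob f g) :
    Sob (fun x => 1 / 2 * (f x + f (-x))) (fun x => 1 / 2 * (g x + -g (-x))) :=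
  (h.add h.comp_neg).const_mul _

end Sob

lemma integral_even {p : ℝ → ℝ} (hp : ∀ x, p (-x) = p x) :
    ∫ x, p x = 2 * ∫ x in Ioi (0 : ℝ), p x := by
  have := integral_comp_abs (f := p)
  rw [← this]
  congr 1
  funext x
  rcases abs_choice x with h | h <;> rw [h]
  rw [hp]

/-! ### Change of variables for primitives -/

/-- Monotone substitution in the integral of `G`. It is needed for merely integrable `G`, where the
chain rule for derivatives is not available at every point. -/
lemma IsPrim.comp {F G τ τ' : ℝ → ℝ} (h : IsPrim F G) (hτ : ∀ x, HasDerivAt τ (τ' x) x)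
    (hτ' : ∀ x, 0 ≤ τ' x) : IsPrim (fun x => F (τ x)) (fun x => τ' x * G (τ x)) := by
  have hc : Continuous τ := continuous_iff_continuousAt.2 fun x => (hτ x).continuousAt
  have hi : ∀ a b, a ≤ b → IntegrableOn (fun x => τ' x * G (τ x)) (Icc a b) := fun a b hab =>
    (integrableOn_Icc_deriv_smul_iff_of_deriv_nonneg (g := G) hc.continuousOn
      (fun x _ => hτ x) (fun x _ => hτ' x) hab).2 (h.loc.integrableOn_isCompact isCompact_Icc)
  have hmono : Monotone τ := monotone_of_hasDerivAt_nonneg hτ hτ'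
  have he : ∀ a b, a ≤ b → ∫ x in a..b, τ' x * G (τ x) = F (τ b) - F (τ a) := by
    intro a b hab
    rw [intervalIntegral.integral_of_le hab, ← integral_Icc_eq_integral_Ioc, ← h.integral_eq,
      intervalIntegral.integral_of_le (hmono hab), ← integral_Icc_eq_integral_Ioc]
    exact integral_Icc_deriv_smul_of_deriv_nonneg (g := G) hc.continuousOn
      (fun x _ => hτ x) (fun x _ => hτ' x) hab
  refine ⟨?_, fun x => ?_⟩
  · intro x
    exact ⟨Icc (x - 1) (x + 1), 
      Icc_mem_nhds (by linarith) (by linarith), hi _ _ (by linarith)⟩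
  · rcases le_total 0 x with hx | hx
    · rw [he 0 x hx]; ring
    · rw [intervalIntegral.integral_symm, he x 0 hx]; ring

/-! ### The coefficients -/

lemma continuous_of_even {f : ℝ → ℝ} (hf : ∀ x, f (-x) = f x) (hc : ContinuousOn f (Ici 0)) :
    Continuous f := by
  have : f = fun x => f |x| := by
    funext x
    rcases abs_choice x with h | h <;> rw [h]
    rw [hf]
  rw [this]
  exact hc.comp_continuous continuous_abs fun x => abs_nonneg x

lemma deriv_odd_of_even {f : ℝ → ℝ} (hf : ∀ x, f (-x) = f x) (x : ℝ) :
    deriv f (-x) = -deriv f x := by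
  have h := deriv_comp_neg (f := f) (x := x)
  simp only [hf] at h
  linarith

lemma deriv_even_of_odd {f : ℝ → ℝ} (hf : ∀ x, f (-x) = -f x) (x : ℝ) :
    deriv f (-x) = deriv f x := by
  have h := deriv_comp_neg (f := f) (x := x)
  have h2 : (fun x => f (-x)) = fun x => -f x := funext hf
  rw [h2, deriv.fun_neg] at h
  linarith

/-- An even function that is `C¹` on the half line with zero derivative at the origin is `C¹`. -/
lemma contDiff_one_of_even {f : ℝ → ℝ} (hf : ∀ x, f (-x) = f x) (hc : ContDiffOn ℝ 1 f (Ici 0))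
    (h0 : derivWithin f (Ici 0) 0 = 0) : Differentiable ℝ f ∧ Continuous (deriv f) := by
  have hd0 : ContinuousOn (derivWithin f (Ici 0)) (Ici 0) :=
    hc.continuousOn_derivWithin (uniqueDiffOn_Ici 0) le_rfl
  have hdiff : DifferentiableOn ℝ f (Ici 0) := hc.differentiableOn (by norm_num)
  have hpos : ∀ x, 0 < x → HasDerivAt f (derivWithin f (Ici 0) x) x := fun x hx =>
    (hdiff x hx.le).hasDerivWithinAt.hasDerivAt (Ici_mem_nhds hx)
  have hneg : ∀ x, x < 0 → HasDerivAt f (-derivWithin f (Ici 0) (-x)) x := fun x hx => by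
    have h := (hpos (-x) (by linarith)).scomp x (hasDerivAt_neg x)
    have e : f ∘ Neg.neg = f := funext hf
    rw [e] at h
    simpa using h
  have hzero : HasDerivAt f 0 0 := by
    have h1 : HasDerivWithinAt f 0 (Ici 0) 0 := by
      have := (hdiff 0 self_mem_Ici).hasDerivWithinAt
      rwa [h0] at this
    have h2 : HasDerivWithinAt f 0 (Iic 0) 0 := by
      have h1' : HasDerivWithinAt f 0 (Ici 0) (-0) := by simpa using h1
      have h := h1'.scomp (0 : ℝ) (hasDerivAt_neg (0:ℝ)).hasDerivWithinAt (s := Iic 0)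
        (fun x hx => by simpa using hx)
      have e : f ∘ Neg.neg = f := funext hf
      rw [e] at h
      simpa using h
    have := h2.union h1
    rwa [Iic_union_Ici, hasDerivWithinAt_univ] at this
  have hfun : deriv f = fun x => if 0 ≤ x then derivWithin f (Ici 0) |x|
      else -derivWithin f (Ici 0) |x| := by
    funext x
    rcases lt_trichotomy x 0 with hx | hx | hx
    · rw [if_neg (not_le.2 hx), abs_of_neg hx, (hneg x hx).deriv]
    · subst hx
      simp [hzero.deriv, h0]
    · rw [if_pos hx.le, abs_of_pos hx, (hpos x hx).deriv]
  constructor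
  · intro x
    rcases lt_trichotomy x 0 with hx | hx | hx
    · exact (hneg x hx).differentiableAt
    · exact hx ▸ hzero.differentiableAt
    · exact (hpos x hx).differentiableAt
  · have hcabs : Continuous fun x : ℝ => derivWithin f (Ici 0) |x| :=
      hd0.comp_continuous continuous_abs fun x => abs_nonneg x
    rw [hfun]
    refine Continuous.if_le hcabs hcabs.neg continuous_const continuous_id fun x hx => ?_
    rw [← hx]
    simp [h0]

namespace Admissible

variable {ρ k γ : ℝ → ℝ}

lemma rho_pos (h : Admissible ρ k γ) (x : ℝ) : 0 < ρ x := by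
  rcases le_total 0 x with hx | hx
  · exact h.pos_rho x hx
  · rw [← h.even_rho]; exact h.pos_rho _ (by linarith)

lemma k_pos (h : Admissible ρ k γ) (x : ℝ) : 0 < k x := by
  rcases le_total 0 x with hx | hx
  · exact h.pos_k x hx
  · rw [← h.even_k]; exact h.pos_k _ (by linarith)

lemma continuous_rho (h : Admissible ρ k γ) : Continuous ρ :=
  continuous_of_even h.even_rho h.smooth_rho.continuousOn

lemma continuous_k (h : Admissible ρ k γ) : Continuous k :=
  continuous_of_even h.even_k h.smooth_k.continuousOn

lemma speed_pos (h : Admissible ρ k γ) (x : ℝ) : 0 < √(ρ x / k x) :=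
  Real.sqrt_pos.2 (div_pos (h.rho_pos x) (h.k_pos x))

lemma inv_speed (x : ℝ) : √(k x / ρ x) = (√(ρ x / k x))⁻¹ := by
  rw [← Real.sqrt_inv, inv_div]

lemma continuous_speed (h : Admissible ρ k γ) : Continuous fun x => √(ρ x / k x) :=
  (h.continuous_rho.div h.continuous_k fun x => (h.k_pos x).ne').sqrt

lemma hasDerivAt_sigma (h : Admissible ρ k γ) (x : ℝ) :
    HasDerivAt (sigmaFn ρ k) (√(ρ x / k x)) x :=
  intervalIntegral.integral_hasDerivAt_right (h.continuous_speed.intervalIntegrable _ _)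
    (h.continuous_speed.stronglyMeasurableAtFilter _ _) h.continuous_speed.continuousAt

lemma continuous_sigma (h : Admissible ρ k γ) : Continuous (sigmaFn ρ k) :=
  continuous_iff_continuousAt.2 fun x => (h.hasDerivAt_sigma x).continuousAt

lemma strictMono_sigma (h : Admissible ρ k γ) : StrictMono (sigmaFn ρ k) :=
  strictMono_of_hasDerivAt_pos h.hasDerivAt_sigma h.speed_pos

lemma sigma_zero : sigmaFn ρ k 0 = 0 := by simp [sigmaFn]

lemma sigma_neg (h : Admissible ρ k γ) (x : ℝ) : sigmaFn ρ k (-x) = -sigmaFn ρ k x := by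
  have e := intervalIntegral.integral_comp_neg (a := 0) (b := x) fun ξ => √(ρ ξ / k ξ)
  simp only [h.even_rho, h.even_k, neg_zero] at e
  rw [sigmaFn, sigmaFn, e, intervalIntegral.integral_symm]

lemma surjective_sigma (h : Admissible ρ k γ) : Function.Surjective (sigmaFn ρ k) := by
  refine h.continuous_sigma.surjective h.sigma_tendsto ?_
  have : sigmaFn ρ k = fun x => -sigmaFn ρ k (-x) := by
    funext x; rw [h.sigma_neg, neg_neg]
  rw [this]
  exact tendsto_neg_atTop_atBot.comp (h.sigma_tendsto.comp tendsto_neg_atBot_atTop)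

/-- `σ` as a homeomorphism of the real line. -/
def sigmaHomeo (h : Admissible ρ k γ) : ℝ ≃ₜ ℝ :=
  (h.strictMono_sigma.orderIsoOfSurjective _ h.surjective_sigma).toHomeomorph

lemma coe_sigmaHomeo (h : Admissible ρ k γ) : ⇑h.sigmaHomeo = sigmaFn ρ k := rfl

lemma sigmaInv_sigma (h : Admissible ρ k γ) (x : ℝ) : sigmaInv ρ k (sigmaFn ρ k x) = x :=
  Function.leftInverse_invFun h.strictMono_sigma.injective x

lemma sigma_sigmaInv (h : Admissible ρ k γ) (l : ℝ) : sigmaFn ρ k (sigmaInv ρ k l) = l :=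
  Function.rightInverse_invFun h.surjective_sigma l

lemma coe_sigmaHomeo_symm (h : Admissible ρ k γ) : ⇑h.sigmaHomeo.symm = sigmaInv ρ k := by
  funext l
  rw [Homeomorph.symm_apply_eq, h.coe_sigmaHomeo, h.sigma_sigmaInv]

lemma continuous_sigmaInv (h : Admissible ρ k γ) : Continuous (sigmaInv ρ k) := by
  rw [← h.coe_sigmaHomeo_symm]
  exact h.sigmaHomeo.symm.continuous

lemma sigmaInv_neg (h : Admissible ρ k γ) (l : ℝ) : sigmaInv ρ k (-l) = -sigmaInv ρ k l := by
  apply h.strictMono_sigma.injective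
  rw [h.sigma_neg, h.sigma_sigmaInv, h.sigma_sigmaInv]

lemma sigmaInv_nonneg (h : Admissible ρ k γ) {l : ℝ} (hl : 0 ≤ l) : 0 ≤ sigmaInv ρ k l := by
  by_contra hneg
  have := h.strictMono_sigma (not_le.1 hneg)
  rw [h.sigma_sigmaInv, sigma_zero] at this
  linarith

lemma hasDerivAt_sigmaInv (h : Admissible ρ k γ) (l : ℝ) :
    HasDerivAt (sigmaInv ρ k) (√(ρ (sigmaInv ρ k l) / k (sigmaInv ρ k l)))⁻¹ l :=
  HasDerivAt.of_local_left_inverse h.continuous_sigmaInv.continuousAt (h.hasDerivAt_sigma _)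
    (h.speed_pos _).ne' (Eventually.of_forall h.sigma_sigmaInv)

lemma contDiff_sigmaInv (h : Admissible ρ k γ) : ContDiff ℝ 1 (sigmaInv ρ k) := by
  rw [contDiff_one_iff_deriv]
  refine ⟨fun l => (h.hasDerivAt_sigmaInv l).differentiableAt, ?_⟩
  rw [funext fun l => (h.hasDerivAt_sigmaInv l).deriv]
  exact (h.continuous_speed.comp h.continuous_sigmaInv).inv₀ fun l => (h.speed_pos _).ne'

/-! ### The factor `⁴√(ρk)` -/

lemma mul_pos (h : Admissible ρ k γ) (x : ℝ) : 0 < ρ x * k x :=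
  _root_.mul_pos (h.rho_pos x) (h.k_pos x)

lemma quart_pos (h : Admissible ρ k γ) (x : ℝ) : 0 < (ρ x * k x) ^ (1 / 4 : ℝ) :=
  Real.rpow_pos_of_pos (h.mul_pos x) _

lemma c0_pos (h : Admissible ρ k γ) : 0 < c0 ρ k := h.quart_pos 0

lemma differentiable_mul (h : Admissible ρ k γ) :
    Differentiable ℝ (fun x => ρ x * k x) ∧ Continuous (deriv fun x => ρ x * k x) :=
  contDiff_one_of_even (fun x => by rw [h.even_rho, h.even_k])
    (h.smooth_rho_k.of_le (by norm_num)) h.deriv_zero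

/-- The right side is the logarithmic derivative of `⁴√(ρk)`. This is why the factor in `S` turns
`𝔻` into plain differentiation. -/
lemma Q1_eq (h : Admissible ρ k γ) (x : ℝ) :
    √(ρ x / k x) * Q1 ρ k x = deriv (fun x => ρ x * k x) x / (4 * (ρ x * k x)) := by
  have e : (fun y => k y * ρ y) = fun y => ρ y * k y := funext fun y => mul_comm _ _
  rw [Q1, e, inv_speed (ρ := ρ) (k := k)]
  have := (h.speed_pos x).ne'
  have := (h.rho_pos x).ne'
  have := (h.k_pos x).ne'
  field_simp

lemma continuous_Q1 (h : Admissible ρ k γ) : Continuous (Q1 ρ k) := by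
  have e : Q1 ρ k = fun x => (√(ρ x / k x))⁻¹ *
      (deriv (fun x => ρ x * k x) x / (4 * (ρ x * k x))) := by
    funext x
    rw [← h.Q1_eq, ← mul_assoc, inv_mul_cancel₀ (h.speed_pos x).ne', one_mul]
  rw [e]
  have h1 : Continuous fun x => 4 * (ρ x * k x) :=
    continuous_const.mul (h.continuous_rho.mul h.continuous_k)
  exact (h.continuous_speed.inv₀ fun x => (h.speed_pos x).ne').mul
    (h.differentiable_mul.2.div h1 fun x => by have := h.mul_pos x; positivity)

lemma hasDerivAt_quart (h : Admissible ρ k γ) (x : ℝ) :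
    HasDerivAt (fun x => (ρ x * k x) ^ (1 / 4 : ℝ))
      (√(ρ x / k x) * Q1 ρ k x * (ρ x * k x) ^ (1 / 4 : ℝ)) x := by
  have h1 := (h.differentiable_mul.1 x).hasDerivAt.rpow_const (p := 1 / 4)
    (Or.inl (h.mul_pos x).ne')
  convert h1 using 1
  rw [h.Q1_eq, Real.rpow_sub_one (h.mul_pos x).ne']
  have := (h.mul_pos x).ne'
  field_simp

lemma continuous_quart (h : Admissible ρ k γ) :
    Continuous fun x => (ρ x * k x) ^ (1 / 4 : ℝ) :=
  continuous_iff_continuousAt.2 fun x => (h.hasDerivAt_quart x).continuousAt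

/-- The denominator is `σ'`, so the squared factor of `S` converts the weight `ρ dx` into the
Jacobian of `σ`; hence `S` is an isometry of `L²` onto `L²_ρ`. -/
lemma quart_sq (h : Admissible ρ k γ) (x : ℝ) :
    ((ρ x * k x) ^ (1 / 4 : ℝ)) ^ 2 = ρ x / √(ρ x / k x) := by
  have h1 : ((ρ x * k x) ^ (1 / 4 : ℝ)) ^ 2 = √(ρ x * k x) := by
    rw [← Real.rpow_natCast, ← Real.rpow_mul (h.mul_pos x).le, Real.sqrt_eq_rpow]
    norm_num
  rw [h1, eq_div_iff (h.speed_pos x).ne', ← Real.sqrt_mul (h.mul_pos x).le]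
  have : ρ x * k x * (ρ x / k x) = ρ x ^ 2 := by
    have := (h.k_pos x).ne'
    field_simp
  rw [this, Real.sqrt_sq (h.rho_pos x).le]

lemma c0_sq (h : Admissible ρ k γ) : √(ρ 0 * k 0) = c0 ρ k ^ 2 := by
  rw [c0, ← Real.rpow_natCast, ← Real.rpow_mul (h.mul_pos 0).le, Real.sqrt_eq_rpow]
  norm_num

lemma opS_opSinv (h : Admissible ρ k γ) (f : ℝ → ℝ) : opS ρ k (opSinv ρ k f) = f := by
  funext x
  rw [opS, opSinv, h.sigmaInv_sigma]
  have := (h.quart_pos x).ne'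
  field_simp

lemma opSinv_opS (h : Admissible ρ k γ) (f : ℝ → ℝ) : opSinv ρ k (opS ρ k f) = f := by
  funext x
  rw [opSinv, opS, h.sigma_sigmaInv]
  have := (h.quart_pos (sigmaInv ρ k x)).ne'
  field_simp

/-- Intertwining `(S⁻¹f)' = S⁻¹(𝔻f)`: the product rule produces the `Q₁` term through `Q1_eq`, and
the derivative of `σ⁻¹` produces `√(k/ρ)`. -/
lemma isPrim_opSinv (h : Admissible ρ k γ) {f g : ℝ → ℝ} (hf : IsPrim f g) :
    IsPrim (opSinv ρ k f)
      (opSinv ρ k fun x => √(k x / ρ x) * g x + Q1 ρ k x * f x) := by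
  have h1 : IsPrim (fun x => (ρ x * k x) ^ (1 / 4 : ℝ))
      fun x => √(ρ x / k x) * Q1 ρ k x * (ρ x * k x) ^ (1 / 4 : ℝ) :=
    IsPrim.of_hasDerivAt h.hasDerivAt_quart
      ((h.continuous_speed.mul h.continuous_Q1).mul h.continuous_quart)
  have h2 := (h1.mul hf).comp h.hasDerivAt_sigmaInv fun l => inv_nonneg.2 (Real.sqrt_nonneg _)
  convert h2 using 1
  · rfl
  funext l
  rw [opSinv, inv_speed (ρ := ρ) (k := k)]
  have := (h.speed_pos (sigmaInv ρ k l)).ne'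
  field_simp
  ring

lemma isPrim_opS (h : Admissible ρ k γ) {f g : ℝ → ℝ} (hf : IsPrim f g) :
    IsPrim (opS ρ k f)
      (fun x => √(ρ x / k x) * (opS ρ k g x - Q1 ρ k x * opS ρ k f x)) := by
  have h0 : ∀ x, HasDerivAt (fun x => ((ρ x * k x) ^ (1 / 4 : ℝ))⁻¹)
      (-(√(ρ x / k x) * Q1 ρ k x) * ((ρ x * k x) ^ (1 / 4 : ℝ))⁻¹) x := fun x => by
    refine ((h.hasDerivAt_quart x).fun_inv (h.quart_pos x).ne').congr_deriv ?_
    have := (h.quart_pos x).ne'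
    field_simp
  have h1 : IsPrim (fun x => ((ρ x * k x) ^ (1 / 4 : ℝ))⁻¹)
      fun x => -(√(ρ x / k x) * Q1 ρ k x) * ((ρ x * k x) ^ (1 / 4 : ℝ))⁻¹ :=
    IsPrim.of_hasDerivAt h0 ((h.continuous_speed.mul h.continuous_Q1).neg.mul
      (h.continuous_quart.inv₀ fun x => (h.quart_pos x).ne'))
  have h2 := (hf.comp h.hasDerivAt_sigma fun l => Real.sqrt_nonneg _).mul h1
  convert h2 using 1 <;> (funext x; simp only [opS]; ring)

/-! ### The potential -/

lemma Q1_odd (h : Admissible ρ k γ) (x : ℝ) : Q1 ρ k (-x) = -Q1 ρ k x := by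
  rw [Q1, Q1, h.even_rho, h.even_k, deriv_odd_of_even fun y => by rw [h.even_rho, h.even_k]]
  ring

/-- The parity rules for `deriv` hold without differentiability, so evenness does not depend on how
regular `Q₁` is at the origin. -/
lemma pot_even (h : Admissible ρ k γ) (x : ℝ) : pot ρ k γ (-x) = pot ρ k γ x := by
  rw [pot, pot, Q2, Q2, h.even_rho, h.even_k, h.even_gamma, deriv_even_of_odd h.Q1_odd, h.Q1_odd]
  ring

lemma r_even (h : Admissible ρ k γ) (l : ℝ) : rFn ρ k γ (-l) = rFn ρ k γ l := by
  rw [rFn, rFn, h.sigmaInv_neg, h.pot_even]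

lemma r_sigma (h : Admissible ρ k γ) (x : ℝ) : rFn ρ k γ (sigmaFn ρ k x) = pot ρ k γ x := by
  rw [rFn, h.sigmaInv_sigma]

lemma contDiffOn_r (h : Admissible ρ k γ) : ContDiffOn ℝ 1 (rFn ρ k γ) (Ici 0) :=
  h.pot_smooth.comp h.contDiff_sigmaInv.contDiffOn fun _ hl => h.sigmaInv_nonneg hl

lemma continuous_pot (h : Admissible ρ k γ) : Continuous (pot ρ k γ) :=
  continuous_of_even h.pot_even h.pot_smooth.continuousOn

lemma exists_r_bound (h : Admissible ρ k γ) : ∃ C, ∀ l, |rFn ρ k γ l| ≤ C := by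
  set C := (eLpNorm (pot ρ k γ) ∞ (volume.restrict (Ioi 0))).toReal with hC
  have h1 : ∀ᵐ x ∂(volume.restrict (Ioi (0 : ℝ))), |pot ρ k γ x| ≤ C := by
    rw [hC, eLpNorm_exponent_top]
    filter_upwards [ae_le_eLpNormEssSup (f := pot ρ k γ) (μ := volume.restrict (Ioi 0))] with x hx
    have h2 := ENNReal.toReal_mono
      (by have := h.pot_bounded.2; rw [eLpNorm_exponent_top] at this; exact this.ne) hx
    simpa using h2
  -- Replacing `|q| ≤ C` by `max |q| C = C` turns an almost-everywhere inequality into an equality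
  -- of continuous functions, which then holds at every point.
  have h2 : EqOn (fun x => max |pot ρ k γ x| C) (fun _ => C) (Ioi 0) :=
    Measure.eqOn_open_of_ae_eq (h1.mono fun x hx => max_eq_right hx) isOpen_Ioi
      (h.continuous_pot.abs.max continuous_const).continuousOn continuousOn_const
  have h3 : EqOn (fun x => max |pot ρ k γ x| C) (fun _ => C) (Ici 0) := by
    rw [← closure_Ioi]
    exact h2.closure (h.continuous_pot.abs.max continuous_const) continuous_const
  have h4 : ∀ x, |pot ρ k γ x| ≤ C := fun x => by
    rcases le_total 0 x with hx | hx
    · exact max_eq_right_iff.1 (h3 hx)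
    · rw [← h.pot_even]
      exact max_eq_right_iff.1 (h3 (by simpa using hx : -x ∈ Ici (0 : ℝ)))
  exact ⟨C, fun l => h4 _⟩

lemma image_sigma (h : Admissible ρ k γ) : sigmaFn ρ k '' Ioi 0 = Ioi 0 := by
  ext l
  constructor
  · rintro ⟨x, hx, rfl⟩
    have := h.strictMono_sigma hx
    rwa [sigma_zero] at this
  · intro hl
    refine ⟨sigmaInv ρ k l, ?_, h.sigma_sigmaInv l⟩
    by_contra hneg
    have := h.strictMono_sigma.monotone (not_lt.1 hneg)
    rw [h.sigma_sigmaInv, sigma_zero] at this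
    exact (lt_of_lt_of_le hl this).false

/-- Under the substitution `l = σ(x)` this is the hypothesis on `√(ρ/k) q σ`: the first moment of
`r` is finite, which is the only decay of `r` used below. -/
lemma integrableOn_r (h : Admissible ρ k γ) : IntegrableOn (fun l => l * rFn ρ k γ l) (Ioi 0) := by
  rw [← h.image_sigma, integrableOn_image_iff_integrableOn_deriv_smul_of_monotoneOn
    measurableSet_Ioi (fun x _ => (h.hasDerivAt_sigma x).hasDerivWithinAt)
    (h.strictMono_sigma.monotone.monotoneOn _)]
  refine h.pot_integrable.congr (Eventually.of_forall fun x => ?_)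
  simp only [smul_eq_mul, h.r_sigma]
  ring

end Admissible

/-! ### Representation of `ℍ¹` by `H¹(ℝ)` -/

/-- The preimage of a null set lies in its image under the left inverse, and differentiable maps of
the line send null sets to null sets. -/
lemma quasiMeasurePreserving_of_leftInverse {τ υ : ℝ → ℝ} (hτ : Continuous τ)
    (hυ : Differentiable ℝ υ) (h : ∀ x, υ (τ x) = x) :
    Measure.QuasiMeasurePreserving τ volume volume := by
  refine ⟨hτ.measurable, Measure.AbsolutelyContinuous.mk fun s hs h0 => ?_⟩
  rw [Measure.map_apply hτ.measurable hs]
  refine measure_mono_null (t := υ '' s) (fun x hx => ⟨τ x, hx, h x⟩) ?_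
  exact addHaar_image_eq_zero_of_differentiableOn_of_addHaar_eq_zero _ hυ.differentiableOn h0

lemma norm_sq_L2 {μ : Measure ℝ} (F : Lp ℝ 2 μ) : ‖F‖ ^ 2 = ∫ x, F x ^ 2 ∂μ := by
  rw [← real_inner_self_eq_norm_sq, L2.inner_def]
  congr 1
  funext x
  simp [sq]

/-- `φ ∈ ℍ¹` is represented by `f ∈ H¹(ℝ)` with derivative `g`. -/
structure Rep {ρ k : ℝ → ℝ} (φ : H1 ρ k) (f g : ℝ → ℝ) : Prop where
  sob : Sob f g
  val : ⇑(valL φ) =ᵐ[volume] opS ρ k f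
  der : ⇑(derL φ) =ᵐ[volume] opS ρ k g

namespace Admissible

variable {ρ k γ : ℝ → ℝ}

lemma measurable_weight (h : Admissible ρ k γ) : Measurable fun x => ENNReal.ofReal (ρ x) :=
  h.continuous_rho.measurable.ennreal_ofReal

lemma wMeasure_ac : wMeasure ρ ≪ volume := withDensity_absolutelyContinuous _ _

lemma ac_wMeasure (h : Admissible ρ k γ) : volume ≪ wMeasure ρ :=
  withDensity_absolutelyContinuous' h.measurable_weight.aemeasurable
    (Eventually.of_forall fun x => by simpa using h.rho_pos x)

lemma ae_wMeasure (h : Admissible ρ k γ) : ae (wMeasure ρ) = ae volume :=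
  le_antisymm wMeasure_ac.ae_le h.ac_wMeasure.ae_le

lemma integral_wMeasure (h : Admissible ρ k γ) (F : ℝ → ℝ) :
    ∫ x, F x ∂(wMeasure ρ) = ∫ x, ρ x * F x := by
  rw [wMeasure, integral_withDensity_eq_integral_toReal_smul h.measurable_weight
    (Eventually.of_forall fun _ => ENNReal.ofReal_lt_top)]
  congr 1
  funext x
  rw [ENNReal.toReal_ofReal (h.rho_pos x).le, smul_eq_mul]

lemma integrable_wMeasure (h : Admissible ρ k γ) (F : ℝ → ℝ) :
    Integrable F (wMeasure ρ) ↔ Integrable fun x => ρ x * F x := by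
  rw [wMeasure, integrable_withDensity_iff_integrable_smul' h.measurable_weight
    (Eventually.of_forall fun _ => ENNReal.ofReal_lt_top)]
  refine integrable_congr (Eventually.of_forall fun x => ?_)
  simp only [ENNReal.toReal_ofReal (h.rho_pos x).le, smul_eq_mul]

lemma quasi_sigma (h : Admissible ρ k γ) :
    Measure.QuasiMeasurePreserving (sigmaFn ρ k) volume volume :=
  quasiMeasurePreserving_of_leftInverse h.continuous_sigma
    (h.contDiff_sigmaInv.differentiable (by norm_num)) h.sigmaInv_sigma

lemma quasi_sigmaInv (h : Admissible ρ k γ) :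
    Measure.QuasiMeasurePreserving (sigmaInv ρ k) volume volume :=
  quasiMeasurePreserving_of_leftInverse h.continuous_sigmaInv
    (fun x => (h.hasDerivAt_sigma x).differentiableAt) h.sigma_sigmaInv

lemma integral_comp_sigma (h : Admissible ρ k γ) (F : ℝ → ℝ) :
    ∫ x, √(ρ x / k x) * F (sigmaFn ρ k x) = ∫ l, F l := by
  have e := integral_image_eq_integral_deriv_smul_of_monotoneOn MeasurableSet.univ
    (fun x _ => (h.hasDerivAt_sigma x).hasDerivWithinAt)
    (h.strictMono_sigma.monotone.monotoneOn univ) F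
  rw [image_univ, h.surjective_sigma.range_eq] at e
  simpa using e.symm

lemma integrable_comp_sigma (h : Admissible ρ k γ) (F : ℝ → ℝ) :
    Integrable (fun x => √(ρ x / k x) * F (sigmaFn ρ k x)) ↔ Integrable F := by
  have e := integrableOn_image_iff_integrableOn_deriv_smul_of_monotoneOn MeasurableSet.univ
    (fun x _ => (h.hasDerivAt_sigma x).hasDerivWithinAt)
    (h.strictMono_sigma.monotone.monotoneOn univ) F
  rw [image_univ, h.surjective_sigma.range_eq] at e
  simpa using e.symm

lemma rho_opS_mul (h : Admissible ρ k γ) (a b : ℝ → ℝ) (x : ℝ) :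
    ρ x * (opS ρ k a x * opS ρ k b x) =
      √(ρ x / k x) * (a (sigmaFn ρ k x) * b (sigmaFn ρ k x)) := by
  have e := h.quart_sq x
  have h1 := (h.quart_pos x).ne'
  have h2 := (h.speed_pos x).ne'
  rw [eq_div_iff h2] at e
  rw [opS, opS, div_mul_div_comm, ← sq, mul_div_assoc', div_eq_iff (pow_ne_zero 2 h1)]
  linear_combination (-(a (sigmaFn ρ k x) * b (sigmaFn ρ k x))) * e

lemma integral_opS_mul (h : Admissible ρ k γ) (a b : ℝ → ℝ) :
    ∫ x, opS ρ k a x * opS ρ k b x ∂(wMeasure ρ) = ∫ l, a l * b l := by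
  rw [h.integral_wMeasure, ← h.integral_comp_sigma fun l => a l * b l]
  simp only [h.rho_opS_mul]

lemma integral_pot_opS_mul (h : Admissible ρ k γ) (a b : ℝ → ℝ) :
    ∫ x, pot ρ k γ x * opS ρ k a x * opS ρ k b x ∂(wMeasure ρ) =
      ∫ l, rFn ρ k γ l * a l * b l := by
  rw [h.integral_wMeasure, ← h.integral_comp_sigma fun l => rFn ρ k γ l * a l * b l]
  congr 1
  funext x
  rw [h.r_sigma]
  linear_combination pot ρ k γ x * h.rho_opS_mul a b x

lemma integrable_opS_sq (h : Admissible ρ k γ) (a : ℝ → ℝ) :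
    Integrable (fun x => opS ρ k a x ^ 2) (wMeasure ρ) ↔ Integrable fun l => a l ^ 2 := by
  rw [h.integrable_wMeasure, ← h.integrable_comp_sigma fun l => a l ^ 2]
  simp only [sq, h.rho_opS_mul]

lemma memLp_opS (h : Admissible ρ k γ) {a : ℝ → ℝ} (ha : MemLp a 2) :
    MemLp (opS ρ k a) 2 (wMeasure ρ) := by
  have h1 : AEStronglyMeasurable (opS ρ k a) volume :=
    ((ha.1.comp_quasiMeasurePreserving h.quasi_sigma).aemeasurable.div
      h.continuous_quart.aemeasurable).aestronglyMeasurable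
  rw [memLp_two_iff_integrable_sq (h1.mono_ac wMeasure_ac), h.integrable_opS_sq]
  exact ha.integrable_sq

lemma memLp_opSinv (h : Admissible ρ k γ) {f : ℝ → ℝ} (hf : MemLp f 2 (wMeasure ρ)) :
    MemLp (opSinv ρ k f) 2 := by
  have h1 : AEStronglyMeasurable (opSinv ρ k f) volume :=
    (h.continuous_quart.comp h.continuous_sigmaInv).aestronglyMeasurable.mul
      ((hf.1.mono_ac h.ac_wMeasure).comp_quasiMeasurePreserving h.quasi_sigmaInv)
  rw [memLp_two_iff_integrable_sq h1, ← h.integrable_opS_sq, h.opS_opSinv]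
  exact hf.integrable_sq

lemma opSinv_congr (h : Admissible ρ k γ) {f g : ℝ → ℝ} (hfg : f =ᵐ[volume] g) :
    opSinv ρ k f =ᵐ[volume] opSinv ρ k g := by
  filter_upwards [h.quasi_sigmaInv.ae_eq_comp hfg] with l hl
  simp only [Function.comp_apply] at hl
  rw [opSinv, opSinv, hl]

lemma opS_congr (h : Admissible ρ k γ) {f g : ℝ → ℝ} (hfg : f =ᵐ[volume] g) :
    opS ρ k f =ᵐ[volume] opS ρ k g := by
  filter_upwards [h.quasi_sigma.ae_eq_comp hfg] with l hl
  simp only [Function.comp_apply] at hl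
  rw [opS, opS, hl]

/-- Every `φ ∈ ℍ¹` is `S f` with `f ∈ H¹(ℝ)`: take `f = S⁻¹φ`, whose derivative is `S⁻¹𝔻φ`. All
later computations take place in `H¹(ℝ)`. -/
lemma exists_rep (h : Admissible ρ k γ) (φ : H1 ρ k) : ∃ f g, Rep φ f g := by
  obtain ⟨f, g, hfg, h1, h2⟩ := φ.2
  rw [EventuallyEq, h.ae_wMeasure] at h1 h2
  obtain ⟨f₀, hf₀, hp⟩ := hfg.exists_isPrim
  have hq := h.isPrim_opSinv hp
  have e1 : ⇑(valL φ) =ᵐ[volume] f₀ := EventuallyEq.trans (show _ =ᵐ[volume] f from h1) hf₀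
  have e2 : ⇑(derL φ) =ᵐ[volume] fun x => √(k x / ρ x) * g x + Q1 ρ k x * f₀ x := by
    filter_upwards [h2, hf₀] with x hx hx'
    rw [← hx']
    exact hx
  refine ⟨_, _, ⟨hq, ?_, ?_⟩, ?_, ?_⟩
  · exact (h.memLp_opSinv (Lp.memLp (valL φ))).ae_eq (h.opSinv_congr e1)
  · exact (h.memLp_opSinv (Lp.memLp (derL φ))).ae_eq (h.opSinv_congr e2)
  · rw [h.opS_opSinv]; exact e1
  · rw [h.opS_opSinv]; exact e2

/-- The element of `ℍ¹` represented by an element of `H¹(ℝ)`. -/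
def ofSob (h : Admissible ρ k γ) {f g : ℝ → ℝ} (hf : Sob f g) : H1 ρ k :=
  ⟨WithLp.toLp 2 ((h.memLp_opS hf.memLp).toLp, (h.memLp_opS hf.memLp_deriv).toLp), by
    refine ⟨_, _, (h.isPrim_opS hf.prim).hasWeakDeriv, MemLp.coeFn_toLp (h.memLp_opS hf.memLp), ?_⟩
    refine (MemLp.coeFn_toLp (h.memLp_opS hf.memLp_deriv)).trans (Eventually.of_forall fun x => ?_)
    have := (h.speed_pos x).ne'
    simp only [inv_speed (ρ := ρ) (k := k)]
    field_simp
    ring⟩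

lemma rep_ofSob (h : Admissible ρ k γ) {f g : ℝ → ℝ} (hf : Sob f g) : Rep (h.ofSob hf) f g where
  sob := hf
  val := by
    have := MemLp.coeFn_toLp (h.memLp_opS hf.memLp)
    rwa [EventuallyEq, h.ae_wMeasure] at this
  der := by
    have := MemLp.coeFn_toLp (h.memLp_opS hf.memLp_deriv)
    rwa [EventuallyEq, h.ae_wMeasure] at this

end Admissible

section Rep

variable {ρ k γ : ℝ → ℝ} {φ ψ : H1 ρ k} {f g f₁ g₁ : ℝ → ℝ}

lemma H1.ext_of_ae (h : Admissible ρ k γ) (h1 : ⇑(valL φ) =ᵐ[volume] valL ψ)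
    (h2 : ⇑(derL φ) =ᵐ[volume] derL ψ) : φ = ψ := by
  apply Subtype.ext
  apply (WithLp.equiv 2 (L2w ρ × L2w ρ)).injective
  refine Prod.ext (Lp.ext ?_) (Lp.ext ?_)
  · rw [EventuallyEq, h.ae_wMeasure]; exact h1
  · rw [EventuallyEq, h.ae_wMeasure]; exact h2

lemma Rep.opSinv_val (h : Admissible ρ k γ) (hφ : Rep φ f g) :
    opSinv ρ k (valL φ) =ᵐ[volume] f := by
  have := h.opSinv_congr hφ.val
  rwa [h.opSinv_opS] at this

lemma Rep.unique (h : Admissible ρ k γ) (hφ : Rep φ f g) (hφ' : Rep φ f₁ g₁) :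
    f = f₁ ∧ g =ᵐ[volume] g₁ :=
  hφ.sob.prim.ae_eq_of_ae_eq hφ'.sob.prim ((hφ.opSinv_val h).symm.trans (hφ'.opSinv_val h))

/-- The component `𝔻φ` is determined by `φ` almost everywhere, so a representation may be checked on
values alone. -/
lemma Rep.of_val (h : Admissible ρ k γ) (hf : Sob f g)
    (hv : ⇑(valL φ) =ᵐ[volume] opS ρ k f) : Rep φ f g := by
  obtain ⟨f₁, g₁, h1⟩ := h.exists_rep φ
  have h2 := h.opSinv_congr hv
  rw [h.opSinv_opS] at h2
  have := hf.prim.ae_eq_of_ae_eq h1.sob.prim (h2.symm.trans (h1.opSinv_val h))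
  exact ⟨hf, hv, h1.der.trans (h.opS_congr this.2.symm)⟩

lemma Rep.eq (h : Admissible ρ k γ) (hφ : Rep φ f g) (hψ : Rep ψ f g) : φ = ψ :=
  H1.ext_of_ae h (hφ.val.trans hψ.val.symm) (hφ.der.trans hψ.der.symm)

lemma Rep.add (h : Admissible ρ k γ) (hφ : Rep φ f g) (hψ : Rep ψ f₁ g₁) :
    Rep (φ + ψ) (fun x => f x + f₁ x) (fun x => g x + g₁ x) := by
  refine Rep.of_val h (hφ.sob.add hψ.sob) ?_
  have e := Lp.coeFn_add (valL φ) (valL ψ)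
  rw [EventuallyEq, h.ae_wMeasure] at e
  filter_upwards [hφ.val, hψ.val, e] with x h1 h2 h3
  have : valL (φ + ψ) x = (valL φ + valL ψ) x := rfl
  rw [this, h3, Pi.add_apply, h1, h2, opS, opS, opS, add_div]

lemma Rep.smul (h : Admissible ρ k γ) (hφ : Rep φ f g) (c : ℝ) :
    Rep (c • φ) (fun x => c * f x) (fun x => c * g x) := by
  refine Rep.of_val h (hφ.sob.const_mul c) ?_
  have e := Lp.coeFn_smul c (valL φ)
  rw [EventuallyEq, h.ae_wMeasure] at e
  filter_upwards [hφ.val, e] with x h1 h3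
  have : valL (c • φ) x = (c • valL φ) x := rfl
  rw [this, h3, Pi.smul_apply, h1, opS, opS, smul_eq_mul, mul_div_assoc]

lemma Rep.sub (h : Admissible ρ k γ) (hφ : Rep φ f g) (hψ : Rep ψ f₁ g₁) :
    Rep (φ - ψ) (fun x => f x - f₁ x) (fun x => g x - g₁ x) := by
  have := hφ.add h (hψ.smul h (-1))
  simpa [sub_eq_add_neg] using this

lemma Rep.norm_sq (h : Admissible ρ k γ) (hφ : Rep φ f g) :
    ‖φ‖ ^ 2 = (∫ x, f x ^ 2) + ∫ x, g x ^ 2 := by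
  have e : ‖φ‖ ^ 2 = ‖valL φ‖ ^ 2 + ‖derL φ‖ ^ 2 := WithLp.prod_norm_sq_eq_of_L2 φ.1
  have hv := hφ.val
  have hd := hφ.der
  rw [EventuallyEq, ← h.ae_wMeasure] at hv hd
  rw [e, norm_sq_L2, norm_sq_L2, integral_congr_ae (hv.mono fun x hx => congrArg (· ^ 2) hx),
    integral_congr_ae (hd.mono fun x hx => congrArg (· ^ 2) hx)]
  simp only [sq, h.integral_opS_mul]

lemma Rep.sq_le (h : Admissible ρ k γ) (hφ : Rep φ f g) (x : ℝ) : |f x| ≤ ‖φ‖ := by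
  refine abs_le_of_sq_le_sq ?_ (norm_nonneg _)
  rw [hφ.norm_sq h]
  exact hφ.sob.sq_le x

lemma Rep.toNeg_apply (h : Admissible ρ k γ) (hφ : Rep φ f g) (hψ : Rep ψ f₁ g₁) :
    toNeg φ ψ = ∫ x, f x * f₁ x := by
  have e : toNeg φ ψ = inner ℝ (valL φ) (valL ψ) := rfl
  have hv := hφ.val
  have hd := hψ.val
  rw [EventuallyEq, ← h.ae_wMeasure] at hv hd
  rw [e, L2.inner_def, ← h.integral_opS_mul]
  refine integral_congr_ae ?_
  filter_upwards [hv, hd] with x h1 h2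
  rw [h1, h2]
  simp [mul_comm]

lemma Rep.contRep_eq (h : Admissible ρ k γ) (hφ : Rep φ f g) :
    contRep (valL φ) = opS ρ k f := by
  have hc : Continuous (opS ρ k f) := (h.isPrim_opS hφ.sob.prim).continuous
  have hs : Continuous (contRep (valL φ)) ∧ contRep (valL φ) =ᵐ[volume] valL φ :=
    Classical.epsilon_spec (p := fun g : ℝ → ℝ => Continuous g ∧ g =ᵐ[volume] valL φ)
      ⟨_, hc, hφ.val.symm⟩
  exact (Continuous.ae_eq_iff_eq volume hs.1 hc).1 (hs.2.trans hφ.val)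

lemma Rep.contRep_zero (h : Admissible ρ k γ) (hφ : Rep φ f g) :
    c0 ρ k * contRep (valL φ) 0 = f 0 := by
  rw [hφ.contRep_eq h, opS, Admissible.sigma_zero]
  exact mul_div_cancel₀ _ h.c0_pos.ne'

/-- The right-hand side of (1) in `H¹(ℝ)`. Since `√((ρk)(0)) = c₀²` and `c₀ φ(0) = f₁(0)`, one
factor `c₀` is absorbed by the evaluation at the origin and one remains in front of the control. -/
lemma Rep.rhs_eq (h : Admissible ρ k γ) (hφ : Rep φ f g) (hψ : Rep ψ f₁ g₁) (a : ℝ) :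
    rhs ρ k γ φ a ψ = -(∫ x, g x * g₁ x) - (∫ x, rFn ρ k γ x * f x * f₁ x)
      - 2 * c0 ρ k * a * f₁ 0 := by
  have hv := hφ.val
  have hd := hφ.der
  have hv' := hψ.val
  have hd' := hψ.der
  rw [EventuallyEq, ← h.ae_wMeasure] at hv hd hv' hd'
  rw [rhs, h.c0_sq, ← hψ.contRep_zero h, ← h.integral_opS_mul, ← h.integral_pot_opS_mul]
  congr 1
  · congr 1
    · congr 1
      refine integral_congr_ae ?_
      filter_upwards [hd, hd'] with x h1 h2
      rw [h1, h2]
    · refine integral_congr_ae ?_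
      filter_upwards [hv, hv'] with x h1 h2
      rw [h1, h2]
  · ring

lemma Rep.isEven_iff (h : Admissible ρ k γ) (hφ : Rep φ f g) :
    IsEven φ ↔ ∀ x, f (-x) = f x := by
  have hc : Continuous (opS ρ k f) := (h.isPrim_opS hφ.sob.prim).continuous
  have hq : (fun x => valL φ (-x)) =ᵐ[volume] fun x => opS ρ k f (-x) :=
    (Measure.measurePreserving_neg volume).quasiMeasurePreserving.ae_eq_comp hφ.val
  have e : IsEven φ ↔ (fun x => opS ρ k f (-x)) = opS ρ k f := by
    rw [← Continuous.ae_eq_iff_eq volume (f := fun x => opS ρ k f (-x)) (hc.comp continuous_neg) hc]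
    exact ⟨fun h1 => hq.symm.trans (h1.trans hφ.val), fun h1 => hq.trans (h1.trans hφ.val.symm)⟩
  rw [e, funext_iff]
  constructor
  · intro h1 x
    have := h1 (sigmaInv ρ k x)
    rw [opS, opS, h.even_rho, h.even_k, h.sigma_neg, h.sigma_sigmaInv] at this
    exact (div_left_inj' (h.quart_pos _).ne').1 this
  · intro h1 x
    rw [opS, opS, h.even_rho, h.even_k, h.sigma_neg, h1]

end Rep

/-! ### Constant coefficients -/

lemma Q1_one : Q1 1 1 = 0 := by
  funext x
  simp [Q1]

lemma pot_one : pot 1 1 0 = 0 := by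
  funext x
  simp [pot, Q2, Q1_one]

lemma sigmaFn_one : sigmaFn 1 1 = id := by
  funext x
  simp [sigmaFn]

/-- Makes every statement about `ℍ¹` and system (1) available for `H¹` and system (2). -/
lemma admissible_one : Admissible 1 1 0 where
  even_rho _ := rfl
  even_k _ := rfl
  even_gamma _ := rfl
  smooth_rho := contDiffOn_const
  smooth_k := contDiffOn_const
  pos_rho _ _ := one_pos
  pos_k _ _ := one_pos
  smooth_rho_k := contDiffOn_const.mul contDiffOn_const
  deriv_zero := by simp
  sigma_tendsto := by rw [sigmaFn_one]; exact tendsto_id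
  pot_bounded := by rw [pot_one]; exact MemLp.zero
  pot_smooth := by rw [pot_one]; exact contDiffOn_const
  pot_integrable := by simp [pot_one]

lemma opS_one (f : ℝ → ℝ) : opS 1 1 f = f := by
  funext x
  simp [opS, sigmaFn_one]

lemma c0_one : c0 1 1 = 1 := by simp [c0]

lemma rFn_one : rFn 1 1 0 = 0 := by
  funext x
  simp [rFn, pot_one]

/-! ### Functions of two variables with continuous partial derivatives -/

lemma hasFDerivAt_of_partials {s : Set (ℝ × ℝ)} (hs : IsOpen s) {f f₁ f₂ : ℝ → ℝ → ℝ}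
    (h₁ : ∀ p ∈ s, HasDerivAt (fun x => f x p.2) (f₁ p.1 p.2) p.1)
    (h₂ : ∀ p ∈ s, HasDerivAt (fun y => f p.1 y) (f₂ p.1 p.2) p.2)
    (c₁ : ContinuousOn (fun p : ℝ × ℝ => f₁ p.1 p.2) s)
    (c₂ : ContinuousOn (fun p : ℝ × ℝ => f₂ p.1 p.2) s) {p : ℝ × ℝ} (hp : p ∈ s) :
    HasFDerivAt (fun p : ℝ × ℝ => f p.1 p.2)
      (f₁ p.1 p.2 • ContinuousLinearMap.fst ℝ ℝ ℝ + f₂ p.1 p.2 • ContinuousLinearMap.snd ℝ ℝ ℝ)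
      p := by
  have hn : s ∈ 𝓝 p := hs.mem_nhds hp
  have := hasStrictFDerivAt_uncurry_coprod (𝕜 := ℝ) (u := p) (f := f)
    (f₁ := fun x y => ContinuousLinearMap.toSpanSingleton ℝ (f₁ x y))
    (f₂ := fun x y => ContinuousLinearMap.toSpanSingleton ℝ (f₂ x y))
    (by filter_upwards [hn] with q hq using (h₁ q hq).hasFDerivAt)
    (by filter_upwards [hn] with q hq using (h₂ q hq).hasFDerivAt)
    (by
      have h := (c₁.continuousAt hn)
      exact (ContinuousLinearMap.toSpanSingletonCLE (𝕜 := ℝ) (E := ℝ)).continuous.continuousAt.comp h)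
    (by
      have h := (c₂.continuousAt hn)
      exact (ContinuousLinearMap.toSpanSingletonCLE (𝕜 := ℝ) (E := ℝ)).continuous.continuousAt.comp h)
  refine this.hasFDerivAt.congr_fderiv ?_
  ext <;> simp [Function.HasUncurry.uncurry]

lemma contDiffOn_succ_of_partials {s : Set (ℝ × ℝ)} (hs : IsOpen s) {f f₁ f₂ : ℝ → ℝ → ℝ} (n : ℕ)
    (h₁ : ∀ p ∈ s, HasDerivAt (fun x => f x p.2) (f₁ p.1 p.2) p.1)
    (h₂ : ∀ p ∈ s, HasDerivAt (fun y => f p.1 y) (f₂ p.1 p.2) p.2)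
    (c₁ : ContDiffOn ℝ n (fun p : ℝ × ℝ => f₁ p.1 p.2) s)
    (c₂ : ContDiffOn ℝ n (fun p : ℝ × ℝ => f₂ p.1 p.2) s) :
    ContDiffOn ℝ (n + 1) (fun p : ℝ × ℝ => f p.1 p.2) s := by
  have hd := fun p hp => hasFDerivAt_of_partials hs h₁ h₂ c₁.continuousOn c₂.continuousOn (p := p) hp
  rw [contDiffOn_succ_iff_fderiv_of_isOpen hs]
  refine ⟨fun p hp => (hd p hp).differentiableAt.differentiableWithinAt, by simp, ?_⟩
  refine ContDiffOn.congr ?_ fun p hp => (hd p hp).fderiv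
  exact (c₁.smul contDiffOn_const).add (c₂.smul contDiffOn_const)

lemma contDiff_succ_of_partials {f f₁ f₂ : ℝ → ℝ → ℝ} (n : ℕ)
    (h₁ : ∀ x y, HasDerivAt (fun x => f x y) (f₁ x y) x)
    (h₂ : ∀ x y, HasDerivAt (fun y => f x y) (f₂ x y) y)
    (c₁ : ContDiff ℝ n (fun p : ℝ × ℝ => f₁ p.1 p.2))
    (c₂ : ContDiff ℝ n (fun p : ℝ × ℝ => f₂ p.1 p.2)) :
    ContDiff ℝ (n + 1) (fun p : ℝ × ℝ => f p.1 p.2) := by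
  rw [← contDiffOn_univ] at *
  exact contDiffOn_succ_of_partials isOpen_univ n (fun p _ => h₁ p.1 p.2) (fun p _ => h₂ p.1 p.2)
    c₁ c₂

lemma contDiff_one_of_partials {f f₁ f₂ : ℝ → ℝ → ℝ}
    (h₁ : ∀ x y, HasDerivAt (fun x => f x y) (f₁ x y) x)
    (h₂ : ∀ x y, HasDerivAt (fun y => f x y) (f₂ x y) y)
    (c₁ : Continuous fun p : ℝ × ℝ => f₁ p.1 p.2) (c₂ : Continuous fun p : ℝ × ℝ => f₂ p.1 p.2) :
    ContDiff ℝ 1 (fun p : ℝ × ℝ => f p.1 p.2) := by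
  have := contDiff_succ_of_partials 0 h₁ h₂ (by rw [Nat.cast_zero]; exact contDiff_zero.2 c₁)
    (by rw [Nat.cast_zero]; exact contDiff_zero.2 c₂)
  simpa using this

/-! ### Parametric integrals -/

lemma hasDerivAt_intervalIntegral_param {E E' : ℝ → ℝ → ℝ}
    (hE : Continuous fun p : ℝ × ℝ => E p.1 p.2) (hE' : Continuous fun p : ℝ × ℝ => E' p.1 p.2)
    (h : ∀ u t, HasDerivAt (fun u => E u t) (E' u t) u) (a b u : ℝ) :
    HasDerivAt (fun u => ∫ t in a..b, E u t) (∫ t in a..b, E' u t) u := by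
  obtain ⟨C, hC⟩ := ((isCompact_closedBall u 1).prod (isCompact_uIcc (a := a) (b := b))).exists_bound_of_continuousOn
    hE'.continuousOn
  have hc : ∀ u, Continuous fun t => E u t := fun u => hE.comp (by fun_prop : Continuous fun t => (u, t))
  have hc' : ∀ u, Continuous fun t => E' u t := fun u => hE'.comp (by fun_prop : Continuous fun t => (u, t))
  refine (intervalIntegral.hasDerivAt_integral_of_dominated_loc_of_deriv_le
    (Metric.ball_mem_nhds u one_pos) (Eventually.of_forall fun x => (hc x).aestronglyMeasurable)
    ((hc u).intervalIntegrable _ _) (hc' u).aestronglyMeasurable (bound := fun _ => C)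
    (Eventually.of_forall fun t ht x hx => ?_) intervalIntegrable_const
    (Eventually.of_forall fun t _ x _ => h x t)).2
  exact hC (x, t) ⟨Metric.ball_subset_closedBall hx, uIoc_subset_uIcc ht⟩

lemma continuous_intervalIntegral_param {E : ℝ → ℝ → ℝ}
    (hE : Continuous fun p : ℝ × ℝ => E p.1 p.2) :
    Continuous fun p : ℝ × ℝ => ∫ t in (0 : ℝ)..p.2, E p.1 t :=
  intervalIntegral.continuous_parametric_intervalIntegral_of_continuous
    (f := fun (p : ℝ × ℝ) t => E p.1 t)
    (hE.comp (by fun_prop : Continuous fun q : (ℝ × ℝ) × ℝ => (q.1.1, q.2))) continuous_snd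

/-- Continuity of `(a, t) ↦ ∫_a^∞ r(λ) Φ(λ, t) dλ`. -/
lemma continuous_tail {r : ℝ → ℝ} (hr : Integrable r) {Φ : ℝ → ℝ → ℝ} {B : ℝ → ℝ}
    (hΦ : Continuous fun p : ℝ × ℝ => Φ p.1 p.2) (hB : Continuous B)
    (hle : ∀ l t, |Φ l t| ≤ B t) :
    Continuous fun p : ℝ × ℝ => ∫ l in Ioi p.1, r l * Φ l p.2 := by
  have e : (fun p : ℝ × ℝ => ∫ l in Ioi p.1, r l * Φ l p.2) =
      fun p => ∫ l, (Ioi p.1).indicator (fun l => r l * Φ l p.2) l := by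
    funext p
    rw [integral_indicator measurableSet_Ioi]
  rw [e]
  refine continuous_iff_continuousAt.2 fun p => ?_
  have hm : ∀ t, Continuous fun l => Φ l t := fun t => hΦ.comp (by fun_prop : Continuous fun l => (l, t))
  refine continuousAt_of_dominated (bound := fun l => |r l| * (B p.2 + 1)) ?_ ?_ ?_ ?_
  · exact Eventually.of_forall fun q =>
      (hr.1.mul (hm q.2).aestronglyMeasurable).indicator measurableSet_Ioi
  · have : ∀ᶠ q : ℝ × ℝ in 𝓝 p, B q.2 < B p.2 + 1 :=
      (hB.comp continuous_snd).continuousAt.eventually (gt_mem_nhds (by simp))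
    filter_upwards [this] with q hq
    refine Eventually.of_forall fun l => ?_
    refine (norm_indicator_le_norm_self _ _).trans ?_
    rw [norm_mul]
    exact mul_le_mul_of_nonneg_left ((hle l q.2).trans hq.le) (norm_nonneg _)
  · exact hr.abs.mul_const _
  -- For fixed `l` the indicator is locally constant in the limit `q.1` except at `q.1 = l`, so
  -- continuity at `p` fails for at most one `l`.
  · have : ∀ᵐ l : ℝ, l ≠ p.1 := by simp [ae_iff, measure_singleton]
    filter_upwards [this] with l hl
    have hcont : ContinuousAt (fun q : ℝ × ℝ => r l * Φ l q.2) p :=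
      (continuous_const.mul (hΦ.comp (by fun_prop : Continuous fun q : ℝ × ℝ => (l, q.2)))).continuousAt
    rcases lt_or_gt_of_ne hl with h | h
    · have : (fun q : ℝ × ℝ => (Ioi q.1).indicator (fun l => r l * Φ l q.2) l) =ᶠ[𝓝 p] fun _ => 0 := by
        filter_upwards [continuous_fst.continuousAt.eventually (lt_mem_nhds h)] with q hq
        exact indicator_of_notMem (by simpa using hq.le) _
      exact continuousAt_const.congr this.symm
    · have : (fun q : ℝ × ℝ => (Ioi q.1).indicator (fun l => r l * Φ l q.2) l) =ᶠ[𝓝 p]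
          fun q => r l * Φ l q.2 := by
        filter_upwards [continuous_fst.continuousAt.eventually (gt_mem_nhds h)] with q hq
        exact indicator_of_mem hq _
      exact hcont.congr this.symm

lemma hasDerivAt_tail {p : ℝ → ℝ} (hp : Integrable p) (hc : Continuous p) (a : ℝ) :
    HasDerivAt (fun a => ∫ l in Ioi a, p l) (-p a) a := by
  have e : (fun a => ∫ l in Ioi a, p l) =
      fun a => (∫ l in Ioi (0 : ℝ), p l) - ∫ l in (0 : ℝ)..a, p l := by
    funext a
    have := intervalIntegral.integral_interval_add_Ioi (a := 0) (b := a) (f := p) (μ := volume)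
      hp.integrableOn hp.integrableOn
    linarith
  rw [e]
  have h := intervalIntegral.integral_hasDerivAt_right (hc.intervalIntegrable 0 a)
    (hc.stronglyMeasurableAtFilter _ _) hc.continuousAt
  simpa using h.const_sub (∫ l in Ioi (0 : ℝ), p l)

lemma abs_tail_le {r : ℝ → ℝ} (hr : Integrable r) {Φ : ℝ → ℝ} {B : ℝ} (hle : ∀ l, |Φ l| ≤ B)
    (a : ℝ) : |∫ l in Ioi a, r l * Φ l| ≤ (∫ l, |r l|) * B := by
  have hB : 0 ≤ B := (abs_nonneg _).trans (hle 0)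
  refine (norm_integral_le_of_norm_le (f := fun l => r l * Φ l) (hr.abs.mul_const B).integrableOn
    (Eventually.of_forall fun l => ?_)).trans ?_
  · rw [norm_mul]
    exact mul_le_mul_of_nonneg_left (hle l) (norm_nonneg _)
  · rw [integral_mul_const]
    exact mul_le_mul_of_nonneg_right
      (setIntegral_le_integral hr.abs (Eventually.of_forall fun l => abs_nonneg _)) hB

/-- Differentiation of `t ↦ ∫_a^∞ r(λ) Φ(λ, t) dλ`. -/
lemma hasDerivAt_tail_param {r : ℝ → ℝ} (hr : Integrable r) {Φ Φ' : ℝ → ℝ → ℝ} {B B' : ℝ → ℝ}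
    (hΦ : Continuous fun p : ℝ × ℝ => Φ p.1 p.2) (hΦ' : Continuous fun p : ℝ × ℝ => Φ' p.1 p.2)
    (hB' : Continuous B') (hle : ∀ l t, |Φ l t| ≤ B t) (hle' : ∀ l t, |Φ' l t| ≤ B' t)
    (h : ∀ l t, HasDerivAt (fun t => Φ l t) (Φ' l t) t) (a t : ℝ) :
    HasDerivAt (fun t => ∫ l in Ioi a, r l * Φ l t) (∫ l in Ioi a, r l * Φ' l t) t := by
  have hm : ∀ t, Continuous fun l => Φ l t := fun t => hΦ.comp (by fun_prop : Continuous fun l => (l, t))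
  have hm' : ∀ t, Continuous fun l => Φ' l t := fun t => hΦ'.comp (by fun_prop : Continuous fun l => (l, t))
  have hr' : Integrable r (volume.restrict (Ioi a)) := hr.integrableOn
  obtain ⟨C, hC⟩ := (isCompact_closedBall t 1).exists_bound_of_continuousOn hB'.continuousOn
  refine (hasDerivAt_integral_of_dominated_loc_of_deriv_le (bound := fun l => |r l| * C)
    (Metric.ball_mem_nhds t one_pos) (Eventually.of_forall fun x =>
      hr'.1.mul (hm x).aestronglyMeasurable) ?_ (hr'.1.mul (hm' t).aestronglyMeasurable)
    (Eventually.of_forall fun l x hx => ?_) (hr'.abs.mul_const C)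
    (Eventually.of_forall fun l x _ => (h l x).const_mul (r l))).2
  · exact Integrable.mono' (hr'.abs.mul_const (B t)) (hr'.1.mul (hm t).aestronglyMeasurable)
      (Eventually.of_forall fun l => by
        rw [Pi.mul_apply, norm_mul]; exact mul_le_mul_of_nonneg_left (hle l t) (norm_nonneg _))
  · rw [norm_mul]
    exact mul_le_mul_of_nonneg_left ((hle' l x).trans ((le_abs_self _).trans
      (hC x (Metric.ball_subset_closedBall hx)))) (norm_nonneg _)

/-- Integration gains the factor `1/c` against the weight `exp(c|t|)`; a large `c` turns Volterra
operators into contractions in the weighted norm. -/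
lemma abs_integral_le_exp {f : ℝ → ℝ} {M c : ℝ} (hc : 0 < c)
    (h : ∀ t, |f t| ≤ M * Real.exp (c * |t|)) (v : ℝ) :
    |∫ t in (0 : ℝ)..v, f t| ≤ M / c * Real.exp (c * |v|) := by
  have hM : 0 ≤ M := by
    have := (abs_nonneg _).trans (h 0)
    simpa using this
  have key : ∀ g : ℝ → ℝ, (∀ t, |g t| ≤ M * Real.exp (c * |t|)) → ∀ w, 0 ≤ w →
      |∫ t in (0 : ℝ)..w, g t| ≤ M / c * Real.exp (c * w) := by
    intro g hg w hw
    have h1 : ∀ t ∈ Ioc 0 w, ‖g t‖ ≤ M * Real.exp (c * t) := fun t ht => by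
      have := hg t
      rwa [abs_of_pos ht.1] at this
    have h2 : IntervalIntegrable (fun t => M * Real.exp (c * t)) volume 0 w :=
      (by fun_prop : Continuous fun t => M * Real.exp (c * t)).intervalIntegrable _ _
    refine (intervalIntegral.norm_integral_le_of_norm_le hw (Eventually.of_forall h1) h2).trans ?_
    have h3 : ∀ t ∈ uIcc 0 w, HasDerivAt (fun t => M / c * Real.exp (c * t))
        (M * Real.exp (c * t)) t := fun t _ => by
      refine (((hasDerivAt_id' t).const_mul c).exp.const_mul (M / c)).congr_deriv ?_
      field_simp
    rw [intervalIntegral.integral_eq_sub_of_hasDerivAt h3 h2]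
    have : 0 ≤ M / c := by positivity
    simp only [mul_zero, Real.exp_zero, mul_one]
    linarith
  rcases le_total 0 v with hv | hv
  · rw [abs_of_nonneg hv]; exact key f h v hv
  · rw [abs_of_nonpos hv]
    have e := intervalIntegral.integral_comp_neg (a := 0) (b := -v) f
    rw [neg_neg, neg_zero] at e
    rw [intervalIntegral.integral_symm, abs_neg, ← e]
    exact key _ (fun t => by simpa using h (-t)) (-v) (by linarith)

/-! ### The Goursat problem in characteristic coordinates -/

/-- `r` is continuously differentiable, bounded and integrable. -/
structure SmoothPot (r : ℝ → ℝ) : Prop where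
  smooth : ContDiff ℝ 1 r
  bdd : ∃ C, ∀ x, |r x| ≤ C
  int : Integrable r

/-- `H` solves the integral equation of the Goursat problem with potential `r`. -/
structure IsGoursat (r : ℝ → ℝ) (H : ℝ → ℝ → ℝ) : Prop where
  cont : Continuous fun p : ℝ × ℝ => H p.1 p.2
  bound : ∃ M c, 0 < c ∧ ∀ u v, |H u v| ≤ M * Real.exp (c * |v|)
  eq : ∀ u v, H u v = 1 / 2 * (∫ l in Ioi u, r l) +
    ∫ t in (0 : ℝ)..v, ∫ l in Ioi (u - t), r l * H (l + t) t

/-- The fixed point is sought as `H = exp(c|v|) J` with `J` bounded and continuous on the whole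
plane. The inner integral costs a factor `‖r‖₁` and the outer one gains `1/c`, so the map on `J`
contracts. Working on the plane avoids any boundary regularity. -/
theorem exists_isGoursat {r : ℝ → ℝ} (hr : SmoothPot r) : ∃ H, IsGoursat r H := by
  set N := ∫ l, |r l| with hN
  have hN0 : 0 ≤ N := integral_nonneg fun l => abs_nonneg _
  -- Any `c ≥ 2‖r‖₁` gives contraction constant `1/2`; the summand one keeps `c` positive when `r =
  -- 0`.
  set c := 2 * N + 1 with hc
  have hc0 : 0 < c := by positivity
  have hNc : N / c ≤ 1 / 2 := by rw [div_le_iff₀ hc0]; linarith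
  let X := BoundedContinuousFunction (ℝ × ℝ) ℝ
  let e : ℝ → ℝ := fun t => Real.exp (c * |t|)
  have he0 : ∀ t, 0 < e t := fun t => Real.exp_pos _
  have he : Continuous e := by fun_prop
  let I : X → ℝ → ℝ → ℝ := fun J u t => ∫ l in Ioi (u - t), r l * (e t * J (l + t, t))
  have hbd : ∀ (J : X) l t, |e t * J (l + t, t)| ≤ ‖J‖ * e t := fun J l t => by
    rw [abs_mul, abs_of_pos (he0 t), mul_comm]
    exact mul_le_mul_of_nonneg_right (J.norm_coe_le_norm _) (he0 t).le
  have hIc : ∀ J : X, Continuous fun p : ℝ × ℝ => I J p.1 p.2 := fun J => by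
    have h1 := continuous_tail hr.int (Φ := fun l t => e t * J (l + t, t)) (B := fun t => ‖J‖ * e t)
      ((he.comp continuous_snd).mul (J.continuous.comp (by fun_prop))) (by fun_prop) (hbd J)
    exact h1.comp (by fun_prop : Continuous fun p : ℝ × ℝ => (p.1 - p.2, p.2))
  have hIb : ∀ (J : X) u t, |I J u t| ≤ (N * ‖J‖) * e t := fun J u t => by
    have := abs_tail_le hr.int (fun l => hbd J l t) (u - t)
    rwa [← mul_assoc] at this
  have hIlin : ∀ (J J' : X) u t, I J u t - I J' u t = I (J - J') u t := fun J J' u t => by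
    have hint : ∀ J : X, IntegrableOn (fun l => r l * (e t * J (l + t, t))) (Ioi (u - t)) := fun J =>
      Integrable.mono' (hr.int.abs.mul_const (‖J‖ * e t)).integrableOn
        (hr.int.1.restrict.mul (continuous_const.mul (J.continuous.comp
          (by fun_prop))).aestronglyMeasurable) (Eventually.of_forall fun l => by
            rw [norm_mul]; exact mul_le_mul_of_nonneg_left (hbd J l t) (norm_nonneg _))
    simp only [I]
    rw [← integral_sub (hint J) (hint J')]
    congr 1
    funext l
    have : (J - J') (l + t, t) = J (l + t, t) - J' (l + t, t) := rfl
    rw [this]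
    ring
  let S : X → ℝ → ℝ → ℝ := fun J u v => ∫ t in (0 : ℝ)..v, I J u t
  have hSc : ∀ J : X, Continuous fun p : ℝ × ℝ => S J p.1 p.2 := fun J =>
    continuous_intervalIntegral_param (hIc J)
  have hSb : ∀ (J : X) u v, |S J u v| ≤ (1 / 2 * ‖J‖) * e v := fun J u v => by
    refine (abs_integral_le_exp hc0 (hIb J u) v).trans (mul_le_mul_of_nonneg_right ?_ (he0 v).le)
    rw [mul_div_right_comm]
    exact mul_le_mul_of_nonneg_right hNc (norm_nonneg _)
  let h0 : ℝ → ℝ := fun u => 1 / 2 * ∫ l in Ioi u, r l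
  have h0c : Continuous h0 := continuous_const.mul
    (continuous_iff_continuousAt.2 fun a =>
      (hasDerivAt_tail hr.int hr.smooth.continuous a).continuousAt)
  have h0b : ∀ u, |h0 u| ≤ N := fun u => by
    have := abs_tail_le hr.int (Φ := fun _ => 1) (B := 1) (by simp) u
    simp only [mul_one] at this
    simp only [h0, abs_mul]
    rw [abs_of_pos (by norm_num : (0:ℝ) < 1 / 2)]
    linarith [abs_nonneg (∫ l in Ioi u, r l)]
  have he1 : ∀ v, 1 ≤ e v := fun v => Real.one_le_exp (by positivity)
  let Ψ : X → X := fun J => BoundedContinuousFunction.ofNormedAddCommGroup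
    (fun p : ℝ × ℝ => (e p.2)⁻¹ * (h0 p.1 + S J p.1 p.2))
    (((he.comp continuous_snd).inv₀ fun p => (he0 _).ne').mul
      ((h0c.comp continuous_fst).add (hSc J))) (N + 1 / 2 * ‖J‖) (fun p => by
        rw [norm_mul, norm_inv, Real.norm_of_nonneg (he0 _).le, inv_mul_le_iff₀ (he0 _)]
        refine (norm_add_le _ _).trans ?_
        have h1 := h0b p.1
        have h2 := hSb J p.1 p.2
        have h3 := mul_le_mul_of_nonneg_left (he1 p.2) hN0
        rw [Real.norm_eq_abs, Real.norm_eq_abs]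
        nlinarith)
  have hΨ : ContractingWith (1 / 2) Ψ := by
    refine ⟨by norm_num, LipschitzWith.of_dist_le_mul fun J J' => ?_⟩
    rw [BoundedContinuousFunction.dist_le (by positivity)]
    intro p
    have h1 : Ψ J p - Ψ J' p = (e p.2)⁻¹ * S (J - J') p.1 p.2 := by
      have h2 : S J p.1 p.2 - S J' p.1 p.2 = S (J - J') p.1 p.2 := by
        have hc1 : ∀ J : X, IntervalIntegrable (fun t => I J p.1 t) volume 0 p.2 := fun J =>
          ((hIc J).comp (by fun_prop : Continuous fun t => (p.1, t))).intervalIntegrable _ _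
        simp only [S]
        rw [← intervalIntegral.integral_sub (hc1 J) (hc1 J')]
        simp only [hIlin]
      rw [← h2]
      change (e p.2)⁻¹ * (h0 p.1 + S J p.1 p.2) - (e p.2)⁻¹ * (h0 p.1 + S J' p.1 p.2) = _
      ring
    rw [Real.dist_eq, h1, abs_mul, abs_inv, abs_of_pos (he0 _), inv_mul_le_iff₀ (he0 _)]
    have := hSb (J - J') p.1 p.2
    rw [dist_eq_norm]
    simp only [NNReal.coe_div, NNReal.coe_one, NNReal.coe_ofNat]
    linarith
  obtain ⟨J, hJ⟩ : ∃ J, Ψ J = J := ⟨_, hΨ.fixedPoint_isFixedPt⟩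
  refine ⟨fun u v => e v * J (u, v), ?_, ⟨‖J‖, c, hc0, fun u v => ?_⟩, fun u v => ?_⟩
  · exact (he.comp continuous_snd).mul J.continuous
  · have := hbd J (u - v) v
    simpa using this
  · have h1 : J (u, v) = (e v)⁻¹ * (h0 u + S J u v) := by
      conv_lhs => rw [← hJ]
      rfl
    rw [h1, ← mul_assoc, mul_inv_cancel₀ (he0 v).ne', one_mul]

namespace IsGoursat

variable {r : ℝ → ℝ} {H : ℝ → ℝ → ℝ}

/-- The derivative of `H` in the first variable. -/
def dU (r : ℝ → ℝ) (H : ℝ → ℝ → ℝ) (u v : ℝ) : ℝ :=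
  -(1 / 2 * r u) - ∫ t in (0 : ℝ)..v, r (u - t) * H u t

/-- The derivative of `H` in the second variable. -/
def dV (r : ℝ → ℝ) (H : ℝ → ℝ → ℝ) (u v : ℝ) : ℝ :=
  ∫ l in Ioi (u - v), r l * H (l + v) v

lemma continuous_shift (h : IsGoursat r H) : Continuous fun p : ℝ × ℝ => H (p.1 + p.2) p.2 :=
  h.cont.comp (by fun_prop : Continuous fun p : ℝ × ℝ => (p.1 + p.2, p.2))

lemma continuous_tail_H (hr : SmoothPot r) (h : IsGoursat r H) :
    Continuous fun p : ℝ × ℝ => ∫ l in Ioi p.1, r l * H (l + p.2) p.2 := by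
  obtain ⟨M, c, -, hb⟩ := h.bound
  exact continuous_tail hr.int (Φ := fun l t => H (l + t) t)
    (B := fun t => M * Real.exp (c * |t|)) h.continuous_shift (by fun_prop) fun l t => hb _ _

lemma hasDerivAt_tail_H (hr : SmoothPot r) (h : IsGoursat r H) (a t : ℝ) :
    HasDerivAt (fun a => ∫ l in Ioi a, r l * H (l + t) t) (-(r a * H (a + t) t)) a := by
  obtain ⟨M, c, -, hb⟩ := h.bound
  have hc : Continuous fun l => r l * H (l + t) t :=
    hr.smooth.continuous.mul (h.continuous_shift.comp (by fun_prop : Continuous fun l => (l, t)))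
  refine hasDerivAt_tail (Integrable.mono' (hr.int.abs.mul_const (M * Real.exp (c * |t|)))
    hc.aestronglyMeasurable (Eventually.of_forall fun l => ?_)) hc a
  rw [norm_mul]
  exact mul_le_mul_of_nonneg_left (hb _ _) (norm_nonneg _)

lemma continuous_dV (hr : SmoothPot r) (h : IsGoursat r H) :
    Continuous fun p : ℝ × ℝ => dV r H p.1 p.2 :=
  (h.continuous_tail_H hr).comp (by fun_prop : Continuous fun p : ℝ × ℝ => (p.1 - p.2, p.2))

lemma continuous_dU_integrand (hr : SmoothPot r) (h : IsGoursat r H) :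
    Continuous fun p : ℝ × ℝ => r (p.1 - p.2) * H p.1 p.2 :=
  (hr.smooth.continuous.comp (by fun_prop)).mul h.cont

lemma continuous_dU (hr : SmoothPot r) (h : IsGoursat r H) :
    Continuous fun p : ℝ × ℝ => dU r H p.1 p.2 :=
  ((continuous_const.mul (hr.smooth.continuous.comp continuous_fst)).neg).sub
    (continuous_intervalIntegral_param (E := fun u t => r (u - t) * H u t)
      (h.continuous_dU_integrand hr))

lemma hasDerivAt_v (hr : SmoothPot r) (h : IsGoursat r H) (u v : ℝ) :
    HasDerivAt (fun v => H u v) (dV r H u v) v := by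
  have hc : Continuous fun t => dV r H u t :=
    (h.continuous_dV hr).comp (by fun_prop : Continuous fun t => (u, t))
  rw [funext fun v => h.eq u v]
  exact (intervalIntegral.integral_hasDerivAt_right (hc.intervalIntegrable 0 v)
    (hc.stronglyMeasurableAtFilter _ _) hc.continuousAt).const_add _

lemma hasDerivAt_dV_u (hr : SmoothPot r) (h : IsGoursat r H) (u v : ℝ) :
    HasDerivAt (fun u => dV r H u v) (-(r (u - v) * H u v)) u := by
  have := (h.hasDerivAt_tail_H hr (u - v) v).comp_sub_const u v
  rw [sub_add_cancel] at this
  exact this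

lemma hasDerivAt_u (hr : SmoothPot r) (h : IsGoursat r H) (u v : ℝ) :
    HasDerivAt (fun u => H u v) (dU r H u v) u := by
  rw [funext fun u => h.eq u v]
  have h1 := (hasDerivAt_tail hr.int hr.smooth.continuous u).const_mul (1 / 2)
  have h2 := hasDerivAt_intervalIntegral_param (h.continuous_dV hr)
    (E' := fun u t => -(r (u - t) * H u t))
    (h.continuous_dU_integrand hr).neg (h.hasDerivAt_dV_u hr) 0 v u
  refine (h1.fun_add h2).congr_deriv ?_
  rw [dU, intervalIntegral.integral_neg]
  ring

lemma hasDerivAt_dU_v (hr : SmoothPot r) (h : IsGoursat r H) (u v : ℝ) :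
    HasDerivAt (fun v => dU r H u v) (-(r (u - v) * H u v)) v := by
  have hc : Continuous fun t => r (u - t) * H u t :=
    (h.continuous_dU_integrand hr).comp (by fun_prop : Continuous fun t => (u, t))
  exact (intervalIntegral.integral_hasDerivAt_right (hc.intervalIntegrable 0 v)
    (hc.stronglyMeasurableAtFilter _ _) hc.continuousAt).const_sub _

lemma contDiff_one (hr : SmoothPot r) (h : IsGoursat r H) :
    ContDiff ℝ 1 fun p : ℝ × ℝ => H p.1 p.2 :=
  contDiff_one_of_partials (h.hasDerivAt_u hr) (h.hasDerivAt_v hr)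
    (h.continuous_dU hr) (h.continuous_dV hr)

lemma dU_bound (hr : SmoothPot r) (h : IsGoursat r H) :
    ∃ B : ℝ → ℝ, Continuous B ∧ ∀ u v, |dU r H u v| ≤ B v := by
  obtain ⟨M, c, hc, hb⟩ := h.bound
  obtain ⟨C, hC⟩ := hr.bdd
  have hC0 : 0 ≤ C := (abs_nonneg _).trans (hC 0)
  refine ⟨fun v => C + C * M / c * Real.exp (c * |v|), by fun_prop, fun u v => ?_⟩
  have h1 := abs_integral_le_exp (f := fun t => r (u - t) * H u t) (M := C * M) hc (fun t => by
    rw [abs_mul, mul_assoc]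
    exact mul_le_mul (hC _) (hb _ _) (abs_nonneg _) hC0) v
  have h2 := hC u
  have h3 : |1 / 2 * r u| ≤ C := by
    rw [abs_mul, abs_of_pos (by norm_num : (0:ℝ) < 1 / 2)]
    linarith [abs_nonneg (r u)]
  rw [dU]
  refine (abs_sub _ _).trans ?_
  rw [abs_neg]
  linarith

lemma dV_bound (hr : SmoothPot r) (h : IsGoursat r H) :
    ∃ B : ℝ → ℝ, Continuous B ∧ ∀ u v, |dV r H u v| ≤ B v := by
  obtain ⟨M, c, hc, hb⟩ := h.bound
  exact ⟨fun v => (∫ l, |r l|) * (M * Real.exp (c * |v|)), by fun_prop,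
    fun u v => abs_tail_le hr.int (fun l => hb _ _) _⟩

lemma contDiff_dU (hr : SmoothPot r) (h : IsGoursat r H) :
    ContDiff ℝ 1 fun p : ℝ × ℝ => dU r H p.1 p.2 := by
  have hr' : ∀ x, HasDerivAt r (deriv r x) x := fun x =>
    (hr.smooth.differentiable (by norm_num)).differentiableAt.hasDerivAt
  have hrc : Continuous (deriv r) := hr.smooth.continuous_deriv le_rfl
  have hE' : Continuous fun p : ℝ × ℝ => deriv r (p.1 - p.2) * H p.1 p.2 +
      r (p.1 - p.2) * dU r H p.1 p.2 :=
    ((hrc.comp (by fun_prop)).mul h.cont).add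
      ((hr.smooth.continuous.comp (by fun_prop)).mul (h.continuous_dU hr))
  refine contDiff_one_of_partials (f := dU r H)
    (f₁ := fun u v => -(1 / 2 * deriv r u) - ∫ t in (0 : ℝ)..v,
      (deriv r (u - t) * H u t + r (u - t) * dU r H u t))
    (f₂ := fun u v => -(r (u - v) * H u v)) (fun u v => ?_) (h.hasDerivAt_dU_v hr) ?_ ?_
  · refine (((hr' u).const_mul (1 / 2)).fun_neg).fun_sub (hasDerivAt_intervalIntegral_param
      (E := fun u t => r (u - t) * H u t)
      (E' := fun u t => deriv r (u - t) * H u t + r (u - t) * dU r H u t)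
      (h.continuous_dU_integrand hr) hE' (fun u t => ?_) 0 v u)
    have := ((hr' (u - t)).comp_sub_const u t).mul (h.hasDerivAt_u hr u t)
    exact this
  · exact ((continuous_const.mul (hrc.comp continuous_fst)).neg).sub
      (continuous_intervalIntegral_param (E := fun u t =>
        (deriv r (u - t) * H u t + r (u - t) * dU r H u t)) hE')
  · exact (h.continuous_dU_integrand hr).neg

/-- With the lower limit and `t` treated as independent variables, differentiation in `t` falls on
`H(l+t,t)` alone, so no integrability of `r'` is required; the limit contributes `-r H`. -/
lemma contDiff_dV (hr : SmoothPot r) (h : IsGoursat r H) :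
    ContDiff ℝ 1 fun p : ℝ × ℝ => dV r H p.1 p.2 := by
  obtain ⟨M, c, hc, hb⟩ := h.bound
  obtain ⟨B₁, hB₁, hb₁⟩ := h.dU_bound hr
  obtain ⟨B₂, hB₂, hb₂⟩ := h.dV_bound hr
  have hsh : Continuous fun p : ℝ × ℝ => (p.1 + p.2, p.2) := by fun_prop
  have hcΦ' : Continuous fun p : ℝ × ℝ => dU r H (p.1 + p.2) p.2 + dV r H (p.1 + p.2) p.2 :=
    ((h.continuous_dU hr).comp hsh).add ((h.continuous_dV hr).comp hsh)
  have hbΦ' : ∀ l t, |dU r H (l + t) t + dV r H (l + t) t| ≤ B₁ t + B₂ t := fun l t =>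
    (abs_add_le _ _).trans (add_le_add (hb₁ _ _) (hb₂ _ _))
  have hd : ∀ l t, HasDerivAt (fun t => H (l + t) t)
      (dU r H (l + t) t + dV r H (l + t) t) t := fun l t => by
    have h1 := hasFDerivAt_of_partials isOpen_univ (f := H) (fun p _ => h.hasDerivAt_u hr p.1 p.2)
      (fun p _ => h.hasDerivAt_v hr p.1 p.2) (h.continuous_dU hr).continuousOn
      (h.continuous_dV hr).continuousOn (mem_univ (l + t, t))
    have h2 : HasDerivAt (fun t => (l + t, t)) ((1 : ℝ), (1 : ℝ)) t :=
      ((hasDerivAt_id t).const_add l).prodMk (hasDerivAt_id t)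
    have := HasFDerivAt.comp_hasDerivAt (f := fun t => (l + t, t)) t h1 h2
    exact this.congr_deriv (by simp)
  have h3 := contDiff_one_of_partials (f := fun a t => ∫ l in Ioi a, r l * H (l + t) t)
    (f₁ := fun a t => -(r a * H (a + t) t))
    (f₂ := fun a t => ∫ l in Ioi a, r l * (dU r H (l + t) t + dV r H (l + t) t))
    (h.hasDerivAt_tail_H hr) (hasDerivAt_tail_param hr.int (Φ := fun l t => H (l + t) t)
      (Φ' := fun l t => dU r H (l + t) t + dV r H (l + t) t)
      (B := fun t => M * Real.exp (c * |t|)) (B' := fun t => B₁ t + B₂ t)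
      h.continuous_shift hcΦ' (hB₁.add hB₂) (fun l t => hb _ _) hbΦ' hd) ?_ ?_
  · exact h3.comp (by fun_prop : ContDiff ℝ 1 fun p : ℝ × ℝ => (p.1 - p.2, p.2))
  · exact ((hr.smooth.continuous.comp continuous_fst).mul h.continuous_shift).neg
  · exact continuous_tail hr.int
      (Φ := fun l t => dU r H (l + t) t + dV r H (l + t) t) (B := fun t => B₁ t + B₂ t)
      hcΦ' (hB₁.add hB₂) hbΦ'

lemma contDiff_two (hr : SmoothPot r) (h : IsGoursat r H) :
    ContDiff ℝ 2 fun p : ℝ × ℝ => H p.1 p.2 := by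
  have := contDiff_succ_of_partials (f := H) 1 (h.hasDerivAt_u hr) (h.hasDerivAt_v hr)
    (by simpa using h.contDiff_dU hr) (by simpa using h.contDiff_dV hr)
  simpa [one_add_one_eq_two] using this

end IsGoursat

/-! ### The function `σ₀` -/

section Sigma0

variable {r : ℝ → ℝ}

lemma sigma0_nonneg (x : ℝ) : 0 ≤ sigma0 r x := integral_nonneg fun _ => abs_nonneg _

lemma sigma0_antitone (hr : Integrable r) : Antitone (sigma0 r) := fun _ _ hab =>
  setIntegral_mono_set hr.abs.integrableOn (Eventually.of_forall fun _ => abs_nonneg _)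
    (Ioi_subset_Ioi hab).eventuallyLE

lemma hasDerivAt_sigma0 (hr : Integrable r) (hc : Continuous r) (x : ℝ) :
    HasDerivAt (sigma0 r) (-|r x|) x := hasDerivAt_tail hr.abs hc.abs x

lemma continuous_sigma0 (hr : Integrable r) (hc : Continuous r) : Continuous (sigma0 r) :=
  continuous_iff_continuousAt.2 fun x => (hasDerivAt_sigma0 hr hc x).continuousAt

lemma tendsto_sigma0 (hr : Integrable r) : Tendsto (sigma0 r) atTop (𝓝 0) := by
  have e : sigma0 r = fun x => (∫ l, |r l|) - ∫ l in Iic x, |r l| := by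
    funext x
    rw [sigma0, ← intervalIntegral.integral_Iic_add_Ioi hr.abs.integrableOn hr.abs.integrableOn
      (b := x)]
    ring
  have := (tendsto_setIntegral_of_monotone (μ := volume) (f := fun l => |r l|) (s := fun x : ℝ => Iic x)
    (fun _ => measurableSet_Iic) (fun _ _ h => Iic_subset_Iic.2 h)
    (by simpa using hr.abs)).const_sub (∫ l, |r l|)
  rw [e]
  simpa [iUnion_Iic] using this

lemma interval_le_sigma0 (hr : Integrable r) {a b : ℝ} (hab : a ≤ b) :
    ∫ l in a..b, |r l| ≤ sigma0 r a := by
  rw [intervalIntegral.integral_of_le hab]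
  exact setIntegral_mono_set hr.abs.integrableOn (Eventually.of_forall fun _ => abs_nonneg _)
    Ioc_subset_Ioi_self.eventuallyLE

lemma abs_integral_r_le (x : ℝ) : |∫ l in Ioi x, r l| ≤ sigma0 r x :=
  abs_integral_le_integral_abs

/-- `r` has a finite first moment on the half line. -/
def FiniteMoment (r : ℝ → ℝ) : Prop := IntegrableOn (fun l => l * r l) (Ioi 0)

lemma FiniteMoment.abs (h : FiniteMoment r) : IntegrableOn (fun l => l * |r l|) (Ioi 0) := by
  refine (Integrable.abs h).congr ?_
  filter_upwards [self_mem_ae_restrict measurableSet_Ioi] with l hl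
  rw [abs_mul, abs_of_pos (show (0:ℝ) < l from hl)]

/-- Integrating `(xσ₀)' = σ₀ - x|r|` gives `∫_0^X σ₀ = Xσ₀(X) + ∫_0^X x|r|`, and the boundary term
is at most `∫_X^∞ x|r|`. -/
lemma integral_sigma0_le (hr : Integrable r) (hc : Continuous r) (hm : FiniteMoment r) {X : ℝ}
    (hX : 0 ≤ X) : ∫ x in (0 : ℝ)..X, sigma0 r x ≤ Rconst r := by
  have hs := continuous_sigma0 hr hc
  have h1 : ∀ x ∈ uIcc 0 X, HasDerivAt (fun x => x * sigma0 r x) (sigma0 r x - x * |r x|) x :=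
    fun x _ => ((hasDerivAt_id' x).mul (hasDerivAt_sigma0 hr hc x)).congr_deriv (by ring)
  have hi1 : IntervalIntegrable (sigma0 r) volume 0 X := hs.intervalIntegrable _ _
  have hi2 : IntervalIntegrable (fun x => x * |r x|) volume 0 X :=
    (continuous_id.mul hc.abs).intervalIntegrable _ _
  have h2 := intervalIntegral.integral_eq_sub_of_hasDerivAt h1 (hi1.sub hi2)
  rw [intervalIntegral.integral_sub hi1 hi2] at h2
  have h3 : X * sigma0 r X ≤ ∫ l in Ioi X, l * |r l| := by
    rw [sigma0, ← integral_const_mul]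
    refine setIntegral_mono_on (hr.abs.integrableOn.const_mul X)
      (hm.abs.mono_set (Ioi_subset_Ioi hX)) measurableSet_Ioi fun l hl => ?_
    exact mul_le_mul_of_nonneg_right (le_of_lt hl) (abs_nonneg _)
  have h4 : (∫ l in (0 : ℝ)..X, l * |r l|) + ∫ l in Ioi X, l * |r l| = Rconst r :=
    intervalIntegral.integral_interval_add_Ioi hm.abs (hm.abs.mono_set (Ioi_subset_Ioi hX))
  linarith

lemma integrableOn_sigma0 (hr : Integrable r) (hc : Continuous r) (hm : FiniteMoment r) :
    IntegrableOn (sigma0 r) (Ioi 0) := by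
  refine integrableOn_Ioi_of_intervalIntegral_norm_bounded (Rconst r) 0
    (fun X => ((continuous_sigma0 hr hc).intervalIntegrable 0 X).1) tendsto_id ?_
  filter_upwards [eventually_ge_atTop 0] with X hX
  refine le_trans (le_of_eq ?_) (integral_sigma0_le hr hc hm hX)
  refine intervalIntegral.integral_congr fun x _ => ?_
  exact Real.norm_of_nonneg (sigma0_nonneg x)

lemma integral_Ioi_sigma0_le (hr : Integrable r) (hc : Continuous r) (hm : FiniteMoment r) :
    ∫ x in Ioi (0 : ℝ), sigma0 r x ≤ Rconst r :=
  le_of_tendsto (intervalIntegral_tendsto_integral_Ioi 0 (integrableOn_sigma0 hr hc hm) tendsto_id)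
    ((eventually_ge_atTop 0).mono fun _ hX => integral_sigma0_le hr hc hm hX)

lemma Rconst_nonneg : 0 ≤ Rconst r :=
  setIntegral_nonneg measurableSet_Ioi fun _ hl => mul_nonneg (le_of_lt hl) (abs_nonneg _)

lemma integral_sigma0_interval_le (hr : Integrable r) (hc : Continuous r) (hm : FiniteMoment r)
    {a b : ℝ} (ha : 0 ≤ a) (hab : a ≤ b) : ∫ x in a..b, sigma0 r x ≤ Rconst r := by
  have hs := continuous_sigma0 hr hc
  have h1 := integral_sigma0_le hr hc hm (ha.trans hab)
  rw [← intervalIntegral.integral_add_adjacent_intervals (hs.intervalIntegrable 0 a)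
    (hs.intervalIntegrable a b)] at h1
  have := intervalIntegral.integral_nonneg (μ := volume) ha fun x _ => sigma0_nonneg (r := r) x
  linarith

end Sigma0

/-! ### A priori estimates -/

/-- The map `N ↦ α + N/2` has the fixed point `2α`. Starting from any finite bound, `n` improvements
leave an error `|N|/2ⁿ`. -/
lemma le_two_mul_of_contraction {X : Type*} {f G : X → ℝ} (hG : ∀ x, 0 ≤ G x) {α : ℝ}
    (hα : 0 ≤ α)
    (hstep : ∀ N, 0 ≤ N → (∀ x, f x ≤ N * G x) → ∀ x, f x ≤ (α + N / 2) * G x)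
    (hN : ∃ N, ∀ x, f x ≤ N * G x) (x : X) : f x ≤ 2 * α * G x := by
  obtain ⟨N, hN⟩ := hN
  have key : ∀ n : ℕ, ∀ x, f x ≤ (2 * α + |N| / 2 ^ n) * G x := by
    intro n
    induction n with
    | zero =>
      intro x
      refine (hN x).trans (mul_le_mul_of_nonneg_right ?_ (hG x))
      simp only [pow_zero, div_one]
      linarith [le_abs_self N]
    | succ n ih =>
      intro x
      refine (hstep _ (by positivity) ih x).trans (le_of_eq ?_)
      rw [pow_succ]
      field_simp
      ring
  have h1 : Tendsto (fun n : ℕ => |N| / (2:ℝ) ^ n) atTop (𝓝 0) :=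
    tendsto_const_nhds.div_atTop (tendsto_pow_atTop_atTop_of_one_lt (by norm_num))
  have h2 : Tendsto (fun n : ℕ => (2 * α + |N| / 2 ^ n) * G x) atTop (𝓝 (2 * α * G x)) := by
    simpa using (h1.const_add (2 * α)).mul_const (G x)
  exact ge_of_tendsto' h2 fun n => key n x

/-- The weight `exp (2 ∫₀ᵛ σ₀(u - t) dt)`. -/
def expWeight (r : ℝ → ℝ) (u v : ℝ) : ℝ := Real.exp (2 * ∫ t in (0 : ℝ)..v, sigma0 r (u - t))

lemma hasDerivAt_expWeight {r : ℝ → ℝ} (hr : Integrable r) (hc : Continuous r) (u v : ℝ) :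
    HasDerivAt (expWeight r u) (2 * sigma0 r (u - v) * expWeight r u v) v := by
  have hs : Continuous fun t => sigma0 r (u - t) :=
    (continuous_sigma0 hr hc).comp (by fun_prop)
  have := ((intervalIntegral.integral_hasDerivAt_right (hs.intervalIntegrable 0 v)
    (hs.stronglyMeasurableAtFilter _ _) hs.continuousAt).const_mul 2).exp
  exact this.congr_deriv (mul_comm _ _)

lemma one_le_expWeight {r : ℝ → ℝ} (u : ℝ) {v : ℝ} (hv : 0 ≤ v) : 1 ≤ expWeight r u v :=
  Real.one_le_exp (mul_nonneg zero_le_two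
    (intervalIntegral.integral_nonneg hv fun _ _ => sigma0_nonneg _))

lemma expWeight_antitone {r : ℝ → ℝ} (hr : Integrable r) (hc : Continuous r) {u u' v : ℝ}
    (hv : 0 ≤ v) (h : u ≤ u') : expWeight r u' v ≤ expWeight r u v := by
  have hs : ∀ u, Continuous fun t => sigma0 r (u - t) := fun u =>
    (continuous_sigma0 hr hc).comp (by fun_prop)
  refine Real.exp_le_exp.2 (mul_le_mul_of_nonneg_left ?_ zero_le_two)
  exact intervalIntegral.integral_mono_on hv ((hs u').intervalIntegrable _ _)
    ((hs u).intervalIntegrable _ _) fun t _ => sigma0_antitone hr (by linarith)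

lemma expWeight_le {r : ℝ → ℝ} (hr : Integrable r) (hc : Continuous r) (hm : FiniteMoment r)
    {u v : ℝ} (hv : 0 ≤ v) (h : v ≤ u) : expWeight r u v ≤ Real.exp (2 * Rconst r) := by
  refine Real.exp_le_exp.2 (mul_le_mul_of_nonneg_left ?_ zero_le_two)
  rw [intervalIntegral.integral_comp_sub_left (sigma0 r) u, sub_zero]
  exact integral_sigma0_interval_le hr hc hm (by linarith) (by linarith)

/-- The basic estimate for the Goursat problem on `{0 < v < u}`. -/
theorem goursat_apriori {r : ℝ → ℝ} (hr : Integrable r) (hc : Continuous r)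
    {F : ℝ → ℝ → ℝ} {g : ℝ → ℝ} {α ε : ℝ} (hα : 0 ≤ α) (hε : 0 < ε) (hg : ∀ u, ε ≤ g u)
    (hga : Antitone g)
    (hb : ∀ V, ∃ N, ∀ u v, 0 < v → v < u → v ≤ V → |F u v| ≤ N)
    (hF : ∀ u v, 0 < v → v < u → |F u v| ≤ α * g u +
      ∫ t in (0 : ℝ)..v, ∫ l in Ioi (u - t), |r l| * |F (l + t) t|)
    {u v : ℝ} (hv : 0 < v) (huv : v < u) : |F u v| ≤ 2 * α * (g u * expWeight r u v) := by
  -- Bounding the second coordinate by `v` makes the rough bound uniform on `X`, and the integral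
  -- operator only refers to smaller second coordinates and larger first ones.
  let X := {p : ℝ × ℝ // 0 < p.2 ∧ p.2 < p.1 ∧ p.2 ≤ v}
  have hg0 : ∀ u, 0 ≤ g u := fun u => hε.le.trans (hg u)
  have hw0 : ∀ u v, 0 ≤ expWeight r u v := fun u v => (Real.exp_pos _).le
  refine le_two_mul_of_contraction (X := X) (f := fun p => |F p.1.1 p.1.2|)
    (G := fun p => g p.1.1 * expWeight r p.1.1 p.1.2)
    (fun p => mul_nonneg (hg0 _) (hw0 _ _)) hα ?_ ?_ ⟨(u, v), hv, huv, le_rfl⟩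
  · rintro N hN0 hN ⟨⟨u, w⟩, hw, huw, hwv⟩
    simp only at hw huw hwv ⊢
    have h1 : ∀ t ∈ Ioc 0 w, ∫ l in Ioi (u - t), |r l| * |F (l + t) t| ≤
        N * g u * (sigma0 r (u - t) * expWeight r u t) := by
      intro t ht
      have h2 : ∫ l in Ioi (u - t), |r l| * |F (l + t) t| ≤
          ∫ l in Ioi (u - t), |r l| * (N * g u * expWeight r u t) := by
        refine integral_mono_of_nonneg (Eventually.of_forall fun l => by positivity)
          (hr.abs.integrableOn.mul_const _) ?_
        filter_upwards [self_mem_ae_restrict measurableSet_Ioi] with l hl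
        have hl' : u < l + t := by have : u - t < l := hl; linarith
        refine mul_le_mul_of_nonneg_left ?_ (abs_nonneg _)
        refine (hN ⟨(l + t, t), ht.1, by simp only; linarith [ht.2], ht.2.trans hwv⟩).trans ?_
        simp only
        rw [mul_assoc]
        refine mul_le_mul_of_nonneg_left ?_ hN0
        exact mul_le_mul (hga hl'.le) (expWeight_antitone hr hc ht.1.le hl'.le) (hw0 _ _) (hg0 _)
      refine h2.trans (le_of_eq ?_)
      rw [integral_mul_const, sigma0]
      ring
    have hwc : Continuous (expWeight r u) :=
      continuous_iff_continuousAt.2 fun t => (hasDerivAt_expWeight hr hc u t).continuousAt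
    have hsc : Continuous fun t => sigma0 r (u - t) :=
      (continuous_sigma0 hr hc).comp (by fun_prop)
    have h3 : ∫ t in (0 : ℝ)..w, ∫ l in Ioi (u - t), |r l| * |F (l + t) t| ≤
        ∫ t in (0 : ℝ)..w, N * g u * (sigma0 r (u - t) * expWeight r u t) := by
      rw [intervalIntegral.integral_of_le hw.le, intervalIntegral.integral_of_le hw.le]
      refine integral_mono_of_nonneg (Eventually.of_forall fun t => integral_nonneg fun l => by
        simp only [Pi.zero_apply]; positivity) ?_ ?_
      · exact ((continuous_const.mul (hsc.mul hwc)).intervalIntegrable 0 w).1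
      · filter_upwards [self_mem_ae_restrict measurableSet_Ioc] with t ht using h1 t ht
    -- The factor two in the exponent of the weight pays off here: the integrand is half of a
    -- derivative, so the bound `N` returns as `N/2`.
    have h4 : ∫ t in (0 : ℝ)..w, N * g u * (sigma0 r (u - t) * expWeight r u t) =
        N / 2 * g u * (expWeight r u w - 1) := by
      have h5 : ∀ t ∈ uIcc 0 w, HasDerivAt (fun t => N / 2 * g u * expWeight r u t)
          (N * g u * (sigma0 r (u - t) * expWeight r u t)) t := fun t _ =>
        ((hasDerivAt_expWeight hr hc u t).const_mul (N / 2 * g u)).congr_deriv (by ring)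
      rw [intervalIntegral.integral_eq_sub_of_hasDerivAt h5
        ((continuous_const.mul (hsc.mul hwc)).intervalIntegrable 0 w)]
      have : expWeight r u 0 = 1 := by simp [expWeight]
      rw [this]
      ring
    have h6 := hF u w hw huw
    have h7 := one_le_expWeight (r := r) u hw.le
    have h8 : 0 ≤ N / 2 * g u := mul_nonneg (by positivity) (hg0 u)
    have h9 : α * g u ≤ α * g u * expWeight r u w :=
      le_mul_of_one_le_right (mul_nonneg hα (hg0 u)) h7
    rw [h4] at h3
    linarith
  · obtain ⟨N, hN⟩ := hb v
    -- The lower bound `g ≥ ε` turns the rough constant bound into a multiple of `g` times the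
    -- weight, which starts the iteration.
    refine ⟨|N| / ε, ?_⟩
    rintro ⟨⟨u, w⟩, hw, huw, hwv⟩
    simp only at hw huw hwv ⊢
    refine (hN u w hw huw hwv).trans ((le_abs_self N).trans ?_)
    have h1 : ε ≤ g u * expWeight r u w :=
      (hg u).trans (le_mul_of_one_le_right (hg0 u) (one_le_expWeight u hw.le))
    calc |N| = |N| / ε * ε := by field_simp
      _ ≤ _ := mul_le_mul_of_nonneg_left h1 (by positivity)

lemma OmBar_subset_closure : OmBar ⊆ closure Om := by
  rintro ⟨a, b⟩ ⟨ha, hab⟩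
  simp only at ha hab
  rw [mem_closure_iff_seq_limit]
  refine ⟨fun n : ℕ => (a + 1 / ((n : ℝ) + 1), b + 2 * (1 / ((n : ℝ) + 1))), fun n => ?_, ?_⟩
  · have : (0:ℝ) < 1 / ((n : ℝ) + 1) := by positivity
    exact ⟨by simp only; linarith, by simp only; linarith⟩
  · have h := tendsto_one_div_add_atTop_nhds_zero_nat (𝕜 := ℝ)
    refine Tendsto.prodMk_nhds ?_ ?_
    · simpa using h.const_add a
    · simpa using (h.const_mul 2).const_add b

namespace IsGoursat

variable {r : ℝ → ℝ} {H : ℝ → ℝ → ℝ}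

/-- The a priori estimate is applied with `g = σ₀ + ε` and `α = 1/2`, since `½|∫_u^∞ r| ≤ ½σ₀(u)`;
the weight is at most `exp(2R)` because `v ≤ u`. Then `ε → 0`, and the strict inequalities `0 < v <
u` are relaxed by continuity of `H`. -/
lemma abs_le (hr : SmoothPot r) (hm : FiniteMoment r) (h : IsGoursat r H) {u v : ℝ} (hv : 0 ≤ v)
    (huv : v ≤ u) : |H u v| ≤ Real.exp (2 * Rconst r) * sigma0 r u := by
  have hc := hr.smooth.continuous
  obtain ⟨M, c, hc0, hb⟩ := h.bound
  have hM : 0 ≤ M := by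
    have := (abs_nonneg _).trans (hb 0 0)
    simpa using this
  have key : ∀ ε > 0, ∀ u v, 0 < v → v < u →
      |H u v| ≤ (sigma0 r u + ε) * Real.exp (2 * Rconst r) := by
    intro ε hε u v hv huv
    have := goursat_apriori (F := H) (g := fun u => sigma0 r u + ε) (α := 1 / 2) hr.int hc
      (by norm_num) hε (fun u => by linarith [sigma0_nonneg (r := r) u])
      (fun a b hab => by simpa using sigma0_antitone hr.int hab) ?_ ?_ hv huv
    · refine this.trans ?_
      rw [show 2 * (1 / 2 : ℝ) = 1 by norm_num, one_mul]
      exact mul_le_mul_of_nonneg_left (expWeight_le hr.int hc hm hv.le huv.le)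
        (by linarith [sigma0_nonneg (r := r) u])
    · intro V
      refine ⟨M * Real.exp (c * V), fun u v hv _ hV => (hb u v).trans ?_⟩
      rw [abs_of_pos hv]
      exact mul_le_mul_of_nonneg_left (Real.exp_le_exp.2 (by gcongr)) hM
    · intro u v hv _
      rw [h.eq u v]
      refine (abs_add_le _ _).trans (add_le_add ?_ ?_)
      · rw [abs_mul, abs_of_pos (by norm_num : (0:ℝ) < 1 / 2)]
        have := abs_integral_r_le (r := r) u
        linarith
      · have hcont : Continuous fun t => ∫ l in Ioi (u - t), |r l| * |H (l + t) t| :=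
          (continuous_tail hr.int.abs (Φ := fun l t => |H (l + t) t|)
            (B := fun t => M * Real.exp (c * |t|)) h.continuous_shift.abs (by fun_prop)
            fun l t => by rw [abs_abs]; exact hb _ _).comp
            (by fun_prop : Continuous fun t => (u - t, t))
        refine intervalIntegral.norm_integral_le_of_norm_le (μ := volume)
          (f := fun t => ∫ l in Ioi (u - t), r l * H (l + t) t) hv.le
          (Eventually.of_forall fun t _ => ?_) (hcont.intervalIntegrable 0 v)
        refine (norm_integral_le_integral_norm _).trans (le_of_eq ?_)
        simp only [norm_mul, Real.norm_eq_abs]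
  have key2 : ∀ u v, 0 < v → v < u → |H u v| ≤ Real.exp (2 * Rconst r) * sigma0 r u := by
    intro u v hv huv
    have h1 : Tendsto (fun ε => (sigma0 r u + ε) * Real.exp (2 * Rconst r)) (𝓝 0)
        (𝓝 ((sigma0 r u + 0) * Real.exp (2 * Rconst r))) :=
      (Continuous.tendsto (by fun_prop) 0)
    rw [add_zero, mul_comm (sigma0 r u)] at h1
    refine ge_of_tendsto (h1.mono_left (nhdsWithin_le_nhds (s := Ioi 0))) ?_
    filter_upwards [self_mem_nhdsWithin] with ε hε using key ε hε u v hv huv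
  have hcH := h.cont.abs
  have h1 : Tendsto (fun n : ℕ => |H (u + 2 * (1 / ((n : ℝ) + 1))) (v + 1 / ((n : ℝ) + 1))|) atTop
      (𝓝 |H u v|) := by
    have h := tendsto_one_div_add_atTop_nhds_zero_nat (𝕜 := ℝ)
    have h2 : Tendsto (fun n : ℕ => (u + 2 * (1 / ((n : ℝ) + 1)), v + 1 / ((n : ℝ) + 1))) atTop
        (𝓝 (u, v)) := Tendsto.prodMk_nhds (by simpa using (h.const_mul 2).const_add u)
          (by simpa using h.const_add v)
    exact (hcH.tendsto (u, v)).comp h2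
  refine le_of_tendsto h1 (Eventually.of_forall fun n => ?_)
  have hn : (0:ℝ) < 1 / ((n : ℝ) + 1) := by positivity
  refine (key2 _ _ (by linarith) (by linarith)).trans ?_
  exact mul_le_mul_of_nonneg_left (sigma0_antitone hr.int (by linarith)) (Real.exp_pos _).le

end IsGoursat

/-! ### Potentials and their smooth extensions -/

/-- The regularity of the potential `r = q ∘ σ⁻¹`. -/
structure KerPot (r : ℝ → ℝ) : Prop where
  even : ∀ x, r (-x) = r x
  smooth : ContDiffOn ℝ 1 r (Ici 0)
  bdd : ∃ C, ∀ x, |r x| ≤ C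
  moment : FiniteMoment r

lemma Admissible.kerPot {ρ k γ : ℝ → ℝ} (h : Admissible ρ k γ) : KerPot (rFn ρ k γ) :=
  ⟨h.r_even, h.contDiffOn_r, h.exists_r_bound, h.integrableOn_r⟩

namespace KerPot

variable {r : ℝ → ℝ}

lemma continuous (h : KerPot r) : Continuous r := continuous_of_even h.even h.smooth.continuousOn

lemma integrable (h : KerPot r) : Integrable r := by
  have h1 : IntegrableOn r (Ioi 0) := by
    rw [← Ioc_union_Ioi_eq_Ioi zero_le_one]
    refine IntegrableOn.union (h.continuous.integrableOn_Ioc) ?_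
    refine Integrable.mono' (h.moment.abs.mono_set (Ioi_subset_Ioi zero_le_one))
      h.continuous.aestronglyMeasurable ?_
    filter_upwards [self_mem_ae_restrict measurableSet_Ioi] with x hx
    exact le_mul_of_one_le_left (abs_nonneg _) (le_of_lt hx)
  have h2 : IntegrableOn r (Iic 0) := by
    have := (integrableOn_Ici_iff_integrableOn_Ioi (μ := volume)).2 h1
    rw [← neg_zero] at this
    have h3 := this.comp_neg_Iic
    simpa only [h.even] using h3
  have := h2.union h1
  rwa [Iic_union_Ioi, integrableOn_univ] at this

/-- The restriction of `r` to the half line extends to a smooth integrable function. -/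
lemma exists_smoothPot (h : KerPot r) : ∃ s, SmoothPot s ∧ EqOn s r (Ici 0) := by
  have hg0 : ContinuousOn (derivWithin r (Ici 0)) (Ici 0) :=
    h.smooth.continuousOn_derivWithin (uniqueDiffOn_Ici 0) le_rfl
  -- The even function `r` may have a corner at the origin. Freezing its right derivative there
  -- gives a `C¹` continuation to negative arguments that is affine.
  set g : ℝ → ℝ := fun x => derivWithin r (Ici 0) (max 0 x) with hg
  have hgc : Continuous g := hg0.comp_continuous (by fun_prop)
    fun x => mem_Ici.2 (le_max_left _ _)
  set P : ℝ → ℝ := fun x => r 0 + ∫ t in (0 : ℝ)..x, g t with hP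
  have hPd : ∀ x, HasDerivAt P (g x) x := fun x =>
    (intervalIntegral.integral_hasDerivAt_right (hgc.intervalIntegrable 0 x)
      (hgc.stronglyMeasurableAtFilter _ _) hgc.continuousAt).const_add _
  have hPs : ContDiff ℝ 1 P := by
    rw [contDiff_one_iff_deriv]
    refine ⟨fun x => (hPd x).differentiableAt, ?_⟩
    rw [funext fun x => (hPd x).deriv]
    exact hgc
  have hPr : EqOn P r (Ici 0) := by
    intro x hx
    have hx0 : (0:ℝ) ≤ x := hx
    have h1 : ∫ t in (0 : ℝ)..x, g t = r x - r 0 := by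
      refine intervalIntegral.integral_eq_sub_of_hasDerivAt_of_le hx0 h.continuous.continuousOn
        (fun t ht => ?_) (hgc.intervalIntegrable _ _)
      have h2 := ((h.smooth.differentiableOn (by norm_num)) t ht.1.le).hasDerivWithinAt.hasDerivAt
        (Ici_mem_nhds ht.1)
      simpa only [hg, max_eq_right ht.1.le] using h2
    simp only [hP, h1]
    ring
  -- The cut-off equals one on `[0,∞)` and zero on `(-∞,-1]`, which restores boundedness and
  -- integrability without changing `r` on the half line.
  set s : ℝ → ℝ := fun x => P x * Real.smoothTransition (x + 1) with hs
  have hss : ContDiff ℝ 1 s := hPs.mul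
    (Real.smoothTransition.contDiff.comp (by fun_prop))
  have hsr : EqOn s r (Ici 0) := fun x hx => by
    have hx0 : (0:ℝ) ≤ x := hx
    simp only [hs, Real.smoothTransition.one_of_one_le (show 1 ≤ x + 1 by linarith), mul_one]
    exact hPr hx
  have hs0 : ∀ x, x ≤ -1 → s x = 0 := fun x hx => by
    simp only [hs, Real.smoothTransition.zero_of_nonpos (show x + 1 ≤ 0 by linarith), mul_zero]
  obtain ⟨C, hC⟩ := h.bdd
  obtain ⟨C', hC'⟩ := (isCompact_Icc (a := (-1:ℝ)) (b := 0)).exists_bound_of_continuousOn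
    hss.continuous.continuousOn
  refine ⟨s, ⟨hss, ⟨max C C', fun x => ?_⟩, ?_⟩, hsr⟩
  · rcases le_total 0 x with hx | hx
    · rw [hsr hx]; exact (hC x).trans (le_max_left _ _)
    · rcases le_total x (-1) with hx1 | hx1
      · rw [hs0 x hx1, abs_zero]
        exact (abs_nonneg _).trans ((hC 0).trans (le_max_left _ _))
      · exact (hC' x ⟨hx1, hx⟩).trans (le_max_right _ _)
  · rw [← integrableOn_univ, ← Iic_union_Ioi (a := (0:ℝ)), ← Iic_union_Ioc_eq_Iic (show (-1:ℝ) ≤ 0 by norm_num)]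
    refine (IntegrableOn.union ?_ ?_).union ?_
    · exact integrableOn_zero.congr_fun (fun x hx => (hs0 x hx).symm) measurableSet_Iic
    · exact hss.continuous.integrableOn_Ioc
    · exact h.integrable.integrableOn.congr_fun (fun x hx => (hsr (mem_Ici.2 (le_of_lt hx))).symm)
        measurableSet_Ioi

end KerPot

lemma setIntegral_Ioi_congr {f g : ℝ → ℝ} (h : EqOn f g (Ici 0)) {x : ℝ} (hx : 0 ≤ x) :
    ∫ l in Ioi x, f l = ∫ l in Ioi x, g l :=
  setIntegral_congr_fun measurableSet_Ioi fun _ hl => h (hx.trans (le_of_lt hl))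

lemma sigma0_congr {s r : ℝ → ℝ} (h : EqOn s r (Ici 0)) {x : ℝ} (hx : 0 ≤ x) :
    sigma0 s x = sigma0 r x :=
  setIntegral_Ioi_congr (fun l hl => by simp only [h hl]) hx

/-! ### The kernel in the original coordinates -/

lemma HasDerivAt.comp_pair {f : ℝ → ℝ → ℝ} {x y a b : ℝ} {α β : ℝ → ℝ} {α' β' t : ℝ}
    (hf : DifferentiableAt ℝ (fun p : ℝ × ℝ => f p.1 p.2) (x, y))
    (ha : HasDerivAt (fun u => f u y) a x) (hb : HasDerivAt (fun v => f x v) b y)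
    (hα : HasDerivAt α α' t) (hβ : HasDerivAt β β' t) (hx : α t = x) (hy : β t = y) :
    HasDerivAt (fun t => f (α t) (β t)) (α' * a + β' * b) t := by
  subst hx hy
  set L := fderiv ℝ (fun p : ℝ × ℝ => f p.1 p.2) (α t, β t) with hL
  have hfd : HasFDerivAt (fun p : ℝ × ℝ => f p.1 p.2) L (α t, β t) := hf.hasFDerivAt
  have h1 : L (1, 0) = a := by
    have := hfd.comp_hasDerivAt (α t) (f := fun u => (u, β t))
      ((hasDerivAt_id' (α t)).prodMk (hasDerivAt_const _ _))
    exact this.unique ha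
  have h2 : L (0, 1) = b := by
    have := hfd.comp_hasDerivAt (β t) (f := fun v => (α t, v))
      ((hasDerivAt_const _ _).prodMk (hasDerivAt_id' (β t)))
    exact this.unique hb
  have h3 := hfd.comp_hasDerivAt t (f := fun t => (α t, β t)) (hα.prodMk hβ)
  refine h3.congr_deriv ?_
  have : ((α', β') : ℝ × ℝ) = α' • (1, 0) + β' • (0, 1) := by simp
  rw [this, map_add, map_smul, map_smul, h1, h2]
  rfl

/-- `f` in the coordinates `u = (y₁ + y₂)/2`, `v = (y₂ - y₁)/2`. -/
def charPull (f : ℝ → ℝ → ℝ) (y₁ y₂ : ℝ) : ℝ := f ((y₁ + y₂) / 2) ((y₂ - y₁) / 2)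

lemma contDiff_charPull {f : ℝ → ℝ → ℝ} {n : WithTop ℕ∞}
    (hf : ContDiff ℝ n fun p : ℝ × ℝ => f p.1 p.2) :
    ContDiff ℝ n fun p : ℝ × ℝ => charPull f p.1 p.2 :=
  hf.comp (by fun_prop : ContDiff ℝ n fun p : ℝ × ℝ => ((p.1 + p.2) / 2, (p.2 - p.1) / 2))

lemma hasDerivAt_charPull₁ {f f₁ f₂ : ℝ → ℝ → ℝ} (hf : ContDiff ℝ 1 fun p : ℝ × ℝ => f p.1 p.2)
    (h₁ : ∀ u v, HasDerivAt (fun u => f u v) (f₁ u v) u)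
    (h₂ : ∀ u v, HasDerivAt (fun v => f u v) (f₂ u v) v) (y₁ y₂ : ℝ) :
    HasDerivAt (fun y => charPull f y y₂) (charPull (fun u v => 1 / 2 * (f₁ u v - f₂ u v)) y₁ y₂)
      y₁ := by
  have := HasDerivAt.comp_pair (α := fun y => (y + y₂) / 2) (β := fun y => (y₂ - y) / 2)
    (hf.differentiable (by norm_num) ((y₁ + y₂) / 2, (y₂ - y₁) / 2)) (h₁ _ _) (h₂ _ _)
    (((hasDerivAt_id' y₁).add_const y₂).div_const 2)
    (((hasDerivAt_id' y₁).const_sub y₂).div_const 2) rfl rfl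
  refine this.congr_deriv ?_
  simp only [charPull]
  ring

lemma hasDerivAt_charPull₂ {f f₁ f₂ : ℝ → ℝ → ℝ} (hf : ContDiff ℝ 1 fun p : ℝ × ℝ => f p.1 p.2)
    (h₁ : ∀ u v, HasDerivAt (fun u => f u v) (f₁ u v) u)
    (h₂ : ∀ u v, HasDerivAt (fun v => f u v) (f₂ u v) v) (y₁ y₂ : ℝ) :
    HasDerivAt (fun y => charPull f y₁ y) (charPull (fun u v => 1 / 2 * (f₁ u v + f₂ u v)) y₁ y₂)
      y₂ := by
  have := HasDerivAt.comp_pair (α := fun y => (y₁ + y) / 2) (β := fun y => (y - y₁) / 2)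
    (hf.differentiable (by norm_num) ((y₁ + y₂) / 2, (y₂ - y₁) / 2)) (h₁ _ _) (h₂ _ _)
    (((hasDerivAt_id' y₂).const_add y₁).div_const 2)
    (((hasDerivAt_id' y₂).sub_const y₁).div_const 2) rfl rfl
  refine this.congr_deriv ?_
  simp only [charPull]
  ring

/-- A kernel with the regularity and the bounds of the transformation kernel of `r`. -/
structure RegKernel (r : ℝ → ℝ) (K K₁ K₂ : ℝ → ℝ → ℝ) (C : ℝ) : Prop where
  smooth : ContDiff ℝ 2 fun p : ℝ × ℝ => K p.1 p.2
  smooth₁ : ContDiff ℝ 1 fun p : ℝ × ℝ => K₁ p.1 p.2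
  smooth₂ : ContDiff ℝ 1 fun p : ℝ × ℝ => K₂ p.1 p.2
  d₁ : ∀ y₁ y₂, HasDerivAt (fun y => K y y₂) (K₁ y₁ y₂) y₁
  d₂ : ∀ y₁ y₂, HasDerivAt (fun y => K y₁ y) (K₂ y₁ y₂) y₂
  pos : 0 < C
  bound : ∀ y₁ y₂, 0 ≤ y₁ → y₁ ≤ y₂ → |K y₁ y₂| ≤ C * sigma0 r ((y₁ + y₂) / 2)
  bound₁ : ∀ y₁ y₂, 0 ≤ y₁ → y₁ ≤ y₂ →
    |K₁ y₁ y₂| ≤ 1 / 4 * |r ((y₁ + y₂) / 2)| + C * sigma0 r ((y₁ + y₂) / 2)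
  bound₂ : ∀ y₁ y₂, 0 ≤ y₁ → y₁ ≤ y₂ →
    |K₂ y₁ y₂| ≤ 1 / 4 * |r ((y₁ + y₂) / 2)| + C * sigma0 r ((y₁ + y₂) / 2)
  growth : ∃ M c, 0 < c ∧ ∀ y₁ y₂, |K y₁ y₂| ≤ M * Real.exp (c * |y₂ - y₁|)

namespace IsGoursat

variable {r : ℝ → ℝ} {H : ℝ → ℝ → ℝ}

/-- The term `½|r(u)|` comes from the data on `v = 0`; in the integral, `H(u,t)` is bounded by
`exp(2R)σ₀(u)` uniformly in `t`, and `∫|r(u-t)|dt ≤ σ₀(0)` as the arguments stay nonnegative. -/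
lemma abs_dU_le (hr : SmoothPot r) (hm : FiniteMoment r) (h : IsGoursat r H) {u v : ℝ}
    (hv : 0 ≤ v) (huv : v ≤ u) :
    |dU r H u v| ≤ 1 / 2 * |r u| + Real.exp (2 * Rconst r) * sigma0 r 0 * sigma0 r u := by
  have h1 : |∫ t in (0 : ℝ)..v, r (u - t) * H u t| ≤
      ∫ t in (0 : ℝ)..v, |r (u - t)| * (Real.exp (2 * Rconst r) * sigma0 r u) := by
    refine intervalIntegral.norm_integral_le_of_norm_le (μ := volume)
      (f := fun t => r (u - t) * H u t) hv (Eventually.of_forall fun t ht => ?_)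
      (Continuous.intervalIntegrable
        ((hr.smooth.continuous.comp (by fun_prop)).abs.mul continuous_const) 0 v)
    rw [norm_mul]
    exact mul_le_mul_of_nonneg_left (h.abs_le hr hm ht.1.le (ht.2.trans huv)) (norm_nonneg _)
  have h2 : ∫ t in (0 : ℝ)..v, |r (u - t)| ≤ sigma0 r 0 := by
    rw [intervalIntegral.integral_comp_sub_left (fun t => |r t|) u, sub_zero]
    exact (interval_le_sigma0 hr.int (by linarith)).trans (sigma0_antitone hr.int (by linarith))
  rw [intervalIntegral.integral_mul_const] at h1
  have h3 := mul_le_mul_of_nonneg_right h2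
    (mul_nonneg (Real.exp_pos (2 * Rconst r)).le (sigma0_nonneg (r := r) u))
  rw [dU]
  refine (abs_sub _ _).trans ?_
  rw [abs_neg, abs_mul, abs_of_pos (by norm_num : (0:ℝ) < 1 / 2)]
  linarith

lemma abs_dV_le (hr : SmoothPot r) (hm : FiniteMoment r) (h : IsGoursat r H) {u v : ℝ}
    (hv : 0 ≤ v) (huv : v ≤ u) :
    |dV r H u v| ≤ Real.exp (2 * Rconst r) * sigma0 r 0 * sigma0 r u := by
  have h1 : |∫ l in Ioi (u - v), r l * H (l + v) v| ≤
      ∫ l in Ioi (u - v), |r l| * (Real.exp (2 * Rconst r) * sigma0 r u) := by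
    refine norm_integral_le_of_norm_le (f := fun l => r l * H (l + v) v)
      (hr.int.abs.integrableOn.mul_const _) ?_
    filter_upwards [self_mem_ae_restrict measurableSet_Ioi] with l hl
    have hl' : u - v < l := hl
    rw [norm_mul]
    refine mul_le_mul_of_nonneg_left ?_ (norm_nonneg _)
    refine (h.abs_le hr hm hv (by linarith)).trans ?_
    exact mul_le_mul_of_nonneg_left (sigma0_antitone hr.int (by linarith)) (Real.exp_pos _).le
  rw [integral_mul_const] at h1
  have h2 : ∫ l in Ioi (u - v), |r l| ≤ sigma0 r 0 := sigma0_antitone hr.int (by linarith)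
  have h3 := mul_le_mul_of_nonneg_right h2
    (mul_nonneg (Real.exp_pos (2 * Rconst r)).le (sigma0_nonneg (r := r) u))
  rw [dV]
  linarith

end IsGoursat

-- Since `∂_{y₁} = ½(∂_u - ∂_v)` and `∂_{y₂} = ½(∂_u + ∂_v)`, the bound `½|r|` for `H_u` becomes the
-- `¼|r|` of (3). The constant dominates both `exp(2R)`, needed for `K`, and `exp(2R)σ₀(0)`, needed
-- for its derivatives.
open IsGoursat in
lemma regKernel {s r : ℝ → ℝ} {H : ℝ → ℝ → ℝ} (hr : KerPot r) (hs : SmoothPot s)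
    (he : EqOn s r (Ici 0)) (h : IsGoursat s H) :
    RegKernel r (charPull H) (charPull fun u v => 1 / 2 * (dU s H u v - dV s H u v))
      (charPull fun u v => 1 / 2 * (dU s H u v + dV s H u v))
      (Real.exp (2 * Rconst s) * (1 + sigma0 s 0)) := by
  have hm : FiniteMoment s := IntegrableOn.congr_fun hr.moment
    (fun l hl => by simp only [he (le_of_lt hl : (0:ℝ) ≤ l)]) measurableSet_Ioi
  have hE : 0 < Real.exp (2 * Rconst s) := Real.exp_pos _
  have hS : 0 ≤ sigma0 s 0 := sigma0_nonneg _
  -- The sign `σ = -1` serves the derivative in `y₁` and `σ = 1` the one in `y₂`.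
  have key : ∀ y₁ y₂ : ℝ, 0 ≤ y₁ → y₁ ≤ y₂ → ∀ σ : ℝ, |σ| = 1 →
      |charPull (fun u v => 1 / 2 * (dU s H u v + σ * dV s H u v)) y₁ y₂| ≤
      1 / 4 * |r ((y₁ + y₂) / 2)| +
        Real.exp (2 * Rconst s) * (1 + sigma0 s 0) * sigma0 r ((y₁ + y₂) / 2) := by
    intro y₁ y₂ h1 h2 σ hσ
    have hv : 0 ≤ (y₂ - y₁) / 2 := by linarith
    have hvu : (y₂ - y₁) / 2 ≤ (y₁ + y₂) / 2 := by linarith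
    have hu : 0 ≤ (y₁ + y₂) / 2 := by linarith
    have a1 := h.abs_dU_le hs hm hv hvu
    have a2 := h.abs_dV_le hs hm hv hvu
    rw [he hu, sigma0_congr he hu] at a1
    rw [sigma0_congr he hu] at a2
    simp only [charPull]
    rw [abs_mul, abs_of_pos (by norm_num : (0:ℝ) < 1 / 2)]
    have a3 := abs_add_le (dU s H ((y₁ + y₂) / 2) ((y₂ - y₁) / 2))
      (σ * dV s H ((y₁ + y₂) / 2) ((y₂ - y₁) / 2))
    rw [abs_mul, hσ, one_mul] at a3
    have a4 := mul_nonneg hE.le (sigma0_nonneg (r := r) ((y₁ + y₂) / 2))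
    nlinarith
  refine ⟨contDiff_charPull (h.contDiff_two hs), contDiff_charPull ?_, contDiff_charPull ?_,
    hasDerivAt_charPull₁ (h.contDiff_one hs) (h.hasDerivAt_u hs) (h.hasDerivAt_v hs),
    hasDerivAt_charPull₂ (h.contDiff_one hs) (h.hasDerivAt_u hs) (h.hasDerivAt_v hs),
    by positivity, fun y₁ y₂ h1 h2 => ?_, fun y₁ y₂ h1 h2 => ?_, fun y₁ y₂ h1 h2 => ?_,
    ?_⟩
  · exact contDiff_const.mul ((h.contDiff_dU hs).sub (h.contDiff_dV hs))
  · exact contDiff_const.mul ((h.contDiff_dU hs).add (h.contDiff_dV hs))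
  · have hu : 0 ≤ (y₁ + y₂) / 2 := by linarith
    refine (h.abs_le hs hm (by linarith) (by linarith)).trans ?_
    rw [sigma0_congr he hu]
    refine mul_le_mul_of_nonneg_right ?_ (sigma0_nonneg _)
    nlinarith
  · have := key y₁ y₂ h1 h2 (-1) (by simp)
    simpa only [neg_one_mul, ← sub_eq_add_neg] using this
  · have := key y₁ y₂ h1 h2 1 (by simp)
    simpa only [one_mul] using this
  · obtain ⟨M, c, hc, hb⟩ := h.bound
    refine ⟨M, c / 2, by positivity, fun y₁ y₂ => (hb _ _).trans (le_of_eq ?_)⟩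
    rw [abs_div, abs_of_pos (two_pos (α := ℝ))]
    ring_nf

lemma charPull_diag {s r : ℝ → ℝ} {H : ℝ → ℝ → ℝ} (he : EqOn s r (Ici 0)) (h : IsGoursat s H)
    {y : ℝ} (hy : 0 ≤ y) : charPull H y y = 1 / 2 * ∫ ξ in Ioi y, r ξ := by
  simp only [charPull, sub_self, zero_div]
  rw [h.eq, add_self_div_two, intervalIntegral.integral_same, add_zero, setIntegral_Ioi_congr he hy]

-- `∂₁² - ∂₂² = -∂_u∂_v`: the pure second derivatives cancel, and both mixed ones equal `-r(u-v)H`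
-- with `u - v = y₁`.
open IsGoursat in
lemma wave_charPull {s : ℝ → ℝ} {H : ℝ → ℝ → ℝ} (hs : SmoothPot s) (h : IsGoursat s H)
    (y₁ y₂ : ℝ) :
    iteratedDeriv 2 (fun y => charPull H y y₂) y₁ - iteratedDeriv 2 (fun y => charPull H y₁ y) y₂ =
      s y₁ * charPull H y₁ y₂ := by
  set A : ℝ → ℝ → ℝ := fun u v => deriv (fun u => dU s H u v) u
  set B : ℝ → ℝ → ℝ := fun u v => deriv (fun v => dV s H u v) v
  have hA : ∀ u v, HasDerivAt (fun u => dU s H u v) (A u v) u := fun u v =>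
    (((h.contDiff_dU hs).comp (by fun_prop : ContDiff ℝ 1 fun u : ℝ => (u, v))).differentiable
      (by norm_num) u).hasDerivAt
  have hB : ∀ u v, HasDerivAt (fun v => dV s H u v) (B u v) v := fun u v =>
    (((h.contDiff_dV hs).comp (by fun_prop : ContDiff ℝ 1 fun v : ℝ => (u, v))).differentiable
      (by norm_num) v).hasDerivAt
  have d1 := hasDerivAt_charPull₁ (h.contDiff_one hs) (h.hasDerivAt_u hs) (h.hasDerivAt_v hs)
  have d2 := hasDerivAt_charPull₂ (h.contDiff_one hs) (h.hasDerivAt_u hs) (h.hasDerivAt_v hs)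
  have d11 := hasDerivAt_charPull₁ (f := fun u v => 1 / 2 * (dU s H u v - dV s H u v))
    (contDiff_const.mul ((h.contDiff_dU hs).sub (h.contDiff_dV hs)))
    (fun u v => ((hA u v).fun_sub (h.hasDerivAt_dV_u hs u v)).const_mul (1 / 2))
    (fun u v => ((h.hasDerivAt_dU_v hs u v).fun_sub (hB u v)).const_mul (1 / 2))
  have d22 := hasDerivAt_charPull₂ (f := fun u v => 1 / 2 * (dU s H u v + dV s H u v))
    (contDiff_const.mul ((h.contDiff_dU hs).add (h.contDiff_dV hs)))
    (fun u v => ((hA u v).fun_add (h.hasDerivAt_dV_u hs u v)).const_mul (1 / 2))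
    (fun u v => ((h.hasDerivAt_dU_v hs u v).fun_add (hB u v)).const_mul (1 / 2))
  simp only [iteratedDeriv_succ, iteratedDeriv_zero]
  rw [funext fun y => (d1 y y₂).deriv, funext fun y => (d2 y₁ y).deriv, (d11 y₁ y₂).deriv,
    (d22 y₁ y₂).deriv]
  simp only [charPull]
  rw [show (y₁ + y₂) / 2 - (y₂ - y₁) / 2 = y₁ by ring]
  ring

/-! ### Uniqueness for the Goursat problem -/

/-- `F` solves `F_{11} - F_{22} = r F` on `Ω`, with first and second derivative `F'`, `F''`. -/
structure WaveOn (r : ℝ → ℝ) (F : ℝ × ℝ → ℝ) (F' : ℝ × ℝ → ℝ × ℝ →L[ℝ] ℝ)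
    (F'' : ℝ × ℝ → ℝ × ℝ →L[ℝ] ℝ × ℝ →L[ℝ] ℝ) : Prop where
  d₁ : ∀ p ∈ Om, HasFDerivAt F (F' p) p
  d₂ : ∀ p ∈ Om, HasFDerivAt F' (F'' p) p
  symm : ∀ p ∈ Om, F'' p (1, 0) (0, 1) = F'' p (0, 1) (1, 0)
  wave : ∀ p ∈ Om, F'' p (1, 0) (1, 0) - F'' p (0, 1) (0, 1) = r p.1 * F p

lemma isOpen_Om : IsOpen Om :=
  (isOpen_lt continuous_const continuous_fst).inter (isOpen_lt continuous_fst continuous_snd)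

lemma Om_subset_OmBar : Om ⊆ OmBar := fun _ hp => ⟨hp.1.le, hp.2.le⟩

lemma WaveOn.sub {r : ℝ → ℝ} {F G : ℝ × ℝ → ℝ} {F' G' F'' G''} (hF : WaveOn r F F' F'')
    (hG : WaveOn r G G' G'') :
    WaveOn r (fun p => F p - G p) (fun p => F' p - G' p) (fun p => F'' p - G'' p) where
  d₁ p hp := (hF.d₁ p hp).sub (hG.d₁ p hp)
  d₂ p hp := (hF.d₂ p hp).sub (hG.d₂ p hp)
  symm p hp := by
    simp only [sub_apply, hF.symm p hp, hG.symm p hp]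
  wave p hp := by
    have h1 := hF.wave p hp
    have h2 := hG.wave p hp
    simp only [sub_apply]
    linarith

lemma iteratedDeriv_two_eq {φ : ℝ → ℝ} {ψ : ℝ → ℝ} {a x : ℝ}
    (h : ∀ᶠ y in 𝓝 x, HasDerivAt φ (ψ y) y) (h' : HasDerivAt ψ a x) :
    iteratedDeriv 2 φ x = a := by
  simp only [iteratedDeriv_succ, iteratedDeriv_zero]
  have : deriv φ =ᶠ[𝓝 x] ψ := h.mono fun y hy => hy.deriv
  rw [this.deriv_eq, h'.deriv]

lemma IsTransformationKernel.waveOn {r : ℝ → ℝ} {K : ℝ → ℝ → ℝ} (h : IsTransformationKernel r K) :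
    ∃ F' F'', WaveOn r (fun p => K p.1 p.2) F' F'' := by
  set F : ℝ × ℝ → ℝ := fun p => K p.1 p.2 with hFdef
  have hc : ∀ p ∈ Om, ContDiffAt ℝ 2 F p := fun p hp => h.smooth.contDiffAt (isOpen_Om.mem_nhds hp)
  have hd₁ : ∀ p ∈ Om, HasFDerivAt F (fderiv ℝ F p) p := fun p hp =>
    ((hc p hp).differentiableAt (by norm_num)).hasFDerivAt
  have hd₂ : ∀ p ∈ Om, HasFDerivAt (fderiv ℝ F) (fderiv ℝ (fderiv ℝ F) p) p := fun p hp =>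
    (((hc p hp).fderiv_right (m := 1) (by norm_num)).differentiableAt (by norm_num)).hasFDerivAt
  refine ⟨fderiv ℝ F, fderiv ℝ (fderiv ℝ F), hd₁, hd₂, fun p hp => ?_, fun p hp => ?_⟩
  · exact ((hc p hp).isSymmSndFDerivAt (by simp)) _ _
  · have hn := isOpen_Om.mem_nhds hp
    have h1 : iteratedDeriv 2 (fun y => K y p.2) p.1 = fderiv ℝ (fderiv ℝ F) p (1, 0) (1, 0) := by
      have hcm : Continuous fun y : ℝ => (y, p.2) := by fun_prop
      have hev : ∀ᶠ y in 𝓝 p.1, (y, p.2) ∈ Om := hcm.continuousAt.eventually_mem hn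
      refine iteratedDeriv_two_eq (ψ := fun y => fderiv ℝ F (y, p.2) (1, 0))
        (hev.mono fun y hy => ?_) ?_
      · exact (hd₁ _ hy).comp_hasDerivAt y (f := fun y => (y, p.2))
          ((hasDerivAt_id' y).prodMk (hasDerivAt_const _ _))
      · have := (hd₂ p hp).comp_hasDerivAt p.1 (f := fun y => (y, p.2))
          ((hasDerivAt_id' p.1).prodMk (hasDerivAt_const _ _))
        exact this.clm_apply (hasDerivAt_const p.1 ((1, 0) : ℝ × ℝ)) |>.congr_deriv (by simp)
    have h2 : iteratedDeriv 2 (fun y => K p.1 y) p.2 = fderiv ℝ (fderiv ℝ F) p (0, 1) (0, 1) := by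
      have hcm : Continuous fun y : ℝ => (p.1, y) := by fun_prop
      have hev : ∀ᶠ y in 𝓝 p.2, (p.1, y) ∈ Om := hcm.continuousAt.eventually_mem hn
      refine iteratedDeriv_two_eq (ψ := fun y => fderiv ℝ F (p.1, y) (0, 1))
        (hev.mono fun y hy => ?_) ?_
      · exact (hd₁ _ hy).comp_hasDerivAt y (f := fun y => (p.1, y))
          ((hasDerivAt_const _ _).prodMk (hasDerivAt_id' y))
      · have := (hd₂ p hp).comp_hasDerivAt p.2 (f := fun y => (p.1, y))
          ((hasDerivAt_const _ _).prodMk (hasDerivAt_id' p.2))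
        exact this.clm_apply (hasDerivAt_const p.2 ((0, 1) : ℝ × ℝ)) |>.congr_deriv (by simp)
    rw [← h1, ← h2]
    exact h.wave p.1 p.2 hp.1 hp.2

/-- The rectangle identity in characteristic coordinates. -/
lemma WaveOn.rectangle {r : ℝ → ℝ} (hrc : Continuous r) {F : ℝ × ℝ → ℝ} {F' F''}
    (h : WaveOn r F F' F'') {u U v w : ℝ} (hw : 0 < w) (hwv : w ≤ v) (hvu : v < u) (huU : u ≤ U) :
    (F (U - v, U + v) - F (u - v, u + v)) - (F (U - w, U + w) - F (u - w, u + w)) =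
      ∫ t in w..v, ∫ x in u..U, -(r (x - t) * F (x - t, x + t)) := by
  have hmem : ∀ x t, w ≤ t → t ≤ v → u ≤ x → (x - t, x + t) ∈ Om := fun x t h1 h2 h3 =>
    ⟨by simp only; linarith, by simp only; linarith⟩
  have hdv : ∀ x t, w ≤ t → t ≤ v → u ≤ x →
      HasDerivAt (fun t => F (x - t, x + t)) (F' (x - t, x + t) (-1, 1)) t := fun x t h1 h2 h3 =>
    (h.d₁ _ (hmem x t h1 h2 h3)).comp_hasDerivAt t (f := fun t => (x - t, x + t))
      (((hasDerivAt_id' t).const_sub x).prodMk ((hasDerivAt_id' t).const_add x))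
  have hFc : ContinuousOn F Om := fun p hp => (h.d₁ p hp).continuousAt.continuousWithinAt
  have hFc' : ContinuousOn F' Om := fun p hp => (h.d₂ p hp).continuousAt.continuousWithinAt
  have inner : ∀ t, w ≤ t → t ≤ v → F' (U - t, U + t) (-1, 1) - F' (u - t, u + t) (-1, 1) =
      ∫ x in u..U, -(r (x - t) * F (x - t, x + t)) := by
    intro t h1 h2
    refine (intervalIntegral.integral_eq_sub_of_hasDerivAt
      (f := fun x => F' (x - t, x + t) (-1, 1)) (fun x hx => ?_)
      (ContinuousOn.intervalIntegrable ?_)).symm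
    · rw [uIcc_of_le huU] at hx
      have hp := hmem x t h1 h2 hx.1
      have := (h.d₂ _ hp).comp_hasDerivAt x (f := fun x => (x - t, x + t))
        (((hasDerivAt_id' x).sub_const t).prodMk ((hasDerivAt_id' x).add_const t))
      refine (this.clm_apply (hasDerivAt_const x ((-1, 1) : ℝ × ℝ))).congr_deriv ?_
      simp only [map_zero, add_zero]
      -- The second derivative along `(1,1)` and `(-1,1)` is `F₂₂ - F₁₁`, the mixed terms cancelling
      -- by symmetry.
      have e1 : ((1, 1) : ℝ × ℝ) = (1, 0) + (0, 1) := by simp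
      have e2 : ((-1, 1) : ℝ × ℝ) = -(1, 0) + (0, 1) := by simp
      rw [e1, e2]
      simp only [map_add, map_neg, add_apply]
      have h3 := h.wave _ hp
      have h4 := h.symm _ hp
      simp only at h3
      linarith
    · rw [uIcc_of_le huU]
      refine ((hrc.comp (by fun_prop)).continuousOn.mul (hFc.comp (by fun_prop) ?_)).neg
      exact fun x hx => hmem x t h1 h2 hx.1
  have outer : ∫ t in w..v, (F' (U - t, U + t) (-1, 1) - F' (u - t, u + t) (-1, 1)) =
      (F (U - v, U + v) - F (u - v, u + v)) - (F (U - w, U + w) - F (u - w, u + w)) := by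
    refine intervalIntegral.integral_eq_sub_of_hasDerivAt
      (f := fun t => F (U - t, U + t) - F (u - t, u + t)) (fun t ht => ?_)
      (ContinuousOn.intervalIntegrable ?_)
    · rw [uIcc_of_le hwv] at ht
      exact (hdv U t ht.1 ht.2 huU).fun_sub (hdv u t ht.1 ht.2 le_rfl)
    · rw [uIcc_of_le hwv]
      have hc : ∀ x, u ≤ x → ContinuousOn (fun t => F' (x - t, x + t) (-1, 1)) (Icc w v) :=
        fun x hx => (hFc'.comp (f := fun t => (x - t, x + t)) (by fun_prop)
          fun t ht => hmem x t ht.1 ht.2 hx).clm_apply continuousOn_const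
      exact (hc U huU).sub (hc u le_rfl)
  rw [← outer]
  refine intervalIntegral.integral_congr fun t ht => ?_
  rw [uIcc_of_le hwv] at ht
  exact inner t ht.1 ht.2

/-- The retraction of the plane onto the closure of `Ω`. -/
def clampOm (p : ℝ × ℝ) : ℝ × ℝ := (max p.1 0, max p.2 (max p.1 0))

lemma continuous_clampOm : Continuous clampOm := by unfold clampOm; fun_prop

lemma clampOm_mem (p : ℝ × ℝ) : clampOm p ∈ OmBar :=
  ⟨le_max_right _ _, le_max_right _ _⟩

lemma clampOm_eq {p : ℝ × ℝ} (hp : p ∈ OmBar) : clampOm p = p := by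
  have h1 : max p.1 0 = p.1 := max_eq_left hp.1
  rw [clampOm, h1, max_eq_left hp.2]

lemma OmAtTop_eventually {P : ℝ × ℝ → Prop} :
    (∀ᶠ p in OmAtTop, P p) ↔ ∃ S, ∀ p ∈ Om, S ≤ p.1 + p.2 → P p := by
  rw [OmAtTop, eventually_inf_principal, eventually_comap, eventually_atTop]
  refine ⟨fun ⟨S, hS⟩ => ⟨S, fun p hp h => hS _ h p rfl hp⟩, fun ⟨S, hS⟩ => ⟨S, ?_⟩⟩
  rintro s hs p rfl hp
  exact hS p hp hs

/-- Beyond `y₁ + y₂ = S` the decay bounds `F` by one; the remaining triangle is contained in a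
compact square. `clampOm` makes `F` continuous on the whole plane, so the bound extends to the
closure. -/
lemma exists_bound_of_decay {F : ℝ × ℝ → ℝ} (hc : ContinuousOn F OmBar)
    (hd : Tendsto F OmAtTop (𝓝 0)) : ∃ N, ∀ p, |F (clampOm p)| ≤ N := by
  have hcc : Continuous fun p => |F (clampOm p)| :=
    (hc.comp_continuous continuous_clampOm clampOm_mem).abs
  have h1 : ∀ᶠ p in OmAtTop, |F p| < 1 := by
    have := hd.abs
    rw [abs_zero] at this
    exact this.eventually_lt_const one_pos
  obtain ⟨S, hS⟩ := OmAtTop_eventually.1 h1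
  obtain ⟨C, hC⟩ := (isCompact_Icc (a := ((0, 0) : ℝ × ℝ)) (b := (S, S))).exists_bound_of_continuousOn
    hcc.continuousOn
  have h2 : Om ⊆ {p | |F (clampOm p)| ≤ max 1 C} := by
    intro p hp
    rcases le_total S (p.1 + p.2) with h | h
    · have := hS p hp h
      rw [← clampOm_eq (Om_subset_OmBar hp)] at this
      exact this.le.trans (le_max_left _ _)
    · have := hC p ⟨⟨hp.1.le, hp.1.le.trans hp.2.le⟩, ⟨?_, ?_⟩⟩
      · simpa using Or.inr this
      · show p.1 ≤ S
        linarith [hp.1, hp.2]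
      · show p.2 ≤ S
        linarith [hp.1, hp.2]
  have h3 := closure_minimal h2 (isClosed_le hcc continuous_const)
  refine ⟨max 1 C, fun p => ?_⟩
  have := h3 (OmBar_subset_closure (clampOm_mem p))
  rwa [mem_ofPred_eq, clampOm_eq (clampOm_mem p)] at this

/-- The rectangle identity has four vertices. Two of them disappear as `w → 0` (zero diagonal data)
and one as `U → ∞` (decay), leaving `|F|` bounded by its own iterated integral. `goursat_apriori`
with `α = 0` then gives zero. The limits are necessary because `F` is `C²` only in the open set `Ω`.
-/
theorem WaveOn.eq_zero {r : ℝ → ℝ} (hr : Integrable r) (hrc : Continuous r) {F : ℝ × ℝ → ℝ}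
    {F' F''} (h : WaveOn r F F' F'') (hc : ContinuousOn F OmBar)
    (hdiag : ∀ y, 0 < y → F (y, y) = 0) (hd : Tendsto F OmAtTop (𝓝 0)) {p : ℝ × ℝ}
    (hp : p ∈ OmBar) : F p = 0 := by
  obtain ⟨N, hN⟩ := exists_bound_of_decay hc hd
  have hcc : Continuous fun p => F (clampOm p) := hc.comp_continuous continuous_clampOm clampOm_mem
  set D : ℝ → ℝ → ℝ := fun u v => F (clampOm (u - v, u + v)) with hD
  have hDc : Continuous fun p : ℝ × ℝ => D p.1 p.2 := hcc.comp (by fun_prop)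
  have hDF : ∀ u v, 0 ≤ v → v ≤ u → D u v = F (u - v, u + v) := fun u v h1 h2 => by
    simp only [hD]
    rw [clampOm_eq ⟨by simp only; linarith, by simp only; linarith⟩]
  have hD0 : ∀ u, 0 < u → D u 0 = 0 := fun u hu => by
    rw [hDF u 0 le_rfl hu.le, sub_zero, add_zero, hdiag u hu]
  have hJc : ∀ u, Continuous fun t => ∫ l in Ioi (u - t), |r l| * |D (l + t) t| := fun u =>
    (continuous_tail hr.abs (Φ := fun l t => |D (l + t) t|) (B := fun _ => N)
      (hDc.comp (by fun_prop : Continuous fun p : ℝ × ℝ => (p.1 + p.2, p.2))).abs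
      continuous_const fun l t => by rw [abs_abs]; exact hN _).comp
      (by fun_prop : Continuous fun t => (u - t, t))
  have hJi : ∀ t a, IntegrableOn (fun l => |r l| * |D (l + t) t|) (Ioi a) := fun t a =>
    Integrable.mono' (hr.abs.mul_const N).integrableOn
      (hrc.abs.mul (hDc.comp (by fun_prop : Continuous fun l => (l + t, t))).abs).aestronglyMeasurable
      (Eventually.of_forall fun l => by
        rw [norm_mul, norm_abs_eq_norm, norm_abs_eq_norm]
        exact mul_le_mul_of_nonneg_left (hN _) (norm_nonneg _))
  have hJ0 : ∀ t a, 0 ≤ ∫ l in Ioi a, |r l| * |D (l + t) t| := fun t a =>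
    integral_nonneg fun l => by simp only [Pi.zero_apply]; positivity
  have step1 : ∀ u U v w, 0 < w → w ≤ v → v < u → u ≤ U →
      |D u v| ≤ |D U v| + |D U w| + |D u w| +
        ∫ t in (0 : ℝ)..v, ∫ l in Ioi (u - t), |r l| * |D (l + t) t| := by
    intro u U v w hw hwv hvu huU
    have h1 := h.rectangle hrc hw hwv hvu huU
    rw [← hDF U v (by linarith) (by linarith), ← hDF u v (by linarith) (by linarith),
      ← hDF U w (by linarith) (by linarith), ← hDF u w (by linarith) (by linarith)] at h1
    have h2 : |∫ t in w..v, ∫ x in u..U, -(r (x - t) * F (x - t, x + t))| ≤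
        ∫ t in w..v, ∫ l in Ioi (u - t), |r l| * |D (l + t) t| := by
      refine intervalIntegral.norm_integral_le_of_norm_le (μ := volume)
        (f := fun t => ∫ x in u..U, -(r (x - t) * F (x - t, x + t))) hwv
        (Eventually.of_forall fun t ht => ?_) ((hJc u).intervalIntegrable _ _)
      have h3 : ∫ x in u..U, -(r (x - t) * F (x - t, x + t)) =
          ∫ l in (u - t)..(U - t), -(r l * D (l + t) t) := by
        rw [← intervalIntegral.integral_comp_sub_right (fun l => -(r l * D (l + t) t)) t]
        refine intervalIntegral.integral_congr fun x hx => ?_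
        rw [uIcc_of_le huU] at hx
        rw [sub_add_cancel, hDF x t (by linarith [ht.1]) (by linarith [ht.2, hx.1])]
      rw [h3, intervalIntegral.integral_of_le (by linarith)]
      refine (norm_integral_le_integral_norm _).trans ?_
      simp only [norm_neg, norm_mul, Real.norm_eq_abs]
      exact setIntegral_mono_set (hJi t _)
        (Eventually.of_forall fun l => by simp only [Pi.zero_apply]; positivity)
        Ioc_subset_Ioi_self.eventuallyLE
    have h4 : ∫ t in w..v, ∫ l in Ioi (u - t), |r l| * |D (l + t) t| ≤
        ∫ t in (0 : ℝ)..v, ∫ l in Ioi (u - t), |r l| * |D (l + t) t| := by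
      rw [← intervalIntegral.integral_add_adjacent_intervals
        ((hJc u).intervalIntegrable (μ := volume) 0 w) ((hJc u).intervalIntegrable w v)]
      have := intervalIntegral.integral_nonneg (μ := volume) hw.le fun t _ => hJ0 t (u - t)
      linarith
    have h5 : D u v = D U v - D U w + D u w -
        ∫ t in w..v, ∫ x in u..U, -(r (x - t) * F (x - t, x + t)) := by
      rw [← h1]; ring
    rw [h5]
    refine (abs_sub _ _).trans (add_le_add ((abs_add_le _ _).trans ?_) (h2.trans h4))
    gcongr
    exact abs_sub _ _
  -- The lower side of the rectangle is moved to the diagonal.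
  have step2 : ∀ u U v, 0 < v → v < u → u ≤ U → |D u v| ≤ |D U v| +
        ∫ t in (0 : ℝ)..v, ∫ l in Ioi (u - t), |r l| * |D (l + t) t| := by
    intro u U v hv hvu huU
    have h1 : Tendsto (fun w => |D U v| + |D U w| + |D u w| +
        ∫ t in (0 : ℝ)..v, ∫ l in Ioi (u - t), |r l| * |D (l + t) t|) (𝓝[>] 0)
        (𝓝 (|D U v| + |D U 0| + |D u 0| +
        ∫ t in (0 : ℝ)..v, ∫ l in Ioi (u - t), |r l| * |D (l + t) t|)) := by
      refine Tendsto.mono_left (Continuous.tendsto ?_ 0) nhdsWithin_le_nhds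
      have : ∀ u, Continuous fun w => |D u w| := fun u =>
        (hDc.comp (by fun_prop : Continuous fun w => (u, w))).abs
      exact ((continuous_const.add (this U)).add (this u)).add continuous_const
    rw [hD0 U (by linarith), hD0 u (by linarith), abs_zero, add_zero, add_zero] at h1
    refine ge_of_tendsto h1 ?_
    filter_upwards [Ioc_mem_nhdsGT hv] with w hw using step1 u U v w hw.1 hw.2 hvu huU
  -- The far vertex is moved to infinity: `U - v` and `U + v` add up to `2U`, so the decay in `y₁ +
  -- y₂` applies.
  have step3 : ∀ u v, 0 < v → v < u → |D u v| ≤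
      ∫ t in (0 : ℝ)..v, ∫ l in Ioi (u - t), |r l| * |D (l + t) t| := by
    intro u v hv hvu
    have h1 : Tendsto (fun U => |D U v|) atTop (𝓝 0) := by
      rw [← abs_zero]
      refine Tendsto.abs ?_
      refine (hd.comp (?_ : Tendsto (fun U => (U - v, U + v)) atTop OmAtTop)).congr' ?_
      · rw [OmAtTop, tendsto_inf, tendsto_comap_iff, tendsto_principal]
        refine ⟨?_, ?_⟩
        · have : ((fun p : ℝ × ℝ => p.1 + p.2) ∘ fun U => (U - v, U + v)) = fun U => 2 * U := by
            funext U; simp only [Function.comp]; ring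
          rw [this]
          exact tendsto_id.const_mul_atTop two_pos
        · filter_upwards [eventually_gt_atTop v] with U hU
          exact ⟨by simp only; linarith, by simp only; linarith⟩
      · filter_upwards [eventually_gt_atTop v] with U hU
        exact (hDF U v hv.le hU.le).symm
    have h2 := h1.add_const (∫ t in (0 : ℝ)..v, ∫ l in Ioi (u - t), |r l| * |D (l + t) t|)
    rw [zero_add] at h2
    refine ge_of_tendsto h2 ?_
    filter_upwards [eventually_ge_atTop u] with U hU using step2 u U v hv hvu hU
  have step4 : ∀ u v, 0 < v → v < u → D u v = 0 := fun u v hv hvu => by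
    have := goursat_apriori hr hrc (F := D) (g := fun _ => 1) (α := 0) le_rfl one_pos
      (fun _ => le_rfl) (fun _ _ _ => le_rfl) (fun V => ⟨N, fun _ _ _ _ _ => hN _⟩)
      (fun u v hv hvu => by rw [zero_mul, zero_add]; exact step3 u v hv hvu) hv hvu
    rw [mul_zero, zero_mul] at this
    exact abs_eq_zero.1 (le_antisymm this (abs_nonneg _))
  have h6 : Om ⊆ {p | F (clampOm p) = 0} := fun p hp => by
    have := step4 ((p.1 + p.2) / 2) ((p.2 - p.1) / 2) (by linarith [hp.2]) (by linarith [hp.1])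
    simp only [hD] at this
    have e : (((p.1 + p.2) / 2 - (p.2 - p.1) / 2, (p.1 + p.2) / 2 + (p.2 - p.1) / 2) : ℝ × ℝ) = p := by
      ext <;> simp only <;> ring
    rwa [e] at this
  have := closure_minimal h6 (isClosed_eq hcc continuous_const) (OmBar_subset_closure hp)
  rwa [mem_ofPred_eq, clampOm_eq hp] at this

theorem IsTransformationKernel.unique {r : ℝ → ℝ} (hr : KerPot r) {K K' : ℝ → ℝ → ℝ}
    (h : IsTransformationKernel r K) (h' : IsTransformationKernel r K') {p : ℝ × ℝ}
    (hp : p ∈ OmBar) : K p.1 p.2 = K' p.1 p.2 := by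
  obtain ⟨_, _, hw⟩ := h.waveOn
  obtain ⟨_, _, hw'⟩ := h'.waveOn
  have hd := h.decay.sub h'.decay
  rw [sub_zero] at hd
  exact sub_eq_zero.1 ((hw.sub hw').eq_zero hr.integrable hr.continuous (h.cont.sub h'.cont)
    (fun y hy => by simp only [h.diag y hy, h'.diag y hy, sub_self]) hd hp)

lemma tendsto_OmAtTop {f : ℝ × ℝ → ℝ} {g : ℝ → ℝ} (hg : Tendsto g atTop (𝓝 0))
    (h : ∀ p ∈ Om, |f p| ≤ g ((p.1 + p.2) / 2)) : Tendsto f OmAtTop (𝓝 0) := by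
  have h1 : Tendsto (fun p : ℝ × ℝ => (p.1 + p.2) / 2) OmAtTop atTop := by
    have h2 : Tendsto (fun p : ℝ × ℝ => p.1 + p.2) OmAtTop atTop :=
      tendsto_comap.mono_left inf_le_left
    exact h2.atTop_div_const two_pos
  refine squeeze_zero_norm' ?_ (hg.comp h1)
  exact eventually_inf_principal.2 (Eventually.of_forall fun p hp => h p hp)

lemma RegKernel.decay {r : ℝ → ℝ} (hr : KerPot r) {K K₁ K₂ : ℝ → ℝ → ℝ} {C : ℝ}
    (h : RegKernel r K K₁ K₂ C) : Tendsto (fun p : ℝ × ℝ => K p.1 p.2) OmAtTop (𝓝 0) := by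
  have h1 := (tendsto_sigma0 hr.integrable).const_mul C
  rw [mul_zero] at h1
  exact tendsto_OmAtTop h1 fun p hp => h.bound _ _ hp.1.le hp.2.le

lemma isTransformationKernel_charPull {s r : ℝ → ℝ} {H : ℝ → ℝ → ℝ} (hr : KerPot r)
    (hs : SmoothPot s) (he : EqOn s r (Ici 0)) (h : IsGoursat s H) :
    IsTransformationKernel r (charPull H) where
  smooth := (regKernel hr hs he h).smooth.contDiffOn
  cont := (regKernel hr hs he h).smooth.continuous.continuousOn
  wave y₁ y₂ h1 h2 := by rw [wave_charPull hs h, he (mem_Ici.2 h1.le)]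
  diag y hy := charPull_diag he h hy.le
  decay := (regKernel hr hs he h).decay hr

theorem KerPot.isTransformationKernel {r : ℝ → ℝ} (hr : KerPot r) :
    IsTransformationKernel r (kerK r) := by
  obtain ⟨s, hs, he⟩ := hr.exists_smoothPot
  obtain ⟨H, hH⟩ := exists_isGoursat hs
  exact Classical.epsilon_spec (p := IsTransformationKernel r)
    ⟨_, isTransformationKernel_charPull hr hs he hH⟩

/-! ### Volterra composition of kernels and resolvents -/

lemma continuous_intervalIntegral_pair {E : ℝ → ℝ → ℝ} (hE : Continuous fun p : ℝ × ℝ => E p.1 p.2) :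
    Continuous fun q : ℝ × ℝ × ℝ => ∫ t in q.1..q.2.1, E q.2.2 t := by
  have h := continuous_intervalIntegral_param hE
  have e : (fun q : ℝ × ℝ × ℝ => ∫ t in q.1..q.2.1, E q.2.2 t) = fun q =>
      (∫ t in (0 : ℝ)..q.2.1, E q.2.2 t) - ∫ t in (0 : ℝ)..q.1, E q.2.2 t := by
    funext q
    have hc : Continuous fun t => E q.2.2 t := hE.comp (by fun_prop : Continuous fun t => (q.2.2, t))
    rw [intervalIntegral.integral_interval_sub_left (hc.intervalIntegrable _ _)
      (hc.intervalIntegrable _ _)]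
  rw [e]
  exact (h.comp (by fun_prop : Continuous fun q : ℝ × ℝ × ℝ => (q.2.2, q.2.1))).sub
    (h.comp (by fun_prop : Continuous fun q : ℝ × ℝ × ℝ => (q.2.2, q.1)))

/-- Leibniz rule with variable limits and parameter. -/
lemma hasDerivAt_integral_limits {E E' : ℝ → ℝ → ℝ} (hE : Continuous fun p : ℝ × ℝ => E p.1 p.2)
    (hE' : Continuous fun p : ℝ × ℝ => E' p.1 p.2)
    (h : ∀ u t, HasDerivAt (fun u => E u t) (E' u t) u) (a x : ℝ) :
    HasDerivAt (fun x => ∫ t in a..x, E x t) (E x x + ∫ t in a..x, E' x t) x := by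
  have hc : ∀ u, Continuous fun t => E u t := fun u => hE.comp (by fun_prop : Continuous fun t => (u, t))
  have d1 : ∀ b u, HasDerivAt (fun b => ∫ t in a..b, E u t) (E u b) b := fun b u =>
    intervalIntegral.integral_hasDerivAt_right ((hc u).intervalIntegrable a b)
      ((hc u).stronglyMeasurableAtFilter _ _) (hc u).continuousAt
  have d2 : ∀ b u, HasDerivAt (fun u => ∫ t in a..b, E u t) (∫ t in a..b, E' u t) u := fun b u =>
    hasDerivAt_intervalIntegral_param hE hE' h a b u
  have hs : ContDiff ℝ 1 fun p : ℝ × ℝ => ∫ t in a..p.1, E p.2 t :=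
    contDiff_one_of_partials (f := fun b u => ∫ t in a..b, E u t) d1 (fun b u => d2 b u)
      (hE.comp (by fun_prop : Continuous fun p : ℝ × ℝ => (p.2, p.1)))
      ((continuous_intervalIntegral_pair hE').comp
        (by fun_prop : Continuous fun p : ℝ × ℝ => (a, p.1, p.2)))
  have := HasDerivAt.comp_pair (f := fun b u => ∫ t in a..b, E u t)
    (hs.differentiable (by norm_num) (x, x)) (d1 x x) (d2 x x) (hasDerivAt_id' x)
    (hasDerivAt_id' x) rfl rfl
  simpa using this

/-- Interchange of integrals over a triangle. -/
lemma integral_triangle_swap {f : ℝ → ℝ → ℝ} (hf : Continuous fun p : ℝ × ℝ => f p.1 p.2)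
    (a b : ℝ) :
    ∫ y in a..b, ∫ x in a..y, f x y = ∫ x in a..b, ∫ y in x..b, f x y := by
  have hf' : Continuous fun p : ℝ × ℝ => f p.2 p.1 := hf.comp continuous_swap
  have hc1 : Continuous fun y => ∫ x in a..y, f x y :=
    (continuous_intervalIntegral_pair (E := fun y x => f x y) hf').comp
      (by fun_prop : Continuous fun y => (a, y, y))
  have d1 : ∀ b, HasDerivAt (fun b => ∫ y in a..b, ∫ x in a..y, f x y) (∫ x in a..b, f x b) b :=
    fun b => intervalIntegral.integral_hasDerivAt_right (hc1.intervalIntegrable a b)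
      (hc1.stronglyMeasurableAtFilter _ _) hc1.continuousAt
  have d2 : ∀ b, HasDerivAt (fun b => ∫ x in a..b, ∫ y in x..b, f x y) (∫ x in a..b, f x b) b := by
    intro b
    have := hasDerivAt_integral_limits (E := fun b x => ∫ y in x..b, f x y) (E' := fun b x => f x b)
      ((continuous_intervalIntegral_pair hf).comp
        (by fun_prop : Continuous fun p : ℝ × ℝ => (p.2, p.1, p.2))) hf' (fun b x => by
          have hcx : Continuous fun y => f x y := hf.comp (by fun_prop : Continuous fun y => (x, y))
          exact intervalIntegral.integral_hasDerivAt_right (hcx.intervalIntegrable x b)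
            (hcx.stronglyMeasurableAtFilter _ _) hcx.continuousAt) a b
    simpa using this
  -- Both iterated integrals have the same derivative in `b` and vanish at `b = a`; this covers
  -- either order of `a` and `b`.
  have h0 : ∀ b, HasDerivAt (fun b => (∫ y in a..b, ∫ x in a..y, f x y) -
      ∫ x in a..b, ∫ y in x..b, f x y) 0 b := fun b =>
    ((d1 b).fun_sub (d2 b)).congr_deriv (sub_self _)
  have := is_const_of_deriv_eq_zero (fun b => (h0 b).differentiableAt) (fun b => (h0 b).deriv) b a
  simp only [intervalIntegral.integral_same, sub_self] at this
  exact sub_eq_zero.1 this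

/-- `(A ∘ B)(a, b) = ∫ₐᵇ A(a, ξ) B(ξ, b) dξ`. -/
def vcomp (A B : ℝ → ℝ → ℝ) (a b : ℝ) : ℝ := ∫ ξ in a..b, A a ξ * B ξ b

section vcomp

variable {A B D : ℝ → ℝ → ℝ}

/-- Rescaling the interval of integration to `[0,1]` moves the variable limits into the integrand.
-/
lemma continuous_vcomp (hA : Continuous fun p : ℝ × ℝ => A p.1 p.2)
    (hB : Continuous fun p : ℝ × ℝ => B p.1 p.2) :
    Continuous fun p : ℝ × ℝ => vcomp A B p.1 p.2 := by
  have e : (fun p : ℝ × ℝ => vcomp A B p.1 p.2) = fun p =>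
      ∫ t in (0 : ℝ)..1, (p.2 - p.1) * (A p.1 (p.1 + t * (p.2 - p.1)) *
        B (p.1 + t * (p.2 - p.1)) p.2) := by
    funext p
    rw [intervalIntegral.integral_const_mul]
    have := intervalIntegral.smul_integral_comp_add_mul
      (a := 0) (b := 1) (fun ξ => A p.1 ξ * B ξ p.2) (p.2 - p.1) p.1
    simp only [smul_eq_mul, mul_zero, mul_one, add_zero, add_sub_cancel] at this
    rw [vcomp, ← this]
    simp only [mul_comm]
  rw [e]
  refine intervalIntegral.continuous_parametric_intervalIntegral_of_continuous'
    (f := fun (p : ℝ × ℝ) t => (p.2 - p.1) * (A p.1 (p.1 + t * (p.2 - p.1)) *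
        B (p.1 + t * (p.2 - p.1)) p.2)) ?_ 0 1
  have h1 := hA.comp (by fun_prop : Continuous fun q : (ℝ × ℝ) × ℝ =>
    (q.1.1, q.1.1 + q.2 * (q.1.2 - q.1.1)))
  have h2 := hB.comp (by fun_prop : Continuous fun q : (ℝ × ℝ) × ℝ =>
    (q.1.1 + q.2 * (q.1.2 - q.1.1), q.1.2))
  exact (by fun_prop : Continuous fun q : (ℝ × ℝ) × ℝ => q.1.2 - q.1.1).mul (h1.mul h2)

lemma vcomp_assoc (hA : Continuous fun p : ℝ × ℝ => A p.1 p.2)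
    (hB : Continuous fun p : ℝ × ℝ => B p.1 p.2) (hD : Continuous fun p : ℝ × ℝ => D p.1 p.2)
    (a b : ℝ) : vcomp (vcomp A B) D a b = vcomp A (vcomp B D) a b := by
  have := integral_triangle_swap (f := fun η ξ => A a η * B η ξ * D ξ b)
    (((hA.comp (by fun_prop : Continuous fun p : ℝ × ℝ => (a, p.1))).mul hB).mul
      (hD.comp (by fun_prop : Continuous fun p : ℝ × ℝ => (p.2, b)))) a b
  simp only [vcomp]
  simp only [mul_assoc, intervalIntegral.integral_const_mul] at this
  rw [← this]
  congr 1
  funext y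
  rw [← intervalIntegral.integral_mul_const]
  simp only [mul_assoc]

lemma vcomp_neg_right (a b : ℝ) : vcomp A (fun x y => -B x y) a b = -vcomp A B a b := by
  simp only [vcomp, mul_neg, intervalIntegral.integral_neg]

lemma vcomp_neg_left (a b : ℝ) : vcomp (fun x y => -A x y) B a b = -vcomp A B a b := by
  simp only [vcomp, neg_mul, intervalIntegral.integral_neg]

lemma intervalIntegrable_vcomp (hA : Continuous fun p : ℝ × ℝ => A p.1 p.2)
    (hB : Continuous fun p : ℝ × ℝ => B p.1 p.2) (x y a b : ℝ) :
    IntervalIntegrable (fun ξ => A x ξ * B ξ y) volume a b :=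
  ((hA.comp (by fun_prop : Continuous fun ξ => (x, ξ))).mul
    (hB.comp (by fun_prop : Continuous fun ξ => (ξ, y)))).intervalIntegrable a b

lemma vcomp_sub_right (hA : Continuous fun p : ℝ × ℝ => A p.1 p.2)
    (hB : Continuous fun p : ℝ × ℝ => B p.1 p.2) (hD : Continuous fun p : ℝ × ℝ => D p.1 p.2)
    (a b : ℝ) : vcomp A (fun x y => B x y - D x y) a b = vcomp A B a b - vcomp A D a b := by
  simp only [vcomp, mul_sub]
  exact intervalIntegral.integral_sub (intervalIntegrable_vcomp hA hB _ _ _ _)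
    (intervalIntegrable_vcomp hA hD _ _ _ _)

lemma vcomp_sub_left (hA : Continuous fun p : ℝ × ℝ => A p.1 p.2)
    (hB : Continuous fun p : ℝ × ℝ => B p.1 p.2) (hD : Continuous fun p : ℝ × ℝ => D p.1 p.2)
    (a b : ℝ) : vcomp (fun x y => A x y - B x y) D a b = vcomp A D a b - vcomp B D a b := by
  simp only [vcomp, sub_mul]
  exact intervalIntegral.integral_sub (intervalIntegrable_vcomp hA hD _ _ _ _)
    (intervalIntegrable_vcomp hB hD _ _ _ _)

lemma vcomp_swap (a b : ℝ) :
    vcomp A B a b = -vcomp (fun x y => B y x) (fun x y => A y x) b a := by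
  rw [vcomp, vcomp, intervalIntegral.integral_symm]
  simp only [mul_comm]

lemma hasDerivAt_vcomp₂ {B₂ : ℝ → ℝ → ℝ} (hA : Continuous fun p : ℝ × ℝ => A p.1 p.2)
    (hB : Continuous fun p : ℝ × ℝ => B p.1 p.2) (hB₂ : Continuous fun p : ℝ × ℝ => B₂ p.1 p.2)
    (h₂ : ∀ x y, HasDerivAt (fun y => B x y) (B₂ x y) y) (a b : ℝ) :
    HasDerivAt (fun b => vcomp A B a b) (A a b * B b b + vcomp A B₂ a b) b := by
  have hA' : Continuous fun p : ℝ × ℝ => A a p.2 :=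
    hA.comp (by fun_prop : Continuous fun p : ℝ × ℝ => (a, p.2))
  exact hasDerivAt_integral_limits (E := fun b ξ => A a ξ * B ξ b)
    (E' := fun b ξ => A a ξ * B₂ ξ b) (hA'.mul (hB.comp continuous_swap))
    (hA'.mul (hB₂.comp continuous_swap)) (fun u t => (h₂ t u).const_mul (A a t)) a b

lemma hasDerivAt_vcomp₁ {A₁ : ℝ → ℝ → ℝ} (hA : Continuous fun p : ℝ × ℝ => A p.1 p.2)
    (hB : Continuous fun p : ℝ × ℝ => B p.1 p.2) (hA₁ : Continuous fun p : ℝ × ℝ => A₁ p.1 p.2)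
    (h₁ : ∀ x y, HasDerivAt (fun x => A x y) (A₁ x y) x) (a b : ℝ) :
    HasDerivAt (fun a => vcomp A B a b) (-(A a a * B a b) + vcomp A₁ B a b) a := by
  have := (hasDerivAt_vcomp₂ (A := fun x y => B y x) (B := fun x y => A y x)
    (B₂ := fun x y => A₁ y x) (hB.comp continuous_swap) (hA.comp continuous_swap)
    (hA₁.comp continuous_swap) (fun x y => h₁ y x) b a).fun_neg
  rw [funext fun a => vcomp_swap (A := A) (B := B) a b]
  refine this.congr_deriv ?_
  rw [neg_add, vcomp_swap (A := A₁) (B := B) a b]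
  ring

lemma contDiff_vcomp {A₁ B₂ : ℝ → ℝ → ℝ} (hA : Continuous fun p : ℝ × ℝ => A p.1 p.2)
    (hB : Continuous fun p : ℝ × ℝ => B p.1 p.2) (hA₁ : Continuous fun p : ℝ × ℝ => A₁ p.1 p.2)
    (hB₂ : Continuous fun p : ℝ × ℝ => B₂ p.1 p.2)
    (h₁ : ∀ x y, HasDerivAt (fun x => A x y) (A₁ x y) x)
    (h₂ : ∀ x y, HasDerivAt (fun y => B x y) (B₂ x y) y) :
    ContDiff ℝ 1 fun p : ℝ × ℝ => vcomp A B p.1 p.2 := by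
  refine contDiff_one_of_partials (hasDerivAt_vcomp₁ hA hB hA₁ h₁) (hasDerivAt_vcomp₂ hA hB hB₂ h₂)
    ?_ ?_
  · exact ((hA.comp (by fun_prop : Continuous fun p : ℝ × ℝ => (p.1, p.1))).mul hB).neg.add
      (continuous_vcomp hA₁ hB)
  · exact (hA.mul (hB.comp (by fun_prop : Continuous fun p : ℝ × ℝ => (p.2, p.2)))).add
      (continuous_vcomp hA hB₂)

end vcomp

lemma abs_integral_le_exp_between {f : ℝ → ℝ} {M c a b : ℝ} (hc : 0 < c) (hM : 0 ≤ M)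
    (h : ∀ ξ ∈ uIcc a b, |f ξ| ≤ M * Real.exp (c * |ξ - a|)) :
    |∫ ξ in a..b, f ξ| ≤ M / c * Real.exp (c * |b - a|) := by
  have h1 : ∫ ξ in a..b, f ξ = ∫ t in (0 : ℝ)..(b - a), (uIcc a b).indicator f (a + t) := by
    rw [intervalIntegral.integral_comp_add_left (fun ξ => (uIcc a b).indicator f ξ) a, add_zero,
      add_sub_cancel]
    exact intervalIntegral.integral_congr fun ξ hξ => (indicator_of_mem hξ f).symm
  rw [h1]
  refine abs_integral_le_exp hc (fun t => ?_) (b - a)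
  by_cases ht : a + t ∈ uIcc a b
  · rw [indicator_of_mem ht]
    simpa using h _ ht
  · rw [indicator_of_notMem ht, abs_zero]
    positivity

/-- `L` is the resolvent of `K`: `L + K + L ∘ K = 0 = L + K + K ∘ L`. -/
structure Resolvent (K L : ℝ → ℝ → ℝ) : Prop where
  cont : Continuous fun p : ℝ × ℝ => L p.1 p.2
  growth : ∃ M c, 0 < c ∧ ∀ y₁ y₂, |L y₁ y₂| ≤ M * Real.exp (c * |y₂ - y₁|)
  left : ∀ a b, L a b = -K a b - vcomp L K a b
  right : ∀ a b, L a b = -K a b - vcomp K L a b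

/-- Fixed point of `L ↦ -K - L∘K` in the weight `exp((d+c)|b-a|)`. The part `exp(c|b-a|)` reproduces
the growth of `K`, and the extra exponent `d` gains the factor `M/d ≤ 1/2`. -/
lemma exists_left_resolvent {K : ℝ → ℝ → ℝ} (hK : Continuous fun p : ℝ × ℝ => K p.1 p.2)
    (hg : ∃ M c, 0 < c ∧ ∀ y₁ y₂, |K y₁ y₂| ≤ M * Real.exp (c * |y₂ - y₁|)) :
    ∃ L : ℝ → ℝ → ℝ, (Continuous fun p : ℝ × ℝ => L p.1 p.2) ∧
      (∃ M c, 0 < c ∧ ∀ y₁ y₂, |L y₁ y₂| ≤ M * Real.exp (c * |y₂ - y₁|)) ∧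
      ∀ a b, L a b = -K a b - vcomp L K a b := by
  obtain ⟨M, c, hc, hb⟩ := hg
  have hM : 0 ≤ M := by simpa using (abs_nonneg _).trans (hb 0 0)
  -- `d ≥ 2M` gives the contraction constant `1/2`; the one keeps `d` positive if `M = 0`.
  obtain ⟨d, hd⟩ : ∃ d, d = 2 * M + 1 := ⟨_, rfl⟩
  have hd0 : 0 < d := by rw [hd]; positivity
  have hMd : M / d ≤ 1 / 2 := by rw [div_le_iff₀ hd0]; linarith
  let X := BoundedContinuousFunction (ℝ × ℝ) ℝ
  let e : ℝ → ℝ → ℝ := fun a b => Real.exp ((d + c) * |b - a|)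
  have he0 : ∀ a b, 0 < e a b := fun a b => Real.exp_pos _
  have he : Continuous fun p : ℝ × ℝ => e p.1 p.2 := by fun_prop
  let E : X → ℝ → ℝ → ℝ := fun J a b => e a b * J (a, b)
  have hEc : ∀ J : X, Continuous fun p : ℝ × ℝ => E J p.1 p.2 := fun J => he.mul J.continuous
  have hEb : ∀ (J : X) a b, |E J a b| ≤ ‖J‖ * e a b := fun J a b => by
    rw [abs_mul, abs_of_pos (he0 _ _), mul_comm]
    exact mul_le_mul_of_nonneg_right (J.norm_coe_le_norm _) (he0 _ _).le
  have hVb : ∀ (J : X) a b, |vcomp (E J) K a b| ≤ 1 / 2 * ‖J‖ * e a b := fun J a b => by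
    have h1 : |vcomp (E J) K a b| ≤ ‖J‖ * M * Real.exp (c * |b - a|) / d *
        Real.exp (d * |b - a|) := by
      refine abs_integral_le_exp_between hd0 (by positivity) fun ξ hξ => ?_
      -- An intermediate point splits the distance exactly, so the exponential weights of the two
      -- factors multiply to the required one.
      have h2 : |ξ - a| + |b - ξ| = |b - a| := by
        rcases le_total a b with hab | hab
        · rw [uIcc_of_le hab] at hξ
          rw [abs_of_nonneg (by linarith [hξ.1]), abs_of_nonneg (by linarith [hξ.2]),
            abs_of_nonneg (by linarith)]
          ring
        · rw [uIcc_of_ge hab] at hξ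
          rw [abs_of_nonpos (by linarith [hξ.2]), abs_of_nonpos (by linarith [hξ.1]),
            abs_of_nonpos (by linarith)]
          ring
      rw [abs_mul]
      refine (mul_le_mul (hEb J a ξ) (hb ξ b) (abs_nonneg _) (by positivity)).trans (le_of_eq ?_)
      simp only [e]
      rw [mul_mul_mul_comm, ← Real.exp_add, mul_assoc _ (Real.exp _) (Real.exp _), ← Real.exp_add,
        ← h2]
      ring_nf
    refine h1.trans ?_
    have h3 : ‖J‖ * M * Real.exp (c * |b - a|) / d * Real.exp (d * |b - a|) =
        M / d * ‖J‖ * e a b := by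
      simp only [e]
      rw [add_mul, Real.exp_add]
      ring
    rw [h3]
    exact mul_le_mul_of_nonneg_right (mul_le_mul_of_nonneg_right hMd (norm_nonneg _)) (he0 _ _).le
  have hKe : ∀ a b, |K a b| ≤ M * e a b := fun a b => (hb a b).trans
    (mul_le_mul_of_nonneg_left (Real.exp_le_exp.2 (mul_le_mul_of_nonneg_right (by linarith)
      (abs_nonneg _))) hM)
  let Ψ : X → X := fun J => BoundedContinuousFunction.ofNormedAddCommGroup
    (fun p : ℝ × ℝ => (e p.1 p.2)⁻¹ * (-K p.1 p.2 - vcomp (E J) K p.1 p.2))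
    ((he.inv₀ fun p => (he0 _ _).ne').mul (hK.neg.sub (continuous_vcomp (hEc J) hK)))
    (M + 1 / 2 * ‖J‖) (fun p => by
      rw [norm_mul, norm_inv, Real.norm_of_nonneg (he0 _ _).le, inv_mul_le_iff₀ (he0 _ _)]
      refine (norm_sub_le _ _).trans ?_
      rw [norm_neg, Real.norm_eq_abs, Real.norm_eq_abs]
      have h1 := hKe p.1 p.2
      have h2 := hVb J p.1 p.2
      linarith)
  have hΨ : ContractingWith (1 / 2) Ψ := by
    refine ⟨by norm_num, LipschitzWith.of_dist_le_mul fun J J' => ?_⟩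
    rw [BoundedContinuousFunction.dist_le (by positivity)]
    intro p
    have h1 : Ψ J p - Ψ J' p = -((e p.1 p.2)⁻¹ * vcomp (E (J - J')) K p.1 p.2) := by
      have h2 : vcomp (E (J - J')) K p.1 p.2 = vcomp (E J) K p.1 p.2 - vcomp (E J') K p.1 p.2 := by
        rw [← vcomp_sub_left (hEc J) (hEc J') hK]
        congr 1
        funext a b
        have : (J - J') (a, b) = J (a, b) - J' (a, b) := rfl
        simp only [E, this]
        ring
      rw [h2]
      change (e p.1 p.2)⁻¹ * (-K p.1 p.2 - vcomp (E J) K p.1 p.2) -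
        (e p.1 p.2)⁻¹ * (-K p.1 p.2 - vcomp (E J') K p.1 p.2) = _
      ring
    rw [Real.dist_eq, h1, abs_neg, abs_mul, abs_inv, abs_of_pos (he0 _ _),
      inv_mul_le_iff₀ (he0 _ _)]
    have := hVb (J - J') p.1 p.2
    rw [dist_eq_norm]
    simp only [NNReal.coe_div, NNReal.coe_one, NNReal.coe_ofNat]
    linarith
  obtain ⟨J, hJ⟩ : ∃ J, Ψ J = J := ⟨_, hΨ.fixedPoint_isFixedPt⟩
  refine ⟨E J, hEc J, ⟨‖J‖, d + c, by positivity, hEb J⟩, fun a b => ?_⟩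
  have h1 : J (a, b) = (e a b)⁻¹ * (-K a b - vcomp (E J) K a b) := by
    conv_lhs => rw [← hJ]
    rfl
  change e a b * J (a, b) = _
  rw [h1, ← mul_assoc, mul_inv_cancel₀ (he0 a b).ne', one_mul]

/-- A right resolvent `S` comes from the left one of the transposed kernel `-K(b,a)`, the sign
accounting for the reversed limits. Expanding `(L∘K)∘S = L∘(K∘S)` with `L∘K = -K-L` and `K∘S = -K-S`
yields `L = S`. -/
theorem exists_resolvent {K : ℝ → ℝ → ℝ} (hK : Continuous fun p : ℝ × ℝ => K p.1 p.2)
    (hg : ∃ M c, 0 < c ∧ ∀ y₁ y₂, |K y₁ y₂| ≤ M * Real.exp (c * |y₂ - y₁|)) :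
    ∃ L, Resolvent K L := by
  obtain ⟨L, hLc, hLg, hL⟩ := exists_left_resolvent hK hg
  obtain ⟨S', hSc', -, hS'⟩ := exists_left_resolvent (K := fun a b => -K b a)
    (hK.comp continuous_swap).neg (by
      obtain ⟨M, c, hc, hb⟩ := hg
      refine ⟨M, c, hc, fun y₁ y₂ => ?_⟩
      rw [abs_neg, abs_sub_comm]
      exact hb _ _)
  obtain ⟨S, hSdef⟩ : ∃ S : ℝ → ℝ → ℝ, S = fun a b => -S' b a := ⟨_, rfl⟩
  have hSc : Continuous fun p : ℝ × ℝ => S p.1 p.2 := by rw [hSdef]; exact (hSc'.comp continuous_swap).neg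
  have hS : ∀ a b, S a b = -K a b - vcomp K S a b := fun a b => by
    have h1 := hS' b a
    rw [vcomp_swap (A := S')] at h1
    have h2 : vcomp (fun x y => -K x y) (fun x y => S' y x) a b = vcomp K S a b := by
      simp only [vcomp, hSdef, neg_mul, mul_neg]
    simp only [hSdef] at h2 ⊢
    rw [h2] at h1
    linarith
  have hLS : ∀ a b, L a b = S a b := by
    intro a b
    have h1 := vcomp_assoc hLc hK hSc a b
    have e1 : vcomp L K = fun a b => -K a b - L a b := by
      funext a b; linarith [hL a b]
    have e2 : vcomp K S = fun a b => -K a b - S a b := by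
      funext a b; linarith [hS a b]
    rw [e1, e2, vcomp_sub_left (A := fun a b => -K a b) hK.neg hLc hSc,
      vcomp_sub_right (B := fun a b => -K a b) hLc hK.neg hSc, vcomp_neg_left, vcomp_neg_right, e1, e2] at h1
    linarith
  refine ⟨L, hLc, hLg, hL, fun a b => ?_⟩
  have : L = S := by funext a b; exact hLS a b
  rw [this]
  exact hS a b

/-! ### Regularity of the inverse kernel -/

lemma exists_partials {F : ℝ → ℝ → ℝ} (h : ContDiff ℝ 1 fun p : ℝ × ℝ => F p.1 p.2) :
    ∃ F₁ F₂ : ℝ → ℝ → ℝ, (∀ x y, HasDerivAt (fun x => F x y) (F₁ x y) x) ∧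
      (∀ x y, HasDerivAt (fun y => F x y) (F₂ x y) y) ∧
      (Continuous fun p : ℝ × ℝ => F₁ p.1 p.2) ∧ Continuous fun p : ℝ × ℝ => F₂ p.1 p.2 := by
  have hd : ∀ p, HasFDerivAt (fun p : ℝ × ℝ => F p.1 p.2) (fderiv ℝ (fun p : ℝ × ℝ => F p.1 p.2) p) p :=
    fun p => (h.differentiable (by norm_num) p).hasFDerivAt
  have hc := h.continuous_fderiv (by norm_num)
  refine ⟨fun x y => fderiv ℝ (fun p : ℝ × ℝ => F p.1 p.2) (x, y) (1, 0),
    fun x y => fderiv ℝ (fun p : ℝ × ℝ => F p.1 p.2) (x, y) (0, 1), fun x y => ?_, fun x y => ?_,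
    hc.clm_apply continuous_const, hc.clm_apply continuous_const⟩
  · exact (hd (x, y)).comp_hasDerivAt x (f := fun x => (x, y))
      ((hasDerivAt_id' x).prodMk (hasDerivAt_const _ _))
  · exact (hd (x, y)).comp_hasDerivAt y (f := fun y => (x, y))
      ((hasDerivAt_const _ _).prodMk (hasDerivAt_id' y))

/-- A Gronwall inequality. -/
lemma one_add_integral_le_exp {f α : ℝ → ℝ} (hf : Continuous f) (hα : Continuous α) {a : ℝ}
    (h : ∀ y, a ≤ y → f y ≤ α y * (1 + ∫ t in a..y, f t)) {y : ℝ} (hy : a ≤ y) :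
    1 + ∫ t in a..y, f t ≤ Real.exp (∫ t in a..y, α t) := by
  have d : ∀ {g : ℝ → ℝ}, Continuous g → ∀ y, HasDerivAt (fun y => ∫ t in a..y, g t) (g y) y :=
    fun hg y => intervalIntegral.integral_hasDerivAt_right (hg.intervalIntegrable _ _)
      (hg.stronglyMeasurableAtFilter _ _) hg.continuousAt
  set φ : ℝ → ℝ := fun y => (1 + ∫ t in a..y, f t) * Real.exp (-∫ t in a..y, α t) with hφ
  have hd : ∀ y, HasDerivAt φ (f y * Real.exp (-∫ t in a..y, α t) +
      (1 + ∫ t in a..y, f t) * (Real.exp (-∫ t in a..y, α t) * -α y)) y := fun y =>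
    ((d hf y).const_add 1).mul (d hα y).fun_neg.exp
  have hanti : AntitoneOn φ (Ici a) := by
    refine antitoneOn_of_deriv_nonpos (convex_Ici a)
      (fun y _ => (hd y).continuousAt.continuousWithinAt)
      (fun y _ => (hd y).differentiableAt.differentiableWithinAt) fun y hy => ?_
    rw [interior_Ici] at hy
    rw [(hd y).deriv]
    have h1 := h y (le_of_lt hy)
    have h2 := Real.exp_pos (-∫ t in a..y, α t)
    nlinarith
  have h3 := hanti self_mem_Ici hy hy
  simp only [hφ, intervalIntegral.integral_same, add_zero, Real.exp_zero, Real.exp_neg, inv_one,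
    mul_one] at h3
  rwa [← div_eq_mul_inv, div_le_one (Real.exp_pos _)] at h3

/-! ### Integrals of functions of the half sum. -/

section Averages

variable {r : ℝ → ℝ}

lemma integral_half_sum (f : ℝ → ℝ) (a y : ℝ) :
    ∫ ξ in a..y, f ((a + ξ) / 2) = 2 * ∫ t in a..((a + y) / 2), f t := by
  have := intervalIntegral.integral_comp_div_add (a := a) (b := y) f (two_ne_zero) (a / 2)
  have e : ∀ ξ : ℝ, ξ / 2 + a / 2 = (a + ξ) / 2 := fun ξ => by ring
  simp only [e, add_self_div_two, smul_eq_mul] at this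
  exact this

lemma integral_half_sum' (f : ℝ → ℝ) (a y : ℝ) :
    ∫ ξ in a..y, f ((ξ + y) / 2) = 2 * ∫ t in ((a + y) / 2)..y, f t := by
  have := intervalIntegral.integral_comp_div_add (a := a) (b := y) f (two_ne_zero) (y / 2)
  have e : ∀ ξ : ℝ, ξ / 2 + y / 2 = (ξ + y) / 2 := fun ξ => by ring
  simp only [e, add_self_div_two, smul_eq_mul] at this
  exact this

lemma integral_sigma0_half_le (hr : KerPot r) {a y : ℝ} (ha : 0 ≤ a) (hy : a ≤ y) :
    ∫ ξ in a..y, sigma0 r ((a + ξ) / 2) ≤ 2 * Rconst r := by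
  rw [integral_half_sum]
  exact mul_le_mul_of_nonneg_left (integral_sigma0_interval_le hr.integrable hr.continuous hr.moment
    ha (by linarith)) zero_le_two

lemma integral_abs_r_half_le (hr : KerPot r) {a y : ℝ} (ha : 0 ≤ a) (hy : a ≤ y) :
    ∫ ξ in a..y, |r ((a + ξ) / 2)| ≤ 2 * sigma0 r 0 := by
  rw [integral_half_sum (fun t => |r t|)]
  exact mul_le_mul_of_nonneg_left ((interval_le_sigma0 hr.integrable (by linarith)).trans
    (sigma0_antitone hr.integrable ha)) zero_le_two

end Averages

lemma RegKernel.mono {r : ℝ → ℝ} {K K₁ K₂ : ℝ → ℝ → ℝ} {C C' : ℝ} (h : RegKernel r K K₁ K₂ C)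
    (hC : C ≤ C') : RegKernel r K K₁ K₂ C' where
  smooth := h.smooth
  smooth₁ := h.smooth₁
  smooth₂ := h.smooth₂
  d₁ := h.d₁
  d₂ := h.d₂
  pos := h.pos.trans_le hC
  bound y₁ y₂ h1 h2 := (h.bound y₁ y₂ h1 h2).trans
    (mul_le_mul_of_nonneg_right hC (sigma0_nonneg _))
  bound₁ y₁ y₂ h1 h2 := (h.bound₁ y₁ y₂ h1 h2).trans
    (add_le_add_right (mul_le_mul_of_nonneg_right hC (sigma0_nonneg _)) _)
  bound₂ y₁ y₂ h1 h2 := (h.bound₂ y₁ y₂ h1 h2).trans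
    (add_le_add_right (mul_le_mul_of_nonneg_right hC (sigma0_nonneg _)) _)
  growth := h.growth

/-- The first derivatives of the resolvent. -/
def resD₁ (K K₁ L : ℝ → ℝ → ℝ) (a b : ℝ) : ℝ := -K₁ a b + K a a * L a b - vcomp K₁ L a b

/-- The second derivatives of the resolvent. -/
def resD₂ (K K₂ L : ℝ → ℝ → ℝ) (a b : ℝ) : ℝ := -K₂ a b - L a b * K b b - vcomp L K₂ a b

namespace Resolvent

variable {r : ℝ → ℝ} {K K₁ K₂ L : ℝ → ℝ → ℝ} {C : ℝ}

/-- The derivative in the first variable is read off the right equation and the one in the second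
variable off the left equation, so that it always falls on `K` under the integral and never on `L`.
-/
lemma hasDerivAt₁ (hK : RegKernel r K K₁ K₂ C) (h : Resolvent K L) (a b : ℝ) :
    HasDerivAt (fun a => L a b) (resD₁ K K₁ L a b) a := by
  rw [funext fun a => h.right a b]
  refine ((hK.d₁ a b).fun_neg.fun_sub (hasDerivAt_vcomp₁ hK.smooth.continuous h.cont
    hK.smooth₁.continuous hK.d₁ a b)).congr_deriv ?_
  rw [resD₁]
  ring

lemma hasDerivAt₂ (hK : RegKernel r K K₁ K₂ C) (h : Resolvent K L) (a b : ℝ) :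
    HasDerivAt (fun b => L a b) (resD₂ K K₂ L a b) b := by
  rw [funext fun b => h.left a b]
  refine ((hK.d₂ a b).fun_neg.fun_sub (hasDerivAt_vcomp₂ h.cont hK.smooth.continuous
    hK.smooth₂.continuous hK.d₂ a b)).congr_deriv ?_
  rw [resD₂]
  ring

lemma continuous_resD₁ (hK : RegKernel r K K₁ K₂ C) (h : Resolvent K L) :
    Continuous fun p : ℝ × ℝ => resD₁ K K₁ L p.1 p.2 :=
  (hK.smooth₁.continuous.neg.add ((hK.smooth.continuous.comp
    (by fun_prop : Continuous fun p : ℝ × ℝ => (p.1, p.1))).mul h.cont)).sub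
    (continuous_vcomp hK.smooth₁.continuous h.cont)

lemma continuous_resD₂ (hK : RegKernel r K K₁ K₂ C) (h : Resolvent K L) :
    Continuous fun p : ℝ × ℝ => resD₂ K K₂ L p.1 p.2 :=
  (hK.smooth₂.continuous.neg.sub (h.cont.mul (hK.smooth.continuous.comp
    (by fun_prop : Continuous fun p : ℝ × ℝ => (p.2, p.2))))).sub
    (continuous_vcomp h.cont hK.smooth₂.continuous)

lemma contDiff_one (hK : RegKernel r K K₁ K₂ C) (h : Resolvent K L) :
    ContDiff ℝ 1 fun p : ℝ × ℝ => L p.1 p.2 :=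
  contDiff_one_of_partials (h.hasDerivAt₁ hK) (h.hasDerivAt₂ hK) (h.continuous_resD₁ hK)
    (h.continuous_resD₂ hK)

lemma contDiff_resD₁ (hK : RegKernel r K K₁ K₂ C) (h : Resolvent K L) :
    ContDiff ℝ 1 fun p : ℝ × ℝ => resD₁ K K₁ L p.1 p.2 := by
  obtain ⟨A, -, hA, -, hAc, -⟩ := exists_partials hK.smooth₁
  have hK1 : ContDiff ℝ 1 fun p : ℝ × ℝ => K p.1 p.2 := hK.smooth.of_le (by norm_num)
  exact (hK.smooth₁.neg.add ((hK1.comp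
    (by fun_prop : ContDiff ℝ 1 fun p : ℝ × ℝ => (p.1, p.1))).mul (h.contDiff_one hK))).sub
    (contDiff_vcomp hK.smooth₁.continuous h.cont hAc (h.continuous_resD₂ hK) hA (h.hasDerivAt₂ hK))

lemma contDiff_resD₂ (hK : RegKernel r K K₁ K₂ C) (h : Resolvent K L) :
    ContDiff ℝ 1 fun p : ℝ × ℝ => resD₂ K K₂ L p.1 p.2 := by
  obtain ⟨-, B, -, hB, -, hBc⟩ := exists_partials hK.smooth₂
  have hK1 : ContDiff ℝ 1 fun p : ℝ × ℝ => K p.1 p.2 := hK.smooth.of_le (by norm_num)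
  exact (hK.smooth₂.neg.sub ((h.contDiff_one hK).mul (hK1.comp
    (by fun_prop : ContDiff ℝ 1 fun p : ℝ × ℝ => (p.2, p.2))))).sub
    (contDiff_vcomp h.cont hK.smooth₂.continuous (h.continuous_resD₁ hK) hBc (h.hasDerivAt₁ hK) hB)

lemma contDiff_two (hK : RegKernel r K K₁ K₂ C) (h : Resolvent K L) :
    ContDiff ℝ 2 fun p : ℝ × ℝ => L p.1 p.2 := by
  have := contDiff_succ_of_partials (f := L) 1 (h.hasDerivAt₁ hK) (h.hasDerivAt₂ hK)
    (by simpa using h.contDiff_resD₁ hK) (by simpa using h.contDiff_resD₂ hK)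
  simpa [one_add_one_eq_two] using this

/-- For `ξ ≥ a` one has `|K(ξ,y)| ≤ Cσ₀((a+y)/2)`, because `σ₀` decreases. So the left equation
gives `|L(a,y)| ≤ Cσ₀((a+y)/2)(1 + ∫_a^y|L(a,·)|)`, and Gronwall applies with `∫σ₀((a+ξ)/2)dξ ≤ 2R`.
-/
lemma abs_le_and_integral_le (hr : KerPot r) (hK : RegKernel r K K₁ K₂ C) (h : Resolvent K L)
    {a b : ℝ} (ha : 0 ≤ a) (hab : a ≤ b) :
    |L a b| ≤ C * Real.exp (2 * C * Rconst r) * sigma0 r ((a + b) / 2) ∧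
      ∫ ξ in a..b, |L a ξ| ≤ Real.exp (2 * C * Rconst r) := by
  have hsc := continuous_sigma0 hr.integrable hr.continuous
  have hfc : Continuous fun y => |L a y| := (h.cont.comp (by fun_prop : Continuous fun y => (a, y))).abs
  have hαc : Continuous fun y => C * sigma0 r ((a + y) / 2) := by fun_prop
  have key : ∀ y, a ≤ y → |L a y| ≤ C * sigma0 r ((a + y) / 2) * (1 + ∫ ξ in a..y, |L a ξ|) := by
    intro y hy
    have h1 : |vcomp L K a y| ≤ ∫ ξ in a..y, |L a ξ| * (C * sigma0 r ((a + y) / 2)) := by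
      refine intervalIntegral.norm_integral_le_of_norm_le (μ := volume)
        (f := fun ξ => L a ξ * K ξ y) hy (Eventually.of_forall fun ξ hξ => ?_)
        ((hfc.mul continuous_const).intervalIntegrable _ _)
      rw [norm_mul]
      refine mul_le_mul_of_nonneg_left ?_ (norm_nonneg _)
      refine (hK.bound ξ y (ha.trans hξ.1.le) hξ.2).trans ?_
      exact mul_le_mul_of_nonneg_left (sigma0_antitone hr.integrable (by linarith [hξ.1])) hK.pos.le
    rw [intervalIntegral.integral_mul_const] at h1
    rw [h.left a y]
    refine (abs_sub _ _).trans ?_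
    rw [abs_neg]
    have h2 := hK.bound a y ha hy
    linarith
  have hexp : ∀ y, a ≤ y → 1 + ∫ ξ in a..y, |L a ξ| ≤ Real.exp (2 * C * Rconst r) := by
    intro y hy
    refine (one_add_integral_le_exp hfc hαc key hy).trans (Real.exp_le_exp.2 ?_)
    rw [intervalIntegral.integral_const_mul]
    have := mul_le_mul_of_nonneg_left (integral_sigma0_half_le hr ha hy) hK.pos.le
    linarith
  refine ⟨(key b hab).trans ?_, by linarith [hexp b hab]⟩
  have := mul_le_mul_of_nonneg_left (hexp b hab)
    (mul_nonneg hK.pos.le (sigma0_nonneg (r := r) ((a + b) / 2)))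
  linarith

/-- In the differentiated resolvent equations only the leading terms `-K₁`, `-K₂` carry `¼|r|` at
the point `(a+b)/2`; in the products and compositions `r` is integrated or absent, and one factor
yields `σ₀((a+b)/2)`. -/
theorem regKernel (hr : KerPot r) (hK : RegKernel r K K₁ K₂ C) (h : Resolvent K L) :
    ∃ C', RegKernel r L (resD₁ K K₁ L) (resD₂ K K₂ L) C' := by
  set E := Real.exp (2 * C * Rconst r) with hE
  have hE0 : 0 < E := Real.exp_pos _
  have hC := hK.pos
  set S := sigma0 r 0 with hS
  have hS0 : 0 ≤ S := sigma0_nonneg _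
  have hR0 : 0 ≤ Rconst r := Rconst_nonneg
  have hrc := hr.continuous
  have hsc := continuous_sigma0 hr.integrable hrc
  -- In order: the leading term, the diagonal product, the composition of `K₁` with `L`, and the two
  -- parts of the composition of `L` with `K₂`. Their sum serves all three bounds.
  set C' := C + C * E * (C * S) + C * E * (S + 2 * C * Rconst r) + E * C +
    C * E * S with hC'
  have hC'0 : 0 < C' := by positivity
  have hsle : ∀ x : ℝ, 0 ≤ x → sigma0 r x ≤ S := fun x hx => sigma0_antitone hr.integrable hx
  have hdiag : ∀ y : ℝ, 0 ≤ y → |K y y| ≤ C * S := fun y hy => (hK.bound y y hy le_rfl).trans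
    (mul_le_mul_of_nonneg_left (hsle _ (by linarith)) hC.le)
  have hLb : ∀ a b : ℝ, 0 ≤ a → a ≤ b → |L a b| ≤ C * E * sigma0 r ((a + b) / 2) :=
    fun a b ha hab => (h.abs_le_and_integral_le hr hK ha hab).1
  refine ⟨C', h.contDiff_two hK, h.contDiff_resD₁ hK, h.contDiff_resD₂ hK, h.hasDerivAt₁ hK,
    h.hasDerivAt₂ hK, hC'0, fun a b ha hab => ?_, fun a b ha hab => ?_, fun a b ha hab => ?_,
    h.growth⟩
  · refine (hLb a b ha hab).trans (mul_le_mul_of_nonneg_right ?_ (sigma0_nonneg _))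
    have : 0 ≤ C + C * E * (C * S) + C * E * (S + 2 * C * Rconst r) + C * E * S := by positivity
    rw [hC']
    linarith
  · set s := sigma0 r ((a + b) / 2) with hs
    have hs0 : 0 ≤ s := sigma0_nonneg _
    have h1 : |vcomp K₁ L a b| ≤ ∫ ξ in a..b,
        (1 / 4 * |r ((a + ξ) / 2)| + C * sigma0 r ((a + ξ) / 2)) * (C * E * s) := by
      refine intervalIntegral.norm_integral_le_of_norm_le (μ := volume)
        (f := fun ξ => K₁ a ξ * L ξ b) hab (Eventually.of_forall fun ξ hξ => ?_)
        (Continuous.intervalIntegrable (by fun_prop) _ _)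
      rw [norm_mul]
      refine mul_le_mul (hK.bound₁ a ξ ha hξ.1.le) ?_ (norm_nonneg _) ?_
      · exact (hLb ξ b (ha.trans hξ.1.le) hξ.2).trans (mul_le_mul_of_nonneg_left
          (sigma0_antitone hr.integrable (by linarith [hξ.1])) (by positivity))
      · exact add_nonneg (by positivity) (mul_nonneg hC.le (sigma0_nonneg _))
    rw [intervalIntegral.integral_mul_const, intervalIntegral.integral_add
      (Continuous.intervalIntegrable (by fun_prop) _ _)
      (Continuous.intervalIntegrable (by fun_prop) _ _), intervalIntegral.integral_const_mul,
      intervalIntegral.integral_const_mul] at h1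
    have h2 := integral_abs_r_half_le hr ha hab
    have h3 := mul_le_mul_of_nonneg_left (integral_sigma0_half_le hr ha hab) hC.le
    have h4 : (1 / 4 * (∫ ξ in a..b, |r ((a + ξ) / 2)|) +
        C * ∫ ξ in a..b, sigma0 r ((a + ξ) / 2)) * (C * E * s) ≤
        (S + 2 * C * Rconst r) * (C * E * s) :=
      mul_le_mul_of_nonneg_right (by linarith) (by positivity)
    have h5 : |K a a * L a b| ≤ C * S * (C * E * s) := by
      rw [abs_mul]
      exact mul_le_mul (hdiag a ha) (hLb a b ha hab) (abs_nonneg _) (by positivity)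
    have h6 := hK.bound₁ a b ha hab
    have h7 : |resD₁ K K₁ L a b| ≤ |K₁ a b| + |K a a * L a b| + |vcomp K₁ L a b| := by
      rw [resD₁]
      refine (abs_sub _ _).trans (add_le_add_left ((abs_add_le _ _).trans ?_) _)
      rw [abs_neg]
    have h8 : 0 ≤ (E * C + C * E * S) * s := by positivity
    rw [hC']
    linarith
  · set s := sigma0 r ((a + b) / 2) with hs
    have hs0 : 0 ≤ s := sigma0_nonneg _
    have hLc : Continuous fun ξ => |L a ξ| :=
      (h.cont.comp (by fun_prop : Continuous fun ξ => (a, ξ))).abs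
    have h1 : |vcomp L K₂ a b| ≤ ∫ ξ in a..b,
        (C * E * S * (1 / 4) * |r ((ξ + b) / 2)| + |L a ξ| * (C * s)) := by
      refine intervalIntegral.norm_integral_le_of_norm_le (μ := volume)
        (f := fun ξ => L a ξ * K₂ ξ b) hab (Eventually.of_forall fun ξ hξ => ?_)
        (Continuous.intervalIntegrable (by fun_prop) _ _)
      rw [norm_mul, Real.norm_eq_abs, Real.norm_eq_abs]
      have h2 := hK.bound₂ ξ b (ha.trans hξ.1.le) hξ.2
      have h3 : C * sigma0 r ((ξ + b) / 2) ≤ C * s := mul_le_mul_of_nonneg_left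
        (sigma0_antitone hr.integrable (by linarith [hξ.1])) hC.le
      have h4 : |L a ξ| ≤ C * E * S := (hLb a ξ ha hξ.1.le).trans
        (mul_le_mul_of_nonneg_left (hsle _ (by linarith [hξ.1])) (by positivity))
      calc |L a ξ| * |K₂ ξ b| ≤ |L a ξ| * (1 / 4 * |r ((ξ + b) / 2)| + C * s) :=
            mul_le_mul_of_nonneg_left (by linarith) (abs_nonneg _)
        _ = |L a ξ| * (1 / 4 * |r ((ξ + b) / 2)|) + |L a ξ| * (C * s) := by ring
        _ ≤ C * E * S * (1 / 4 * |r ((ξ + b) / 2)|) + |L a ξ| * (C * s) :=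
            add_le_add_left (mul_le_mul_of_nonneg_right h4 (by positivity)) _
        _ = _ := by ring
    rw [intervalIntegral.integral_add (Continuous.intervalIntegrable (by fun_prop) _ _)
      (Continuous.intervalIntegrable (by fun_prop) _ _), intervalIntegral.integral_const_mul,
      intervalIntegral.integral_mul_const, integral_half_sum' (fun t => |r t|)] at h1
    have h2 : ∫ t in ((a + b) / 2)..b, |r t| ≤ s := interval_le_sigma0 hr.integrable (by linarith)
    have h3 := mul_le_mul_of_nonneg_left h2 (show 0 ≤ C * E * S by positivity)
    have h4 := mul_le_mul_of_nonneg_right (h.abs_le_and_integral_le hr hK ha hab).2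
      (show 0 ≤ C * s by positivity)
    have h5 : |L a b * K b b| ≤ C * E * s * (C * S) := by
      rw [abs_mul]
      exact mul_le_mul (hLb a b ha hab) (hdiag b (ha.trans hab)) (abs_nonneg _) (by positivity)
    have h6 := hK.bound₂ a b ha hab
    have h7 : |resD₂ K K₂ L a b| ≤ |K₂ a b| + |L a b * K b b| + |vcomp L K₂ a b| := by
      rw [resD₂]
      refine (abs_sub _ _).trans (add_le_add_left ((abs_sub _ _).trans ?_) _)
      rw [abs_neg]
    have h8 : 0 ≤ (C * E * (S + 2 * C * Rconst r)) * s := by positivity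
    have h9 : 0 ≤ C * E * S * s := by positivity
    rw [hC']
    linarith

end Resolvent

/-! ### The pair of kernels -/

/-- `K` and `L` are smooth representatives of the two kernels of the potential `r`. -/
structure KernelPair (r : ℝ → ℝ) (K K₁ K₂ L L₁ L₂ : ℝ → ℝ → ℝ) (C : ℝ) : Prop where
  pot : KerPot r
  regK : RegKernel r K K₁ K₂ C
  regL : RegKernel r L L₁ L₂ C
  res : Resolvent K L
  diag : ∀ y, 0 ≤ y → K y y = 1 / 2 * ∫ ξ in Ioi y, r ξ
  kerK_eq : ∀ a b, 0 ≤ a → a ≤ b → kerK r a b = K a b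
  kerL_eq : ∀ a b, 0 ≤ a → a ≤ b → kerL r a b = L a b
  isL : IsInverseKernel (kerK r) L
  char : ∃ s H, SmoothPot s ∧ EqOn s r (Ici 0) ∧ IsGoursat s H ∧ K = charPull H

/-- Composing `D = -D∘K` with `L` on the right gives `-D∘L = D∘(K∘L) = -D∘K - D∘L`, hence `D∘K = 0`
and `D = 0`. Only the row of `D` at `a` enters. -/
lemma Resolvent.eq_zero_of_comp {K L D : ℝ → ℝ → ℝ} (hK : Continuous fun p : ℝ × ℝ => K p.1 p.2)
    (hD : Continuous fun p : ℝ × ℝ => D p.1 p.2) (h : Resolvent K L) {a b : ℝ} (hab : a < b)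
    (heq : ∀ y, a < y → y ≤ b → D a y = -vcomp D K a y) : D a b = 0 := by
  have h1 := vcomp_assoc hD hK h.cont a b
  have h2 : vcomp (vcomp D K) L a b = -vcomp D L a b := by
    rw [vcomp, vcomp, ← intervalIntegral.integral_neg]
    refine intervalIntegral.integral_congr_ae (Eventually.of_forall fun ξ hξ => ?_)
    rw [uIoc_of_le hab.le] at hξ
    rw [heq ξ hξ.1 hξ.2]
    ring
  have h3 : vcomp K L = fun a b => -K a b - L a b := by
    funext a b; linarith [h.right a b]
  rw [h2, h3, vcomp_sub_right (B := fun a b => -K a b) hD hK.neg h.cont, vcomp_neg_right] at h1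
  rw [heq b hab le_rfl]
  linarith

lemma intervalIntegral_congr_Icc {f g : ℝ → ℝ} {a b : ℝ} (hab : a ≤ b)
    (h : ∀ x, a ≤ x → x ≤ b → f x = g x) : ∫ x in a..b, f x = ∫ x in a..b, g x :=
  intervalIntegral.integral_congr fun x hx => by
    rw [uIcc_of_le hab] at hx
    exact h x hx.1 hx.2

/-- The difference of two solutions satisfies `D = -D∘K`; `K` is a continuous representative on the
plane of the kernel `K₀`, which is known only on the closure of `Ω`. -/
lemma IsInverseKernel.unique {K₀ K L L' L'' : ℝ → ℝ → ℝ}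
    (hK : Continuous fun p : ℝ × ℝ => K p.1 p.2) (hres : Resolvent K L)
    (hKK : ∀ a b, 0 ≤ a → a ≤ b → K₀ a b = K a b) (h' : IsInverseKernel K₀ L')
    (h'' : IsInverseKernel K₀ L'') {p : ℝ × ℝ} (hp : p ∈ OmBar) : L' p.1 p.2 = L'' p.1 p.2 := by
  set F : ℝ × ℝ → ℝ := fun p => L' p.1 p.2 - L'' p.1 p.2 with hF
  have hFc : ContinuousOn F OmBar := h'.cont.sub h''.cont
  have hDc : Continuous fun p => F (clampOm p) := hFc.comp_continuous continuous_clampOm clampOm_mem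
  have hDF : ∀ a b, 0 ≤ a → a ≤ b → F (clampOm (a, b)) = L' a b - L'' a b := fun a b ha hab => by
    rw [clampOm_eq (p := (a, b)) ⟨ha, hab⟩]
  have key : Om ⊆ {p | F (clampOm p) = 0} := by
    rintro ⟨a, b⟩ ⟨ha, hab⟩
    refine hres.eq_zero_of_comp (D := fun a b => F (clampOm (a, b))) hK hDc hab fun y hy _ => ?_
    have e1 := h'.eqn a y ha hy
    have e2 := h''.eqn a y ha hy
    have hsec : ∀ M : ℝ → ℝ → ℝ, ContinuousOn (fun p : ℝ × ℝ => M p.1 p.2) OmBar →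
        IntervalIntegrable (fun ξ => M a ξ * K ξ y) volume a y := fun M hM => by
      refine ContinuousOn.intervalIntegrable (ContinuousOn.mul ?_
        (hK.comp (by fun_prop : Continuous fun ξ => (ξ, y))).continuousOn)
      refine hM.comp (f := fun ξ => (a, ξ)) (by fun_prop) fun ξ hξ => ?_
      rw [uIcc_of_le hy.le] at hξ
      exact ⟨ha.le, hξ.1⟩
    have hcg : ∀ M : ℝ → ℝ → ℝ, ∫ ξ in a..y, M a ξ * K₀ ξ y = ∫ ξ in a..y, M a ξ * K ξ y :=
      fun M => intervalIntegral_congr_Icc hy.le fun ξ h1 h2 => by rw [hKK ξ y (ha.le.trans h1) h2]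
    rw [hcg] at e1 e2
    have e3 : vcomp (fun a b => F (clampOm (a, b))) K a y =
        (∫ ξ in a..y, L' a ξ * K ξ y) - ∫ ξ in a..y, L'' a ξ * K ξ y := by
      rw [← intervalIntegral.integral_sub (hsec L' h'.cont) (hsec L'' h''.cont)]
      exact intervalIntegral_congr_Icc hy.le fun ξ h1 _ => by
        simp only [hDF a ξ ha.le h1, sub_mul]
    rw [e3, hDF a y ha.le hy.le]
    linarith
  have := closure_minimal key (isClosed_eq hDc continuous_const) (OmBar_subset_closure hp)
  rw [mem_ofPred_eq, clampOm_eq hp] at this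
  exact sub_eq_zero.1 this

/-- `kerK` and `kerL` are chosen by their defining properties alone; uniqueness identifies them on
`{0 ≤ a ≤ b}` with the constructed kernels, which are smooth on the plane and carry the estimates.
-/
theorem KerPot.exists_kernelPair {r : ℝ → ℝ} (hr : KerPot r) :
    ∃ K K₁ K₂ L L₁ L₂ C, KernelPair r K K₁ K₂ L L₁ L₂ C := by
  obtain ⟨s, hs, he⟩ := hr.exists_smoothPot
  obtain ⟨H, hH⟩ := exists_isGoursat hs
  have hK := _root_.NeumannHeat.regKernel hr hs he hH
  have hKt := isTransformationKernel_charPull hr hs he hH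
  obtain ⟨L, hL⟩ := exists_resolvent hK.smooth.continuous hK.growth
  obtain ⟨C', hLr⟩ := hL.regKernel hr hK
  have hkK : ∀ a b, 0 ≤ a → a ≤ b → kerK r a b = charPull H a b := fun a b ha hab =>
    hr.isTransformationKernel.unique hr hKt (p := (a, b)) ⟨ha, hab⟩
  have hLi : IsInverseKernel (kerK r) L := by
    refine ⟨hLr.smooth.contDiffOn, hL.cont.continuousOn, fun a b ha hab => ?_⟩
    rw [hkK a b ha.le hab.le, intervalIntegral_congr_Icc (g := fun ξ => L a ξ * charPull H ξ b)
      hab.le fun ξ h1 h2 => by rw [hkK ξ b (ha.le.trans h1) h2]]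
    have := hL.left a b
    rw [vcomp] at this
    linarith
  have hLe : IsInverseKernel (kerK r) (kerL r) :=
    Classical.epsilon_spec (p := IsInverseKernel (kerK r)) ⟨L, hLi⟩
  exact ⟨_, _, _, L, _, _, _, hr, hK.mono (le_max_left _ C'), hLr.mono (le_max_right _ C'), hL,
    fun y hy => charPull_diag he hH hy, hkK,
    fun a b ha hab => hLe.unique hK.smooth.continuous hL hkK hLi (p := (a, b)) ⟨ha, hab⟩, hLi,
    s, H, hs, he, hH, rfl⟩

lemma KerPot.isInverseKernel {r : ℝ → ℝ} (hr : KerPot r) : IsInverseKernel (kerK r) (kerL r) := by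
  obtain ⟨_, _, _, L, _, _, _, h⟩ := hr.exists_kernelPair
  exact Classical.epsilon_spec (p := IsInverseKernel (kerK r)) ⟨L, h.isL⟩

/-! ### Majorants of the kernels -/

/-- The majorant `|r|/4 + C σ₀` of the kernels and their derivatives. -/
def kmaj (r : ℝ → ℝ) (C : ℝ) (u : ℝ) : ℝ := 1 / 4 * |r u| + C * sigma0 r u

section kmaj

variable {r : ℝ → ℝ} {C : ℝ}

lemma continuous_kmaj (hr : KerPot r) : Continuous (kmaj r C) :=
  (continuous_const.mul hr.continuous.abs).add
    (continuous_const.mul (continuous_sigma0 hr.integrable hr.continuous))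

lemma integrableOn_kmaj (hr : KerPot r) : IntegrableOn (kmaj r C) (Ioi 0) :=
  (hr.integrable.abs.integrableOn.const_mul _).add
    ((integrableOn_sigma0 hr.integrable hr.continuous hr.moment).const_mul _)

lemma exists_kmaj_bound (hr : KerPot r) (hC : 0 < C) :
    ∃ B, 0 < B ∧ ∀ u, 0 ≤ u → kmaj r C u ≤ B := by
  obtain ⟨B, hB⟩ := hr.bdd
  have hB0 : 0 ≤ B := (abs_nonneg _).trans (hB 0)
  have hs := sigma0_nonneg (r := r) 0
  refine ⟨B + C * sigma0 r 0 + 1, by positivity, fun u hu => ?_⟩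
  have h1 := mul_le_mul_of_nonneg_left (sigma0_antitone hr.integrable hu) hC.le
  have h2 := hB u
  rw [kmaj]
  linarith [abs_nonneg (r u)]

lemma indicator_half_sum (f : ℝ → ℝ) (y : ℝ) :
    (Ioi y).indicator (fun x => f ((x + y) / 2)) = fun x => (Ioi y).indicator f ((x + y) / 2) := by
  funext x
  have : (x + y) / 2 ∈ Ioi y ↔ x ∈ Ioi y := by
    simp only [mem_Ioi]; constructor <;> intro h <;> linarith
  by_cases hx : x ∈ Ioi y
  · rw [indicator_of_mem hx, indicator_of_mem (this.2 hx)]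
  · rw [indicator_of_notMem hx, indicator_of_notMem (mt this.1 hx)]

lemma integrableOn_half_sum {f : ℝ → ℝ} {y : ℝ} (hf : IntegrableOn f (Ioi y)) :
    IntegrableOn (fun x => f ((y + x) / 2)) (Ioi y) := by
  simp only [add_comm y]
  rw [← integrable_indicator_iff measurableSet_Ioi, indicator_half_sum]
  exact (((integrable_indicator_iff measurableSet_Ioi).2 hf).comp_div two_ne_zero).comp_add_right y

lemma integral_Ioi_half_sum (f : ℝ → ℝ) (y : ℝ) :
    ∫ x in Ioi y, f ((y + x) / 2) = 2 * ∫ x in Ioi y, f x := by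
  simp only [add_comm y]
  rw [← integral_indicator measurableSet_Ioi, indicator_half_sum,
    integral_add_right_eq_self (fun x => (Ioi y).indicator f (x / 2)) y,
    Measure.integral_comp_div, integral_indicator measurableSet_Ioi, abs_of_pos two_pos, smul_eq_mul]

lemma memLp_two_of_bounded {f : ℝ → ℝ} {s : Set ℝ} (hs : MeasurableSet s) (hf : IntegrableOn f s)
    {B : ℝ} (hB : ∀ x ∈ s, |f x| ≤ B) : MemLp f 2 (volume.restrict s) := by
  rw [memLp_two_iff_integrable_sq hf.aestronglyMeasurable]
  refine Integrable.mono' (hf.abs.const_mul B) (hf.aestronglyMeasurable.pow 2) ?_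
  filter_upwards [self_mem_ae_restrict hs] with x hx
  rw [norm_pow, Real.norm_eq_abs, pow_two]
  exact mul_le_mul_of_nonneg_right (hB x hx) (abs_nonneg _)

end kmaj

/-- Sections of kernels with majorant are integrable and square integrable. -/
lemma section_integrable {r : ℝ → ℝ} {C : ℝ} (hr : KerPot r) (hC : 0 < C) {f : ℝ → ℝ} {y : ℝ}
    (hy : 0 ≤ y) (hf : Continuous f) (hb : ∀ x, y ≤ x → |f x| ≤ kmaj r C ((y + x) / 2)) :
    IntegrableOn f (Ioi y) ∧ MemLp f 2 (volume.restrict (Ioi y)) := by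
  have h1 : IntegrableOn f (Ioi y) := by
    refine Integrable.mono' (integrableOn_half_sum ((integrableOn_kmaj hr (C := C)).mono_set
      (Ioi_subset_Ioi hy)))
      hf.aestronglyMeasurable ?_
    filter_upwards [self_mem_ae_restrict measurableSet_Ioi] with x hx using hb x (le_of_lt hx)
  obtain ⟨B, -, hB⟩ := exists_kmaj_bound hr hC
  refine ⟨h1, memLp_two_of_bounded measurableSet_Ioi h1 (B := B) fun x hx => ?_⟩
  have : y < x := hx
  exact (hb x this.le).trans (hB _ (by linarith))

namespace RegKernel

variable {r : ℝ → ℝ} {K K₁ K₂ : ℝ → ℝ → ℝ} {C : ℝ}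

lemma abs_le (h : RegKernel r K K₁ K₂ C) (a b : ℝ) (ha : 0 ≤ a) (hab : a ≤ b) :
    |K a b| ≤ kmaj r C ((a + b) / 2) :=
  (h.bound a b ha hab).trans (le_add_of_nonneg_left (by positivity))

lemma section_K (hr : KerPot r) (h : RegKernel r K K₁ K₂ C) {y : ℝ} (hy : 0 ≤ y) :
    IntegrableOn (K y) (Ioi y) ∧ MemLp (K y) 2 (volume.restrict (Ioi y)) :=
  section_integrable hr h.pos hy (h.smooth.continuous.comp (by fun_prop : Continuous fun x => (y, x)))
    fun x hx => h.abs_le y x hy hx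

lemma section_K₁ (hr : KerPot r) (h : RegKernel r K K₁ K₂ C) {y : ℝ} (hy : 0 ≤ y) :
    IntegrableOn (K₁ y) (Ioi y) ∧ MemLp (K₁ y) 2 (volume.restrict (Ioi y)) :=
  section_integrable hr h.pos hy (h.smooth₁.continuous.comp (by fun_prop : Continuous fun x => (y, x)))
    fun x hx => h.bound₁ y x hy hx

/-- `N` agrees with `K` only for `0 ≤ a ≤ b`, so its derivative at `0` can be taken only from the
right; there it is the ordinary derivative of `K`. -/
lemma d1zero_eq (h : RegKernel r K K₁ K₂ C) {N : ℝ → ℝ → ℝ}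
    (hN : ∀ a b, 0 ≤ a → a ≤ b → N a b = K a b) {x : ℝ} (hx : 0 < x) :
    HasDerivWithinAt (fun y => N y x) (K₁ 0 x) (Ici 0) 0 := by
  refine ((h.d₁ 0 x).hasDerivWithinAt).congr_of_eventuallyEq ?_ (hN 0 x le_rfl hx.le)
  filter_upwards [self_mem_nhdsWithin, mem_nhdsWithin_of_mem_nhds (Iio_mem_nhds hx)] with y h1 h2
  exact hN y x h1 (le_of_lt h2)

lemma d1zero_congr (h : RegKernel r K K₁ K₂ C) {N : ℝ → ℝ → ℝ}
    (hN : ∀ a b, 0 ≤ a → a ≤ b → N a b = K a b) {x : ℝ} (hx : 0 < x) : d1zero N x = K₁ 0 x :=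
  (h.d1zero_eq hN hx).derivWithin (uniqueDiffOn_Ici 0 0 self_mem_Ici)

lemma deriv₁_eq (h : RegKernel r K K₁ K₂ C) {N : ℝ → ℝ → ℝ}
    (hN : ∀ a b, 0 ≤ a → a ≤ b → N a b = K a b) {a b : ℝ} (ha : 0 < a) (hab : a < b) :
    deriv (fun y => N y b) a = K₁ a b := by
  rw [← (h.d₁ a b).deriv]
  refine EventuallyEq.deriv_eq ?_
  filter_upwards [Ioo_mem_nhds ha hab] with y hy using hN y b hy.1.le hy.2.le

lemma deriv₂_eq (h : RegKernel r K K₁ K₂ C) {N : ℝ → ℝ → ℝ}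
    (hN : ∀ a b, 0 ≤ a → a ≤ b → N a b = K a b) {a b : ℝ} (ha : 0 < a) (hab : a < b) :
    deriv (fun y => N a y) b = K₂ a b := by
  rw [← (h.d₂ a b).deriv]
  refine EventuallyEq.deriv_eq ?_
  filter_upwards [Ioi_mem_nhds hab] with y hy using hN a y ha.le (le_of_lt hy)

lemma memLp_congr (hr : KerPot r) (h : RegKernel r K K₁ K₂ C) {N : ℝ → ℝ → ℝ}
    (hN : ∀ a b, 0 ≤ a → a ≤ b → N a b = K a b) {y : ℝ} (hy : 0 ≤ y) :
    MemLp (N y) 2 (volume.restrict (Ioi y)) := by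
  refine (h.section_K hr hy).2.ae_eq ?_
  filter_upwards [self_mem_ae_restrict measurableSet_Ioi] with x hx
  exact (hN y x hy (le_of_lt hx)).symm

lemma d1zero_ae (h : RegKernel r K K₁ K₂ C) {N : ℝ → ℝ → ℝ}
    (hN : ∀ a b, 0 ≤ a → a ≤ b → N a b = K a b) :
    K₁ 0 =ᵐ[volume.restrict (Ioi 0)] d1zero N := by
  filter_upwards [self_mem_ae_restrict measurableSet_Ioi] with x hx
  exact (h.d1zero_congr hN hx).symm

end RegKernel

/-- The assertions about the kernels. -/
theorem kernel_statement {r : ℝ → ℝ} (hr : KerPot r) :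
    IsTransformationKernel r (kerK r) ∧
      (∀ K', IsTransformationKernel r K' → ∀ p ∈ OmBar, K' p.1 p.2 = kerK r p.1 p.2) ∧
      (Tendsto r atTop (𝓝 0) →
        Tendsto (fun p : ℝ × ℝ => deriv (fun y => kerK r y p.2) p.1) OmAtTop (𝓝 0) ∧
        Tendsto (fun p : ℝ × ℝ => deriv (fun y => kerK r p.1 y) p.2) OmAtTop (𝓝 0)) ∧
      IsInverseKernel (kerK r) (kerL r) ∧
      (∀ L', IsInverseKernel (kerK r) L' → ∀ p ∈ OmBar, L' p.1 p.2 = kerL r p.1 p.2) ∧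
      (∀ y, 0 ≤ y → MemLp (kerK r y) 2 (volume.restrict (Ioi y)) ∧
        MemLp (kerL r y) 2 (volume.restrict (Ioi y))) ∧
      (∀ x, 0 < x → DifferentiableWithinAt ℝ (fun y => kerK r y x) (Ici 0) 0 ∧
        DifferentiableWithinAt ℝ (fun y => kerL r y x) (Ici 0) 0) ∧
      IntegrableOn (d1zero (kerK r)) (Ioi 0) ∧
      MemLp (d1zero (kerK r)) 2 (volume.restrict (Ioi 0)) ∧
      MemLp (d1zero (kerL r)) 2 (volume.restrict (Ioi 0)) ∧
      ∃ M₁ > 0, KernelDerivBound r M₁ := by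
  obtain ⟨K, K₁, K₂, L, L₁, L₂, C, h⟩ := hr.exists_kernelPair
  refine ⟨hr.isTransformationKernel, fun K' hK' p hp => hK'.unique hr hr.isTransformationKernel hp,
    fun h0 => ?_, hr.isInverseKernel, fun L' hL' p hp =>
      hL'.unique h.regK.smooth.continuous h.res h.kerK_eq hr.isInverseKernel hp,
    fun y hy => ⟨h.regK.memLp_congr hr h.kerK_eq hy, h.regL.memLp_congr hr h.kerL_eq hy⟩,
    fun x hx => ⟨(h.regK.d1zero_eq h.kerK_eq hx).differentiableWithinAt,
      (h.regL.d1zero_eq h.kerL_eq hx).differentiableWithinAt⟩,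
    (h.regK.section_K₁ hr le_rfl).1.congr (h.regK.d1zero_ae h.kerK_eq),
    (h.regK.section_K₁ hr le_rfl).2.ae_eq (h.regK.d1zero_ae h.kerK_eq),
    (h.regL.section_K₁ hr le_rfl).2.ae_eq (h.regL.d1zero_ae h.kerL_eq), C, h.regK.pos,
    fun a b ha hab => ?_⟩
  · have h1 : Tendsto (kmaj r C) atTop (𝓝 0) := by
      have := (h0.abs.const_mul (1 / 4)).add ((tendsto_sigma0 hr.integrable).const_mul C)
      rw [abs_zero, mul_zero, mul_zero, add_zero] at this
      exact this
    exact ⟨tendsto_OmAtTop h1 fun p hp => by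
        rw [h.regK.deriv₁_eq h.kerK_eq hp.1 hp.2]
        exact h.regK.bound₁ _ _ hp.1.le hp.2.le,
      tendsto_OmAtTop h1 fun p hp => by
        rw [h.regK.deriv₂_eq h.kerK_eq hp.1 hp.2]
        exact h.regK.bound₂ _ _ hp.1.le hp.2.le⟩
  · rw [h.regK.deriv₁_eq h.kerK_eq ha hab]
    exact h.regK.bound₁ _ _ ha.le hab.le

/-! ### Even extension of functions on the half line -/

/-- `F` belongs to `H¹(0, ∞)` with derivative `G`. -/
structure HalfSob (F G : ℝ → ℝ) : Prop where
  prim : ∀ x, 0 ≤ x → F x = F 0 + ∫ t in (0 : ℝ)..x, G t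
  memLp : MemLp F 2 (volume.restrict (Ioi 0))
  memLp_deriv : MemLp G 2 (volume.restrict (Ioi 0))

/-- The odd extension. -/
def oddExt (G : ℝ → ℝ) (l : ℝ) : ℝ := Real.sign l * G |l|

lemma oddExt_of_pos (G : ℝ → ℝ) {l : ℝ} (hl : 0 < l) : oddExt G l = G l := by
  rw [oddExt, Real.sign_of_pos hl, one_mul, abs_of_pos hl]

lemma memLp_reflect {F : ℝ → ℝ} (hF : MemLp F 2 (volume.restrict (Ioi 0))) (c : ℝ) :
    MemLp (fun l => (Ioi 0).indicator F l + c * (Ioi 0).indicator F (-l)) 2 := by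
  have h1 : MemLp ((Ioi 0).indicator F) 2 volume := (memLp_indicator_iff_restrict measurableSet_Ioi).2 hF
  exact h1.add ((h1.comp_measurePreserving (Measure.measurePreserving_neg volume)).const_mul c)

lemma ae_ne_zero : ∀ᵐ l : ℝ, l ≠ 0 := by
  rw [ae_iff]
  simp

lemma memLp_comp_abs {F : ℝ → ℝ} (hF : MemLp F 2 (volume.restrict (Ioi 0))) :
    MemLp (fun l => F |l|) 2 := by
  refine (memLp_reflect hF 1).ae_eq ?_
  filter_upwards [ae_ne_zero] with l hl
  rcases lt_or_gt_of_ne hl with h | h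
  · rw [indicator_of_notMem (by simpa using h.le), indicator_of_mem (by simpa using h),
      abs_of_neg h]
    ring
  · rw [indicator_of_mem (by simpa using h), indicator_of_notMem (by simpa using h.le),
      abs_of_pos h]
    ring

lemma memLp_oddExt {F : ℝ → ℝ} (hF : MemLp F 2 (volume.restrict (Ioi 0))) :
    MemLp (oddExt F) 2 := by
  refine (memLp_reflect hF (-1)).ae_eq ?_
  filter_upwards [ae_ne_zero] with l hl
  rcases lt_or_gt_of_ne hl with h | h
  · rw [indicator_of_notMem (by simpa using h.le), indicator_of_mem (by simpa using h),
      oddExt, Real.sign_of_neg h, abs_of_neg h]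
    ring
  · rw [indicator_of_mem (by simpa using h), indicator_of_notMem (by simpa using h.le),
      oddExt_of_pos _ h]
    ring

lemma integral_comp_abs_sq (F : ℝ → ℝ) :
    ∫ l, F |l| ^ 2 = 2 * ∫ l in Ioi (0 : ℝ), F l ^ 2 := by
  rw [integral_even (p := fun l => F |l| ^ 2) fun x => by simp only [abs_neg]]
  congr 1
  exact setIntegral_congr_fun measurableSet_Ioi fun l hl => by simp only [abs_of_pos (mem_Ioi.1 hl)]

lemma oddExt_neg (G : ℝ → ℝ) (l : ℝ) : oddExt G (-l) = -oddExt G l := by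
  rw [oddExt, oddExt, Real.sign_neg, abs_neg, neg_mul]

lemma integral_oddExt_sq (G : ℝ → ℝ) :
    ∫ l, oddExt G l ^ 2 = 2 * ∫ l in Ioi (0 : ℝ), G l ^ 2 := by
  rw [integral_even (p := fun l => oddExt G l ^ 2) fun x => by simp only [oddExt_neg, neg_sq]]
  congr 1
  exact setIntegral_congr_fun measurableSet_Ioi fun l hl => by simp only [oddExt_of_pos _ hl]

lemma HalfSob.sob {F G : ℝ → ℝ} (h : HalfSob F G) : Sob (fun l => F |l|) (oddExt G) where
  prim := by
    refine IsPrim.of_even (fun x => by rw [abs_neg]) (oddExt_neg G)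
      ((memLp_oddExt h.memLp_deriv).locallyIntegrable one_le_two) fun x hx => ?_
    rw [abs_of_nonneg hx, abs_zero, h.prim x hx]
    congr 1
    refine intervalIntegral.integral_congr_ae (Eventually.of_forall fun t ht => ?_)
    rw [uIoc_of_le hx] at ht
    exact (oddExt_of_pos G ht.1).symm
  memLp := memLp_comp_abs h.memLp
  memLp_deriv := memLp_oddExt h.memLp_deriv

/-! ### Integral operators with majorized kernels -/

/-- Square integrability of the majorant. -/
structure Maj (r : ℝ → ℝ) (C c : ℝ) : Prop where
  pot : KerPot r
  posC : 0 < C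
  pos : 0 < c
  sq_int : IntegrableOn (fun u => kmaj r C u ^ 2) (Ioi 0)
  sq_le : ∀ a, 0 ≤ a → ∫ u in Ioi a, kmaj r C u ^ 2 ≤ c * sigma0 r a

/-- For `u > a`, `(x+y)² ≤ 2x² + 2y²` bounds the squared majorant by `B|r(u)| + 2C²σ₀(a)σ₀(u)`. Both
terms integrate over `(a,∞)` to a multiple of `σ₀(a)`, which is itself integrable in `a`; this
double integrability makes the operators Hilbert–Schmidt. -/
lemma exists_maj {r : ℝ → ℝ} (hr : KerPot r) {C : ℝ} (hC : 0 < C) : ∃ c, Maj r C c := by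
  obtain ⟨B, hB⟩ := hr.bdd
  have hB0 : 0 ≤ B := (abs_nonneg _).trans (hB 0)
  have hR : 0 ≤ Rconst r := Rconst_nonneg
  have hpt : ∀ a, 0 ≤ a → ∀ u ∈ Ioi a, kmaj r C u ^ 2 ≤
      B * |r u| + 2 * C ^ 2 * sigma0 r a * sigma0 r u := by
    intro a ha u hu
    have h1 : sigma0 r u ≤ sigma0 r a := sigma0_antitone hr.integrable (le_of_lt hu)
    have h2 := sigma0_nonneg (r := r) u
    have h3 := mul_le_mul_of_nonneg_right (hB u) (abs_nonneg (r u))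
    have h4 := mul_le_mul_of_nonneg_right h1 h2
    have h5 := mul_le_mul_of_nonneg_left h4 (sq_nonneg C)
    rw [kmaj]
    nlinarith [sq_nonneg (1 / 4 * |r u| - C * sigma0 r u), abs_nonneg (r u)]
  have hi : ∀ a, 0 ≤ a → IntegrableOn (fun u => B * |r u| + 2 * C ^ 2 * sigma0 r a * sigma0 r u)
      (Ioi a) := fun a ha => (hr.integrable.abs.integrableOn.const_mul B).add
    (((integrableOn_sigma0 hr.integrable hr.continuous hr.moment).mono_set
      (Ioi_subset_Ioi ha)).const_mul _)
  refine ⟨B + 2 * C ^ 2 * Rconst r + 1, hr, hC, by positivity, ?_, fun a ha => ?_⟩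
  · refine Integrable.mono' (hi 0 le_rfl) ((continuous_kmaj hr).pow 2).aestronglyMeasurable ?_
    filter_upwards [self_mem_ae_restrict measurableSet_Ioi] with u hu
    rw [Real.norm_of_nonneg (sq_nonneg _)]
    exact hpt 0 le_rfl u hu
  · have h1 : ∫ u in Ioi a, kmaj r C u ^ 2 ≤
        ∫ u in Ioi a, (B * |r u| + 2 * C ^ 2 * sigma0 r a * sigma0 r u) := by
      refine integral_mono_of_nonneg (Eventually.of_forall fun u => sq_nonneg _) (hi a ha) ?_
      filter_upwards [self_mem_ae_restrict measurableSet_Ioi] with u hu using hpt a ha u hu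
    have hsi := (integrableOn_sigma0 hr.integrable hr.continuous hr.moment)
    have h2 : ∫ u in Ioi a, sigma0 r u ≤ Rconst r :=
      (setIntegral_mono_set hsi (Eventually.of_forall fun u => sigma0_nonneg _)
        (Ioi_subset_Ioi ha).eventuallyLE).trans
        (integral_Ioi_sigma0_le hr.integrable hr.continuous hr.moment)
    rw [integral_add (hr.integrable.abs.integrableOn.const_mul B)
      ((hsi.mono_set (Ioi_subset_Ioi ha)).const_mul _), integral_const_mul, integral_const_mul,
      show ∫ u in Ioi a, |r u| = sigma0 r a from rfl] at h1
    have hs := sigma0_nonneg (r := r) a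
    have h3 := mul_le_mul_of_nonneg_left h2 (show 0 ≤ 2 * C ^ 2 * sigma0 r a by positivity)
    linarith

/-- A continuous kernel bounded by the majorant on `{0 ≤ a ≤ b}`. -/
structure KBound (r : ℝ → ℝ) (N : ℝ → ℝ → ℝ) (C : ℝ) : Prop where
  cont : Continuous fun p : ℝ × ℝ => N p.1 p.2
  bound : ∀ a b, 0 ≤ a → a ≤ b → |N a b| ≤ kmaj r C ((a + b) / 2)

section RegToBound

variable {r : ℝ → ℝ} {K K₁ K₂ : ℝ → ℝ → ℝ} {C : ℝ}

lemma RegKernel.kb (h : RegKernel r K K₁ K₂ C) : KBound r K C := ⟨h.smooth.continuous, h.abs_le⟩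
lemma RegKernel.kb₁ (h : RegKernel r K K₁ K₂ C) : KBound r K₁ C := ⟨h.smooth₁.continuous, h.bound₁⟩
lemma RegKernel.kb₂ (h : RegKernel r K K₁ K₂ C) : KBound r K₂ C := ⟨h.smooth₂.continuous, h.bound₂⟩

end RegToBound

/-- `∫_l^∞ N(l, ξ) g(ξ) dξ`. -/
def fwdOp (N : ℝ → ℝ → ℝ) (g : ℝ → ℝ) (l : ℝ) : ℝ := ∫ ξ in Ioi l, N l ξ * g ξ

/-- `∫_0^l N(ξ, l) g(ξ) dξ`. -/
def bwdOp (N : ℝ → ℝ → ℝ) (g : ℝ → ℝ) (l : ℝ) : ℝ := ∫ ξ in (0 : ℝ)..l, N ξ l * g ξ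

/-- The weight `√(2 c σ₀)`. -/
def sqw (r : ℝ → ℝ) (c : ℝ) (l : ℝ) : ℝ := √(2 * c * sigma0 r l)

section Ops

variable {r : ℝ → ℝ} {C c : ℝ} {N N₁ N₂ : ℝ → ℝ → ℝ} {g : ℝ → ℝ}

lemma sqw_nonneg (l : ℝ) : 0 ≤ sqw r c l := Real.sqrt_nonneg _

lemma Maj.continuous_sqw (hM : Maj r C c) : Continuous (sqw r c) :=
  (continuous_const.mul (continuous_sigma0 hM.pot.integrable hM.pot.continuous)).sqrt

lemma Maj.sqw_sq (hM : Maj r C c) (l : ℝ) : sqw r c l ^ 2 = 2 * c * sigma0 r l :=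
  Real.sq_sqrt (mul_nonneg (by have := hM.pos; positivity) (sigma0_nonneg _))

lemma Maj.memLp_sqw (hM : Maj r C c) : MemLp (sqw r c) 2 (volume.restrict (Ioi 0)) := by
  rw [memLp_two_iff_integrable_sq hM.continuous_sqw.aestronglyMeasurable]
  simp only [hM.sqw_sq]
  exact (integrableOn_sigma0 hM.pot.integrable hM.pot.continuous hM.pot.moment).const_mul _

lemma Maj.memLp_sqw_half (hM : Maj r C c) :
    MemLp (fun l => sqw r c (l / 2)) 2 (volume.restrict (Ioi 0)) := by
  have hc : Continuous fun l => sqw r c (l / 2) := hM.continuous_sqw.comp (by fun_prop)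
  rw [memLp_two_iff_integrable_sq hc.aestronglyMeasurable]
  simp only [hM.sqw_sq]
  have := integrableOn_half_sum (integrableOn_sigma0 hM.pot.integrable hM.pot.continuous
    hM.pot.moment)
  simp only [zero_add] at this
  exact this.const_mul _

lemma Maj.integral_sqw_sq_le (hM : Maj r C c) :
    ∫ l in Ioi (0 : ℝ), sqw r c l ^ 2 ≤ 4 * c * Rconst r := by
  simp only [hM.sqw_sq, integral_const_mul]
  have h1 := mul_le_mul_of_nonneg_left
    (integral_Ioi_sigma0_le hM.pot.integrable hM.pot.continuous hM.pot.moment) hM.pos.le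
  have h2 := mul_nonneg hM.pos.le (Rconst_nonneg (r := r))
  linarith

lemma Maj.integral_sqw_half_sq_le (hM : Maj r C c) :
    ∫ l in Ioi (0 : ℝ), sqw r c (l / 2) ^ 2 ≤ 4 * c * Rconst r := by
  simp only [hM.sqw_sq, integral_const_mul]
  have h3 := integral_Ioi_half_sum (sigma0 r) 0
  simp only [zero_add] at h3
  rw [h3]
  have h1 := mul_le_mul_of_nonneg_left
    (integral_Ioi_sigma0_le hM.pot.integrable hM.pot.continuous hM.pot.moment) hM.pos.le
  linarith

lemma sqrt_integral_mono {f : ℝ → ℝ} {s t : Set ℝ} (hf : MemLp f 2 (volume.restrict t))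
    (hst : s ⊆ t) : √(∫ x in s, f x ^ 2) ≤ √(∫ x in t, f x ^ 2) :=
  Real.sqrt_le_sqrt (setIntegral_mono_set (memLp_sq_integrable hf)
    (Eventually.of_forall fun _ => sq_nonneg _) hst.eventuallyLE)

lemma abs_setIntegral_mul_le (s : Set ℝ) (f g : ℝ → ℝ) :
    |∫ x in s, f x * g x| ≤ ∫ x in s, |f x| * |g x| := by
  simp only [← abs_mul]
  exact abs_integral_le_integral_abs

/-- The basic estimate for `∫_a^∞ N(a, ξ) g(ξ) dξ`. -/
lemma KBound.fwd_section (hM : Maj r C c) (hN : KBound r N C) {a : ℝ} (ha : 0 ≤ a)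
    (hg : MemLp g 2 (volume.restrict (Ioi a))) :
    IntegrableOn (fun ξ => N a ξ * g ξ) (Ioi a) ∧
      ∫ ξ in Ioi a, |N a ξ| * |g ξ| ≤ sqw r c a * √(∫ ξ in Ioi a, g ξ ^ 2) := by
  have hNc : Continuous fun x => N a x := hN.cont.comp (by fun_prop : Continuous fun x => (a, x))
  have hs := section_integrable hM.pot hM.posC ha hNc fun x hx => hN.bound a x ha hx
  refine ⟨memLp_mul_integrable hs.2 hg, (abs_integral_mul_le hs.2 hg).trans ?_⟩
  refine mul_le_mul_of_nonneg_right (Real.sqrt_le_sqrt ?_) (Real.sqrt_nonneg _)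
  have hsq := hM.sq_int.mono_set (Ioi_subset_Ioi ha)
  have h1 : ∫ x in Ioi a, N a x ^ 2 ≤ ∫ x in Ioi a, kmaj r C ((a + x) / 2) ^ 2 := by
    refine integral_mono_of_nonneg (Eventually.of_forall fun x => sq_nonneg _)
      (integrableOn_half_sum (f := fun u => kmaj r C u ^ 2) hsq) ?_
    filter_upwards [self_mem_ae_restrict measurableSet_Ioi] with x hx
    exact sq_le_sq' (neg_le_of_abs_le (hN.bound a x ha (le_of_lt hx)))
      (le_of_abs_le (hN.bound a x ha (le_of_lt hx)))
  rw [integral_Ioi_half_sum (fun u => kmaj r C u ^ 2)] at h1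
  have := hM.sq_le a ha
  linarith

/-- The basic estimate for `∫_a^l N(ξ, l) p(ξ) dξ`. -/
lemma KBound.bwd_section (hM : Maj r C c) (hN : KBound r N C) {a l : ℝ} (ha : 0 ≤ a) (hal : a ≤ l)
    (hg : MemLp g 2 (volume.restrict (Ioi a))) :
    |∫ ξ in a..l, N ξ l * g ξ| ≤ sqw r c (l / 2) * √(∫ ξ in Ioi a, g ξ ^ 2) := by
  have hNc : Continuous fun x => N x l := hN.cont.comp (by fun_prop : Continuous fun x => (x, l))
  have hN2 : MemLp (fun x => N x l) 2 (volume.restrict (Ioc a l)) := by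
    rw [memLp_two_iff_integrable_sq hNc.aestronglyMeasurable]
    exact (hNc.pow 2).integrableOn_Ioc
  have hg' : MemLp g 2 (volume.restrict (Ioc a l)) :=
    hg.mono_measure (Measure.restrict_mono Ioc_subset_Ioi_self le_rfl)
  rw [intervalIntegral.integral_of_le hal]
  refine (abs_setIntegral_mul_le _ _ _).trans ?_
  refine (abs_integral_mul_le hN2 hg').trans ?_
  refine mul_le_mul (Real.sqrt_le_sqrt ?_) (sqrt_integral_mono hg Ioc_subset_Ioi_self)
    (Real.sqrt_nonneg _) (sqw_nonneg _)
  have hkc := continuous_kmaj (C := C) hM.pot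
  have h1 : ∫ x in Ioc a l, N x l ^ 2 ≤ ∫ x in Ioc 0 l, kmaj r C ((x + l) / 2) ^ 2 := by
    refine le_trans ?_ (setIntegral_mono_set (Continuous.integrableOn_Ioc (by fun_prop))
      (Eventually.of_forall fun x => sq_nonneg _) (Ioc_subset_Ioc_left ha).eventuallyLE)
    refine integral_mono_of_nonneg (Eventually.of_forall fun x => sq_nonneg _)
      (Continuous.integrableOn_Ioc (by fun_prop)) ?_
    filter_upwards [self_mem_ae_restrict measurableSet_Ioc] with x hx
    have := hN.bound x l (ha.trans hx.1.le) hx.2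
    exact sq_le_sq' (neg_le_of_abs_le this) (le_of_abs_le this)
  -- As `ξ` runs through `(0,l)` the half sum `(ξ+l)/2` runs through `(l/2,l)`; hence the weight at
  -- `l/2`.
  rw [← intervalIntegral.integral_of_le (ha.trans hal),
    integral_half_sum' (fun u => kmaj r C u ^ 2), zero_add,
    intervalIntegral.integral_of_le (by linarith)] at h1
  have h2 : ∫ u in Ioc (l / 2) l, kmaj r C u ^ 2 ≤ ∫ u in Ioi (l / 2), kmaj r C u ^ 2 :=
    setIntegral_mono_set (hM.sq_int.mono_set (Ioi_subset_Ioi (by linarith)))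
      (Eventually.of_forall fun x => sq_nonneg _) Ioc_subset_Ioi_self.eventuallyLE
  have := hM.sq_le (l / 2) (by linarith)
  linarith

lemma KBound.abs_fwd_le (hM : Maj r C c) (hN : KBound r N C) {a : ℝ} (ha : 0 ≤ a)
    (hg : MemLp g 2 (volume.restrict (Ioi 0))) :
    |fwdOp N g a| ≤ sqw r c a * √(∫ ξ in Ioi 0, g ξ ^ 2) := by
  have hg' := hg.mono_measure (Measure.restrict_mono (Ioi_subset_Ioi ha) le_rfl)
  refine (abs_setIntegral_mul_le _ _ _).trans ?_
  exact (hN.fwd_section hM ha hg').2.trans (mul_le_mul_of_nonneg_left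
    (sqrt_integral_mono hg (Ioi_subset_Ioi ha)) (sqw_nonneg _))

lemma KBound.abs_interval_le (hM : Maj r C c) (hN : KBound r N C) {a X : ℝ} (ha : 0 ≤ a)
    (haX : a ≤ X) (hg : MemLp g 2 (volume.restrict (Ioi 0))) :
    |∫ ξ in a..X, N a ξ * g ξ| ≤ sqw r c a * √(∫ ξ in Ioi 0, g ξ ^ 2) := by
  have hg' := hg.mono_measure (Measure.restrict_mono (Ioi_subset_Ioi ha) le_rfl)
  rw [intervalIntegral.integral_of_le haX]
  refine (abs_setIntegral_mul_le _ _ _).trans ?_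
  refine le_trans ?_ ((hN.fwd_section hM ha hg').2.trans (mul_le_mul_of_nonneg_left
    (sqrt_integral_mono hg (Ioi_subset_Ioi ha)) (sqw_nonneg _)))
  refine setIntegral_mono_set ?_ (Eventually.of_forall fun ξ => by
    simp only [Pi.zero_apply]; positivity) Ioc_subset_Ioi_self.eventuallyLE
  have := (hN.fwd_section hM ha hg').1.abs
  simp only [abs_mul] at this
  exact this

lemma KBound.tendsto_interval (hM : Maj r C c) (hN : KBound r N C) {a : ℝ} (ha : 0 ≤ a)
    (hg : MemLp g 2 (volume.restrict (Ioi 0))) :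
    Tendsto (fun X => ∫ ξ in a..X, N a ξ * g ξ) atTop (𝓝 (fwdOp N g a)) :=
  intervalIntegral_tendsto_integral_Ioi a (hN.fwd_section hM ha
    (hg.mono_measure (Measure.restrict_mono (Ioi_subset_Ioi ha) le_rfl))).1 tendsto_id

lemma continuous_fwd_trunc (hN : Continuous fun p : ℝ × ℝ => N p.1 p.2) (hgc : Continuous g) (X : ℝ) :
    Continuous fun a => ∫ ξ in a..X, N a ξ * g ξ :=
  (continuous_intervalIntegral_pair (E := fun a ξ => N a ξ * g ξ)
    (hN.mul (hgc.comp continuous_snd))).comp (by fun_prop : Continuous fun a => (a, X, a))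

lemma continuous_bwd (hN : Continuous fun p : ℝ × ℝ => N p.1 p.2) (hgc : Continuous g) (a : ℝ) :
    Continuous fun l => ∫ ξ in a..l, N ξ l * g ξ :=
  (continuous_intervalIntegral_pair (E := fun l ξ => N ξ l * g ξ)
    ((hN.comp continuous_swap).mul (hgc.comp continuous_snd))).comp
    (by fun_prop : Continuous fun l => (a, l, l))

lemma KBound.aestronglyMeasurable_fwd (hM : Maj r C c) (hN : KBound r N C) (hgc : Continuous g)
    (hg : MemLp g 2 (volume.restrict (Ioi 0))) :
    AEStronglyMeasurable (fwdOp N g) (volume.restrict (Ioi 0)) := by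
  refine aestronglyMeasurable_of_tendsto_ae (atTop : Filter ℝ)
    (fun X => (continuous_fwd_trunc hN.cont hgc X).aestronglyMeasurable) ?_
  filter_upwards [self_mem_ae_restrict measurableSet_Ioi] with a ha
  exact hN.tendsto_interval hM (le_of_lt ha) hg

lemma memLp_and_integral_le {F w : ℝ → ℝ} {M D : ℝ} {μ : Measure ℝ} (hF : AEStronglyMeasurable F μ)
    (hw : MemLp w 2 μ) (hb : ∀ᵐ x ∂μ, |F x| ≤ w x * M) (hD : ∫ x, w x ^ 2 ∂μ ≤ D) :
    MemLp F 2 μ ∧ ∫ x, F x ^ 2 ∂μ ≤ D * M ^ 2 := by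
  refine ⟨(hw.mul_const M).mono' hF hb, ?_⟩
  refine (integral_mono_of_nonneg (Eventually.of_forall fun x => sq_nonneg _)
    ((memLp_sq_integrable hw).mul_const (M ^ 2)) ?_).trans ?_
  · filter_upwards [hb] with x hx
    rw [← mul_pow]
    exact sq_le_sq' (neg_le_of_abs_le hx) (le_of_abs_le hx)
  · rw [integral_mul_const]
    exact mul_le_mul_of_nonneg_right hD (sq_nonneg _)

/-- Cauchy–Schwarz in the inner variable gives a pointwise bound by `√(2cσ₀)` times the norm of `g`,
and `σ₀` is integrable. -/
lemma KBound.memLp_fwd (hM : Maj r C c) (hN : KBound r N C) (hgc : Continuous g)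
    (hg : MemLp g 2 (volume.restrict (Ioi 0))) :
    MemLp (fwdOp N g) 2 (volume.restrict (Ioi 0)) ∧
      ∫ l in Ioi 0, fwdOp N g l ^ 2 ≤ 4 * c * Rconst r * ∫ l in Ioi 0, g l ^ 2 := by
  have := memLp_and_integral_le (hN.aestronglyMeasurable_fwd hM hgc hg) hM.memLp_sqw
    (M := √(∫ ξ in Ioi 0, g ξ ^ 2)) (by
      filter_upwards [self_mem_ae_restrict measurableSet_Ioi] with a ha
      exact hN.abs_fwd_le hM (le_of_lt ha) hg) hM.integral_sqw_sq_le
  rwa [Real.sq_sqrt (integral_nonneg fun _ => sq_nonneg _)] at this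

lemma KBound.memLp_bwd (hM : Maj r C c) (hN : KBound r N C) (hgc : Continuous g)
    (hg : MemLp g 2 (volume.restrict (Ioi 0))) :
    MemLp (bwdOp N g) 2 (volume.restrict (Ioi 0)) ∧
      ∫ l in Ioi 0, bwdOp N g l ^ 2 ≤ 4 * c * Rconst r * ∫ l in Ioi 0, g l ^ 2 := by
  have := memLp_and_integral_le (F := bwdOp N g) (continuous_bwd hN.cont hgc 0).aestronglyMeasurable
    hM.memLp_sqw_half (M := √(∫ ξ in Ioi 0, g ξ ^ 2)) (by
      filter_upwards [self_mem_ae_restrict measurableSet_Ioi] with a ha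
      exact hN.bwd_section hM le_rfl (le_of_lt ha) hg) hM.integral_sqw_half_sq_le
  rwa [Real.sq_sqrt (integral_nonneg fun _ => sq_nonneg _)] at this

/-- Identities are proved on the triangle `a ≤ ξ ≤ η ≤ X`, where all integrands live on compact
sets, and then carried to the half line; the majorant `|p|·√(2cσ₀)·‖w‖` does not depend on `X`. -/
lemma KBound.tendsto_integral_trunc (hM : Maj r C c) (hN : KBound r N C) {p w : ℝ → ℝ} {a : ℝ}
    (ha : 0 ≤ a) (hp : MemLp p 2 (volume.restrict (Ioi a))) (hwc : Continuous w)
    (hw : MemLp w 2 (volume.restrict (Ioi 0))) :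
    Tendsto (fun X => ∫ ξ in a..X, p ξ * ∫ η in ξ..X, N ξ η * w η) atTop
      (𝓝 (∫ ξ in Ioi a, p ξ * fwdOp N w ξ)) := by
  have hsub : volume.restrict (Ioi a) ≤ volume.restrict (Ioi 0) :=
    Measure.restrict_mono (Ioi_subset_Ioi ha) le_rfl
  set M := √(∫ ξ in Ioi 0, w ξ ^ 2) with hMdef
  have h1 : Tendsto (fun X => ∫ ξ in Ioi a, (Iic X).indicator
      (fun ξ => p ξ * ∫ η in ξ..X, N ξ η * w η) ξ) atTop (𝓝 (∫ ξ in Ioi a, p ξ * fwdOp N w ξ)) := by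
    refine tendsto_integral_filter_of_dominated_convergence (fun ξ => |p ξ| * (sqw r c ξ * M))
      (Eventually.of_forall fun X => ?_) (Eventually.of_forall fun X => ?_) ?_ ?_
    · exact (hp.aestronglyMeasurable.mul
        (continuous_fwd_trunc hN.cont hwc X).aestronglyMeasurable).indicator measurableSet_Iic
    · filter_upwards [self_mem_ae_restrict measurableSet_Ioi] with ξ hξ
      have hξ' : a < ξ := hξ
      by_cases hX : ξ ∈ Iic X
      · rw [indicator_of_mem hX, norm_mul]
        exact mul_le_mul_of_nonneg_left (hN.abs_interval_le hM (by linarith) hX hw) (norm_nonneg _)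
      · rw [indicator_of_notMem hX, norm_zero]
        exact mul_nonneg (abs_nonneg _) (mul_nonneg (sqw_nonneg _) (Real.sqrt_nonneg _))
    · exact memLp_mul_integrable hp.abs ((hM.memLp_sqw.mono_measure hsub).mul_const M)
    · filter_upwards [self_mem_ae_restrict measurableSet_Ioi] with ξ hξ
      have hξ' : a < ξ := hξ
      refine ((hN.tendsto_interval hM (by linarith) hw).const_mul (p ξ)).congr' ?_
      filter_upwards [eventually_ge_atTop ξ] with X hX
      rw [indicator_of_mem (mem_Iic.2 hX)]
  refine h1.congr' ?_
  filter_upwards [eventually_ge_atTop a] with X hX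
  rw [setIntegral_indicator measurableSet_Iic, Ioi_inter_Iic,
    intervalIntegral.integral_of_le hX]

/-- Exchange of the order of integration for kernels on the half line. -/
lemma KBound.integral_swap (hM : Maj r C c) (hN : KBound r N C) {p w : ℝ → ℝ} {a : ℝ} (ha : 0 ≤ a)
    (hpc : Continuous p) (hp : MemLp p 2 (volume.restrict (Ioi a))) (hwc : Continuous w)
    (hw : MemLp w 2 (volume.restrict (Ioi 0))) :
    ∫ ξ in Ioi a, p ξ * fwdOp N w ξ = ∫ η in Ioi a, (∫ ξ in a..η, p ξ * N ξ η) * w η := by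
  have hsub : volume.restrict (Ioi a) ≤ volume.restrict (Ioi 0) :=
    Measure.restrict_mono (Ioi_subset_Ioi ha) le_rfl
  have hfin : ∀ X, ∫ ξ in a..X, p ξ * ∫ η in ξ..X, N ξ η * w η =
      ∫ η in a..X, (∫ ξ in a..η, p ξ * N ξ η) * w η := by
    intro X
    have := integral_triangle_swap (f := fun ξ η => p ξ * (N ξ η * w η))
      ((hpc.comp continuous_fst).mul (hN.cont.mul (hwc.comp continuous_snd))) a X
    simp only [intervalIntegral.integral_const_mul] at this
    rw [← this]
    congr 1
    funext η
    rw [← intervalIntegral.integral_mul_const]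
    simp only [mul_assoc]
  have hR : Tendsto (fun X => ∫ η in a..X, (∫ ξ in a..η, p ξ * N ξ η) * w η) atTop
      (𝓝 (∫ η in Ioi a, (∫ ξ in a..η, p ξ * N ξ η) * w η)) := by
    refine intervalIntegral_tendsto_integral_Ioi a ?_ tendsto_id
    refine memLp_mul_integrable ?_ (hw.mono_measure hsub)
    have hcc := continuous_bwd hN.cont hpc a
    simp only [mul_comm (N _ _)] at hcc
    refine MemLp.mono' ((hM.memLp_sqw_half.mono_measure hsub).mul_const
      √(∫ ξ in Ioi a, p ξ ^ 2)) hcc.aestronglyMeasurable ?_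
    filter_upwards [self_mem_ae_restrict measurableSet_Ioi] with l hl
    have := hN.bwd_section hM ha (le_of_lt hl) hp
    rw [Real.norm_eq_abs]
    simpa only [mul_comm (N _ _)] using this
  have hL := hN.tendsto_integral_trunc hM ha hp hwc hw
  simp only [hfin] at hL
  exact tendsto_nhds_unique hL hR

end Ops

/-! ### The integral operators on Sobolev functions -/

/-- The derivative of `fwdOp N g`. -/
def fwdD (N N₁ : ℝ → ℝ → ℝ) (g : ℝ → ℝ) (l : ℝ) : ℝ := -(N l l * g l) + fwdOp N₁ g l

/-- The derivative of `bwdOp N g`. -/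
def bwdD (N N₂ : ℝ → ℝ → ℝ) (g : ℝ → ℝ) (l : ℝ) : ℝ := N l l * g l + bwdOp N₂ g l

lemma integral_add_sq_le {μ : Measure ℝ} {f g : ℝ → ℝ} (hf : MemLp f 2 μ) (hg : MemLp g 2 μ) :
    ∫ x, (f x + g x) ^ 2 ∂μ ≤ 2 * (∫ x, f x ^ 2 ∂μ) + 2 * ∫ x, g x ^ 2 ∂μ := by
  rw [← integral_const_mul, ← integral_const_mul,
    ← integral_add ((memLp_sq_integrable hf).const_mul 2) ((memLp_sq_integrable hg).const_mul 2)]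
  refine integral_mono_of_nonneg (Eventually.of_forall fun x => sq_nonneg _)
    (((memLp_sq_integrable hf).const_mul 2).add ((memLp_sq_integrable hg).const_mul 2))
    (Eventually.of_forall fun x => ?_)
  simp only
  nlinarith [sq_nonneg (f x - g x)]

section OpsSob

variable {r : ℝ → ℝ} {C c : ℝ} {N N₁ N₂ : ℝ → ℝ → ℝ} {g : ℝ → ℝ}

lemma RegKernel.continuous_diag (hN : RegKernel r N N₁ N₂ C) : Continuous fun l => N l l :=
  hN.smooth.continuous.comp (by fun_prop : Continuous fun l => (l, l))

lemma RegKernel.diag_le (hM : Maj r C c) (hN : RegKernel r N N₁ N₂ C) {l : ℝ} (hl : 0 ≤ l) :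
    |N l l| ≤ C * sigma0 r 0 :=
  (hN.bound l l hl le_rfl).trans (mul_le_mul_of_nonneg_left
    (sigma0_antitone hM.pot.integrable (by linarith)) hM.posC.le)

lemma RegKernel.memLp_diag (hM : Maj r C c) (hN : RegKernel r N N₁ N₂ C) (hgc : Continuous g)
    (hg : MemLp g 2 (volume.restrict (Ioi 0))) :
    MemLp (fun l => N l l * g l) 2 (volume.restrict (Ioi 0)) ∧
      ∫ l in Ioi 0, (N l l * g l) ^ 2 ≤ (∫ l in Ioi 0, g l ^ 2) * (C * sigma0 r 0) ^ 2 := by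
  have := memLp_and_integral_le (F := fun l => N l l * g l) (w := fun l => |g l|)
    (μ := volume.restrict (Ioi 0)) (M := C * sigma0 r 0) (D := ∫ l in Ioi 0, g l ^ 2)
    (hN.continuous_diag.mul hgc).aestronglyMeasurable hg.abs (by
      filter_upwards [self_mem_ae_restrict measurableSet_Ioi] with l hl
      rw [abs_mul, mul_comm]
      exact mul_le_mul_of_nonneg_left (hN.diag_le hM (le_of_lt hl)) (abs_nonneg _))
    (by simp only [sq_abs]; exact le_rfl)
  exact this

/-- The integral truncated at `X` is differentiable by the Leibniz rule. The limit `X → ∞` is taken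
in the integrated form, so no uniform convergence of derivatives is needed. -/
lemma RegKernel.fwd_prim (hM : Maj r C c) (hN : RegKernel r N N₁ N₂ C) (hgc : Continuous g)
    (hg : MemLp g 2 (volume.restrict (Ioi 0))) {l : ℝ} (hl : 0 ≤ l) :
    fwdOp N g l = fwdOp N g 0 + ∫ s in (0 : ℝ)..l, fwdD N N₁ g s := by
  set M := √(∫ ξ in Ioi 0, g ξ ^ 2) with hMdef
  have hd : ∀ X a, HasDerivAt (fun a => ∫ ξ in a..X, N a ξ * g ξ)
      (-(N a a * g a) + ∫ ξ in a..X, N₁ a ξ * g ξ) a := by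
    intro X a
    have := (hasDerivAt_integral_limits (E := fun a ξ => N a ξ * g ξ)
      (E' := fun a ξ => N₁ a ξ * g ξ) (hN.smooth.continuous.mul (hgc.comp continuous_snd))
      (hN.smooth₁.continuous.mul (hgc.comp continuous_snd))
      (fun u t => (hN.d₁ u t).mul_const (g t)) X a).fun_neg
    simp only [intervalIntegral.integral_symm _ X, neg_neg] at this ⊢
    exact this.congr_deriv (by ring)
  have hcX : ∀ X, Continuous fun a => -(N a a * g a) + ∫ ξ in a..X, N₁ a ξ * g ξ := fun X =>
    (hN.continuous_diag.mul hgc).neg.add (continuous_fwd_trunc hN.smooth₁.continuous hgc X)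
  have hfin : ∀ X, (∫ s in (0 : ℝ)..l, (-(N s s * g s) + ∫ ξ in s..X, N₁ s ξ * g ξ)) =
      (∫ ξ in l..X, N l ξ * g ξ) - ∫ ξ in (0 : ℝ)..X, N 0 ξ * g ξ := fun X =>
    intervalIntegral.integral_eq_sub_of_hasDerivAt (fun a _ => hd X a)
      ((hcX X).intervalIntegrable _ _)
  have hR := (hN.kb.tendsto_interval hM hl hg).sub (hN.kb.tendsto_interval hM le_rfl hg)
  have hL : Tendsto (fun X => ∫ s in (0 : ℝ)..l, (-(N s s * g s) + ∫ ξ in s..X, N₁ s ξ * g ξ))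
      atTop (𝓝 (∫ s in (0 : ℝ)..l, fwdD N N₁ g s)) := by
    refine intervalIntegral.tendsto_integral_filter_of_dominated_convergence
      (fun s => |N s s * g s| + sqw r c s * M)
      (Eventually.of_forall fun X => (hcX X).aestronglyMeasurable) ?_
      (Continuous.intervalIntegrable ((hN.continuous_diag.mul hgc).abs.add
        (hM.continuous_sqw.mul continuous_const)) _ _) ?_
    · filter_upwards [eventually_ge_atTop l] with X hX
      refine Eventually.of_forall fun s hs => ?_
      rw [uIoc_of_le hl] at hs
      refine (norm_add_le _ _).trans ?_
      rw [norm_neg]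
      exact add_le_add_right (hN.kb₁.abs_interval_le hM hs.1.le (hs.2.trans hX) hg) _
    · refine Eventually.of_forall fun s hs => ?_
      rw [uIoc_of_le hl] at hs
      exact (hN.kb₁.tendsto_interval hM hs.1.le hg).const_add _
  simp only [hfin] at hL
  have := tendsto_nhds_unique hL hR
  linarith

/-- The bound for the operators on the half line. -/
def opBound (r : ℝ → ℝ) (C c : ℝ) : ℝ := 2 * (C * sigma0 r 0) ^ 2 + 8 * c * Rconst r

lemma RegKernel.fwd_halfSob (hM : Maj r C c) (hN : RegKernel r N N₁ N₂ C) (hgc : Continuous g)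
    (hg : MemLp g 2 (volume.restrict (Ioi 0))) :
    HalfSob (fwdOp N g) (fwdD N N₁ g) ∧
      ∫ l in Ioi 0, fwdOp N g l ^ 2 ≤ opBound r C c * ∫ l in Ioi 0, g l ^ 2 ∧
      ∫ l in Ioi 0, fwdD N N₁ g l ^ 2 ≤ opBound r C c * ∫ l in Ioi 0, g l ^ 2 := by
  have h1 := hN.kb.memLp_fwd hM hgc hg
  have h2 := hN.kb₁.memLp_fwd hM hgc hg
  have h3 := hN.memLp_diag hM hgc hg
  have hG : 0 ≤ ∫ l in Ioi 0, g l ^ 2 := integral_nonneg fun _ => sq_nonneg _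
  have hc := hM.pos
  have hR : 0 ≤ Rconst r := Rconst_nonneg
  refine ⟨⟨fun x hx => hN.fwd_prim hM hgc hg hx, h1.1, h3.1.neg.add h2.1⟩, h1.2.trans ?_, ?_⟩
  · refine mul_le_mul_of_nonneg_right ?_ hG
    rw [opBound]
    nlinarith [sq_nonneg (C * sigma0 r 0), mul_nonneg hc.le hR]
  · have h4 := integral_add_sq_le h3.1.neg h2.1
    simp only [Pi.neg_apply, neg_sq] at h4
    rw [opBound]
    simp only [fwdD]
    linarith [h3.2, h2.2]

lemma RegKernel.bwd_hasDerivAt (hN : RegKernel r N N₁ N₂ C) (hgc : Continuous g) (l : ℝ) :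
    HasDerivAt (bwdOp N g) (bwdD N N₂ g l) l :=
  hasDerivAt_integral_limits (E := fun l ξ => N ξ l * g ξ) (E' := fun l ξ => N₂ ξ l * g ξ)
    ((hN.smooth.continuous.comp continuous_swap).mul (hgc.comp continuous_snd))
    ((hN.smooth₂.continuous.comp continuous_swap).mul (hgc.comp continuous_snd))
    (fun u t => (hN.d₂ t u).mul_const (g t)) 0 l

lemma RegKernel.continuous_bwdD (hN : RegKernel r N N₁ N₂ C) (hgc : Continuous g) :
    Continuous (bwdD N N₂ g) :=
  (hN.continuous_diag.mul hgc).add (continuous_bwd hN.smooth₂.continuous hgc 0)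

lemma RegKernel.bwd_halfSob (hM : Maj r C c) (hN : RegKernel r N N₁ N₂ C) (hgc : Continuous g)
    (hg : MemLp g 2 (volume.restrict (Ioi 0))) :
    HalfSob (bwdOp N g) (bwdD N N₂ g) ∧
      ∫ l in Ioi 0, bwdOp N g l ^ 2 ≤ opBound r C c * ∫ l in Ioi 0, g l ^ 2 ∧
      ∫ l in Ioi 0, bwdD N N₂ g l ^ 2 ≤ opBound r C c * ∫ l in Ioi 0, g l ^ 2 := by
  have h1 := hN.kb.memLp_bwd hM hgc hg
  have h2 := hN.kb₂.memLp_bwd hM hgc hg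
  have h3 := hN.memLp_diag hM hgc hg
  have hG : 0 ≤ ∫ l in Ioi 0, g l ^ 2 := integral_nonneg fun _ => sq_nonneg _
  have hc := hM.pos
  have hR : 0 ≤ Rconst r := Rconst_nonneg
  refine ⟨⟨fun x hx => (IsPrim.of_hasDerivAt (hN.bwd_hasDerivAt hgc) (hN.continuous_bwdD hgc)).eq x,
    h1.1, h3.1.add h2.1⟩, h1.2.trans ?_, ?_⟩
  · refine mul_le_mul_of_nonneg_right ?_ hG
    rw [opBound]
    nlinarith [sq_nonneg (C * sigma0 r 0), mul_nonneg hc.le hR]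
  · have h4 := integral_add_sq_le h3.1 h2.1
    rw [opBound]
    simp only [bwdD]
    linarith [h3.2, h2.2]

/-- Bound for the sum of a Sobolev function and the even extension of a half-line function. -/
lemma Sob.add_ext {w w' F G : ℝ → ℝ} {D : ℝ} (hw : Sob w w') (hF : HalfSob F G) (hD : 0 ≤ D)
    (h1 : ∫ l in Ioi 0, F l ^ 2 ≤ D * ∫ l in Ioi 0, w l ^ 2)
    (h2 : ∫ l in Ioi 0, G l ^ 2 ≤ D * ∫ l in Ioi 0, w l ^ 2) :
    Sob (fun l => w l + F |l|) (fun l => w' l + oddExt G l) ∧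
      (∫ l, (w l + F |l|) ^ 2) + ∫ l, (w' l + oddExt G l) ^ 2 ≤
        (2 + 8 * D) * ((∫ l, w l ^ 2) + ∫ l, w' l ^ 2) := by
  have hs := hF.sob
  refine ⟨hw.add hs, ?_⟩
  have h3 := integral_add_sq_le hw.memLp hs.memLp
  have h4 := integral_add_sq_le hw.memLp_deriv hs.memLp_deriv
  rw [integral_comp_abs_sq] at h3
  rw [integral_oddExt_sq] at h4
  have h5 : ∫ l in Ioi 0, w l ^ 2 ≤ ∫ l, w l ^ 2 := setIntegral_le_integral
    (memLp_sq_integrable hw.memLp) (Eventually.of_forall fun _ => sq_nonneg _)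
  have h6 := mul_le_mul_of_nonneg_left h5 hD
  have h7 : 0 ≤ D * ∫ l, w' l ^ 2 := mul_nonneg hD (integral_nonneg fun _ => sq_nonneg _)
  linarith

end OpsSob

/-! ### Inversion and duality -/

namespace KernelPair

variable {r : ℝ → ℝ} {C c : ℝ} {K K₁ K₂ L L₁ L₂ : ℝ → ℝ → ℝ}

/-- Exchanging integrals, `K(Lw)` has kernel `K∘L = -K - L`, so `(1+K)(1+L)w = w`. -/
lemma fwd_inverse (h : KernelPair r K K₁ K₂ L L₁ L₂ C) (hM : Maj r C c) {w Z : ℝ → ℝ}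
    (hwc : Continuous w) (hw : MemLp w 2 (volume.restrict (Ioi 0)))
    (hZ : ∀ l, 0 ≤ l → Z l = w l + fwdOp L w l) {l : ℝ} (hl : 0 ≤ l) :
    Z l + fwdOp K Z l = w l := by
  have hsub : volume.restrict (Ioi l) ≤ volume.restrict (Ioi 0) :=
    Measure.restrict_mono (Ioi_subset_Ioi hl) le_rfl
  have hLw := (h.regL.kb.memLp_fwd hM hwc hw).1
  have hKs := (h.regK.section_K hM.pot hl).2
  have e1 : fwdOp K Z l = fwdOp K w l + ∫ ξ in Ioi l, K l ξ * fwdOp L w ξ := by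
    rw [fwdOp, fwdOp, ← integral_add (memLp_mul_integrable hKs (hw.mono_measure hsub))
      (memLp_mul_integrable hKs (hLw.mono_measure hsub))]
    refine setIntegral_congr_fun measurableSet_Ioi fun ξ hξ => ?_
    rw [hZ ξ (hl.trans (le_of_lt hξ))]
    ring
  have hKc : Continuous (K l) := h.regK.smooth.continuous.comp (by fun_prop : Continuous fun x => (l, x))
  have e2 := h.regL.kb.integral_swap hM hl hKc hKs hwc hw
  have e3 : ∫ η in Ioi l, (∫ ξ in l..η, K l ξ * L ξ η) * w η = -fwdOp K w l - fwdOp L w l := by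
    rw [fwdOp, fwdOp, ← neg_add', ← integral_add
      (memLp_mul_integrable hKs (hw.mono_measure hsub))
      (memLp_mul_integrable (h.regL.section_K hM.pot hl).2 (hw.mono_measure hsub)), ← integral_neg]
    refine setIntegral_congr_fun measurableSet_Ioi fun η _ => ?_
    have := h.res.right l η
    rw [vcomp] at this
    rw [show ∫ ξ in l..η, K l ξ * L ξ η = -K l η - L l η by linarith]
    ring
  rw [hZ l hl, e1, e2, e3]
  ring

/-- The transposed computation uses the other equation `L∘K = -K - L`. The triangles are bounded, so
continuity of `f` suffices. -/
lemma bwd_inverse (h : KernelPair r K K₁ K₂ L L₁ L₂ C) {f Φ : ℝ → ℝ}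
    (hfc : Continuous f) (hΦ : ∀ l, 0 ≤ l → Φ l = f l + bwdOp L f l) {l : ℝ} (hl : 0 ≤ l) :
    Φ l + bwdOp K Φ l = f l := by
  have hKc : Continuous fun ξ => K ξ l :=
    h.regK.smooth.continuous.comp (by fun_prop : Continuous fun x => (x, l))
  have hLc : Continuous fun η => L η l :=
    h.regL.smooth.continuous.comp (by fun_prop : Continuous fun x => (x, l))
  have hbc : Continuous (bwdOp L f) := continuous_bwd h.regL.smooth.continuous hfc 0
  have i1 : IntervalIntegrable (fun ξ => K ξ l * f ξ) volume 0 l := (hKc.mul hfc).intervalIntegrable _ _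
  have i2 : IntervalIntegrable (fun ξ => L ξ l * f ξ) volume 0 l := (hLc.mul hfc).intervalIntegrable _ _
  have i3 : IntervalIntegrable (fun ξ => K ξ l * bwdOp L f ξ) volume 0 l :=
    (hKc.mul hbc).intervalIntegrable _ _
  have e1 : bwdOp K Φ l = bwdOp K f l + ∫ ξ in (0 : ℝ)..l, K ξ l * bwdOp L f ξ := by
    rw [bwdOp, bwdOp, ← intervalIntegral.integral_add i1 i3]
    refine intervalIntegral_congr_Icc hl fun ξ h0 _ => ?_
    rw [hΦ ξ h0]
    ring
  have e2 := integral_triangle_swap (f := fun η ξ => L η ξ * f η * K ξ l)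
    ((h.regL.smooth.continuous.mul (hfc.comp continuous_fst)).mul (hKc.comp continuous_snd)) 0 l
  have e3 : ∫ ξ in (0 : ℝ)..l, K ξ l * bwdOp L f ξ =
      ∫ ξ in (0 : ℝ)..l, ∫ η in (0 : ℝ)..ξ, L η ξ * f η * K ξ l := by
    congr 1
    funext ξ
    rw [intervalIntegral.integral_mul_const, bwdOp, mul_comm]
  have e4 : ∫ η in (0 : ℝ)..l, ∫ ξ in η..l, L η ξ * f η * K ξ l = -bwdOp K f l - bwdOp L f l := by
    rw [bwdOp, bwdOp, ← neg_add', ← intervalIntegral.integral_add i1 i2,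
      ← intervalIntegral.integral_neg]
    congr 1
    funext η
    have e5 : ∫ ξ in η..l, L η ξ * f η * K ξ l = f η * vcomp L K η l := by
      rw [vcomp, ← intervalIntegral.integral_const_mul]
      congr 1
      funext ξ
      ring
    have := h.res.left η l
    rw [e5, show vcomp L K η l = -K η l - L η l by linarith]
    ring
  rw [hΦ l hl, e1, e3, e2, e4]
  ring

/-- `∫ (w + L w) f = ∫ w (f + L* f)`. -/
lemma duality (h : KernelPair r K K₁ K₂ L L₁ L₂ C) (hM : Maj r C c) {w f : ℝ → ℝ}
    (hwc : Continuous w) (hw : MemLp w 2 (volume.restrict (Ioi 0)))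
    (hfc : Continuous f) (hf : MemLp f 2 (volume.restrict (Ioi 0))) :
    ∫ l in Ioi 0, (w l + fwdOp L w l) * f l = ∫ l in Ioi 0, w l * (f l + bwdOp L f l) := by
  have e := h.regL.kb.integral_swap hM le_rfl hfc hf hwc hw
  have i1 := memLp_mul_integrable hw hf
  have i2 := memLp_mul_integrable hf (h.regL.kb.memLp_fwd hM hwc hw).1
  have i3 := memLp_mul_integrable (h.regL.kb.memLp_bwd hM hfc hf).1 hw
  have e1 : ∫ l in Ioi 0, (w l + fwdOp L w l) * f l =
      (∫ l in Ioi 0, w l * f l) + ∫ l in Ioi 0, f l * fwdOp L w l := by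
    rw [← integral_add i1 i2]
    congr 1
    funext l
    ring
  have e2 : ∫ l in Ioi 0, w l * (f l + bwdOp L f l) =
      (∫ l in Ioi 0, w l * f l) + ∫ l in Ioi 0, bwdOp L f l * w l := by
    rw [← integral_add i1 i3]
    congr 1
    funext l
    ring
  rw [e1, e2, e]
  congr 2
  funext l
  rw [bwdOp]
  simp only [mul_comm (f _)]

end KernelPair

/-! ### The intertwining identity -/

namespace KernelPair

variable {r : ℝ → ℝ} {C c : ℝ} {K K₁ K₂ L L₁ L₂ : ℝ → ℝ → ℝ}

/-- The representative built from the Goursat problem satisfies the wave equation on the whole plane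
with the extended potential `s`, including the diagonal and the axis, where the integrations by
parts take their boundary values. -/
lemma exists_second (h : KernelPair r K K₁ K₂ L L₁ L₂ C) :
    ∃ (s : ℝ → ℝ) (A B : ℝ → ℝ → ℝ), EqOn s r (Ici 0) ∧
      (Continuous fun p : ℝ × ℝ => A p.1 p.2) ∧ (Continuous fun p : ℝ × ℝ => B p.1 p.2) ∧
      (∀ x y, HasDerivAt (fun x => K₁ x y) (A x y) x) ∧
      (∀ x y, HasDerivAt (fun y => K₂ x y) (B x y) y) ∧ ∀ x y, A x y - B x y = s x * K x y := by
  obtain ⟨s, H, hs, he, hH, rfl⟩ := h.char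
  obtain ⟨A, -, hA, -, hAc, -⟩ := exists_partials h.regK.smooth₁
  obtain ⟨-, B, -, hB, -, hBc⟩ := exists_partials h.regK.smooth₂
  refine ⟨s, A, B, he, hAc, hBc, hA, hB, fun x y => ?_⟩
  rw [← wave_charPull hs hH x y,
    iteratedDeriv_two_eq (Eventually.of_forall fun x => h.regK.d₁ x y) (hA x y),
    iteratedDeriv_two_eq (Eventually.of_forall fun y => h.regK.d₂ x y) (hB x y)]

lemma hasDerivAt_diag (h : KernelPair r K K₁ K₂ L L₁ L₂ C) (x : ℝ) :
    HasDerivAt (fun x => K x x) (K₁ x x + K₂ x x) x := by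
  have := HasDerivAt.comp_pair (f := K) (h.regK.smooth.differentiable (by norm_num) (x, x))
    (h.regK.d₁ x x) (h.regK.d₂ x x) (hasDerivAt_id' x) (hasDerivAt_id' x) rfl rfl
  simpa using this

lemma diag_deriv (h : KernelPair r K K₁ K₂ L L₁ L₂ C) {x : ℝ} (hx : 0 < x) :
    K₁ x x + K₂ x x = -(1 / 2 * r x) := by
  have h1 := (hasDerivAt_tail h.pot.integrable h.pot.continuous x).const_mul (1 / 2)
  have h2 : (fun x => K x x) =ᶠ[𝓝 x] fun x => 1 / 2 * ∫ l in Ioi x, r l := by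
    filter_upwards [Ioi_mem_nhds hx] with y hy using h.diag y (le_of_lt hy)
  rw [(h.hasDerivAt_diag x).unique (h1.congr_of_eventuallyEq h2)]
  ring

/-- Integrate the first term by parts in `x` and the second in `y`. This brings in the double
integrals of `K_{y₁y₁}` and `K_{y₂y₂}`, whose difference is `rK` and cancels the third term. The
diagonal contributes `K₁ + K₂ = -½r`; the rest is boundary terms at `0` and `X`. -/
lemma truncated_identity (h : KernelPair r K K₁ K₂ L L₁ L₂ C) {Z Z' Φ Φ' : ℝ → ℝ}
    (hZ : IsPrim Z Z') (hΦ : IsPrim Φ Φ') {X : ℝ} (hX : 0 ≤ X) :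
    (∫ x in (0 : ℝ)..X, Φ' x * ∫ y in x..X, K₁ x y * Z y)
      - (∫ y in (0 : ℝ)..X, Z' y * bwdOp K₂ Φ y)
      + (∫ x in (0 : ℝ)..X, r x * Φ x * ∫ y in x..X, K x y * Z y) =
    -(Φ 0 * ∫ y in (0 : ℝ)..X, K₁ 0 y * Z y) - Z X * bwdOp K₂ Φ X
      - 1 / 2 * ∫ x in (0 : ℝ)..X, r x * (Z x * Φ x) := by
  obtain ⟨s, A, B, hs, hAc, hBc, hA, hB, hAB⟩ := h.exists_second
  have hZc := hZ.continuous
  have hΦc := hΦ.continuous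
  have hK := h.regK
  have hsnd : Continuous fun p : ℝ × ℝ => Z p.2 := hZc.comp continuous_snd
  have hd1 : Continuous fun x => K₁ x x :=
    hK.smooth₁.continuous.comp (by fun_prop : Continuous fun x => (x, x))
  have hd2 : Continuous fun x => K₂ x x :=
    hK.smooth₂.continuous.comp (by fun_prop : Continuous fun x => (x, x))
  -- the first term
  set g : ℝ → ℝ := fun x => ∫ y in x..X, K₁ x y * Z y with hg
  set a : ℝ → ℝ := fun x => ∫ y in x..X, A x y * Z y with ha
  have hac : Continuous a := continuous_fwd_trunc hAc hZc X
  have hgd : ∀ x, HasDerivAt g (-(K₁ x x * Z x) + a x) x := fun x => by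
    have := (hasDerivAt_integral_limits (E := fun x y => K₁ x y * Z y)
      (E' := fun x y => A x y * Z y) (hK.smooth₁.continuous.mul hsnd) (hAc.mul hsnd)
      (fun u t => (hA u t).mul_const (Z t)) X x).fun_neg
    simp only [intervalIntegral.integral_symm _ X, neg_neg] at this
    refine this.congr_deriv ?_
    simp only [ha]
    ring
  have p1 := hΦ.mul (IsPrim.of_hasDerivAt hgd ((hd1.mul hZc).neg.add hac))
  have hgc : Continuous g := continuous_fwd_trunc hK.smooth₁.continuous hZc X
  have e1 := p1.integral_eq 0 X
  have iΦ : IntervalIntegrable (fun x => Φ' x * g x) volume 0 X :=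
    (hΦ.intervalIntegrable 0 X).mul_continuousOn hgc.continuousOn
  have iK1 : IntervalIntegrable (fun x => K₁ x x * (Z x * Φ x)) volume 0 X :=
    (hd1.mul (hZc.mul hΦc)).intervalIntegrable _ _
  have ia : IntervalIntegrable (fun x => Φ x * a x) volume 0 X :=
    (hΦc.mul hac).intervalIntegrable _ _
  have e1' : ∫ x in (0 : ℝ)..X, (Φ' x * g x + Φ x * (-(K₁ x x * Z x) + a x)) =
      (∫ x in (0 : ℝ)..X, Φ' x * g x) - (∫ x in (0 : ℝ)..X, K₁ x x * (Z x * Φ x)) +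
        ∫ x in (0 : ℝ)..X, Φ x * a x := by
    rw [← intervalIntegral.integral_sub iΦ iK1, ← intervalIntegral.integral_add (iΦ.sub iK1) ia]
    congr 1
    funext x
    ring
  have g0 : g X = 0 := intervalIntegral.integral_same
  rw [e1', g0] at e1
  -- the second term
  set b : ℝ → ℝ := fun y => ∫ x in (0 : ℝ)..y, B x y * Φ x with hb
  have hbc : Continuous b := continuous_bwd hBc hΦc 0
  have hh : ∀ y, HasDerivAt (bwdOp K₂ Φ) (K₂ y y * Φ y + b y) y := fun y =>
    hasDerivAt_integral_limits (E := fun l ξ => K₂ ξ l * Φ ξ) (E' := fun l ξ => B ξ l * Φ ξ)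
      ((hK.smooth₂.continuous.comp continuous_swap).mul (hΦc.comp continuous_snd))
      ((hBc.comp continuous_swap).mul (hΦc.comp continuous_snd))
      (fun u t => (hB t u).mul_const (Φ t)) 0 y
  have p2 := hZ.mul (IsPrim.of_hasDerivAt hh ((hd2.mul hΦc).add hbc))
  have hhc : Continuous (bwdOp K₂ Φ) := continuous_bwd hK.smooth₂.continuous hΦc 0
  have e2 := p2.integral_eq 0 X
  have iZ : IntervalIntegrable (fun x => Z' x * bwdOp K₂ Φ x) volume 0 X :=
    (hZ.intervalIntegrable 0 X).mul_continuousOn hhc.continuousOn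
  have iK2 : IntervalIntegrable (fun x => K₂ x x * (Z x * Φ x)) volume 0 X :=
    (hd2.mul (hZc.mul hΦc)).intervalIntegrable _ _
  have ib : IntervalIntegrable (fun x => Z x * b x) volume 0 X :=
    (hZc.mul hbc).intervalIntegrable _ _
  have e2' : ∫ x in (0 : ℝ)..X, (Z' x * bwdOp K₂ Φ x + Z x * (K₂ x x * Φ x + b x)) =
      (∫ x in (0 : ℝ)..X, Z' x * bwdOp K₂ Φ x) + (∫ x in (0 : ℝ)..X, K₂ x x * (Z x * Φ x)) +
        ∫ x in (0 : ℝ)..X, Z x * b x := by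
    rw [← intervalIntegral.integral_add iZ iK2, ← intervalIntegral.integral_add (iZ.add iK2) ib]
    congr 1
    funext x
    ring
  have b0 : bwdOp K₂ Φ 0 = 0 := intervalIntegral.integral_same
  rw [e2', b0] at e2
  -- cancellation
  have e3 : ∫ x in (0 : ℝ)..X, Z x * b x = ∫ x in (0 : ℝ)..X, Φ x * ∫ y in x..X, B x y * Z y := by
    have := integral_triangle_swap (f := fun x y => Φ x * (B x y * Z y))
      ((hΦc.comp continuous_fst).mul (hBc.mul hsnd)) 0 X
    simp only [intervalIntegral.integral_const_mul] at this
    rw [← this]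
    congr 1
    funext y
    rw [hb, ← intervalIntegral.integral_const_mul]
    congr 1
    funext x
    ring
  have e4 : ∫ x in (0 : ℝ)..X, r x * Φ x * ∫ y in x..X, K x y * Z y =
      (∫ x in (0 : ℝ)..X, Φ x * a x) - ∫ x in (0 : ℝ)..X, Φ x * ∫ y in x..X, B x y * Z y := by
    have iB : IntervalIntegrable (fun x => Φ x * ∫ y in x..X, B x y * Z y) volume 0 X :=
      (hΦc.mul (continuous_fwd_trunc hBc hZc X)).intervalIntegrable _ _
    rw [← intervalIntegral.integral_sub ia iB]
    refine intervalIntegral_congr_Icc hX fun x hx _ => ?_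
    have hsec : ∀ M : ℝ → ℝ → ℝ, (Continuous fun p : ℝ × ℝ => M p.1 p.2) →
        IntervalIntegrable (fun y => M x y * Z y) volume x X := fun M hM =>
      ((hM.comp (by fun_prop : Continuous fun y => (x, y))).mul hZc).intervalIntegrable _ _
    rw [← mul_sub, ha, ← intervalIntegral.integral_sub (hsec A hAc) (hsec B hBc)]
    simp only [← sub_mul, hAB, mul_assoc, intervalIntegral.integral_const_mul]
    rw [hs (mem_Ici.2 hx)]
    ring
  have e5 : (∫ x in (0 : ℝ)..X, K₁ x x * (Z x * Φ x)) + ∫ x in (0 : ℝ)..X, K₂ x x * (Z x * Φ x) =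
      -(1 / 2 * ∫ x in (0 : ℝ)..X, r x * (Z x * Φ x)) := by
    rw [← intervalIntegral.integral_add iK1 iK2, ← intervalIntegral.integral_const_mul,
      ← intervalIntegral.integral_neg]
    refine intervalIntegral.integral_congr_ae (Eventually.of_forall fun x hx => ?_)
    rw [uIoc_of_le hX] at hx
    rw [← add_mul, h.diag_deriv hx.1]
    ring
  rw [e4, ← e3]
  have e6 : g 0 = ∫ y in (0 : ℝ)..X, K₁ 0 y * Z y := rfl
  rw [e6] at e1
  linarith

lemma memLp_r_mul (h : KernelPair r K K₁ K₂ L L₁ L₂ C) {f : ℝ → ℝ}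
    (hf : MemLp f 2 (volume.restrict (Ioi 0))) :
    MemLp (fun x => r x * f x) 2 (volume.restrict (Ioi 0)) := by
  obtain ⟨B, hB⟩ := h.pot.bdd
  refine MemLp.mono' (hf.abs.const_mul B)
    (h.pot.continuous.aestronglyMeasurable.mul hf.aestronglyMeasurable)
    (Eventually.of_forall fun x => ?_)
  rw [norm_mul]
  exact mul_le_mul_of_nonneg_right (hB x) (norm_nonneg _)

/-- The limit `X → ∞` of the truncated identity. -/
lemma half_identity (h : KernelPair r K K₁ K₂ L L₁ L₂ C) (hM : Maj r C c) {Z Z' Φ Φ' : ℝ → ℝ}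
    (hZ : Sob Z Z') (hΦ : Sob Φ Φ') :
    (∫ x in Ioi 0, Φ' x * fwdOp K₁ Z x) - (∫ y in Ioi 0, Z' y * bwdOp K₂ Φ y)
      + (∫ x in Ioi 0, r x * Φ x * fwdOp K Z x) =
    -(Φ 0 * fwdOp K₁ Z 0) - 1 / 2 * ∫ x in Ioi 0, r x * (Z x * Φ x) := by
  have hZc := hZ.continuous
  have hΦc := hΦ.continuous
  have hZm := hZ.memLp.restrict (Ioi 0)
  have hΦm := hΦ.memLp.restrict (Ioi 0)
  have t1 := h.regK.kb₁.tendsto_integral_trunc hM le_rfl (hΦ.memLp_deriv.restrict (Ioi 0)) hZc hZm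
  have t2 : Tendsto (fun X => ∫ y in (0 : ℝ)..X, Z' y * bwdOp K₂ Φ y) atTop
      (𝓝 (∫ y in Ioi 0, Z' y * bwdOp K₂ Φ y)) :=
    intervalIntegral_tendsto_integral_Ioi 0 (memLp_mul_integrable (hZ.memLp_deriv.restrict (Ioi 0))
      (h.regK.kb₂.memLp_bwd hM hΦc hΦm).1) tendsto_id
  have t3 := h.regK.kb.tendsto_integral_trunc hM le_rfl (h.memLp_r_mul hΦm) hZc hZm
  have t4 := (h.regK.kb₁.tendsto_interval hM le_rfl hZm).const_mul (Φ 0)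
  -- `Z` is bounded by its `H¹` norm and the other factor by a multiple of `√σ₀(X/2)`, which tends
  -- to zero.
  have t5 : Tendsto (fun X => Z X * bwdOp K₂ Φ X) atTop (𝓝 0) := by
    set S := √((∫ x, Z x ^ 2) + ∫ x, Z' x ^ 2) with hS
    set M := √(∫ ξ in Ioi 0, Φ ξ ^ 2) with hMd
    have h1 : Tendsto (fun X => S * (sqw r c (X / 2) * M)) atTop (𝓝 0) := by
      have h2 : Tendsto (sqw r c) atTop (𝓝 0) := by
        have := ((tendsto_sigma0 h.pot.integrable).const_mul (2 * c)).sqrt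
        rwa [mul_zero, Real.sqrt_zero] at this
      have h3 := h2.comp (tendsto_id.atTop_div_const (two_pos (α := ℝ)))
      have := (h3.mul_const M).const_mul S
      rw [zero_mul, mul_zero] at this
      exact this
    refine squeeze_zero_norm' ?_ h1
    filter_upwards [eventually_ge_atTop 0] with X hX
    rw [norm_mul]
    refine mul_le_mul (Real.abs_le_sqrt (hZ.sq_le X)) ?_ (norm_nonneg _) (Real.sqrt_nonneg _)
    exact h.regK.kb₂.bwd_section hM le_rfl hX hΦm
  have t6 : Tendsto (fun X => ∫ x in (0 : ℝ)..X, r x * (Z x * Φ x)) atTop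
      (𝓝 (∫ x in Ioi 0, r x * (Z x * Φ x))) := by
    refine intervalIntegral_tendsto_integral_Ioi 0 ?_ tendsto_id
    have := memLp_mul_integrable (h.memLp_r_mul hZm) hΦm
    simp only [mul_assoc] at this
    exact this
  have hL := (t1.sub t2).add t3
  have hR := ((t4.neg).sub t5).sub (t6.const_mul (1 / 2))
  rw [sub_zero] at hR
  refine tendsto_nhds_unique (hL.congr' ?_) hR
  filter_upwards [eventually_ge_atTop 0] with X hX
  exact h.truncated_identity hZ.prim hΦ.prim hX

/-- The integral over the half line of the derivative of `K(x,x)Z(x)Φ(x)`. Its term `½∫rZΦ`,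
together with `-½∫rZΦ` from `half_identity`, accounts for the potential acting on the identity part
of `1+K`. -/
lemma diag_identity (h : KernelPair r K K₁ K₂ L L₁ L₂ C) (hM : Maj r C c) {Z Z' Φ Φ' : ℝ → ℝ}
    (hZ : Sob Z Z') (hΦ : Sob Φ Φ') :
    (∫ x in Ioi 0, Z' x * (K x x * Φ x)) + (∫ x in Ioi 0, Φ' x * (K x x * Z x)) =
      1 / 2 * (∫ x in Ioi 0, r x * (Z x * Φ x)) - K 0 0 * Z 0 * Φ 0 := by
  have hZm := hZ.memLp.restrict (Ioi 0)
  have hΦm := hΦ.memLp.restrict (Ioi 0)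
  have hKΦ := (h.regK.memLp_diag hM hΦ.continuous hΦm).1
  have hKZ := (h.regK.memLp_diag hM hZ.continuous hZm).1
  have i1 := memLp_mul_integrable (hZ.memLp_deriv.restrict (Ioi 0)) hKΦ
  have i2 := memLp_mul_integrable (hΦ.memLp_deriv.restrict (Ioi 0)) hKZ
  have i3 : Integrable (fun x => r x * (Z x * Φ x)) (volume.restrict (Ioi 0)) := by
    have := memLp_mul_integrable (h.memLp_r_mul hZm) hΦm
    simpa only [mul_assoc] using this
  have hd1 : Continuous fun x => K₁ x x + K₂ x x :=
    (h.regK.smooth₁.continuous.comp (by fun_prop : Continuous fun x => (x, x))).add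
      (h.regK.smooth₂.continuous.comp (by fun_prop : Continuous fun x => (x, x)))
  have p := (IsPrim.of_hasDerivAt h.hasDerivAt_diag hd1).mul (hZ.prim.mul hΦ.prim)
  have hae : (fun x => -(1 / 2) * (r x * (Z x * Φ x)) + (Z' x * (K x x * Φ x) +
      Φ' x * (K x x * Z x))) =ᵐ[volume.restrict (Ioi 0)] fun x =>
      (K₁ x x + K₂ x x) * (Z x * Φ x) + K x x * (Z' x * Φ x + Z x * Φ' x) := by
    filter_upwards [self_mem_ae_restrict measurableSet_Ioi] with x hx
    rw [h.diag_deriv hx]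
    ring
  have i12 : Integrable (fun x => Z' x * (K x x * Φ x) + Φ' x * (K x x * Z x))
      (volume.restrict (Ioi 0)) := i1.add i2
  have hi := (i3.const_mul (-(1 / 2))).add i12
  have h1 := p.integral_Ioi 0 (by
    have := memLp_mul_integrable hKZ hΦm
    simp only [mul_assoc] at this
    exact this) (hi.congr hae)
  rw [← integral_congr_ae hae, integral_add (i3.const_mul (-(1 / 2))) i12,
    integral_const_mul, integral_add i1 i2] at h1
  linarith

/-- The intertwining identity for the operators `1 + K` and `1 + K*`. -/
theorem intertwining (h : KernelPair r K K₁ K₂ L L₁ L₂ C) (hM : Maj r C c) {Z Z' Φ Φ' : ℝ → ℝ}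
    (hZ : Sob Z Z') (hΦ : Sob Φ Φ') :
    (∫ x in Ioi 0, (Z' x + fwdD K K₁ Z x) * Φ' x) +
      (∫ x in Ioi 0, r x * (Z x + fwdOp K Z x) * Φ x) =
    (∫ x in Ioi 0, Z' x * (Φ' x + bwdD K K₂ Φ x)) + (K 0 0 * Z 0 - fwdOp K₁ Z 0) * Φ 0 := by
  have hZm := hZ.memLp.restrict (Ioi 0)
  have hΦm := hΦ.memLp.restrict (Ioi 0)
  have hZ'm := hZ.memLp_deriv.restrict (Ioi 0)
  have hΦ'm := hΦ.memLp_deriv.restrict (Ioi 0)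
  have i1 := memLp_mul_integrable hZ'm hΦ'm
  have i2 := memLp_mul_integrable hΦ'm (h.regK.memLp_diag hM hZ.continuous hZm).1
  have i3 := memLp_mul_integrable hΦ'm (h.regK.kb₁.memLp_fwd hM hZ.continuous hZm).1
  have i4 : Integrable (fun x => r x * (Z x * Φ x)) (volume.restrict (Ioi 0)) := by
    have := memLp_mul_integrable (h.memLp_r_mul hZm) hΦm
    simpa only [mul_assoc] using this
  have i5 := memLp_mul_integrable (h.memLp_r_mul hΦm) (h.regK.kb.memLp_fwd hM hZ.continuous hZm).1
  have i6 := memLp_mul_integrable hZ'm (h.regK.memLp_diag hM hΦ.continuous hΦm).1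
  have i7 := memLp_mul_integrable hZ'm (h.regK.kb₂.memLp_bwd hM hΦ.continuous hΦm).1
  have e1 : ∫ x in Ioi 0, (Z' x + fwdD K K₁ Z x) * Φ' x =
      (∫ x in Ioi 0, Z' x * Φ' x) - (∫ x in Ioi 0, Φ' x * (K x x * Z x)) +
        ∫ x in Ioi 0, Φ' x * fwdOp K₁ Z x := by
    have i12 : Integrable (fun x => Z' x * Φ' x - Φ' x * (K x x * Z x))
      (volume.restrict (Ioi 0)) := i1.sub i2
    rw [← integral_sub i1 i2, ← integral_add i12 i3]
    congr 1
    funext x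
    simp only [fwdD]
    ring
  have e2 : ∫ x in Ioi 0, r x * (Z x + fwdOp K Z x) * Φ x =
      (∫ x in Ioi 0, r x * (Z x * Φ x)) + ∫ x in Ioi 0, r x * Φ x * fwdOp K Z x := by
    rw [← integral_add i4 i5]
    congr 1
    funext x
    ring
  have e3 : ∫ x in Ioi 0, Z' x * (Φ' x + bwdD K K₂ Φ x) =
      (∫ x in Ioi 0, Z' x * Φ' x) + (∫ x in Ioi 0, Z' x * (K x x * Φ x)) +
        ∫ x in Ioi 0, Z' x * bwdOp K₂ Φ x := by
    have i16 : Integrable (fun x => Z' x * Φ' x + Z' x * (K x x * Φ x))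
      (volume.restrict (Ioi 0)) := i1.add i6
    rw [← integral_add i1 i6, ← integral_add i16 i7]
    congr 1
    funext x
    simp only [bwdD]
    ring
  have h1 := h.half_identity hM hZ hΦ
  have h2 := h.diag_identity hM hZ hΦ
  rw [e1, e2, e3]
  linarith

/-- The boundary term of the intertwining identity. -/
lemma boundary_term (h : KernelPair r K K₁ K₂ L L₁ L₂ C) (hM : Maj r C c) {w Z : ℝ → ℝ}
    (hwc : Continuous w) (hw : MemLp w 2 (volume.restrict (Ioi 0)))
    (hZ : ∀ l, 0 ≤ l → Z l = w l + fwdOp L w l) :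
    K 0 0 * Z 0 - fwdOp K₁ Z 0 = 1 / 2 * w 0 * (∫ ξ in Ioi 0, r ξ) + ∫ x in Ioi 0, L₁ 0 x * w x := by
  have hLw := (h.regL.kb.memLp_fwd hM hwc hw).1
  have hK1 := (h.regK.section_K₁ hM.pot le_rfl).2
  have hK1c : Continuous (K₁ 0) :=
    h.regK.smooth₁.continuous.comp (by fun_prop : Continuous fun x => ((0 : ℝ), x))
  have i1 := memLp_mul_integrable hK1 hw
  have i2 := memLp_mul_integrable (h.regL.section_K hM.pot le_rfl).2 hw
  have i3 := memLp_mul_integrable (h.regL.section_K₁ hM.pot le_rfl).2 hw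
  have e1 : fwdOp K₁ Z 0 = fwdOp K₁ w 0 + ∫ ξ in Ioi 0, K₁ 0 ξ * fwdOp L w ξ := by
    rw [fwdOp, fwdOp, ← integral_add i1 (memLp_mul_integrable hK1 hLw)]
    refine setIntegral_congr_fun measurableSet_Ioi fun ξ hξ => ?_
    rw [hZ ξ (le_of_lt hξ)]
    ring
  -- The right resolvent equation differentiated in its first variable at zero expresses the
  -- composition of `K₁(0,·)` with `L` through `L₁(0,·)`; the `K₁` and `L(0,·)` terms then cancel.
  have hL1 : ∀ x, L₁ 0 x = -K₁ 0 x + K 0 0 * L 0 x - vcomp K₁ L 0 x := fun x =>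
    (h.regL.d₁ 0 x).unique (h.res.hasDerivAt₁ h.regK 0 x)
  have e2 := h.regL.kb.integral_swap hM le_rfl hK1c hK1 hwc hw
  have e3 : ∫ η in Ioi 0, (∫ ξ in (0 : ℝ)..η, K₁ 0 ξ * L ξ η) * w η =
      K 0 0 * fwdOp L w 0 - fwdOp K₁ w 0 - ∫ x in Ioi 0, L₁ 0 x * w x := by
    have i21 : Integrable (fun x => K 0 0 * (L 0 x * w x) - K₁ 0 x * w x)
      (volume.restrict (Ioi 0)) := (i2.const_mul _).sub i1
    rw [fwdOp, fwdOp, ← integral_const_mul, ← integral_sub (i2.const_mul _) i1,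
      ← integral_sub i21 i3]
    congr 1
    funext η
    have := hL1 η
    rw [vcomp] at this
    rw [show ∫ ξ in (0 : ℝ)..η, K₁ 0 ξ * L ξ η = -K₁ 0 η + K 0 0 * L 0 η - L₁ 0 η by linarith]
    ring
  rw [e1, e2, e3, hZ 0 le_rfl, mul_add, h.diag 0 le_rfl]
  ring

end KernelPair

/-! ### The transformed system -/

lemma absCont_of_dist_le {X Y : Type*} [PseudoMetricSpace X] [PseudoMetricSpace Y] {f : ℝ → X}
    {g : ℝ → Y} {a b D : ℝ} (hf : AbsolutelyContinuousOnInterval f a b)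
    (h : ∀ s ∈ uIcc a b, ∀ t ∈ uIcc a b, dist (g s) (g t) ≤ D * dist (f s) (f t)) :
    AbsolutelyContinuousOnInterval g a b := by
  unfold AbsolutelyContinuousOnInterval at hf ⊢
  refine squeeze_zero' ?_ ?_ (by simpa using hf.const_mul D)
  · exact Eventually.of_forall fun _ => Finset.sum_nonneg fun i hi => dist_nonneg
  rw [eventually_inf_principal]
  filter_upwards with I hI
  rw [Finset.mul_sum]
  refine Finset.sum_le_sum fun i hi => ?_
  simp only [AbsolutelyContinuousOnInterval.disjWithin, mem_ofPred_eq] at hI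
  exact h _ (hI.left i hi).left _ (hI.left i hi).right

/-- The even part. -/
def evenPart (f : ℝ → ℝ) (x : ℝ) : ℝ := 1 / 2 * (f x + f (-x))

/-- The derivative of the even part. -/
def evenPartD (g : ℝ → ℝ) (x : ℝ) : ℝ := 1 / 2 * (g x + -g (-x))

lemma evenPart_neg (f : ℝ → ℝ) (x : ℝ) : evenPart f (-x) = evenPart f x := by
  rw [evenPart, evenPart, neg_neg, add_comm]

lemma evenPartD_neg (f : ℝ → ℝ) (x : ℝ) : evenPartD f (-x) = -evenPartD f x := by
  rw [evenPartD, evenPartD, neg_neg]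
  ring

lemma Sob.evenPart {f g : ℝ → ℝ} (h : Sob f g) : Sob (evenPart f) (evenPartD g) := h.even_part

lemma integral_half_add_neg_sq_le {f : ℝ → ℝ} (hf : MemLp f 2) (s : ℝ) (hs : s ^ 2 = 1) :
    ∫ x, (1 / 2 * (f x + s * f (-x))) ^ 2 ≤ ∫ x, f x ^ 2 := by
  have hn : MemLp (fun x => s * f (-x)) 2 :=
    (hf.comp_measurePreserving (Measure.measurePreserving_neg volume)).const_mul s
  have h1 := integral_add_sq_le hf hn
  have h2 : ∫ x, (s * f (-x)) ^ 2 = ∫ x, f x ^ 2 := by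
    simp only [mul_pow, hs, one_mul]
    exact integral_neg_eq_self (fun x => f x ^ 2) volume
  simp only [mul_pow _ (f _ + _), integral_const_mul]
  rw [h2] at h1
  linarith

lemma Sob.evenPart_le {f g : ℝ → ℝ} (h : Sob f g) :
    (∫ x, NeumannHeat.evenPart f x ^ 2) + ∫ x, evenPartD g x ^ 2 ≤
      (∫ x, f x ^ 2) + ∫ x, g x ^ 2 := by
  have h1 := integral_half_add_neg_sq_le h.memLp 1 (by norm_num)
  have h2 := integral_half_add_neg_sq_le h.memLp_deriv (-1) (by norm_num)
  simp only [one_mul, neg_one_mul] at h1 h2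
  exact add_le_add h1 h2

/-- An even function pairs only with the even part of a test function. In this way arbitrary
elements of the test space are reduced to half-line identities. -/
lemma integral_mul_evenPart {p f : ℝ → ℝ} (hp : ∀ x, p (-x) = p x) (h1 : MemLp p 2)
    (h2 : MemLp f 2) : ∫ x, p x * f x = 2 * ∫ x in Ioi 0, p x * evenPart f x := by
  rw [← integral_even (p := fun x => p x * evenPart f x) fun x => by rw [hp, evenPart_neg]]
  have hi := memLp_mul_integrable h1 h2
  have e : ∫ x, p x * f (-x) = ∫ x, p x * f x := by
    have := integral_neg_eq_self (fun x => p x * f x) volume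
    simpa only [hp] using this
  have hi' : Integrable fun x => p x * f (-x) := by
    have := hi.comp_neg
    simpa only [hp] using this
  have : ∫ x, p x * evenPart f x = 1 / 2 * ((∫ x, p x * f x) + ∫ x, p x * f (-x)) := by
    rw [← integral_add hi hi', ← integral_const_mul]
    congr 1
    funext x
    rw [evenPart]
    ring
  rw [this, e]
  ring

lemma integral_mul_evenPartD {p f : ℝ → ℝ} (hp : ∀ x, p (-x) = -p x) (h1 : MemLp p 2)
    (h2 : MemLp f 2) : ∫ x, p x * f x = 2 * ∫ x in Ioi 0, p x * evenPartD f x := by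
  rw [← integral_even (p := fun x => p x * evenPartD f x) fun x => by
    rw [hp, evenPartD_neg, neg_mul_neg]]
  have hi := memLp_mul_integrable h1 h2
  have e : ∫ x, p x * -f (-x) = ∫ x, p x * f x := by
    have := integral_neg_eq_self (fun x => p x * f x) volume
    simpa only [hp, neg_mul, mul_neg] using this
  have hi' : Integrable fun x => p x * -f (-x) := by
    have := hi.comp_neg
    simpa only [hp, neg_mul, mul_neg] using this
  have : ∫ x, p x * evenPartD f x = 1 / 2 * ((∫ x, p x * f x) + ∫ x, p x * -f (-x)) := by
    rw [← integral_add hi hi', ← integral_const_mul]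
    congr 1
    funext x
    rw [evenPartD]
    ring
  rw [this, e]
  ring

/-- The forward transform of an even function. -/
def fwdExt (N : ℝ → ℝ → ℝ) (w : ℝ → ℝ) (l : ℝ) : ℝ := w l + fwdOp N w |l|

/-- The derivative of `fwdExt`. -/
def fwdExtD (N N₁ : ℝ → ℝ → ℝ) (w w' : ℝ → ℝ) (l : ℝ) : ℝ := w' l + oddExt (fwdD N N₁ w) l

/-- The adjoint transform of an even function. -/
def bwdExt (N : ℝ → ℝ → ℝ) (w : ℝ → ℝ) (l : ℝ) : ℝ := w l + bwdOp N w |l|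

/-- The derivative of `bwdExt`. -/
def bwdExtD (N N₂ : ℝ → ℝ → ℝ) (w w' : ℝ → ℝ) (l : ℝ) : ℝ := w' l + oddExt (bwdD N N₂ w) l

lemma fwdExt_of_nonneg (N : ℝ → ℝ → ℝ) (w : ℝ → ℝ) {l : ℝ} (hl : 0 ≤ l) :
    fwdExt N w l = w l + fwdOp N w l := by rw [fwdExt, abs_of_nonneg hl]

lemma bwdExt_of_nonneg (N : ℝ → ℝ → ℝ) (w : ℝ → ℝ) {l : ℝ} (hl : 0 ≤ l) :
    bwdExt N w l = w l + bwdOp N w l := by rw [bwdExt, abs_of_nonneg hl]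

lemma fwdExtD_of_pos (N N₁ : ℝ → ℝ → ℝ) (w w' : ℝ → ℝ) {l : ℝ} (hl : 0 < l) :
    fwdExtD N N₁ w w' l = w' l + fwdD N N₁ w l := by rw [fwdExtD, oddExt_of_pos _ hl]

lemma bwdExtD_of_pos (N N₁ : ℝ → ℝ → ℝ) (w w' : ℝ → ℝ) {l : ℝ} (hl : 0 < l) :
    bwdExtD N N₁ w w' l = w' l + bwdD N N₁ w l := by rw [bwdExtD, oddExt_of_pos _ hl]

lemma eq_abs_of_even {w : ℝ → ℝ} (hw : ∀ x, w (-x) = w x) (l : ℝ) : w l = w |l| := by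
  rcases abs_choice l with h | h <;> rw [h]
  rw [hw]

section Ext

variable {r : ℝ → ℝ} {C c : ℝ} {N N₁ N₂ : ℝ → ℝ → ℝ} {w w' : ℝ → ℝ}

lemma opBound_nonneg (hM : Maj r C c) : 0 ≤ opBound r C c := by
  have := mul_nonneg hM.pos.le (Rconst_nonneg (r := r))
  rw [opBound]
  nlinarith [sq_nonneg (C * sigma0 r 0)]

lemma RegKernel.fwdExt_sob (hM : Maj r C c) (hN : RegKernel r N N₁ N₂ C) (hw : Sob w w') :
    Sob (fwdExt N w) (fwdExtD N N₁ w w') ∧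
      (∫ l, fwdExt N w l ^ 2) + ∫ l, fwdExtD N N₁ w w' l ^ 2 ≤
        (2 + 8 * opBound r C c) * ((∫ l, w l ^ 2) + ∫ l, w' l ^ 2) := by
  obtain ⟨h1, h2, h3⟩ := hN.fwd_halfSob hM hw.continuous (hw.memLp.restrict _)
  exact hw.add_ext h1 (opBound_nonneg hM) h2 h3

lemma RegKernel.bwdExt_sob (hM : Maj r C c) (hN : RegKernel r N N₁ N₂ C) (hw : Sob w w') :
    Sob (bwdExt N w) (bwdExtD N N₂ w w') ∧
      (∫ l, bwdExt N w l ^ 2) + ∫ l, bwdExtD N N₂ w w' l ^ 2 ≤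
        (2 + 8 * opBound r C c) * ((∫ l, w l ^ 2) + ∫ l, w' l ^ 2) := by
  obtain ⟨h1, h2, h3⟩ := hN.bwd_halfSob hM hw.continuous (hw.memLp.restrict _)
  exact hw.add_ext h1 (opBound_nonneg hM) h2 h3

lemma fwdExt_neg (hw : ∀ x, w (-x) = w x) (x : ℝ) : fwdExt N w (-x) = fwdExt N w x := by
  rw [fwdExt, fwdExt, hw, abs_neg]

lemma bwdExt_neg (hw : ∀ x, w (-x) = w x) (x : ℝ) : bwdExt N w (-x) = bwdExt N w x := by
  rw [bwdExt, bwdExt, hw, abs_neg]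

lemma fwdExtD_neg (hw : ∀ x, w' (-x) = -w' x) (x : ℝ) :
    fwdExtD N N₁ w w' (-x) = -fwdExtD N N₁ w w' x := by
  rw [fwdExtD, fwdExtD, hw, oddExt_neg]
  ring

lemma bwdExtD_neg (hw : ∀ x, w' (-x) = -w' x) (x : ℝ) :
    bwdExtD N N₁ w w' (-x) = -bwdExtD N N₁ w w' x := by
  rw [bwdExtD, bwdExtD, hw, oddExt_neg]
  ring

lemma bwdOp_add {f g : ℝ → ℝ} (hN : Continuous fun p : ℝ × ℝ => N p.1 p.2) (hf : Continuous f)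
    (hg : Continuous g) (l : ℝ) :
    bwdOp N (fun x => f x + g x) l = bwdOp N f l + bwdOp N g l := by
  have hc : Continuous fun ξ => N ξ l := hN.comp (by fun_prop : Continuous fun x => (x, l))
  have i1 : IntervalIntegrable (fun ξ => N ξ l * f ξ) volume 0 l := (hc.mul hf).intervalIntegrable _ _
  have i2 : IntervalIntegrable (fun ξ => N ξ l * g ξ) volume 0 l := (hc.mul hg).intervalIntegrable _ _
  rw [bwdOp, bwdOp, bwdOp, ← intervalIntegral.integral_add i1 i2]
  simp only [mul_add]

lemma bwdOp_const_mul (a : ℝ) (f : ℝ → ℝ) (l : ℝ) :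
    bwdOp N (fun x => a * f x) l = a * bwdOp N f l := by
  rw [bwdOp, bwdOp, ← intervalIntegral.integral_const_mul]
  congr 1
  funext ξ
  ring

end Ext

namespace KernelPair

variable {r : ℝ → ℝ} {C c : ℝ} {K K₁ K₂ L L₁ L₂ : ℝ → ℝ → ℝ}

lemma fwdExt_inverse (h : KernelPair r K K₁ K₂ L L₁ L₂ C) (hM : Maj r C c) {w : ℝ → ℝ}
    (hwe : ∀ x, w (-x) = w x) (hwc : Continuous w) (hw : MemLp w 2 (volume.restrict (Ioi 0))) :
    fwdExt K (fwdExt L w) = w := by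
  funext l
  rw [eq_abs_of_even hwe l, eq_abs_of_even (fwdExt_neg (fwdExt_neg hwe)) l,
    fwdExt_of_nonneg _ _ (abs_nonneg l)]
  exact h.fwd_inverse hM hwc hw (fun l hl => fwdExt_of_nonneg _ _ hl) (abs_nonneg l)

lemma bwdExt_inverse (h : KernelPair r K K₁ K₂ L L₁ L₂ C) {w : ℝ → ℝ}
    (hwe : ∀ x, w (-x) = w x) (hwc : Continuous w) : bwdExt K (bwdExt L w) = w := by
  funext l
  rw [eq_abs_of_even hwe l, eq_abs_of_even (bwdExt_neg (bwdExt_neg hwe)) l,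
    bwdExt_of_nonneg _ _ (abs_nonneg l)]
  exact h.bwd_inverse hwc (fun l hl => bwdExt_of_nonneg _ _ hl) (abs_nonneg l)

/-- The duality between the transforms on the real line. -/
lemma line_duality (h : KernelPair r K K₁ K₂ L L₁ L₂ C) (hM : Maj r C c) {w w' f f' : ℝ → ℝ}
    (hwe : ∀ x, w (-x) = w x) (hw : Sob w w') (hf : Sob f f') :
    ∫ x, fwdExt L w x * f x = ∫ x, w x * bwdExt L (evenPart f) x := by
  have hfe := hf.evenPart
  rw [integral_mul_evenPart (fwdExt_neg hwe) (h.regL.fwdExt_sob hM hw).1.memLp hf.memLp,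
    integral_even (p := fun x => w x * bwdExt L (evenPart f) x) fun x => by
      rw [hwe, bwdExt_neg (evenPart_neg f)]]
  have e := h.duality hM hw.continuous (hw.memLp.restrict _) hfe.continuous (hfe.memLp.restrict _)
  have e1 : ∫ x in Ioi 0, fwdExt L w x * evenPart f x =
      ∫ l in Ioi 0, (w l + fwdOp L w l) * evenPart f l :=
    setIntegral_congr_fun measurableSet_Ioi fun x hx => by
      rw [fwdExt_of_nonneg _ _ (le_of_lt hx)]
  have e2 : ∫ x in Ioi 0, w x * bwdExt L (evenPart f) x =
      ∫ l in Ioi 0, w l * (evenPart f l + bwdOp L (evenPart f) l) :=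
    setIntegral_congr_fun measurableSet_Ioi fun x hx => by
      rw [bwdExt_of_nonneg _ _ (le_of_lt hx)]
  rw [e1, e2, e]

/-- The intertwining identity on the real line. -/
lemma line_intertwining (h : KernelPair r K K₁ K₂ L L₁ L₂ C) (hM : Maj r C c) {w w' f f' : ℝ → ℝ}
    (hwe : ∀ x, w (-x) = w x) (hwo : ∀ x, w' (-x) = -w' x) (hw : Sob w w') (hf : Sob f f') :
    (∫ x, w' x * bwdExtD L L₂ (evenPart f) (evenPartD f') x) +
        (∫ x, r x * w x * bwdExt L (evenPart f) x) =
      (∫ x, fwdExtD L L₁ w w' x * f' x) +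
        2 * (1 / 2 * w 0 * (∫ ξ in Ioi 0, r ξ) + ∫ x in Ioi 0, L₁ 0 x * w x) * f 0 := by
  have hfe := hf.evenPart
  have hZ := (h.regL.fwdExt_sob hM hw).1
  have hΦ := (h.regL.bwdExt_sob hM hfe).1
  have hm : MemLp w 2 (volume.restrict (Ioi 0)) := hw.memLp.restrict _
  -- The half-line identity is applied to `Z = (1+L)w` and `Φ = (1+L*)f`; inversion then turns
  -- `(1+K)Z` back into `w` and `(1+K*)Φ` into the even part of `f`, and the same holds for the
  -- derivatives almost everywhere.
  have eZ := h.fwdExt_inverse hM hwe hw.continuous hm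
  have eΦ := h.bwdExt_inverse (evenPart_neg f) hfe.continuous
  have dZ := ((h.regK.fwdExt_sob hM hZ).1.prim.ae_eq_of_ae_eq hw.prim
    (Eventually.of_forall (congrFun eZ))).2
  have dΦ := ((h.regK.bwdExt_sob hM hΦ).1.prim.ae_eq_of_ae_eq hfe.prim
    (Eventually.of_forall (congrFun eΦ))).2
  have hI := h.intertwining hM hZ hΦ
  rw [h.boundary_term hM hw.continuous hm fun l hl => fwdExt_of_nonneg _ _ hl] at hI
  rw [integral_even (p := fun x => w' x * bwdExtD L L₂ (evenPart f) (evenPartD f') x) fun x => by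
      rw [hwo, bwdExtD_neg (evenPartD_neg f'), neg_mul_neg],
    integral_even (p := fun x => r x * w x * bwdExt L (evenPart f) x) fun x => by
      rw [h.pot.even, hwe, bwdExt_neg (evenPart_neg f)],
    integral_mul_evenPartD (fwdExtD_neg hwo) hZ.memLp_deriv hf.memLp_deriv]
  have e1 : ∫ x in Ioi 0, w' x * bwdExtD L L₂ (evenPart f) (evenPartD f') x =
      ∫ x in Ioi 0, (fwdExtD L L₁ w w' x + fwdD K K₁ (fwdExt L w) x) *
        bwdExtD L L₂ (evenPart f) (evenPartD f') x := by
    refine integral_congr_ae ?_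
    filter_upwards [self_mem_ae_restrict measurableSet_Ioi, ae_restrict_of_ae dZ] with x hx hd
    rw [← hd, fwdExtD_of_pos K _ _ _ hx]
  have e2 : ∫ x in Ioi 0, r x * w x * bwdExt L (evenPart f) x =
      ∫ x in Ioi 0, r x * (fwdExt L w x + fwdOp K (fwdExt L w) x) * bwdExt L (evenPart f) x :=
    setIntegral_congr_fun measurableSet_Ioi fun x hx => by
      rw [← fwdExt_of_nonneg K _ (le_of_lt hx), eZ]
  have e3 : ∫ x in Ioi 0, fwdExtD L L₁ w w' x * evenPartD f' x =
      ∫ x in Ioi 0, fwdExtD L L₁ w w' x * (bwdExtD L L₂ (evenPart f) (evenPartD f') x +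
        bwdD K K₂ (bwdExt L (evenPart f)) x) := by
    refine integral_congr_ae ?_
    filter_upwards [self_mem_ae_restrict measurableSet_Ioi, ae_restrict_of_ae dΦ] with x hx hd
    rw [← hd, bwdExtD_of_pos K _ _ _ hx]
  have e4 : bwdExt L (evenPart f) 0 = f 0 := by
    rw [bwdExt_of_nonneg _ _ le_rfl, bwdOp, intervalIntegral.integral_same, evenPart, neg_zero]
    ring
  rw [e4] at hI
  rw [e1, e2, e3]
  linarith

end KernelPair

/-! ### Transfer of solutions -/

/-- The dual of a bounded operator is bounded, so it preserves both absolute continuity and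
differentiability in the dual norm. -/
lemma exists_precomp {E F : Type*} [NormedAddCommGroup E] [NormedSpace ℝ E] [NormedAddCommGroup F]
    [NormedSpace ℝ F] (A : E →L[ℝ] F) :
    ∃ (Q : StrongDual ℝ F → StrongDual ℝ E) (D : ℝ), (∀ V φ, Q V φ = V (A φ)) ∧
      (∀ V V', dist (Q V) (Q V') ≤ D * dist V V') ∧
      ∀ (f : ℝ → StrongDual ℝ F) (g : ℝ → StrongDual ℝ E) (V : StrongDual ℝ F) (t : ℝ),
        HasDerivAt f V t → (∀ᶠ s in 𝓝 t, g s = Q (f s)) → HasDerivAt g (Q V) t := by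
  set Q : StrongDual ℝ F →L[ℝ] StrongDual ℝ E := ContinuousLinearMap.precomp ℝ A
  refine ⟨Q, ‖Q‖, fun _ _ => rfl, fun V V' => ?_, fun f g V t hf hg => ?_⟩
  · rw [dist_eq_norm, dist_eq_norm, ← map_sub]
    exact Q.le_opNorm _
  · exact (Q.hasFDerivAt.comp_hasDerivAt t hf).congr_of_eventuallyEq hg

lemma exists_dual_map {ρ k ρ' k' : ℝ → ℝ} (A : H1 ρ k →L[ℝ] H1 ρ' k') :
    ∃ (Q : HNeg ρ' k' → HNeg ρ k) (D : ℝ), (∀ V φ, Q V φ = V (A φ)) ∧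
      (∀ V V', dist (Q V) (Q V') ≤ D * dist V V') ∧
      ∀ (f : ℝ → HNeg ρ' k') (g : ℝ → HNeg ρ k) (V : HNeg ρ' k') (t : ℝ), HasDerivAt f V t →
        (∀ᶠ s in 𝓝 t, g s = Q (f s)) → HasDerivAt g (Q V) t := by
  obtain ⟨Q, D, h1, h2, h3⟩ := @exists_precomp (H1 ρ k) (H1 ρ' k') _ _ _ _ A
  refine ⟨Q, D, h1, h2, fun f g V t hf hg => ?_⟩
  have h4 := h3 f g V t hf hg
  exact h4

lemma evenPart_of_even {f : ℝ → ℝ} (hf : ∀ x, f (-x) = f x) : evenPart f = f := by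
  funext x
  rw [evenPart, hf]
  ring

lemma evenPart_add (f g : ℝ → ℝ) :
    evenPart (fun x => f x + g x) = fun x => evenPart f x + evenPart g x := by
  funext x
  simp only [evenPart]
  ring

lemma evenPart_const_mul (a : ℝ) (f : ℝ → ℝ) :
    evenPart (fun x => a * f x) = fun x => a * evenPart f x := by
  funext x
  simp only [evenPart]
  ring

lemma Rep.exists_even {ρ k γ : ℝ → ℝ} (h : Admissible ρ k γ) {φ : H1 ρ k} (hφ : IsEven φ) :
    ∃ w w', Rep φ w w' ∧ (∀ x, w (-x) = w x) ∧ ∀ x, w' (-x) = -w' x := by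
  obtain ⟨w, w', hw⟩ := h.exists_rep φ
  have he := (hw.isEven_iff h).1 hφ
  refine ⟨w, evenPartD w', Rep.of_val h ?_ hw.val, he, evenPartD_neg w'⟩
  have := hw.sob.evenPart
  rwa [evenPart_of_even he] at this

namespace KernelPair

variable {ρ k γ : ℝ → ℝ} {C c : ℝ} {K K₁ K₂ L L₁ L₂ : ℝ → ℝ → ℝ}

/-- The adjoint of the inverse transformation operator. -/
lemma exists_adjoint (h : Admissible ρ k γ) (hP : KernelPair (rFn ρ k γ) K K₁ K₂ L L₁ L₂ C)
    (hM : Maj (rFn ρ k γ) C c) :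
    ∃ A : H1 1 1 →L[ℝ] H1 ρ k, ∀ φ f f', Rep φ f f' →
      Rep (A φ) (bwdExt L (evenPart f)) (bwdExtD L L₂ (evenPart f) (evenPartD f')) := by
  have hS : ∀ {f f' : ℝ → ℝ}, Sob f f' → Sob (bwdExt L (evenPart f))
      (bwdExtD L L₂ (evenPart f) (evenPartD f')) := fun hf => (hP.regL.bwdExt_sob hM hf.evenPart).1
  -- The choice of representatives is arbitrary, but they are unique, and this makes the map below
  -- additive and homogeneous.
  choose F F' hF using admissible_one.exists_rep
  have hR : ∀ φ, Rep (h.ofSob (hS (hF φ).sob)) (bwdExt L (evenPart (F φ)))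
      (bwdExtD L L₂ (evenPart (F φ)) (evenPartD (F' φ))) := fun φ => h.rep_ofSob _
  have hL := hP.regL.smooth.continuous
  let A₀ : H1 1 1 →ₗ[ℝ] H1 ρ k :=
    { toFun := fun φ => h.ofSob (hS (hF φ).sob)
      map_add' := fun φ ψ => by
        have e := ((hF (φ + ψ)).unique admissible_one ((hF φ).add admissible_one (hF ψ))).1
        refine (hR (φ + ψ)).eq h (Rep.of_val h (hR (φ + ψ)).sob ?_)
        have := ((hR φ).add h (hR ψ)).val
        convert this using 2
        funext x
        rw [e, evenPart_add]
        simp only [bwdExt]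
        rw [bwdOp_add hL (hF φ).sob.evenPart.continuous (hF ψ).sob.evenPart.continuous]
        ring
      map_smul' := fun a φ => by
        have e := ((hF (a • φ)).unique admissible_one ((hF φ).smul admissible_one a)).1
        refine (hR (a • φ)).eq h (Rep.of_val h (hR (a • φ)).sob ?_)
        have := ((hR φ).smul h a).val
        simp only [RingHom.id_apply]
        convert this using 2
        funext x
        rw [e, evenPart_const_mul]
        simp only [bwdExt]
        rw [bwdOp_const_mul]
        ring }
  have hb : ∀ φ, ‖A₀ φ‖ ≤ √(2 + 8 * opBound (rFn ρ k γ) C c) * ‖φ‖ := fun φ => by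
    have h0 : 0 ≤ 2 + 8 * opBound (rFn ρ k γ) C c := by
      have := opBound_nonneg hM
      linarith
    refine abs_le_of_sq_le_sq' ?_ (by positivity) |>.2
    rw [mul_pow, Real.sq_sqrt h0, (hF φ).norm_sq admissible_one]
    refine ((hR φ).norm_sq h).le.trans ?_
    exact (hP.regL.bwdExt_sob hM (hF φ).sob.evenPart).2.trans
      (mul_le_mul_of_nonneg_left (hF φ).sob.evenPart_le h0)
  refine ⟨A₀.mkContinuous _ hb, fun φ f f' hf => ?_⟩
  obtain ⟨e, -⟩ := hf.unique admissible_one (hF φ)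
  refine Rep.of_val h (hS hf.sob) ?_
  rw [e]
  exact (hR φ).val

/-- The inverse transformation operator on `ℍ¹`. -/
lemma exists_transform (h : Admissible ρ k γ) (hP : KernelPair (rFn ρ k γ) K K₁ K₂ L L₁ L₂ C)
    (hM : Maj (rFn ρ k γ) C c) :
    ∃ B : H1 ρ k → H1 1 1, ∀ φ f f', Rep φ f f' →
      Rep (B φ) (fwdExt L f) (fwdExtD L L₁ f f') := by
  choose F F' hF using h.exists_rep
  refine ⟨fun φ => admissible_one.ofSob (hP.regL.fwdExt_sob hM (hF φ).sob).1, fun φ f f' hf => ?_⟩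
  obtain ⟨e, -⟩ := hf.unique h (hF φ)
  refine Rep.of_val admissible_one (hP.regL.fwdExt_sob hM hf.sob).1 ?_
  rw [e]
  exact (admissible_one.rep_ofSob (hP.regL.fwdExt_sob hM (hF φ).sob).1).val

section Transform

variable {B : H1 ρ k → H1 1 1}

lemma transform_norm_le (h : Admissible ρ k γ) (hP : KernelPair (rFn ρ k γ) K K₁ K₂ L L₁ L₂ C)
    (hM : Maj (rFn ρ k γ) C c)
    (hB : ∀ φ f f', Rep φ f f' → Rep (B φ) (fwdExt L f) (fwdExtD L L₁ f f')) (φ : H1 ρ k) :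
    ‖B φ‖ ≤ √(2 + 8 * opBound (rFn ρ k γ) C c) * ‖φ‖ := by
  obtain ⟨w, w', hw⟩ := h.exists_rep φ
  have h0 : 0 ≤ 2 + 8 * opBound (rFn ρ k γ) C c := by
    have := opBound_nonneg hM
    linarith
  refine abs_le_of_sq_le_sq' ?_ (by positivity) |>.2
  rw [mul_pow, Real.sq_sqrt h0, hw.norm_sq h]
  exact ((hB _ _ _ hw).norm_sq admissible_one).le.trans (hP.regL.fwdExt_sob hM hw.sob).2

lemma transform_opTinv (h : Admissible ρ k γ) (hP : KernelPair (rFn ρ k γ) K K₁ K₂ L L₁ L₂ C)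
    (hB : ∀ φ f f', Rep φ f f' → Rep (B φ) (fwdExt L f) (fwdExtD L L₁ f f')) (φ : H1 ρ k) :
    ⇑(valL (B φ)) =ᵐ[volume] opTinv ρ k γ (valL φ) := by
  obtain ⟨w, w', hw⟩ := h.exists_rep φ
  have h1 := (hB _ _ _ hw).val
  rw [opS_one] at h1
  refine h1.trans ?_
  have h2 := hw.opSinv_val h
  filter_upwards [h2] with l hl
  rw [opTinv, opKer, hl, fwdExt, fwdOp]
  congr 1
  refine integral_congr_ae ?_
  filter_upwards [self_mem_ae_restrict measurableSet_Ioi, ae_restrict_of_ae h2] with ξ hξ e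
  rw [e, hP.kerL_eq _ _ (abs_nonneg l) (le_of_lt hξ)]

lemma opT_transform (h : Admissible ρ k γ) (hP : KernelPair (rFn ρ k γ) K K₁ K₂ L L₁ L₂ C)
    (hM : Maj (rFn ρ k γ) C c)
    (hB : ∀ φ f f', Rep φ f f' → Rep (B φ) (fwdExt L f) (fwdExtD L L₁ f f')) {φ : H1 ρ k}
    (hφ : IsEven φ) : opT ρ k γ (valL (B φ)) =ᵐ[volume] valL φ := by
  obtain ⟨w, w', hw⟩ := h.exists_rep φ
  have he := (hw.isEven_iff h).1 hφ
  have h1 := (hB _ _ _ hw).val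
  rw [opS_one] at h1
  refine EventuallyEq.trans ?_ hw.val.symm
  refine h.opS_congr ?_
  have e := hP.fwdExt_inverse hM he hw.sob.continuous (hw.sob.memLp.restrict _)
  filter_upwards [h1] with l hl
  rw [← congrFun e l, opKer, hl]
  conv_rhs => rw [fwdExt, fwdOp]
  congr 1
  refine integral_congr_ae ?_
  filter_upwards [self_mem_ae_restrict measurableSet_Ioi, ae_restrict_of_ae h1] with ξ hξ e
  rw [e, hP.kerK_eq _ _ (abs_nonneg l) (le_of_lt hξ)]

/-- The control of the transformed system in terms of representatives. -/
lemma control110_eq (h : Admissible ρ k γ) (hP : KernelPair (rFn ρ k γ) K K₁ K₂ L L₁ L₂ C)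
    {u : ℝ → ℝ} {W : ℝ → H1 ρ k} {t : ℝ} {w w' : ℝ → ℝ} (hw : Rep (W t) w w') :
    control110 ρ k γ u W t = c0 ρ k * u t +
      (1 / 2 * w 0 * (∫ ξ in Ioi 0, rFn ρ k γ ξ) + ∫ x in Ioi 0, L₁ 0 x * w x) := by
  have e : ∫ x in Ioi (0 : ℝ), d1zero (kerL (rFn ρ k γ)) x * opSinv ρ k (valL (W t)) x =
      ∫ x in Ioi 0, L₁ 0 x * w x := by
    refine integral_congr_ae ?_
    filter_upwards [hP.regL.d1zero_ae hP.kerL_eq, ae_restrict_of_ae (hw.opSinv_val h)] with x h1 h2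
    rw [h1, h2]
  rw [control110, e, mul_assoc (1 / 2 : ℝ), hw.contRep_zero h]
  ring

/-- In the dual spaces the transform is composition with the bounded map `A` given by `1+L*`, so (1)
tested with `Aφ` is an equation for `Z` tested with `φ`. By `line_intertwining` the potential
disappears and the boundary term joins `c₀u` to form `u¹¹⁰`. -/
lemma transform_isSolution (h : Admissible ρ k γ)
    (hP : KernelPair (rFn ρ k γ) K K₁ K₂ L L₁ L₂ C) (hM : Maj (rFn ρ k γ) C c)
    (hB : ∀ φ f f', Rep φ f f' → Rep (B φ) (fwdExt L f) (fwdExtD L L₁ f f'))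
    {T : ℝ} (hT : 0 ≤ T) {u : ℝ → ℝ} {W0 : H1 ρ k} {W : ℝ → H1 ρ k}
    (hW : IsSolution ρ k γ T u W0 W) :
    IsSolution 1 1 0 T (control110 ρ k γ u W) (B W0) (fun t => B (W t)) := by
  obtain ⟨A, hA⟩ := exists_adjoint h hP hM
  obtain ⟨Q, D, hQ, hQd, hQv⟩ := exists_dual_map A
  -- Here evenness of `W(·,t)` is needed: the duality identity on the line is for even `w` and
  -- arbitrary test functions.
  have hdual : ∀ t ∈ Icc 0 T, toNeg (B (W t)) = Q (toNeg (W t)) := fun t ht => by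
    obtain ⟨w, w', hw, hwe, -⟩ := Rep.exists_even h (hW.even t ht)
    ext φ
    obtain ⟨f, f', hf⟩ := admissible_one.exists_rep φ
    rw [(hB _ _ _ hw).toNeg_apply admissible_one hf, hQ, hw.toNeg_apply h (hA _ _ _ hf)]
    exact hP.line_duality hM hwe hw.sob hf.sob
  refine ⟨fun t ht => ?_, by rw [hW.init], ?_, ?_⟩
  · obtain ⟨w, w', hw, hwe, -⟩ := Rep.exists_even h (hW.even t ht)
    exact ((hB _ _ _ hw).isEven_iff admissible_one).2 (fwdExt_neg hwe)
  · refine absCont_of_dist_le (D := D) hW.absCont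
      fun s hs t ht => ?_
    rw [uIcc_of_le hT] at hs ht
    rw [hdual s hs, hdual t ht]
    exact hQd _ _
  · filter_upwards [hW.eqn, self_mem_ae_restrict measurableSet_Ioo] with t ⟨V, hV, he⟩ ht
    obtain ⟨w, w', hw, hwe, hwo⟩ := Rep.exists_even h (hW.even t (Ioo_subset_Icc_self ht))
    refine ⟨Q V, ?_, fun φ => ?_⟩
    · refine hQv (fun s => toNeg (W s)) (fun s => toNeg (B (W s))) V t hV ?_
      filter_upwards [Ioo_mem_nhds ht.1 ht.2] with s hs
      exact hdual s (Ioo_subset_Icc_self hs)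
    · obtain ⟨f, f', hf⟩ := admissible_one.exists_rep φ
      rw [hQ, he,
        hw.rhs_eq h (hA _ _ _ hf), (hB _ _ _ hw).rhs_eq admissible_one hf, rFn_one, c0_one,
        hP.control110_eq h hw]
      have e := hP.line_intertwining hM hwe hwo hw.sob hf.sob
      have e4 : bwdExt L (evenPart f) 0 = f 0 := by
        rw [bwdExt_of_nonneg _ _ le_rfl, bwdOp, intervalIntegral.integral_same, evenPart, neg_zero]
        ring
      rw [e4]
      simp only [Pi.zero_apply, zero_mul, integral_zero]
      linarith

end Transform

end KernelPair

/-! ### The heat kernel -/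

/-- The space derivative of the heat kernel. -/
def heatKer₁ (t x : ℝ) : ℝ := -(x / (2 * t)) * heatKer t x

/-- The second space derivative of the heat kernel. -/
def heatKer₂ (t x : ℝ) : ℝ := (x ^ 2 / (4 * t ^ 2) - 1 / (2 * t)) * heatKer t x

/-- The third space derivative of the heat kernel. -/
def heatKer₃ (t x : ℝ) : ℝ := (3 * x / (4 * t ^ 2) - x ^ 3 / (8 * t ^ 3)) * heatKer t x

lemma hasDerivAt_heatKer_space {t : ℝ} (ht : 0 < t) (x : ℝ) :
    HasDerivAt (heatKer t) (heatKer₁ t x) x := by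
  have h1 : HasDerivAt (fun x : ℝ => -(x ^ 2 / (4 * t))) (-(2 * x / (4 * t))) x := by
    have := (((hasDerivAt_id' x).pow 2).div_const (4 * t)).fun_neg
    refine this.congr_deriv ?_
    norm_num
  refine (h1.exp.div_const (√(4 * Real.pi * t))).congr_deriv ?_
  rw [heatKer₁, heatKer]
  field_simp
  ring

lemma hasDerivAt_heatKer₁_space {t : ℝ} (ht : 0 < t) (x : ℝ) :
    HasDerivAt (heatKer₁ t) (heatKer₂ t x) x := by
  have h1 := (((hasDerivAt_id' x).div_const (2 * t)).fun_neg).mul (hasDerivAt_heatKer_space ht x)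
  refine h1.congr_deriv ?_
  rw [heatKer₂, heatKer₁]
  field_simp
  ring

lemma hasDerivAt_heatKer_time {t : ℝ} (ht : 0 < t) (x : ℝ) :
    HasDerivAt (fun t => heatKer t x) (heatKer₂ t x) t := by
  have hp := Real.pi_pos
  have h4 : 0 < 4 * Real.pi * t := by positivity
  have h1 : HasDerivAt (fun t : ℝ => -(x ^ 2 / (4 * t))) (x ^ 2 / (4 * t ^ 2)) t := by
    have := ((hasDerivAt_const t (x ^ 2)).fun_div ((hasDerivAt_id' t).const_mul 4)
      (by positivity)).fun_neg
    refine this.congr_deriv ?_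
    field_simp
    ring
  have h2 : HasDerivAt (fun t : ℝ => √(4 * Real.pi * t)) (4 * Real.pi / (2 * √(4 * Real.pi * t))) t := by
    have := ((hasDerivAt_id' t).const_mul (4 * Real.pi)).sqrt h4.ne'
    refine this.congr_deriv ?_
    rw [mul_one]
  have hs : √(4 * Real.pi * t) ^ 2 = 4 * Real.pi * t := Real.sq_sqrt h4.le
  have hs0 : √(4 * Real.pi * t) ≠ 0 := (Real.sqrt_pos.2 h4).ne'
  refine (h1.exp.fun_div h2 hs0).congr_deriv ?_
  rw [heatKer₂, heatKer]
  have e : 4 * Real.pi / (2 * √(4 * Real.pi * t)) = √(4 * Real.pi * t) / (2 * t) := by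
    rw [div_eq_div_iff (by positivity) (by positivity)]
    linear_combination (-2) * hs
  rw [e, hs]
  field_simp
  rw [show 4 * t * Real.pi = 4 * Real.pi * t by ring, hs]

lemma hasDerivAt_heatKer₁_time {t : ℝ} (ht : 0 < t) (x : ℝ) :
    HasDerivAt (fun t => heatKer₁ t x) (heatKer₃ t x) t := by
  have h1 : HasDerivAt (fun t : ℝ => -(x / (2 * t))) (x / (2 * t ^ 2)) t := by
    have := ((hasDerivAt_const t x).fun_div ((hasDerivAt_id' t).const_mul 2)
      (by positivity)).fun_neg
    refine this.congr_deriv ?_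
    field_simp
    ring
  refine (h1.fun_mul (hasDerivAt_heatKer_time ht x)).congr_deriv ?_
  rw [heatKer₃, heatKer₂]
  field_simp
  ring

lemma heatKer_neg (t x : ℝ) : heatKer t (-x) = heatKer t x := by
  rw [heatKer, heatKer, neg_sq]

lemma heatKer_nonneg (t x : ℝ) : 0 ≤ heatKer t x :=
  div_nonneg (Real.exp_nonneg _) (Real.sqrt_nonneg _)

lemma heatKer_pos {t : ℝ} (ht : 0 < t) (x : ℝ) : 0 < heatKer t x :=
  div_pos (Real.exp_pos _) (Real.sqrt_pos.2 (mul_pos (mul_pos four_pos Real.pi_pos) ht))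

/-- The Gaussian majorant on a time interval bounded by `b`. -/
def heatMaj (b x : ℝ) : ℝ := Real.exp (-(1 / (8 * b)) * x ^ 2)

lemma continuous_heatMaj (b : ℝ) : Continuous (heatMaj b) := by
  unfold heatMaj
  fun_prop

lemma memLp_heatMaj {b : ℝ} (hb : 0 < b) : MemLp (heatMaj b) 2 := by
  rw [memLp_two_iff_integrable_sq (continuous_heatMaj b).aestronglyMeasurable]
  refine (integrable_exp_neg_mul_sq (b := 1 / (4 * b)) (by positivity)).congr
    (Eventually.of_forall fun x => ?_)
  simp only [heatMaj]
  rw [← Real.exp_nat_mul]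
  congr 1
  push_cast
  field_simp
  ring

/-- For `t ≤ b` the Gaussian is at most `exp(-x²/(4b))` up to the normalization at `t = a`. Half of
this exponent absorbs the polynomial factors of the derivatives, the other half is the majorant. -/
lemma exists_heatKer_bound {a b : ℝ} (ha : 0 < a) (hab : a ≤ b) :
    ∃ D, 0 ≤ D ∧ ∀ t ∈ Icc a b, ∀ x, |heatKer t x| ≤ D * heatMaj b x ∧
      |heatKer₁ t x| ≤ D * heatMaj b x ∧ |heatKer₂ t x| ≤ D * heatMaj b x ∧
      |heatKer₃ t x| ≤ D * heatMaj b x := by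
  have hb : 0 < b := ha.trans_le hab
  have hp := Real.pi_pos
  set s := √(4 * Real.pi * a) with hs
  have hs0 : 0 < s := Real.sqrt_pos.2 (by positivity)
  -- With `y = x²/(8b)`, `x⁴ = 128b²·(y²/2)` and `y²/2 ≤ eʸ`.
  set P := 1 + 128 * b ^ 2 with hP
  -- The sum of the absolute coefficients in the kernel and its three derivative formulas at `t =
  -- a`, where they are largest; each monomial is at most `1 + x⁴`.
  set Q := 1 + 1 / (2 * a) + (1 / (4 * a ^ 2) + 1 / (2 * a)) +
    (3 / (4 * a ^ 2) + 1 / (8 * a ^ 3)) with hQ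
  have hpoly : ∀ x : ℝ, 1 + x ^ 4 ≤ P * Real.exp (x ^ 2 / (8 * b)) := fun x => by
    have h1 := Real.quadratic_le_exp_of_nonneg (x := x ^ 2 / (8 * b)) (by positivity)
    have h2 : x ^ 4 = 128 * b ^ 2 * ((x ^ 2 / (8 * b)) ^ 2 / 2) := by
      field_simp
      ring
    have h3 : 0 ≤ x ^ 2 / (8 * b) := by positivity
    have h4 : 0 ≤ (x ^ 2 / (8 * b)) ^ 2 / 2 := by positivity
    have h5 : 1 ≤ Real.exp (x ^ 2 / (8 * b)) := Real.one_le_exp h3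
    rw [h2, hP, add_mul, one_mul]
    exact add_le_add h5 (mul_le_mul_of_nonneg_left (by linarith) (by positivity))
  have hker : ∀ t ∈ Icc a b, ∀ x, (1 + x ^ 4) * heatKer t x ≤ P / s * heatMaj b x := by
    intro t ht x
    have ht0 : 0 < t := ha.trans_le ht.1
    have h1 : heatKer t x ≤ Real.exp (-(x ^ 2 / (4 * b))) / s := by
      rw [heatKer]
      refine div_le_div₀ (Real.exp_nonneg _) (Real.exp_le_exp.2 (neg_le_neg ?_)) hs0
        (Real.sqrt_le_sqrt ?_)
      · exact div_le_div_of_nonneg_left (sq_nonneg x) (by positivity) (by linarith [ht.2])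
      · exact mul_le_mul_of_nonneg_left ht.1 (by positivity)
    refine (mul_le_mul (hpoly x) h1 (heatKer_nonneg t x) (by positivity)).trans (le_of_eq ?_)
    have e : Real.exp (x ^ 2 / (8 * b)) * Real.exp (-(x ^ 2 / (4 * b))) = heatMaj b x := by
      rw [← Real.exp_add, heatMaj]
      congr 1
      field_simp
      ring
    rw [← e]
    ring
  have h128 : 0 ≤ P / s := by positivity
  refine ⟨Q * (P / s), by positivity, fun t ht x => ?_⟩
  have ht0 : 0 < t := ha.trans_le ht.1
  have hk := hker t ht x
  have hk0 := heatKer_nonneg t x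
  have key : ∀ q : ℝ, |q| ≤ Q * (1 + x ^ 4) → |q * heatKer t x| ≤ Q * (P / s) * heatMaj b x := by
    intro q hq
    rw [abs_mul, abs_of_nonneg hk0, mul_assoc]
    refine (mul_le_mul_of_nonneg_right hq hk0).trans ?_
    rw [mul_assoc]
    exact mul_le_mul_of_nonneg_left hk (by positivity)
  have x1 : |x| ≤ 1 + x ^ 4 := abs_le.2 ⟨by nlinarith [sq_nonneg (x ^ 2 - 1), sq_nonneg (x + 1)],
    by nlinarith [sq_nonneg (x ^ 2 - 1), sq_nonneg (x - 1)]⟩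
  have x2 : x ^ 2 ≤ 1 + x ^ 4 := by nlinarith [sq_nonneg (x ^ 2 - 1)]
  have x3 : |x| ^ 3 ≤ 1 + x ^ 4 := by
    have : x ^ 4 = |x| ^ 4 := by rw [pow_abs, abs_of_nonneg (by positivity)]
    rw [this]
    rcases le_total |x| 1 with h | h
    · have := pow_le_one₀ (n := 3) (abs_nonneg x) h
      have := pow_nonneg (abs_nonneg x) 4
      linarith
    · have := pow_le_pow_right₀ h (show 3 ≤ 4 by norm_num)
      linarith
  have x0 : 1 ≤ 1 + x ^ 4 := by nlinarith [sq_nonneg (x ^ 2)]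
  have i1 : 1 / t ≤ 1 / a := one_div_le_one_div_of_le ha ht.1
  have d1 : 1 / (2 * t) ≤ 1 / (2 * a) := one_div_le_one_div_of_le (by positivity) (by linarith [ht.1])
  have d2 : 1 / (4 * t ^ 2) ≤ 1 / (4 * a ^ 2) := one_div_le_one_div_of_le (by positivity)
    (mul_le_mul_of_nonneg_left (pow_le_pow_left₀ ha.le ht.1 2) (by norm_num))
  have d3 : 1 / (8 * t ^ 3) ≤ 1 / (8 * a ^ 3) := one_div_le_one_div_of_le (by positivity)
    (mul_le_mul_of_nonneg_left (pow_le_pow_left₀ ha.le ht.1 3) (by norm_num))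
  have p1 : 0 ≤ 1 / (2 * t) := by positivity
  have p2 : 0 ≤ 1 / (4 * t ^ 2) := by positivity
  have p3 : 0 ≤ 1 / (8 * t ^ 3) := by positivity
  have m1 : 1 / (2 * t) * |x| ≤ 1 / (2 * a) * (1 + x ^ 4) := mul_le_mul d1 x1 (abs_nonneg _) (p1.trans d1)
  have m1' : 1 / (2 * t) * 1 ≤ 1 / (2 * a) * (1 + x ^ 4) := mul_le_mul d1 x0 zero_le_one (p1.trans d1)
  have m2 : 1 / (4 * t ^ 2) * x ^ 2 ≤ 1 / (4 * a ^ 2) * (1 + x ^ 4) :=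
    mul_le_mul d2 x2 (sq_nonneg _) (p2.trans d2)
  have m2' : 1 / (4 * t ^ 2) * |x| ≤ 1 / (4 * a ^ 2) * (1 + x ^ 4) :=
    mul_le_mul d2 x1 (abs_nonneg _) (p2.trans d2)
  have m3 : 1 / (8 * t ^ 3) * |x| ^ 3 ≤ 1 / (8 * a ^ 3) * (1 + x ^ 4) :=
    mul_le_mul d3 x3 (by positivity) (p3.trans d3)
  have n1 : 0 ≤ 1 / (2 * a) * (1 + x ^ 4) := by positivity
  have n2 : 0 ≤ 1 / (4 * a ^ 2) * (1 + x ^ 4) := by positivity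
  have n3 : 0 ≤ 1 / (8 * a ^ 3) * (1 + x ^ 4) := by positivity
  have eQ : Q * (1 + x ^ 4) = (1 + x ^ 4) + 1 / (2 * a) * (1 + x ^ 4) +
      (1 / (4 * a ^ 2) * (1 + x ^ 4) + 1 / (2 * a) * (1 + x ^ 4)) +
      (3 * (1 / (4 * a ^ 2) * (1 + x ^ 4)) + 1 / (8 * a ^ 3) * (1 + x ^ 4)) := by
    rw [hQ]
    ring
  refine ⟨?_, key _ ?_, key _ ?_, key _ ?_⟩
  · have := key 1 (by rw [abs_one, eQ]; linarith)
    rwa [one_mul] at this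
  · rw [abs_neg, abs_div, abs_of_pos (show 0 < 2 * t by positivity), eQ, div_eq_mul_one_div, mul_comm]
    linarith
  · rw [eQ]
    refine (abs_sub _ _).trans ?_
    rw [abs_of_nonneg (by positivity), abs_of_nonneg p1, div_eq_mul_one_div, mul_comm]
    linarith
  · rw [eQ]
    refine (abs_sub _ _).trans ?_
    rw [abs_div, abs_div, abs_mul, abs_pow, abs_of_pos (show (0 : ℝ) < 3 by norm_num),
      abs_of_pos (show 0 < 4 * t ^ 2 by positivity), abs_of_pos (show 0 < 8 * t ^ 3 by positivity),
      div_eq_mul_one_div, div_eq_mul_one_div (|x| ^ 3)]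
    nlinarith

lemma continuous_heatKer {t : ℝ} (ht : 0 < t) : Continuous (heatKer t) :=
  continuous_iff_continuousAt.2 fun x => (hasDerivAt_heatKer_space ht x).continuousAt

lemma continuous_heatKer₁ {t : ℝ} (ht : 0 < t) : Continuous (heatKer₁ t) :=
  continuous_iff_continuousAt.2 fun x => (hasDerivAt_heatKer₁_space ht x).continuousAt

lemma continuous_heatKer₂ {t : ℝ} (ht : 0 < t) : Continuous (heatKer₂ t) := by
  have := continuous_heatKer ht
  unfold heatKer₂
  fun_prop

lemma heatKer_sob {t : ℝ} (ht : 0 < t) :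
    Sob (heatKer t) (heatKer₁ t) ∧ Sob (heatKer₁ t) (heatKer₂ t) := by
  obtain ⟨D, hD, h⟩ := exists_heatKer_bound ht le_rfl
  have hm := (memLp_heatMaj ht).const_mul D
  have hb := fun x => h t ⟨le_rfl, le_rfl⟩ x
  have m1 : MemLp (heatKer₁ t) 2 := hm.mono' (continuous_heatKer₁ ht).aestronglyMeasurable
    (Eventually.of_forall fun x => (hb x).2.1)
  exact ⟨⟨IsPrim.of_hasDerivAt (hasDerivAt_heatKer_space ht) (continuous_heatKer₁ ht),
    hm.mono' (continuous_heatKer ht).aestronglyMeasurable (Eventually.of_forall fun x => (hb x).1),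
    m1⟩, IsPrim.of_hasDerivAt (hasDerivAt_heatKer₁_space ht) (continuous_heatKer₂ ht), m1,
    hm.mono' (continuous_heatKer₂ ht).aestronglyMeasurable
      (Eventually.of_forall fun x => (hb x).2.2.1)⟩

lemma memLp_comp_sub {f : ℝ → ℝ} (hf : MemLp f 2) (x : ℝ) : MemLp (fun y => f (x - y)) 2 :=
  hf.comp_measurePreserving (Measure.measurePreserving_sub_left volume x)

lemma heatKer_sob_sub {t : ℝ} (ht : 0 < t) (x : ℝ) :
    Sob (fun y => heatKer t (x - y)) (fun y => -heatKer₁ t (x - y)) ∧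
      Sob (fun y => -heatKer₁ t (x - y)) (fun y => heatKer₂ t (x - y)) := by
  obtain ⟨h1, h2⟩ := heatKer_sob ht
  have hs : ∀ y : ℝ, HasDerivAt (fun y => x - y) (-1) y := fun y => (hasDerivAt_id' y).const_sub x
  have m1 : MemLp (fun y => -heatKer₁ t (x - y)) 2 := (memLp_comp_sub h1.memLp_deriv x).neg
  have hc : Continuous fun y => x - y := by fun_prop
  refine ⟨⟨IsPrim.of_hasDerivAt (fun y => ?_) ((continuous_heatKer₁ ht).comp hc).neg,
    memLp_comp_sub h1.memLp x, m1⟩, ⟨IsPrim.of_hasDerivAt (fun y => ?_)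
    ((continuous_heatKer₂ ht).comp hc), m1, memLp_comp_sub h2.memLp_deriv x⟩⟩
  · refine ((hasDerivAt_heatKer_space ht (x - y)).comp y (hs y)).congr_deriv ?_
    ring
  · refine ((hasDerivAt_heatKer₁_space ht (x - y)).comp y (hs y)).fun_neg.congr_deriv ?_
    ring

/-! ### Testing a solution with the heat kernel -/

lemma absCont_of_dist_le_add {X Y Y' : Type*} [PseudoMetricSpace X] [PseudoMetricSpace Y]
    [PseudoMetricSpace Y'] {f : ℝ → X} {f' : ℝ → Y'} {g : ℝ → Y} {a b D D' : ℝ}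
    (hf : AbsolutelyContinuousOnInterval f a b) (hf' : AbsolutelyContinuousOnInterval f' a b)
    (h : ∀ s ∈ uIcc a b, ∀ t ∈ uIcc a b,
      dist (g s) (g t) ≤ D * dist (f s) (f t) + D' * dist (f' s) (f' t)) :
    AbsolutelyContinuousOnInterval g a b := by
  unfold AbsolutelyContinuousOnInterval at hf hf' ⊢
  refine squeeze_zero' ?_ ?_ (by simpa using (hf.const_mul D).add (hf'.const_mul D'))
  · exact Eventually.of_forall fun _ => Finset.sum_nonneg fun i hi => dist_nonneg
  rw [eventually_inf_principal]
  filter_upwards with I hI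
  rw [Finset.mul_sum, Finset.mul_sum, ← Finset.sum_add_distrib]
  refine Finset.sum_le_sum fun i hi => ?_
  simp only [AbsolutelyContinuousOnInterval.disjWithin, mem_ofPred_eq] at hI
  exact h _ (hI.left i hi).left _ (hI.left i hi).right

section Pairing

variable {E : Type*} [NormedAddCommGroup E] [NormedSpace ℝ E] {N : ℝ → StrongDual ℝ E} {e : ℝ → E}

lemma absCont_pairing {a b D : ℝ} (hN : AbsolutelyContinuousOnInterval N a b)
    (he : ∀ s ∈ uIcc a b, ∀ t ∈ uIcc a b, ‖e s - e t‖ ≤ D * |s - t|) :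
    AbsolutelyContinuousOnInterval (fun s => N s (e s)) a b := by
  obtain ⟨B, hB⟩ := hN.exists_bound
  have hid : AbsolutelyContinuousOnInterval (fun s : ℝ => s) a b :=
    (contDiff_id.contDiffOn).absolutelyContinuousOnInterval
  have hB0 : 0 ≤ B := (norm_nonneg _).trans (hB a left_mem_uIcc)
  have hE : ∀ s ∈ uIcc a b, ‖e s‖ ≤ ‖e a‖ + |D| * |b - a| := fun s hs => by
    have h1 := he s hs a left_mem_uIcc
    have h2 : ‖e s‖ ≤ ‖e a‖ + ‖e s - e a‖ := by
      have := norm_add_le (e a) (e s - e a)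
      rwa [add_sub_cancel] at this
    have h3 : |s - a| ≤ |b - a| := by
      have := abs_sub_left_of_mem_uIcc hs
      exact this
    have h4 : D * |s - a| ≤ |D| * |b - a| :=
      mul_le_mul (le_abs_self D) h3 (abs_nonneg _) (abs_nonneg _)
    linarith
  refine absCont_of_dist_le_add (D := ‖e a‖ + |D| * |b - a|) (D' := B * |D|) hN hid
    fun s hs t ht => ?_
  rw [dist_eq_norm, dist_eq_norm, Real.dist_eq]
  have h1 : N s (e s) - N t (e t) = (N s - N t) (e s) + N t (e s - e t) := by
    rw [sub_apply, map_sub]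
    ring
  rw [h1]
  refine (norm_add_le _ _).trans (add_le_add ?_ ?_)
  · rw [mul_comm]
    exact ((N s - N t).le_opNorm _).trans (mul_le_mul_of_nonneg_left (hE s hs) (norm_nonneg _))
  · refine ((N t).le_opNorm _).trans ?_
    rw [mul_assoc]
    refine mul_le_mul (hB t ht) ((he s hs t ht).trans ?_) (norm_nonneg _) hB0
    exact mul_le_mul_of_nonneg_right (le_abs_self D) (abs_nonneg _)

/-- A product rule in which `e` need not be differentiable in norm: it suffices that `e` is
Lipschitz at `s` and differentiable when paired with the fixed functional `N s`. The cross term `(N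
t - N s)(e t - e s)` is quadratic in `t - s`. -/
lemma hasDerivAt_pairing {V : StrongDual ℝ E} {s d D : ℝ} (hN : HasDerivAt N V s)
    (he : ∀ᶠ t in 𝓝 s, ‖e t - e s‖ ≤ D * |t - s|) (hd : HasDerivAt (fun t => N s (e t)) d s) :
    HasDerivAt (fun t => N t (e t)) (V (e s) + d) s := by
  have h1 : HasDerivAt (fun t => N t (e s)) (V (e s)) s := by
    have := hN.clm_apply (hasDerivAt_const s (e s))
    simpa using this
  have h2 : HasDerivAt (fun t => (N t - N s) (e t - e s)) 0 s := by
    rw [hasDerivAt_iff_isLittleO]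
    simp only [sub_self, map_zero, sub_zero, smul_zero]
    have a1 : (fun t => N t - N s) =O[𝓝 s] fun t => t - s := hN.isBigO_sub
    have a2 : (fun t => e t - e s) =O[𝓝 s] fun t => t - s :=
      Asymptotics.IsBigO.of_bound D (he.mono fun t ht => by rwa [Real.norm_eq_abs])
    have a3 : (fun t => (N t - N s) (e t - e s)) =O[𝓝 s] fun t => ‖N t - N s‖ * ‖e t - e s‖ :=
      Asymptotics.IsBigO.of_bound 1 (Eventually.of_forall fun t => by
        rw [one_mul, norm_mul, norm_norm, norm_norm]
        exact (N t - N s).le_opNorm _)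
    refine (a3.trans (a1.norm_left.mul a2.norm_left)).trans_isLittleO ?_
    have a4 : (fun t : ℝ => t - s) =o[𝓝 s] fun _ => (1 : ℝ) := by
      rw [Asymptotics.isLittleO_one_iff]
      have : Tendsto (fun t : ℝ => t - s) (𝓝 s) (𝓝 (s - s)) :=
        (continuous_id.sub continuous_const).tendsto s
      rwa [sub_self] at this
    have := a4.mul_isBigO (Asymptotics.isBigO_refl (fun t : ℝ => t - s) (𝓝 s))
    simpa only [one_mul] using this
  have h3 := (h1.fun_add h2).fun_add hd
  have h4 := h3.sub_const (N s (e s))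
  refine (h4.congr_deriv (by ring)).congr_of_eventuallyEq (Eventually.of_forall fun t => ?_)
  simp only [sub_apply, map_sub]
  ring

end Pairing

lemma H1.absCont_pairing {ρ k : ℝ → ℝ} {N : ℝ → HNeg ρ k} {e : ℝ → H1 ρ k} {a b D : ℝ}
    (hN : AbsolutelyContinuousOnInterval N a b)
    (he : ∀ s ∈ uIcc a b, ∀ t ∈ uIcc a b, ‖e s - e t‖ ≤ D * |s - t|) :
    AbsolutelyContinuousOnInterval (fun s => N s (e s)) a b :=
  @NeumannHeat.absCont_pairing (H1 ρ k) _ _ N e a b D hN he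

lemma H1.hasDerivAt_pairing {ρ k : ℝ → ℝ} {N : ℝ → HNeg ρ k} {e : ℝ → H1 ρ k} {V : HNeg ρ k}
    {s d D : ℝ} (hN : HasDerivAt N V s) (he : ∀ᶠ t in 𝓝 s, ‖e t - e s‖ ≤ D * |t - s|)
    (hd : HasDerivAt (fun t => N s (e t)) d s) :
    HasDerivAt (fun t => N t (e t)) (V (e s) + d) s :=
  @NeumannHeat.hasDerivAt_pairing (H1 ρ k) _ _ N e V s d D hN he hd

/-! ### The regularized Duhamel formula -/

lemma heatKer_lipschitz {a b : ℝ} (ha : 0 < a) (hab : a ≤ b) :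
    ∃ D, 0 ≤ D ∧ ∀ τ ∈ Icc a b, ∀ σ ∈ Icc a b, ∀ x,
      |heatKer τ x - heatKer σ x| ≤ D * heatMaj b x * |τ - σ| ∧
      |heatKer₁ τ x - heatKer₁ σ x| ≤ D * heatMaj b x * |τ - σ| := by
  obtain ⟨D, hD, h⟩ := exists_heatKer_bound ha hab
  refine ⟨D, hD, fun τ hτ σ hσ x => ⟨?_, ?_⟩⟩
  · exact (convex_Icc a b).norm_image_sub_le_of_norm_hasDerivWithin_le
      (fun t ht => (hasDerivAt_heatKer_time (ha.trans_le ht.1) x).hasDerivWithinAt)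
      (fun t ht => (h t ht x).2.2.1) hσ hτ
  · exact (convex_Icc a b).norm_image_sub_le_of_norm_hasDerivWithin_le
      (fun t ht => (hasDerivAt_heatKer₁_time (ha.trans_le ht.1) x).hasDerivWithinAt)
      (fun t ht => (h t ht x).2.2.2) hσ hτ

lemma heatKer_norm_lipschitz {a b : ℝ} (ha : 0 < a) (hab : a ≤ b) (x : ℝ) {e : ℝ → H1 1 1}
    (he : ∀ τ, 0 < τ → Rep (e τ) (fun y => heatKer τ (x - y)) (fun y => -heatKer₁ τ (x - y))) :
    ∃ D, ∀ τ ∈ Icc a b, ∀ σ ∈ Icc a b, ‖e τ - e σ‖ ≤ D * |τ - σ| := by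
  obtain ⟨D, hD, h⟩ := heatKer_lipschitz ha hab
  have hb := ha.trans_le hab
  have hm := (memLp_comp_sub (memLp_heatMaj hb) x).const_mul D
  set I := ∫ y, (D * heatMaj b (x - y)) ^ 2 with hI
  have hI0 : 0 ≤ I := integral_nonneg fun _ => sq_nonneg _
  refine ⟨√(2 * I), fun τ hτ σ hσ => ?_⟩
  have hr := (he τ (ha.trans_le hτ.1)).sub admissible_one (he σ (ha.trans_le hσ.1))
  refine (abs_le_of_sq_le_sq' ?_ (by positivity)).2
  rw [hr.norm_sq admissible_one, mul_pow, Real.sq_sqrt (by positivity), sq_abs]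
  have key : ∀ F : ℝ → ℝ, (∀ y, |F y| ≤ D * heatMaj b (x - y) * |τ - σ|) →
      ∫ y, F y ^ 2 ≤ I * (τ - σ) ^ 2 := fun F hF => by
    rw [hI, ← integral_mul_const]
    refine integral_mono_of_nonneg (Eventually.of_forall fun y => sq_nonneg _)
      ((memLp_sq_integrable hm).mul_const _) (Eventually.of_forall fun y => ?_)
    have := pow_le_pow_left₀ (abs_nonneg _) (hF y) 2
    rwa [sq_abs, mul_pow, sq_abs] at this
  have k1 := key _ fun y => (h τ hτ σ hσ (x - y)).1
  have k2 := key (fun y => -heatKer₁ τ (x - y) - -heatKer₁ σ (x - y)) fun y => by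
    rw [neg_sub_neg, abs_sub_comm]
    exact (h τ hτ σ hσ (x - y)).2
  linarith

lemma hasDerivAt_integral_heatKer {f : ℝ → ℝ} (hf : MemLp f 2) {τ : ℝ} (hτ : 0 < τ) (x : ℝ) :
    HasDerivAt (fun τ => ∫ y, f y * heatKer τ (x - y)) (∫ y, f y * heatKer₂ τ (x - y)) τ := by
  have ha : 0 < τ / 2 := by positivity
  obtain ⟨D, hD, h⟩ := exists_heatKer_bound ha (show τ / 2 ≤ 2 * τ by linarith)
  have hm := (memLp_comp_sub (memLp_heatMaj (show 0 < 2 * τ by positivity)) x).const_mul D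
  have hs : Icc (τ / 2) (2 * τ) ∈ 𝓝 τ := Icc_mem_nhds (by linarith) (by linarith)
  have hc : Continuous fun y => x - y := by fun_prop
  refine (hasDerivAt_integral_of_dominated_loc_of_deriv_le
    (F := fun τ y => f y * heatKer τ (x - y)) (F' := fun τ y => f y * heatKer₂ τ (x - y))
    (bound := fun y => |f y| * (D * heatMaj (2 * τ) (x - y))) hs ?_ ?_ ?_ ?_ ?_ ?_).2
  · filter_upwards [hs] with t ht
    exact hf.aestronglyMeasurable.mul
      ((continuous_heatKer (ha.trans_le ht.1)).comp hc).aestronglyMeasurable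
  · exact memLp_mul_integrable hf (heatKer_sob_sub hτ x).1.memLp
  · exact hf.aestronglyMeasurable.mul ((continuous_heatKer₂ hτ).comp hc).aestronglyMeasurable
  · refine Eventually.of_forall fun y t ht => ?_
    rw [norm_mul]
    exact mul_le_mul_of_nonneg_left (h t ht _).2.2.1 (abs_nonneg _)
  · exact memLp_mul_integrable hf.abs hm
  · exact Eventually.of_forall fun y t ht =>
      (hasDerivAt_heatKer_time (ha.trans_le ht.1) _).const_mul _

/-- The Duhamel formula, tested with a heat kernel. -/
theorem IsSolution.duhamel {T : ℝ} {v : ℝ → ℝ} {Z0 : H1 1 1} {Z : ℝ → H1 1 1}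
    (hZ : IsSolution 1 1 0 T v Z0 Z) {z z' : ℝ → ℝ → ℝ} (hz : ∀ s, Rep (Z s) (z s) (z' s))
    {t ε : ℝ} (ht : 0 ≤ t) (htT : t ≤ T) (hε : 0 < ε) (x : ℝ) :
    IntervalIntegrable (fun s => -2 * v s * heatKer (t + ε - s) x) volume 0 t ∧
      (∫ y, z t y * heatKer ε (x - y)) - (∫ y, z 0 y * heatKer (t + ε) (x - y)) =
        ∫ s in (0 : ℝ)..t, -2 * v s * heatKer (t + ε - s) x := by
  -- The element of `H¹` given by the heat kernel at time `τ`. For `τ ≤ 0` the value is an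
  -- irrelevant zero, since only times between `ε` and `t + ε` occur.
  choose e he using fun τ : ℝ => show ∃ φ : H1 1 1, 0 < τ →
      Rep φ (fun y => heatKer τ (x - y)) (fun y => -heatKer₁ τ (x - y)) from
    (lt_or_ge 0 τ).elim
      (fun h => ⟨_, fun _ => admissible_one.rep_ofSob (heatKer_sob_sub h x).1⟩)
      fun h => ⟨0, fun h' => absurd h' h.not_gt⟩
  have hpos : ∀ s ∈ Icc 0 t, 0 < t + ε - s := fun s hs => by linarith [hs.2]
  have hmem : ∀ s ∈ Icc 0 t, t + ε - s ∈ Icc ε (t + ε) := fun s hs =>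
    ⟨by linarith [hs.2], by linarith [hs.1]⟩
  obtain ⟨D, hD⟩ := heatKer_norm_lipschitz hε (show ε ≤ t + ε by linarith) x he
  have hD' : ∀ s ∈ Icc 0 t, ∀ s' ∈ Icc 0 t, ‖e (t + ε - s) - e (t + ε - s')‖ ≤ D * |s - s'| := by
    intro s hs s' hs'
    have := hD _ (hmem s hs) _ (hmem s' hs')
    rwa [sub_sub_sub_cancel_left, abs_sub_comm] at this
  have hval : ∀ s, ∀ τ, 0 < τ → toNeg (Z s) (e τ) = ∫ y, z s y * heatKer τ (x - y) := fun s τ hτ =>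
    (hz s).toNeg_apply admissible_one (he τ hτ)
  have hac : AbsolutelyContinuousOnInterval (fun s => toNeg (Z s) (e (t + ε - s))) 0 t := by
    refine H1.absCont_pairing (N := fun s => toNeg (Z s)) (e := fun s => e (t + ε - s)) (D := D)
      (hZ.absCont.mono ?_) ?_
    · rw [uIcc_of_le ht, uIcc_of_le (ht.trans htT)]
      exact Icc_subset_Icc_right htT
    · rw [uIcc_of_le ht]
      exact hD'
  have hder : ∀ᵐ s ∂volume.restrict (Ioo 0 t),
      HasDerivAt (fun s => toNeg (Z s) (e (t + ε - s))) (-2 * v s * heatKer (t + ε - s) x) s := by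
    filter_upwards [ae_restrict_of_ae_restrict_of_subset (Ioo_subset_Ioo_right htT) hZ.eqn,
      self_mem_ae_restrict measurableSet_Ioo] with s ⟨V, hV, hVe⟩ hs
    have hs' := Ioo_subset_Icc_self hs
    have hτ := hpos s hs'
    have hnear : Icc 0 t ∈ 𝓝 s := Icc_mem_nhds hs.1 hs.2
    have hd : HasDerivAt (fun s' => toNeg (Z s) (e (t + ε - s')))
        (-∫ y, z s y * heatKer₂ (t + ε - s) (x - y)) s := by
      have h1 := (hasDerivAt_integral_heatKer (hz s).sob.memLp hτ x).comp s
        ((hasDerivAt_id' s).const_sub (t + ε))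
      refine (h1.congr_deriv (by ring)).congr_of_eventuallyEq ?_
      filter_upwards [hnear] with s' h2
      exact hval s _ (hpos s' h2)
    have h3 := H1.hasDerivAt_pairing (e := fun s => e (t + ε - s)) (D := D) hV
      (by filter_upwards [hnear] with s' h2 using hD' s' h2 s hs') hd
    refine h3.congr_deriv ?_
    rw [hVe, (hz s).rhs_eq admissible_one (he _ hτ), rFn_one, c0_one]
    -- The kernel runs backwards in time and solves the heat equation, so the diffusion term cancels
    -- after one integration by parts and only the source at the origin remains.
    have h4 := (hz s).sob.integral_parts (heatKer_sob_sub hτ x).2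
    rw [integral_add (memLp_mul_integrable (hz s).sob.memLp_deriv (heatKer_sob_sub hτ x).2.memLp)
      (memLp_mul_integrable (hz s).sob.memLp (heatKer_sob_sub hτ x).2.memLp_deriv)] at h4
    simp only [Pi.zero_apply, zero_mul, integral_zero, sub_zero]
    linarith
  have hder' : ∀ᵐ s, s ∈ uIoc 0 t →
      deriv (fun s => toNeg (Z s) (e (t + ε - s))) s = -2 * v s * heatKer (t + ε - s) x := by
    rw [uIoc_of_le ht, ← ae_restrict_iff' measurableSet_Ioc, ← restrict_Ioo_eq_restrict_Ioc]
    exact hder.mono fun s hs => hs.deriv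
  refine ⟨hac.intervalIntegrable_deriv.congr_ae ?_, ?_⟩
  · exact (ae_restrict_iff' measurableSet_uIoc).2 hder'
  · rw [← intervalIntegral.integral_congr_ae hder', hac.integral_deriv_eq_sub, hval _ _ (by linarith),
      hval _ _ (by linarith)]
    ring_nf

/-- Nothing is assumed about the control in `IsSolution`. By Duhamel's formula `-2v` times a heat
kernel is almost everywhere the derivative of an absolutely continuous function; dividing by that
kernel, continuous and positive since its time is at least one, gives integrability of `v`. -/
lemma IsSolution.intervalIntegrable {T : ℝ} (hT : 0 ≤ T) {v : ℝ → ℝ} {Z0 : H1 1 1} {Z : ℝ → H1 1 1}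
    (hZ : IsSolution 1 1 0 T v Z0 Z) : IntervalIntegrable v volume 0 T := by
  choose z z' hz using fun s => admissible_one.exists_rep (Z s)
  have h1 := (hZ.duhamel hz hT le_rfl one_pos 0).1
  have hpos : ∀ s ∈ uIcc 0 T, 0 < T + 1 - s := fun s hs => by
    rw [uIcc_of_le hT] at hs
    linarith [hs.2]
  have h2 : ContinuousOn (fun s => (-2 * heatKer (T + 1 - s) 0)⁻¹) (uIcc 0 T) := fun s hs => by
    refine ContinuousAt.continuousWithinAt (ContinuousAt.inv₀ (continuousAt_const.mul ?_) ?_)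
    · exact (hasDerivAt_heatKer_time (hpos s hs) 0).continuousAt.comp (by fun_prop)
    · exact mul_ne_zero (by norm_num) (heatKer_pos (hpos s hs) 0).ne'
  refine (h1.mul_continuousOn h2).congr fun s hs => ?_
  have h3 := (heatKer_pos (hpos s (uIoc_subset_uIcc hs)) 0).ne'
  field_simp

/-! ### The limit of the regularized Duhamel formula -/

lemma heatKer_one_eq (z : ℝ) :
    heatKer 1 z = Real.exp (-(1 / 4) * z ^ 2) * (√(4 * Real.pi))⁻¹ := by
  rw [heatKer, mul_one, mul_one, div_eq_mul_inv]
  congr 2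
  ring

lemma integrable_heatKer_one : Integrable (heatKer 1) := by
  refine ((integrable_exp_neg_mul_sq (b := 1 / 4) (by norm_num)).mul_const
    (√(4 * Real.pi))⁻¹).congr (Eventually.of_forall fun z => (heatKer_one_eq z).symm)

lemma integral_heatKer_one : ∫ z, heatKer 1 z = 1 := by
  simp only [heatKer_one_eq]
  rw [integral_mul_const, integral_gaussian, show Real.pi / (1 / 4) = 4 * Real.pi by ring]
  exact mul_inv_cancel₀ (Real.sqrt_pos.2 (by positivity)).ne'

/-- The solution of the heat equation with initial value `f`. -/
def heatConv (f : ℝ → ℝ) (τ x : ℝ) : ℝ := ∫ z, heatKer 1 z * f (x - √τ * z)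

section HeatConv

variable {f : ℝ → ℝ} {B : ℝ}

/-- The substitution `y = x - √τ z` in the heat convolution gives a formula that is meaningful at `τ
= 0` and continuous there, so the initial value is attained without a separate limit. -/
lemma heatConv_zero (x : ℝ) : heatConv f 0 x = f x := by
  simp only [heatConv, Real.sqrt_zero, zero_mul, sub_zero]
  rw [integral_mul_const, integral_heatKer_one, one_mul]

lemma continuous_heatConv (hf : Continuous f) (hB : ∀ x, |f x| ≤ B) :
    Continuous fun p : ℝ × ℝ => heatConv f p.1 p.2 := by
  refine continuous_of_dominated (bound := fun z => heatKer 1 z * B)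
    (fun p => ((continuous_heatKer one_pos).mul (by fun_prop)).aestronglyMeasurable)
    (fun p => Eventually.of_forall fun z => ?_) (integrable_heatKer_one.mul_const B)
    (Eventually.of_forall fun z => by fun_prop)
  rw [norm_mul, Real.norm_of_nonneg (heatKer_nonneg 1 z)]
  exact mul_le_mul_of_nonneg_left (hB _) (heatKer_nonneg 1 z)

lemma abs_heatConv_le (hB : ∀ x, |f x| ≤ B) (τ x : ℝ) : |heatConv f τ x| ≤ B := by
  have := norm_integral_le_of_norm_le (integrable_heatKer_one.mul_const B)
    (f := fun z => heatKer 1 z * f (x - √τ * z)) (Eventually.of_forall fun z => by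
      rw [norm_mul, Real.norm_of_nonneg (heatKer_nonneg 1 z)]
      exact mul_le_mul_of_nonneg_left (hB _) (heatKer_nonneg 1 z))
  rwa [integral_mul_const, integral_heatKer_one, one_mul] at this

lemma integral_mul_heatKer {τ : ℝ} (hτ : 0 < τ) (x : ℝ) :
    ∫ y, f y * heatKer τ (x - y) = heatConv f τ x := by
  have hs := Real.sqrt_pos.2 hτ
  have hss := Real.sq_sqrt hτ.le
  have e1 : ∫ y, f y * heatKer τ (x - y) = ∫ y, f (x - y) * heatKer τ y := by
    have := integral_sub_left_eq_self (fun y => f y * heatKer τ (x - y)) volume x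
    simpa only [sub_sub_cancel] using this.symm
  have e2 := Measure.integral_comp_mul_left (fun y => f (x - y) * heatKer τ y) (√τ)
  have e3 : ∀ z, heatKer τ (√τ * z) = (√τ)⁻¹ * heatKer 1 z := fun z => by
    rw [heatKer, heatKer, mul_pow, hss, mul_one, mul_one, Real.sqrt_mul (by positivity) τ,
      show τ * z ^ 2 / (4 * τ) = z ^ 2 / 4 by field_simp]
    field_simp
  rw [e1, heatConv]
  have e4 : ∫ z, f (x - √τ * z) * heatKer τ (√τ * z) =
      (√τ)⁻¹ * ∫ z, heatKer 1 z * f (x - √τ * z) := by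
    rw [← integral_const_mul]
    congr 1
    funext z
    rw [e3]
    ring
  rw [e4, abs_of_pos (inv_pos.2 hs), smul_eq_mul] at e2
  exact (mul_left_cancel₀ (inv_pos.2 hs).ne' e2).symm

lemma continuous_integral_heatConv {κ : ℝ → ℝ} (hκ : IntegrableOn κ (Ioi 0)) (hf : Continuous f)
    (hB : ∀ x, |f x| ≤ B) : Continuous fun τ => ∫ x in Ioi 0, κ x * heatConv f τ x := by
  have hc := continuous_heatConv hf hB
  refine continuous_of_dominated (bound := fun x => |κ x| * B) (fun τ => ?_) (fun τ => ?_)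
    (hκ.abs.mul_const B) (Eventually.of_forall fun x => ?_)
  · exact hκ.aestronglyMeasurable.mul
      (hc.comp (by fun_prop : Continuous fun x => (τ, x))).aestronglyMeasurable
  · refine Eventually.of_forall fun x => ?_
    rw [norm_mul]
    exact mul_le_mul_of_nonneg_left (abs_heatConv_le hB τ x) (abs_nonneg _)
  · exact continuous_const.mul (hc.comp (by fun_prop : Continuous fun τ => (τ, x)))

end HeatConv

/-- The kernel `(πt)^{-1/2} (∫ κ(x) e^{-x²/4t} dx - m)`. -/
def voltKer (κ : ℝ → ℝ) (m t : ℝ) : ℝ :=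
  1 / √(Real.pi * t) * ((∫ x in Ioi (0 : ℝ), κ x * Real.exp (-(x ^ 2 / (4 * t)))) - m)

section VoltKer

variable {κ : ℝ → ℝ} {m : ℝ}

/-- `√(4πt) = 2√(πt)`: the prefactor of `P` is twice the heat kernel at the origin, matching the
factor `-2` of the source. -/
lemma voltKer_eq {t : ℝ} (ht : 0 < t) :
    voltKer κ m t = 2 * (∫ x in Ioi (0 : ℝ), κ x * heatKer t x) - 2 * m * heatKer t 0 := by
  have hp := Real.pi_pos
  have e0 : √(4 * Real.pi * t) = 2 * √(Real.pi * t) := by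
    rw [mul_assoc, Real.sqrt_mul (by norm_num), show (4 : ℝ) = 2 ^ 2 by norm_num,
      Real.sqrt_sq (by norm_num)]
  have hs : 0 < √(Real.pi * t) := Real.sqrt_pos.2 (by positivity)
  have e1 : ∫ x in Ioi (0 : ℝ), κ x * heatKer t x = (2 * √(Real.pi * t))⁻¹ *
      ∫ x in Ioi (0 : ℝ), κ x * Real.exp (-(x ^ 2 / (4 * t))) := by
    rw [← integral_const_mul]
    congr 1
    funext x
    rw [heatKer, e0]
    ring
  rw [e1, voltKer, heatKer, e0]
  norm_num
  field_simp

lemma abs_integral_exp_le (hκ : IntegrableOn κ (Ioi 0)) {t : ℝ} (ht : 0 < t) :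
    |∫ x in Ioi (0 : ℝ), κ x * Real.exp (-(x ^ 2 / (4 * t)))| ≤ ∫ x in Ioi 0, |κ x| := by
  refine norm_integral_le_of_norm_le (f := fun x => κ x * Real.exp (-(x ^ 2 / (4 * t)))) hκ.abs
    (Eventually.of_forall fun x => ?_)
  rw [norm_mul, Real.norm_of_nonneg (Real.exp_nonneg _)]
  refine mul_le_of_le_one_right (norm_nonneg _) (Real.exp_le_one_iff.2 ?_)
  rw [neg_nonpos]
  positivity

lemma abs_voltKer_le (hκ : IntegrableOn κ (Ioi 0)) {t : ℝ} (ht : 0 < t) :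
    |voltKer κ m t| ≤ ((∫ x in Ioi 0, |κ x|) + |m|) / √(Real.pi * t) := by
  have h0 : 0 ≤ 1 / √(Real.pi * t) := by positivity
  rw [voltKer, abs_mul, abs_of_nonneg h0, mul_comm]
  refine (mul_le_mul_of_nonneg_right ((abs_sub _ _).trans ?_) h0).trans_eq (mul_one_div _ _)
  exact add_le_add (abs_integral_exp_le hκ ht) le_rfl

lemma continuousOn_voltKer (hκ : IntegrableOn κ (Ioi 0)) : ContinuousOn (voltKer κ m) (Ioi 0) := by
  have hp := Real.pi_pos
  have h1 : ContinuousOn (fun t => ∫ x in Ioi (0 : ℝ), κ x * Real.exp (-(x ^ 2 / (4 * t)))) (Ioi 0) := by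
    refine continuousOn_of_dominated (bound := fun x => |κ x|) (fun t _ => ?_) (fun t ht => ?_) hκ.abs
      (Eventually.of_forall fun x => ?_)
    · exact hκ.aestronglyMeasurable.mul (by fun_prop : Continuous fun x : ℝ =>
        Real.exp (-(x ^ 2 / (4 * t)))).aestronglyMeasurable
    · refine Eventually.of_forall fun x => ?_
      rw [norm_mul, Real.norm_of_nonneg (Real.exp_nonneg _)]
      refine mul_le_of_le_one_right (norm_nonneg _) (Real.exp_le_one_iff.2 ?_)
      have := mem_Ioi.1 ht
      rw [neg_nonpos]
      positivity
    · refine continuousOn_const.mul (ContinuousOn.rexp (ContinuousOn.neg ?_))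
      refine continuousOn_const.div (by fun_prop) fun t ht => ?_
      have := mem_Ioi.1 ht
      positivity
  refine ContinuousOn.mul ?_ (h1.sub continuousOn_const)
  refine continuousOn_const.div (by fun_prop) fun t ht => ?_
  have := mem_Ioi.1 ht
  positivity

/-- Fubini for the source term of the Duhamel formula. -/
lemma integral_source_swap (hκ : IntegrableOn κ (Ioi 0)) {v : ℝ → ℝ} {t ε : ℝ} (ht : 0 ≤ t)
    (hε : 0 < ε) (hv : IntervalIntegrable v volume 0 t) :
    ∫ x in Ioi 0, κ x * (∫ s in (0 : ℝ)..t, -2 * v s * heatKer (t + ε - s) x) =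
      ∫ s in (0 : ℝ)..t, v s * (-2 * ∫ x in Ioi 0, κ x * heatKer (t + ε - s) x) := by
  have hp := Real.pi_pos
  have hv' : IntegrableOn v (Ioc 0 t) := (intervalIntegrable_iff_integrableOn_Ioc_of_le ht).1 hv
  simp only [intervalIntegral.integral_of_le ht, ← integral_const_mul]
  have hm : Measurable fun p : ℝ × ℝ => heatKer (t + ε - p.2) p.1 := by
    unfold heatKer
    fun_prop
  have hi : Integrable (Function.uncurry fun x s => κ x * (-2 * v s * heatKer (t + ε - s) x))
      ((volume.restrict (Ioi 0)).prod (volume.restrict (Ioc 0 t))) := by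
    have h1 : Integrable (fun p : ℝ × ℝ => κ p.1 * v p.2)
        ((volume.restrict (Ioi 0)).prod (volume.restrict (Ioc 0 t))) := Integrable.mul_prod hκ hv'
    have h2 := (h1.const_mul (-2)).mul_bdd (c := 1 / √(4 * Real.pi * ε))
      hm.aestronglyMeasurable (by
        have : ∀ᵐ p : ℝ × ℝ ∂((volume.restrict (Ioi 0)).prod (volume.restrict (Ioc 0 t))),
            p.2 ∈ Ioc 0 t :=
          Measure.quasiMeasurePreserving_snd.ae (self_mem_ae_restrict measurableSet_Ioc)
        filter_upwards [this] with p hp2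
        rw [Real.norm_of_nonneg (heatKer_nonneg _ _), heatKer]
        refine div_le_div₀ zero_le_one (Real.exp_le_one_iff.2 ?_)
          (Real.sqrt_pos.2 (by positivity)) (Real.sqrt_le_sqrt ?_)
        · have : 0 < t + ε - p.2 := by linarith [hp2.2]
          rw [neg_nonpos]
          positivity
        · exact mul_le_mul_of_nonneg_left (by linarith [hp2.2]) (by positivity))
    refine h2.congr (Eventually.of_forall fun p => ?_)
    simp only [Function.uncurry]
    ring
  rw [integral_integral_swap hi]
  congr 1
  funext s
  congr 1
  funext x
  ring

/-- The kernel at `t + ε - s` is bounded by a constant times `(t+ε-s)^{-1/2} ≤ (t-s)^{-1/2}`, so the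
Abel integral of `|v|`, assumed finite, dominates uniformly in `ε`. -/
lemma tendsto_voltKer_integral (hκ : IntegrableOn κ (Ioi 0)) {v : ℝ → ℝ} {t : ℝ} (ht : 0 ≤ t)
    (hv : IntervalIntegrable v volume 0 t)
    (hvt : IntervalIntegrable (fun s => (√(t - s))⁻¹ * |v s|) volume 0 t) :
    Tendsto (fun ε => ∫ s in (0 : ℝ)..t, voltKer κ m (t + ε - s) * v s) (𝓝[>] 0)
      (𝓝 (∫ s in (0 : ℝ)..t, voltKer κ m (t - s) * v s)) := by
  have hp := Real.pi_pos
  set c := ((∫ x in Ioi 0, |κ x|) + |m|) / √Real.pi with hc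
  have hc0 : 0 ≤ c := div_nonneg (add_nonneg (integral_nonneg fun _ => abs_nonneg _) (abs_nonneg _))
    (Real.sqrt_nonneg _)
  have hP := continuousOn_voltKer (m := m) hκ
  refine intervalIntegral.tendsto_integral_filter_of_dominated_convergence
    (fun s => c * ((√(t - s))⁻¹ * |v s|)) ?_ ?_ (hvt.const_mul c) ?_
  · filter_upwards [self_mem_nhdsWithin] with ε hε
    rw [uIoc_of_le ht]
    have h1 : ContinuousOn (fun s => voltKer κ m (t + ε - s)) (Ioc 0 t) :=
      hP.comp (by fun_prop) fun s hs => mem_Ioi.2 (by linarith [hs.2, mem_Ioi.1 hε])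
    exact (h1.aestronglyMeasurable measurableSet_Ioc).mul
      ((intervalIntegrable_iff_integrableOn_Ioc_of_le ht).1 hv).aestronglyMeasurable
  · filter_upwards [self_mem_nhdsWithin] with ε hε
    have hne : ∀ᵐ s : ℝ, s ≠ t := by simp [ae_iff]
    filter_upwards [hne] with s hst hs
    rw [uIoc_of_le ht] at hs
    have hlt : 0 < t - s := sub_pos.2 (lt_of_le_of_ne hs.2 hst)
    have hle : t - s ≤ t + ε - s := by linarith [mem_Ioi.1 hε]
    rw [norm_mul, ← mul_assoc]
    refine mul_le_mul_of_nonneg_right ?_ (norm_nonneg _)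
    refine (abs_voltKer_le hκ (hlt.trans_le hle)).trans ?_
    rw [Real.sqrt_mul hp.le, ← div_div, ← hc, div_eq_mul_inv]
    exact mul_le_mul_of_nonneg_left
      (inv_anti₀ (Real.sqrt_pos.2 hlt) (Real.sqrt_le_sqrt hle)) hc0
  · have hne : ∀ᵐ s : ℝ, s ≠ t := by simp [ae_iff]
    filter_upwards [hne] with s hst hs
    rw [uIoc_of_le ht] at hs
    have hlt : 0 < t - s := sub_pos.2 (lt_of_le_of_ne hs.2 hst)
    refine Tendsto.mul_const _ ?_
    have h1 : ContinuousAt (voltKer κ m) (t - s) := hP.continuousAt (Ioi_mem_nhds hlt)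
    have h2 : Tendsto (fun ε : ℝ => t + ε - s) (𝓝[>] 0) (𝓝 (t - s)) := by
      have : Tendsto (fun ε : ℝ => t + ε - s) (𝓝 0) (𝓝 (t + 0 - s)) :=
        Continuous.tendsto (by fun_prop) 0
      rw [add_zero] at this
      exact this.mono_left nhdsWithin_le_nhds
    exact h1.tendsto.comp h2

/-- The trace functional `m Z(0) - ∫ κ Z` of a solution satisfies a Volterra formula. -/
theorem IsSolution.volterra (hκ : IntegrableOn κ (Ioi 0)) {T : ℝ} {v : ℝ → ℝ} {Z0 : H1 1 1}
    {Z : ℝ → H1 1 1} (hZ : IsSolution 1 1 0 T v Z0 Z) {z z' : ℝ → ℝ → ℝ}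
    (hz : ∀ s, Rep (Z s) (z s) (z' s)) {t : ℝ} (ht : 0 < t) (htT : t ≤ T)
    (hvt : IntervalIntegrable (fun s => (√(t - s))⁻¹ * |v s|) volume 0 t) :
    m * z t 0 - ∫ x in Ioi 0, κ x * z t x =
      m * heatConv (z 0) t 0 - (∫ x in Ioi 0, κ x * heatConv (z 0) t x) +
        ∫ s in (0 : ℝ)..t, voltKer κ m (t - s) * v s := by
  have hv : IntervalIntegrable v volume 0 t :=
    (hZ.intervalIntegrable (ht.le.trans htT)).mono_set (by
      rw [uIcc_of_le ht.le, uIcc_of_le (ht.le.trans htT)]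
      exact Icc_subset_Icc_right htT)
  have hzc : ∀ s, Continuous (z s) := fun s => (hz s).sob.continuous
  have hzB : ∀ s x, |z s x| ≤ ‖Z s‖ := fun s x => (hz s).sq_le admissible_one x
  -- the regularized identity
  have hreg : ∀ ε, 0 < ε →
      (m * heatConv (z t) ε 0 - ∫ x in Ioi 0, κ x * heatConv (z t) ε x) -
        (m * heatConv (z 0) (t + ε) 0 - ∫ x in Ioi 0, κ x * heatConv (z 0) (t + ε) x) =
      ∫ s in (0 : ℝ)..t, voltKer κ m (t + ε - s) * v s := by
    intro ε hε
    have hd := fun x => hZ.duhamel hz ht.le htT hε x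
    simp only [integral_mul_heatKer hε, integral_mul_heatKer (show 0 < t + ε by linarith)] at hd
    have hint : ∀ s τ, IntegrableOn (fun x => κ x * heatConv (z s) τ x) (Ioi 0) := fun s τ => by
      refine Integrable.mul_bdd (c := ‖Z s‖) hκ ?_ (Eventually.of_forall fun x => ?_)
      · exact ((continuous_heatConv (hzc s) (hzB s)).comp
          (by fun_prop : Continuous fun x => (τ, x))).aestronglyMeasurable
      · exact abs_heatConv_le (hzB s) τ x
    have e1 : (∫ x in Ioi 0, κ x * heatConv (z t) ε x) -
        ∫ x in Ioi 0, κ x * heatConv (z 0) (t + ε) x =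
        ∫ s in (0 : ℝ)..t, v s * (-2 * ∫ x in Ioi 0, κ x * heatKer (t + ε - s) x) := by
      rw [← integral_source_swap hκ ht.le hε hv, ← integral_sub (hint t ε) (hint 0 (t + ε))]
      congr 1
      funext x
      rw [← (hd x).2]
      ring
    have e2 : m * heatConv (z t) ε 0 - m * heatConv (z 0) (t + ε) 0 =
        ∫ s in (0 : ℝ)..t, m * (-2 * v s * heatKer (t + ε - s) 0) := by
      rw [intervalIntegral.integral_const_mul, ← (hd 0).2]
      ring
    have hcont : ContinuousOn (fun s => voltKer κ m (t + ε - s)) (uIcc 0 t) := by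
      rw [uIcc_of_le ht.le]
      exact (continuousOn_voltKer hκ).comp (by fun_prop) fun s hs => mem_Ioi.2 (by linarith [hs.2])
    have hi1 : IntervalIntegrable (fun s => m * (-2 * v s * heatKer (t + ε - s) 0)) volume 0 t :=
      ((hd 0).1).const_mul m
    have hi2 : IntervalIntegrable (fun s => voltKer κ m (t + ε - s) * v s) volume 0 t :=
      hv.continuousOn_mul hcont
    have e3 : ∫ s in (0 : ℝ)..t, v s * (-2 * ∫ x in Ioi 0, κ x * heatKer (t + ε - s) x) =
        (∫ s in (0 : ℝ)..t, m * (-2 * v s * heatKer (t + ε - s) 0)) -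
          ∫ s in (0 : ℝ)..t, voltKer κ m (t + ε - s) * v s := by
      rw [← intervalIntegral.integral_sub hi1 hi2]
      refine intervalIntegral_congr_Icc ht.le fun s _ hs => ?_
      rw [voltKer_eq (by linarith)]
      ring
    linarith
  -- the limit
  have hcL : Continuous fun ε => (m * heatConv (z t) ε 0 - ∫ x in Ioi 0, κ x * heatConv (z t) ε x) -
      (m * heatConv (z 0) (t + ε) 0 - ∫ x in Ioi 0, κ x * heatConv (z 0) (t + ε) x) := by
    have a := fun s => continuous_heatConv (hzc s) (hzB s)
    have b := fun s => continuous_integral_heatConv hκ (hzc s) (hzB s)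
    refine ((continuous_const.mul ((a t).comp (by fun_prop : Continuous fun ε : ℝ => (ε, (0 : ℝ))))).sub
      (b t)).sub ((continuous_const.mul ((a 0).comp
        (by fun_prop : Continuous fun ε : ℝ => (t + ε, (0 : ℝ))))).sub ((b 0).comp (by fun_prop)))
  have h1 := (hcL.tendsto 0).mono_left (nhdsWithin_le_nhds (s := Ioi 0))
  have h2 := tendsto_voltKer_integral (m := m) hκ ht.le hv hvt
  have h3 := tendsto_nhds_unique (h1.congr' (by
    filter_upwards [self_mem_nhdsWithin] with ε hε using hreg ε hε)) h2
  simp only [heatConv_zero, add_zero] at h3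
  linarith

end VoltKer

/-! ### A Volterra inequality with an Abel kernel -/

/-- A nonnegative derivative of a function continuous up to the endpoints is automatically
integrable; this admits the endpoint singularities of the Abel kernel. -/
lemma lintegral_deriv_of_nonneg {f g : ℝ → ℝ} {b : ℝ} (hb : 0 ≤ b) (hf : ContinuousOn f (Icc 0 b))
    (hd : ∀ x ∈ Ioo 0 b, HasDerivAt f (g x) x) (hg : ∀ x ∈ Ioo 0 b, 0 ≤ g x) :
    ∫⁻ x in Ioo 0 b, ENNReal.ofReal (g x) = ENNReal.ofReal (f b - f 0) := by
  have hi : IntegrableOn g (Ioc 0 b) := intervalIntegral.integrableOn_deriv_of_nonneg hf hd hg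
  rw [restrict_Ioo_eq_restrict_Ioc, ← ofReal_integral_eq_lintegral_ofReal hi,
    ← intervalIntegral.integral_of_le hb, intervalIntegral.integral_eq_sub_of_hasDerivAt_of_le hb hf hd
      ((intervalIntegrable_iff_integrableOn_Ioc_of_le hb).2 hi)]
  rw [← restrict_Ioo_eq_restrict_Ioc]
  filter_upwards [self_mem_ae_restrict measurableSet_Ioo] with x hx using hg x hx

/-- The Abel kernel `t^{-1/2}` on the positive half line. -/
def abelKer : ℝ → ℝ≥0∞ := (Ioi 0).indicator fun t => ENNReal.ofReal (√t)⁻¹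

lemma measurable_abelKer : Measurable abelKer :=
  Measurable.indicator (by fun_prop) measurableSet_Ioi

lemma lintegral_mul_abelKer (A : ℝ → ℝ≥0∞) (t : ℝ) :
    ∫⁻ s in Ioi 0, A s * abelKer (-s + t) =
      ∫⁻ s in Ioo 0 t, A s * ENNReal.ofReal (√(t - s))⁻¹ := by
  rw [← lintegral_indicator measurableSet_Ioi, ← lintegral_indicator measurableSet_Ioo]
  congr 1
  funext s
  by_cases h1 : 0 < s
  · by_cases h2 : s < t
    · rw [indicator_of_mem (mem_Ioi.2 h1), indicator_of_mem (mem_Ioo.2 ⟨h1, h2⟩), abelKer,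
        indicator_of_mem (by rw [mem_Ioi]; linarith), neg_add_eq_sub]
    · rw [indicator_of_mem (mem_Ioi.2 h1), indicator_of_notMem (fun h => h2 h.2), abelKer,
        indicator_of_notMem (by rw [mem_Ioi]; linarith), mul_zero]
  · rw [indicator_of_notMem (by rwa [mem_Ioi]), indicator_of_notMem (fun h => h1 h.1)]

lemma lintegral_abelKer_self {t : ℝ} (ht : 0 ≤ t) :
    ∫⁻ s in Ioo 0 t, ENNReal.ofReal (√(t - s))⁻¹ = ENNReal.ofReal (2 * √t) := by
  rw [lintegral_deriv_of_nonneg (f := fun s => -(2 * √(t - s))) ht (by fun_prop) (fun x hx => ?_)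
    fun x hx => by positivity]
  · simp
  · have h1 : 0 < t - x := by linarith [hx.2]
    refine ((((hasDerivAt_id' x).const_sub t).sqrt h1.ne').const_mul 2).fun_neg.congr_deriv ?_
    field_simp
    try ring

/-- `∫_0^t ds/√(s(t-s)) = B(½,½) = π` for every `t > 0`, with antiderivative `arcsin(2s/t - 1)`. -/
lemma abelKer_conv (t : ℝ) :
    lconvolution abelKer abelKer volume t = (Ioi 0).indicator (fun _ => ENNReal.ofReal Real.pi) t := by
  have e0 : lconvolution abelKer abelKer volume t = ∫⁻ s in Ioi 0, abelKer s * abelKer (-s + t) := by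
    rw [lconvolution_def, ← lintegral_indicator measurableSet_Ioi]
    congr 1
    funext s
    by_cases h : s ∈ Ioi (0 : ℝ)
    · rw [indicator_of_mem h]
    · rw [indicator_of_notMem h, abelKer, indicator_of_notMem h, zero_mul]
  rw [e0, lintegral_mul_abelKer]
  by_cases ht : 0 < t
  · rw [indicator_of_mem (mem_Ioi.2 ht)]
    have e1 : ∫⁻ s in Ioo 0 t, abelKer s * ENNReal.ofReal (√(t - s))⁻¹ =
        ∫⁻ s in Ioo 0 t, ENNReal.ofReal ((√s)⁻¹ * (√(t - s))⁻¹) := by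
      refine setLIntegral_congr_fun measurableSet_Ioo fun s hs => ?_
      rw [abelKer, indicator_of_mem (mem_Ioi.2 hs.1), ENNReal.ofReal_mul (by positivity)]
    rw [e1, lintegral_deriv_of_nonneg (f := fun s => Real.arcsin (2 * s / t - 1)) ht.le
      (Real.continuous_arcsin.comp (by fun_prop)).continuousOn (fun x hx => ?_)
      fun x hx => by positivity]
    · congr 1
      rw [mul_div_assoc, div_self ht.ne', mul_zero, zero_div]
      norm_num
    · have h0 := hx.1
      have h1 : 0 < t - x := by linarith [hx.2]
      have d1 : HasDerivAt (fun s => 2 * s / t - 1) (2 / t) x := by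
        have := (((hasDerivAt_id' x).const_mul 2).div_const t).sub_const 1
        rwa [mul_one] at this
      have hlt : 2 * x / t < 2 := by
        rw [div_lt_iff₀ ht]
        linarith
      have hgt : 0 < 2 * x / t := by positivity
      have d2 := (Real.hasDerivAt_arcsin (x := 2 * x / t - 1) (by linarith) (by linarith)).comp x d1
      refine d2.congr_deriv ?_
      have e2 : 1 - (2 * x / t - 1) ^ 2 = (2 / t) ^ 2 * (x * (t - x)) := by
        field_simp
        ring
      rw [e2, Real.sqrt_mul (sq_nonneg _), Real.sqrt_sq (by positivity), Real.sqrt_mul h0.le]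
      have := Real.sqrt_pos.2 h0
      have := Real.sqrt_pos.2 h1
      field_simp
  · rw [indicator_of_notMem (by rwa [mem_Ioi]), Ioo_eq_empty ht]
    simp

/-- Gronwall's inequality for integral inequalities. -/
lemma gronwall_integral {y : ℝ → ℝ} (hy : Continuous y) {G l : ℝ} (hl : 0 ≤ l)
    {T : ℝ} (h : ∀ t ∈ Icc 0 T, y t ≤ ∫ s in (0 : ℝ)..t, (G + l * y s)) {t : ℝ} (ht : t ∈ Icc 0 T) :
    G + l * y t ≤ G * Real.exp (l * t) := by
  set Y : ℝ → ℝ := fun t => ∫ s in (0 : ℝ)..t, (G + l * y s) with hY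
  have hc : Continuous fun s => G + l * y s := by fun_prop
  have hYd : ∀ t, HasDerivAt Y (G + l * y t) t := fun t =>
    intervalIntegral.integral_hasDerivAt_right (hc.intervalIntegrable _ _)
      (hc.stronglyMeasurableAtFilter _ _) hc.continuousAt
  have hd : ∀ t, HasDerivAt (fun t => (G + l * Y t) * Real.exp (-(l * t)))
      (l * (G + l * y t) * Real.exp (-(l * t)) +
        (G + l * Y t) * (Real.exp (-(l * t)) * -(l * 1))) t := fun t =>
    (((hYd t).const_mul l).const_add G).mul ((hasDerivAt_id' t).const_mul l).fun_neg.exp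
  have hanti : AntitoneOn (fun t => (G + l * Y t) * Real.exp (-(l * t))) (Icc 0 T) := by
    refine antitoneOn_of_deriv_nonpos (convex_Icc 0 T)
      (fun t _ => (hd t).continuousAt.continuousWithinAt)
      (fun t _ => (hd t).differentiableAt.differentiableWithinAt) fun t ht => ?_
    rw [interior_Icc] at ht
    rw [(hd t).deriv]
    have h1 : 0 ≤ l ^ 2 * (Y t - y t) * Real.exp (-(l * t)) :=
      mul_nonneg (mul_nonneg (sq_nonneg l) (sub_nonneg.2 (h t (Ioo_subset_Icc_self ht))))
        (Real.exp_nonneg _)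
    linarith
  have h1 := hanti ⟨le_rfl, ht.1.trans ht.2⟩ ht ht.1
  have h2 : Y 0 = 0 := intervalIntegral.integral_same
  simp only [h2, mul_zero, neg_zero, Real.exp_zero, add_zero, mul_one] at h1
  have h3 : G + l * Y t ≤ G * Real.exp (l * t) := by
    have := mul_le_mul_of_nonneg_right h1 (Real.exp_nonneg (l * t))
    rwa [mul_assoc, ← Real.exp_add, neg_add_cancel, Real.exp_zero, mul_one] at this
  exact (add_le_add_right (mul_le_mul_of_nonneg_left (h t ht) hl) G).trans h3

section Volterra

variable {T : ℝ} {v : ℝ → ℝ}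

/-- The absolute value of `v` on `(0,T)`, extended by zero. -/
def cutAbs (T : ℝ) (v : ℝ → ℝ) : ℝ → ℝ≥0∞ := (Ioo 0 T).indicator fun t => ENNReal.ofReal |v t|

lemma aemeasurable_cutAbs (hv : IntegrableOn v (Ioo 0 T)) : AEMeasurable (cutAbs T v) := by
  rw [cutAbs, aemeasurable_indicator_iff measurableSet_Ioo]
  exact hv.abs.aemeasurable.ennreal_ofReal

lemma cutAbs_conv (f : ℝ → ℝ≥0∞) (t : ℝ) :
    lconvolution (cutAbs T v) f volume t = ∫⁻ s in Ioi 0, cutAbs T v s * f (-s + t) := by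
  rw [lconvolution_def, ← lintegral_indicator measurableSet_Ioi]
  congr 1
  funext s
  by_cases h : s ∈ Ioi (0 : ℝ)
  · rw [indicator_of_mem h]
  · rw [indicator_of_notMem h, cutAbs, indicator_of_notMem (fun h' => h h'.1), zero_mul]

lemma lintegral_cutAbs (hv : IntegrableOn v (Ioo 0 T)) {t : ℝ} (h0 : 0 ≤ t) (ht : t ≤ T) :
    ∫⁻ s in Ioo 0 t, cutAbs T v s = ENNReal.ofReal (∫ s in (0 : ℝ)..t, |v s|) := by
  rw [intervalIntegral.integral_of_le h0, ← restrict_Ioo_eq_restrict_Ioc,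
    ofReal_integral_eq_lintegral_ofReal (hv.mono_set (Ioo_subset_Ioo_right ht)).abs
      (Eventually.of_forall fun _ => abs_nonneg _)]
  exact setLIntegral_congr_fun measurableSet_Ioo fun s hs =>
    indicator_of_mem (mem_Ioo.2 ⟨hs.1, hs.2.trans_le ht⟩) _

lemma cutAbs_conv_abelKer_conv (t : ℝ) :
    lconvolution (cutAbs T v) (lconvolution abelKer abelKer volume) volume t =
      ENNReal.ofReal Real.pi * ∫⁻ s in Ioo 0 t, cutAbs T v s := by
  rw [cutAbs_conv, ← lintegral_const_mul' _ _ ENNReal.ofReal_ne_top,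
    ← lintegral_indicator measurableSet_Ioi, ← lintegral_indicator measurableSet_Ioo]
  congr 1
  funext s
  simp only [abelKer_conv]
  by_cases h1 : 0 < s
  · by_cases h2 : s < t
    · rw [indicator_of_mem (mem_Ioi.2 h1), indicator_of_mem (mem_Ioo.2 ⟨h1, h2⟩),
        indicator_of_mem (by rw [mem_Ioi]; linarith), mul_comm]
    · rw [indicator_of_mem (mem_Ioi.2 h1), indicator_of_notMem (by rw [mem_Ioi]; linarith),
        indicator_of_notMem (fun h => h2 h.2), mul_zero]
  · rw [indicator_of_notMem (by rwa [mem_Ioi]), indicator_of_notMem (fun h => h1 h.1)]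

lemma cutAbs_assoc (hv : IntegrableOn v (Ioo 0 T)) (t : ℝ) :
    lconvolution (lconvolution (cutAbs T v) abelKer volume) abelKer volume t =
      ENNReal.ofReal Real.pi * ∫⁻ s in Ioo 0 t, cutAbs T v s := by
  rw [← cutAbs_conv_abelKer_conv, lconvolution_assoc₀ (aemeasurable_cutAbs hv)
    measurable_abelKer.aemeasurable measurable_abelKer.aemeasurable]

/-- Convolving once more with the Abel kernel and evaluating at `T` gives `π∫|v| < ∞`. The added
factor is positive on `(0,T)`, so the inner convolution is finite almost everywhere. -/
lemma ae_cutAbs_conv_lt_top (hT : 0 ≤ T) (hv : IntegrableOn v (Ioo 0 T)) :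
    ∀ᵐ t ∂volume.restrict (Ioo 0 T), lconvolution (cutAbs T v) abelKer volume t < ∞ := by
  have h1 := cutAbs_assoc hv T
  rw [lconvolution_def, lintegral_cutAbs hv hT le_rfl, ← ENNReal.ofReal_mul Real.pi_pos.le] at h1
  have hm : AEMeasurable fun y => lconvolution (cutAbs T v) abelKer volume y * abelKer (-y + T) :=
    (aemeasurable_lconvolution (aemeasurable_cutAbs hv) measurable_abelKer.aemeasurable).mul
      (measurable_abelKer.comp (by fun_prop)).aemeasurable
  have h2 := ae_lt_top' hm (by rw [h1]; exact ENNReal.ofReal_ne_top)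
  filter_upwards [ae_restrict_of_ae h2, self_mem_ae_restrict measurableSet_Ioo] with t h3 ht
  by_contra h4
  rw [not_lt, top_le_iff] at h4
  have h5 : 0 < T - t := by linarith [ht.2]
  rw [h4, abelKer, indicator_of_mem (by rw [mem_Ioi]; linarith), ENNReal.top_mul] at h3
  · exact lt_irrefl _ h3
  · rw [ENNReal.ofReal_ne_zero_iff, neg_add_eq_sub]
    positivity

lemma cutAbs_conv_eq {t : ℝ} (ht : t ≤ T) :
    lconvolution (cutAbs T v) abelKer volume t =
      ∫⁻ s in Ioo 0 t, ENNReal.ofReal ((√(t - s))⁻¹ * |v s|) := by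
  rw [cutAbs_conv, lintegral_mul_abelKer]
  refine setLIntegral_congr_fun measurableSet_Ioo fun s hs => ?_
  rw [cutAbs, indicator_of_mem (mem_Ioo.2 ⟨hs.1, hs.2.trans_le ht⟩), mul_comm, ← ENNReal.ofReal_mul (by positivity)]

/-- The Abel integral of an integrable function converges almost everywhere. -/
lemma ae_intervalIntegrable_abel (hT : 0 ≤ T) (hv : IntegrableOn v (Ioo 0 T)) :
    ∀ᵐ t ∂volume.restrict (Ioo 0 T),
      IntervalIntegrable (fun s => (√(t - s))⁻¹ * |v s|) volume 0 t := by
  filter_upwards [ae_cutAbs_conv_lt_top hT hv, self_mem_ae_restrict measurableSet_Ioo] with t h1 ht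
  rw [intervalIntegrable_iff_integrableOn_Ioo_of_le ht.1.le]
  rw [cutAbs_conv_eq ht.2.le] at h1
  have hm : AEStronglyMeasurable (fun s => (√(t - s))⁻¹ * |v s|) (volume.restrict (Ioo 0 t)) :=
    (by fun_prop : Measurable fun s => (√(t - s))⁻¹).aestronglyMeasurable.mul
      (hv.mono_set (Ioo_subset_Ioo_right ht.2.le)).abs.aestronglyMeasurable
  refine ⟨hm, ?_⟩
  rw [hasFiniteIntegral_iff_ofReal (Eventually.of_forall fun s =>
    mul_nonneg (inv_nonneg.2 (Real.sqrt_nonneg _)) (abs_nonneg _))]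
  exact h1

/-- An integrable function with `|v| ≤ F + c ∫ (t-s)^{-1/2} |v|` is bounded. -/
theorem volterra_bound (hT : 0 < T) (hv : IntegrableOn v (Ioo 0 T)) {F c : ℝ} (hF : 0 ≤ F)
    (hc : 0 ≤ c) (h : ∀ᵐ t ∂volume.restrict (Ioo 0 T),
      |v t| ≤ F + c * ∫ s in (0 : ℝ)..t, (√(t - s))⁻¹ * |v s|) :
    ∀ᵐ t ∂volume.restrict (Ioo 0 T),
      |v t| ≤ F * (1 + 2 * c * √T) * Real.exp (c ^ 2 * Real.pi * T) := by
  have hp := Real.pi_pos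
  have hvi : IntervalIntegrable (fun t => |v t|) volume 0 T :=
    (intervalIntegrable_iff_integrableOn_Ioo_of_le hT.le).2 hv.abs
  -- the inequality in extended nonnegative numbers
  have h1 : ∀ᵐ t ∂volume.restrict (Ioo 0 T), cutAbs T v t ≤
      ENNReal.ofReal F + ENNReal.ofReal c * lconvolution (cutAbs T v) abelKer volume t := by
    filter_upwards [h, ae_intervalIntegrable_abel hT.le hv,
      self_mem_ae_restrict measurableSet_Ioo] with t h2 h3 ht
    rw [intervalIntegrable_iff_integrableOn_Ioo_of_le ht.1.le] at h3
    have hn : ∀ s, 0 ≤ (√(t - s))⁻¹ * |v s| := fun s => by positivity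
    rw [cutAbs_conv_eq ht.2.le, ← ofReal_integral_eq_lintegral_ofReal h3 (Eventually.of_forall hn),
      ← ENNReal.ofReal_mul hc, ← ENNReal.ofReal_add hF (mul_nonneg hc (integral_nonneg hn)), cutAbs,
      indicator_of_mem ht]
    refine ENNReal.ofReal_le_ofReal ?_
    rwa [intervalIntegral.integral_of_le ht.1.le, ← restrict_Ioo_eq_restrict_Ioc] at h2
  -- iteration
  set G := F * (1 + 2 * c * √T) with hG
  have hG0 : 0 ≤ G := by positivity
  set l := c ^ 2 * Real.pi with hl
  have hl0 : 0 ≤ l := by positivity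
  -- Convolving the inequality with the Abel kernel: the constant `F` contributes `2√t F`, and the
  -- double convolution collapses to `cπ∫|v|`. Substituted back, this yields `|v| ≤ F(1+2c√T) +
  -- c²π∫|v|`, an inequality without singularity.
  have h2 : ∀ t ∈ Ioo 0 T, lconvolution (cutAbs T v) abelKer volume t ≤
      ENNReal.ofReal (F * (2 * √T) + c * Real.pi * ∫ s in (0 : ℝ)..t, |v s|) := by
    intro t ht
    have hI : 0 ≤ ∫ s in (0 : ℝ)..t, |v s| :=
      intervalIntegral.integral_nonneg ht.1.le fun _ _ => abs_nonneg _
    have hm : Measurable fun s : ℝ => ENNReal.ofReal (√(t - s))⁻¹ := by fun_prop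
    rw [cutAbs_conv, lintegral_mul_abelKer]
    calc ∫⁻ s in Ioo 0 t, cutAbs T v s * ENNReal.ofReal (√(t - s))⁻¹
        ≤ ∫⁻ s in Ioo 0 t, (ENNReal.ofReal F * ENNReal.ofReal (√(t - s))⁻¹ + ENNReal.ofReal c *
            (lconvolution (cutAbs T v) abelKer volume s * ENNReal.ofReal (√(t - s))⁻¹)) := by
          refine lintegral_mono_ae ?_
          filter_upwards [ae_restrict_of_ae_restrict_of_subset (Ioo_subset_Ioo_right ht.2.le) h1]
            with s hs
          rw [← mul_assoc, ← add_mul]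
          exact mul_le_mul_left hs _
      _ ≤ ENNReal.ofReal F * ENNReal.ofReal (2 * √t) + ENNReal.ofReal c *
            (ENNReal.ofReal Real.pi * ENNReal.ofReal (∫ s in (0 : ℝ)..t, |v s|)) := by
          rw [lintegral_add_left (hm.const_mul _), lintegral_const_mul' _ _ ENNReal.ofReal_ne_top,
            lintegral_const_mul' _ _ ENNReal.ofReal_ne_top, lintegral_abelKer_self ht.1.le,
            ← lintegral_cutAbs hv ht.1.le ht.2.le, ← cutAbs_assoc hv]
          refine add_le_add_right (mul_le_mul_right ?_ _) _
          rw [lconvolution_def, ← lintegral_mul_abelKer]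
          exact setLIntegral_le_lintegral _ _
      _ ≤ _ := by
          rw [← ENNReal.ofReal_mul hF, ← ENNReal.ofReal_mul hp.le, ← ENNReal.ofReal_mul hc,
            ← ENNReal.ofReal_add (by positivity) (by positivity), ← mul_assoc c]
          refine ENNReal.ofReal_le_ofReal (add_le_add_left (mul_le_mul_of_nonneg_left ?_ hF) _)
          exact mul_le_mul_of_nonneg_left (Real.sqrt_le_sqrt ht.2.le) zero_le_two
  have h3 : ∀ᵐ t ∂volume.restrict (Ioo 0 T), |v t| ≤ G + l * ∫ s in (0 : ℝ)..t, |v s| := by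
    filter_upwards [h1, self_mem_ae_restrict measurableSet_Ioo] with t h4 ht
    have hI : 0 ≤ ∫ s in (0 : ℝ)..t, |v s| :=
      intervalIntegral.integral_nonneg ht.1.le fun _ _ => abs_nonneg _
    have h5 := h4.trans (add_le_add_right (mul_le_mul_right (h2 t ht) _) _)
    rw [← ENNReal.ofReal_mul hc, ← ENNReal.ofReal_add hF (by positivity), cutAbs,
      indicator_of_mem ht, ENNReal.ofReal_le_ofReal_iff (by positivity)] at h5
    refine h5.trans (le_of_eq ?_)
    rw [hG, hl]
    ring
  -- Gronwall
  have hvx : IsPrim (fun t => 0 + ∫ s in (0 : ℝ)..t, (Ioo 0 T).indicator (fun s => |v s|) s)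
      ((Ioo 0 T).indicator fun s => |v s|) :=
    IsPrim.of_integral ((integrable_indicator_iff measurableSet_Ioo).2 hv.abs).locallyIntegrable 0 0
  have hye : ∀ t ∈ Icc 0 T, (0 + ∫ s in (0 : ℝ)..t, (Ioo 0 T).indicator (fun s => |v s|) s) =
      ∫ s in (0 : ℝ)..t, |v s| := by
    intro t ht
    rw [zero_add, intervalIntegral.integral_of_le ht.1, intervalIntegral.integral_of_le ht.1,
      ← restrict_Ioo_eq_restrict_Ioc]
    exact setIntegral_congr_fun measurableSet_Ioo fun s hs =>
      indicator_of_mem (mem_Ioo.2 ⟨hs.1, hs.2.trans_le ht.2⟩) _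
  have h6 := fun t => gronwall_integral (G := G) (T := T) (t := t) hvx.continuous hl0 (by
    intro t ht
    have hyc := hvx.continuous
    rw [hye t ht, intervalIntegral.integral_of_le ht.1, intervalIntegral.integral_of_le ht.1,
      ← restrict_Ioo_eq_restrict_Ioc]
    refine integral_mono_ae (hv.mono_set (Ioo_subset_Ioo_right ht.2)).abs ?_ ?_
    · exact ((continuous_const.add (continuous_const.mul hyc)).integrableOn_Icc).mono_set
        Ioo_subset_Icc_self
    · filter_upwards [ae_restrict_of_ae_restrict_of_subset (Ioo_subset_Ioo_right ht.2) h3,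
        self_mem_ae_restrict measurableSet_Ioo] with s h4 hs
      rw [hye s ⟨hs.1.le, hs.2.le.trans ht.2⟩]
      exact h4)
  filter_upwards [h3, self_mem_ae_restrict measurableSet_Ioo] with t h4 ht
  have h7 := h6 t (Ioo_subset_Icc_self ht)
  rw [hye t (Ioo_subset_Icc_self ht)] at h7
  refine (h4.trans h7).trans (mul_le_mul_of_nonneg_left (Real.exp_le_exp.2 ?_) hG0)
  exact mul_le_mul_of_nonneg_left ht.2.le hl0

end Volterra

/-! ### The Volterra equation of the transformed control -/

section Volterra

variable {κ v : ℝ → ℝ} {m c T : ℝ}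

lemma voltKer_integral (hκ : IntegrableOn κ (Ioi 0)) (hc : (∫ x in Ioi 0, |κ x|) + |m| ≤ c) {t : ℝ}
    (ht : 0 ≤ t) (hv : IntegrableOn v (Ioo 0 t))
    (hvt : IntervalIntegrable (fun s => (√(t - s))⁻¹ * |v s|) volume 0 t) :
    IntervalIntegrable (fun s => voltKer κ m (t - s) * v s) volume 0 t ∧
      |∫ s in (0 : ℝ)..t, voltKer κ m (t - s) * v s| ≤
        c / √Real.pi * ∫ s in (0 : ℝ)..t, (√(t - s))⁻¹ * |v s| := by
  have hb : ∀ s ∈ Ioo 0 t, ‖voltKer κ m (t - s) * v s‖ ≤ c / √Real.pi * ((√(t - s))⁻¹ * |v s|) := by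
    intro s hs
    have hts : 0 < t - s := sub_pos.2 hs.2
    rw [Real.norm_eq_abs, abs_mul, ← mul_assoc]
    refine mul_le_mul_of_nonneg_right ((abs_voltKer_le hκ hts).trans ?_) (abs_nonneg _)
    rw [Real.sqrt_mul Real.pi_pos.le, ← div_eq_mul_inv, div_div]
    exact div_le_div_of_nonneg_right hc (by positivity)
  have hm : AEStronglyMeasurable (fun s => voltKer κ m (t - s) * v s) (volume.restrict (Ioo 0 t)) := by
    refine AEStronglyMeasurable.mul ?_ hv.aestronglyMeasurable
    refine ContinuousOn.aestronglyMeasurable ?_ measurableSet_Ioo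
    exact (continuousOn_voltKer hκ).comp (by fun_prop) fun s hs => sub_pos.2 hs.2
  have hi := hvt.const_mul (c / √Real.pi)
  rw [← intervalIntegral.integral_const_mul]
  rw [intervalIntegrable_iff_integrableOn_Ioo_of_le ht] at hi ⊢
  have hae : ∀ᵐ s ∂volume.restrict (Ioo 0 t),
      ‖voltKer κ m (t - s) * v s‖ ≤ c / √Real.pi * ((√(t - s))⁻¹ * |v s|) := by
    filter_upwards [self_mem_ae_restrict measurableSet_Ioo] with s hs using hb s hs
  refine ⟨Integrable.mono' hi hm hae, ?_⟩
  rw [intervalIntegral.integral_of_le ht, intervalIntegral.integral_of_le ht,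
    ← restrict_Ioo_eq_restrict_Ioc]
  exact norm_integral_le_of_norm_le hi hae

/-- The a priori bound for solutions of the Volterra equation. -/
theorem SolvesVolterra.bound (hκ : IntegrableOn κ (Ioi 0)) (hc : (∫ x in Ioi 0, |κ x|) + |m| ≤ c)
    (hT : 0 < T) (hv : IntegrableOn v (Ioo 0 T)) {f : ℝ → ℝ} {F : ℝ} (hF : 0 ≤ F)
    (hf : ∀ᵐ t ∂volume.restrict (Ioo 0 T), |f t| ≤ F) (h : SolvesVolterra T f (voltKer κ m) v) :
    ∀ᵐ t ∂volume.restrict (Ioo 0 T), |v t| ≤ F * (1 + 2 * √(T / Real.pi) * c) * Real.exp (c ^ 2 * T) := by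
  have hc0 : 0 ≤ c := (add_nonneg (integral_nonneg fun _ => abs_nonneg _) (abs_nonneg _)).trans hc
  have h1 := volterra_bound hT hv hF (div_nonneg hc0 (Real.sqrt_nonneg Real.pi)) (by
    filter_upwards [h, hf, ae_intervalIntegrable_abel hT.le hv,
      self_mem_ae_restrict measurableSet_Ioo] with t e1 e2 e3 ht
    rw [e1]
    exact (abs_add_le _ _).trans (add_le_add e2 (voltKer_integral hκ hc ht.1.le
      (hv.mono_set (Ioo_subset_Ioo_right ht.2.le)) e3).2))
  -- The kernel bound is `c/√(πt)`, so the Abel constant is `c/√π`, and the `π` of the double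
  -- convolution cancels in the exponent.
  have e1 : 2 * (c / √Real.pi) * √T = 2 * √(T / Real.pi) * c := by
    rw [Real.sqrt_div hT.le]
    ring
  have e2 : (c / √Real.pi) ^ 2 * Real.pi * T = c ^ 2 * T := by
    rw [div_pow, Real.sq_sqrt Real.pi_pos.le, div_mul_cancel₀ _ Real.pi_ne_zero]
  rwa [e1, e2] at h1

/-- The difference solves the homogeneous equation, for which the a priori bound is zero.
Integrability alone suffices for this. -/
theorem SolvesVolterra.unique (hκ : IntegrableOn κ (Ioi 0)) (hT : 0 < T) {v' f : ℝ → ℝ}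
    (hv : IntegrableOn v (Ioo 0 T)) (hv' : IntegrableOn v' (Ioo 0 T))
    (h : SolvesVolterra T f (voltKer κ m) v) (h' : SolvesVolterra T f (voltKer κ m) v') :
    v =ᵐ[volume.restrict (Ioo 0 T)] v' := by
  have hd : IntegrableOn (fun t => v t - v' t) (Ioo 0 T) := hv.sub hv'
  have h1 : SolvesVolterra T (fun _ => 0) (voltKer κ m) fun t => v t - v' t := by
    filter_upwards [h, h', ae_intervalIntegrable_abel hT.le hv, ae_intervalIntegrable_abel hT.le hv',
      self_mem_ae_restrict measurableSet_Ioo] with t e1 e2 a1 a2 ht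
    have i1 := (voltKer_integral hκ le_rfl ht.1.le
      (hv.mono_set (Ioo_subset_Ioo_right ht.2.le)) a1 (m := m)).1
    have i2 := (voltKer_integral hκ le_rfl ht.1.le
      (hv'.mono_set (Ioo_subset_Ioo_right ht.2.le)) a2 (m := m)).1
    simp only [mul_sub]
    rw [intervalIntegral.integral_sub i1 i2, e1, e2]
    ring
  filter_upwards [h1.bound hκ le_rfl hT hd le_rfl (by simp)] with t ht
  rw [zero_mul, zero_mul] at ht
  exact sub_eq_zero.1 (abs_nonpos_iff.1 ht)

lemma abs_le_linfNorm {u : ℝ → ℝ} (hu : MemLinf T u) :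
    ∀ᵐ t ∂volume.restrict (Ioo 0 T), |u t| ≤ linfNorm T u := by
  have hu' : eLpNorm u ∞ (volume.restrict (Ioo 0 T)) < ∞ := hu.2
  filter_upwards [ae_le_eLpNormEssSup (f := u) (μ := volume.restrict (Ioo 0 T))] with t ht
  rw [← eLpNorm_exponent_top] at ht
  have := ENNReal.toReal_mono hu'.ne ht
  rwa [toReal_enorm, Real.norm_eq_abs] at this

lemma linfNorm_le {u : ℝ → ℝ} {A : ℝ} (hA : 0 ≤ A)
    (hu : ∀ᵐ t ∂volume.restrict (Ioo 0 T), |u t| ≤ A) : linfNorm T u ≤ A := by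
  rw [linfNorm, eLpNorm_exponent_top]
  refine ENNReal.toReal_le_of_le_ofReal hA ?_
  refine eLpNormEssSup_le_of_ae_enorm_bound ?_
  filter_upwards [hu] with t ht
  rw [← ofReal_norm]
  exact ENNReal.ofReal_le_ofReal ht

lemma MemLinf.integrableOn {u : ℝ → ℝ} (hu : MemLinf T u) : IntegrableOn u (Ioo 0 T) := by
  have : IsFiniteMeasure (volume.restrict (Ioo (0 : ℝ) T)) := ⟨by simp⟩
  exact MemLp.integrable le_top hu

end Volterra

/-! ### The size of the Volterra kernel in terms of `σ₀(0)` and `R`. -/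

section Derivative

variable {r : ℝ → ℝ} {K K₁ K₂ L L₁ L₂ : ℝ → ℝ → ℝ} {C M : ℝ}

lemma KernelPair.integrableOn_d1zero (h : KernelPair r K K₁ K₂ L L₁ L₂ C) :
    IntegrableOn (d1zero (kerK r)) (Ioi 0) :=
  (h.regK.section_K₁ h.pot le_rfl).1.congr (h.regK.d1zero_ae h.kerK_eq)

/-- Estimate (3) holds in the open set `Ω`; both of its sides are continuous up to `y₁ = 0` for the
smooth representative. -/
lemma KernelPair.abs_d1zero_le (h : KernelPair r K K₁ K₂ L L₁ L₂ C) (hM : KernelDerivBound r M)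
    {x : ℝ} (hx : 0 < x) :
    |d1zero (kerK r) x| ≤ 1 / 4 * |r ((0 + x) / 2)| + M * sigma0 r ((0 + x) / 2) := by
  rw [h.regK.d1zero_congr h.kerK_eq hx]
  have hc : Continuous fun a => |K₁ a x| :=
    (h.regK.smooth₁.continuous.comp (by fun_prop : Continuous fun a : ℝ => (a, x))).abs
  have hr := h.pot.continuous
  have hs := continuous_sigma0 h.pot.integrable hr
  have hd : Continuous fun a => 1 / 4 * |r ((a + x) / 2)| + M * sigma0 r ((a + x) / 2) := by fun_prop
  refine le_of_tendsto_of_tendsto ((hc.tendsto 0).mono_left nhdsWithin_le_nhds)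
    ((hd.tendsto 0).mono_left nhdsWithin_le_nhds) (b := 𝓝[>] (0 : ℝ)) ?_
  filter_upwards [Ioo_mem_nhdsGT hx] with a ha
  rw [← h.regK.deriv₁_eq h.kerK_eq ha.1 ha.2]
  exact hM a x ha.1 ha.2

/-- The half-sum substitution doubles the integrals: `¼|r(x/2)|` gives `½σ₀(0)` and `Mσ₀(x/2)` gives
at most `2MR`. The other half of `σ₀(0)` comes from `½|∫r|`. -/
lemma KernelPair.voltKer_const_le (h : KernelPair r K K₁ K₂ L L₁ L₂ C) (hM0 : 0 ≤ M)
    (hM : KernelDerivBound r M) :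
    (∫ x in Ioi 0, |d1zero (kerK r) x|) + |1 / 2 * ∫ ξ in Ioi 0, r ξ| ≤
      sigma0 r 0 + 2 * M * Rconst r := by
  have hr := h.pot
  have i1 : IntegrableOn (fun x => 1 / 4 * |r ((0 + x) / 2)|) (Ioi 0) :=
    (integrableOn_half_sum hr.integrable.abs.integrableOn).const_mul _
  have i2 : IntegrableOn (fun x => M * sigma0 r ((0 + x) / 2)) (Ioi 0) :=
    (integrableOn_half_sum (integrableOn_sigma0 hr.integrable hr.continuous hr.moment)).const_mul _
  have h1 : ∫ x in Ioi 0, |d1zero (kerK r) x| ≤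
      ∫ x in Ioi 0, (1 / 4 * |r ((0 + x) / 2)| + M * sigma0 r ((0 + x) / 2)) :=
    setIntegral_mono_on h.integrableOn_d1zero.abs (i1.add i2) measurableSet_Ioi fun x hx =>
      h.abs_d1zero_le hM hx
  rw [integral_add i1 i2, integral_const_mul, integral_const_mul,
    integral_Ioi_half_sum (fun x => |r x|), integral_Ioi_half_sum (sigma0 r)] at h1
  have h2 := mul_le_mul_of_nonneg_left
    (integral_Ioi_sigma0_le hr.integrable hr.continuous hr.moment) hM0
  have h3 : |1 / 2 * ∫ ξ in Ioi 0, r ξ| ≤ 1 / 2 * sigma0 r 0 := by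
    rw [abs_mul, abs_of_pos one_half_pos]
    exact mul_le_mul_of_nonneg_left (abs_integral_r_le 0) one_half_pos.le
  have h4 : ∫ x in Ioi 0, |r x| = sigma0 r 0 := rfl
  rw [h4] at h1
  linarith

end Derivative

/-! ### The transformed control and its Volterra equation. -/

section Control

variable {ρ k γ : ℝ → ℝ} {C c : ℝ} {K K₁ K₂ L L₁ L₂ : ℝ → ℝ → ℝ}

lemma volP_eq (ρ k γ : ℝ → ℝ) : volP ρ k γ =
    voltKer (d1zero (kerK (rFn ρ k γ))) (1 / 2 * ∫ ξ in Ioi 0, rFn ρ k γ ξ) := rfl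

lemma volF_eq (ρ k γ u : ℝ → ℝ) {φ : H1 1 1} {z z' : ℝ → ℝ} (hz : Rep φ z z') {t : ℝ} (ht : 0 < t) :
    volF ρ k γ u (valL φ) t = c0 ρ k * u t +
      ((1 / 2 * ∫ ξ in Ioi 0, rFn ρ k γ ξ) * heatConv z t 0 -
        ∫ x in Ioi 0, d1zero (kerK (rFn ρ k γ)) x * heatConv z t x) := by
  have hv := hz.val
  rw [opS_one] at hv
  have h1 : ∀ x, ∫ y, heatKer t (x - y) * valL φ y = heatConv z t x := fun x => by
    rw [← integral_mul_heatKer ht]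
    refine integral_congr_ae ?_
    filter_upwards [hv] with y hy
    rw [hy, mul_comm]
  have h2 : ∫ y, heatKer t y * valL φ y = heatConv z t 0 := by
    rw [← h1 0]
    simp only [zero_sub, heatKer_neg]
  rw [volF, h2]
  simp only [h1]
  ring

/-- Heat convolution is an average and so keeps the sup norm of the initial value, which is at most
its `H¹` norm. -/
lemma abs_volF_le {T : ℝ} {u : ℝ → ℝ} (h : Admissible ρ k γ)
    (hκ : IntegrableOn (d1zero (kerK (rFn ρ k γ))) (Ioi 0)) (hu : MemLinf T u) (φ : H1 1 1) :
    ∀ᵐ t ∂volume.restrict (Ioo 0 T), |volF ρ k γ u (valL φ) t| ≤ c0 ρ k * linfNorm T u +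
      ((∫ x in Ioi 0, |d1zero (kerK (rFn ρ k γ)) x|) + |1 / 2 * ∫ ξ in Ioi 0, rFn ρ k γ ξ|) * ‖φ‖ := by
  obtain ⟨z, z', hz⟩ := admissible_one.exists_rep φ
  have hB : ∀ x, |z x| ≤ ‖φ‖ := hz.sq_le admissible_one
  filter_upwards [abs_le_linfNorm hu, self_mem_ae_restrict measurableSet_Ioo] with t h1 ht
  rw [volF_eq ρ k γ u hz ht.1]
  refine (abs_add_le _ _).trans (add_le_add ?_ ((abs_sub _ _).trans ?_))
  · rw [abs_mul, abs_of_pos h.c0_pos]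
    exact mul_le_mul_of_nonneg_left h1 h.c0_pos.le
  · have h2 : |∫ x in Ioi 0, d1zero (kerK (rFn ρ k γ)) x * heatConv z t x| ≤
        ∫ x in Ioi 0, |d1zero (kerK (rFn ρ k γ)) x| * ‖φ‖ :=
      norm_integral_le_of_norm_le
        (f := fun x => d1zero (kerK (rFn ρ k γ)) x * heatConv z t x) (hκ.abs.mul_const ‖φ‖) (Eventually.of_forall fun x =>
        (abs_mul _ _).le.trans
          (mul_le_mul_of_nonneg_left (abs_heatConv_le hB t x) (abs_nonneg _)))
    rw [integral_mul_const] at h2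
    rw [add_mul, add_comm, abs_mul]
    exact add_le_add h2 (mul_le_mul_of_nonneg_left (abs_heatConv_le hB t 0) (abs_nonneg _))

/-- The transformed control solves the Volterra equation. -/
theorem control110_solvesVolterra (h : Admissible ρ k γ)
    (hP : KernelPair (rFn ρ k γ) K K₁ K₂ L L₁ L₂ C) (hM : Maj (rFn ρ k γ) C c) {B : H1 ρ k → H1 1 1}
    (hB : ∀ φ f f', Rep φ f f' → Rep (B φ) (fwdExt L f) (fwdExtD L L₁ f f'))
    {T : ℝ} (hT : 0 < T) {u : ℝ → ℝ} {W0 : H1 ρ k} {W : ℝ → H1 ρ k}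
    (hW : IsSolution ρ k γ T u W0 W) :
    SolvesVolterra T (volF ρ k γ u (valL (B W0))) (volP ρ k γ) (control110 ρ k γ u W) := by
  have hZ := KernelPair.transform_isSolution h hP hM hB hT.le hW
  choose w w' hw using fun t => h.exists_rep (W t)
  have hz : ∀ t, Rep (B (W t)) (fwdExt L (w t)) (fwdExtD L L₁ (w t) (w' t)) := fun t =>
    hB _ _ _ (hw t)
  have hv : IntegrableOn (control110 ρ k γ u W) (Ioo 0 T) :=
    (intervalIntegrable_iff_integrableOn_Ioo_of_le hT.le).1 (hZ.intervalIntegrable hT.le)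
  filter_upwards [ae_intervalIntegrable_abel hT.le hv, self_mem_ae_restrict measurableSet_Ioo]
    with t h1 ht
  have h2 := hZ.volterra (m := 1 / 2 * ∫ ξ in Ioi 0, rFn ρ k γ ξ) hP.integrableOn_d1zero hz ht.1
    ht.2.le h1
  have h3 := hP.boundary_term hM (hw t).sob.continuous ((hw t).sob.memLp.restrict _)
    (fun l hl => fwdExt_of_nonneg L (w t) hl)
  have h4 : fwdOp K₁ (fwdExt L (w t)) 0 =
      ∫ x in Ioi 0, d1zero (kerK (rFn ρ k γ)) x * fwdExt L (w t) x := by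
    refine integral_congr_ae ?_
    filter_upwards [hP.regK.d1zero_ae hP.kerK_eq] with x hx
    rw [hx]
  -- The boundary term, read through `w`, is `u¹¹⁰ - c₀u`. Read through `Z` it is the trace
  -- functional of `IsSolution.volterra`, with `m = K(0,0)` and `κ = K_{y₁}(0,·)`. Equating the two
  -- gives the equation.
  rw [hP.diag 0 le_rfl, h4, h2] at h3
  rw [KernelPair.control110_eq h hP (hw t), ← h3, ← hW.init, volF_eq ρ k γ u (hz 0) ht.1, volP_eq]
  ring

end Control

end NeumannHeat

end

theorem mainTheorem5 (ρ k γ : ℝ → ℝ) (h : Admissible ρ k γ) :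
    -- the kernels `K` and `L` exist, are unique, and have the regularity used below
    (IsTransformationKernel (rFn ρ k γ) (kerK (rFn ρ k γ)) ∧
      (∀ K', IsTransformationKernel (rFn ρ k γ) K' →
        ∀ p ∈ OmBar, K' p.1 p.2 = kerK (rFn ρ k γ) p.1 p.2) ∧
      (Tendsto (rFn ρ k γ) atTop (𝓝 0) →
        Tendsto (fun p : ℝ × ℝ => deriv (fun y => kerK (rFn ρ k γ) y p.2) p.1) OmAtTop (𝓝 0) ∧
        Tendsto (fun p : ℝ × ℝ => deriv (fun y => kerK (rFn ρ k γ) p.1 y) p.2) OmAtTop (𝓝 0)) ∧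
      IsInverseKernel (kerK (rFn ρ k γ)) (kerL (rFn ρ k γ)) ∧
      (∀ L', IsInverseKernel (kerK (rFn ρ k γ)) L' →
        ∀ p ∈ OmBar, L' p.1 p.2 = kerL (rFn ρ k γ) p.1 p.2) ∧
      (∀ y, 0 ≤ y → MemLp (kerK (rFn ρ k γ) y) 2 (volume.restrict (Ioi y)) ∧
        MemLp (kerL (rFn ρ k γ) y) 2 (volume.restrict (Ioi y))) ∧
      (∀ x, 0 < x → DifferentiableWithinAt ℝ (fun y => kerK (rFn ρ k γ) y x) (Ici 0) 0 ∧
        DifferentiableWithinAt ℝ (fun y => kerL (rFn ρ k γ) y x) (Ici 0) 0) ∧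
      IntegrableOn (d1zero (kerK (rFn ρ k γ))) (Ioi 0) ∧
      MemLp (d1zero (kerK (rFn ρ k γ))) 2 (volume.restrict (Ioi 0)) ∧
      MemLp (d1zero (kerL (rFn ρ k γ))) 2 (volume.restrict (Ioi 0)) ∧
      ∃ M₁ > 0, KernelDerivBound (rFn ρ k γ) M₁) ∧
    ∃ E₂ > 0, ∀ M₁ > 0, KernelDerivBound (rFn ρ k γ) M₁ →
      -- the Volterra kernel is `O(t^{-1/2})`
      (∀ t > 0, |volP ρ k γ t| ≤
        (sigma0 (rFn ρ k γ) 0 + 2 * M₁ * Rconst (rFn ρ k γ)) / √(Real.pi * t)) ∧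
      ∃ E₃ > 0, ∀ T > 0, ∀ (u : ℝ → ℝ) (W0 : H1 ρ k) (W : ℝ → H1 ρ k),
        MemLinf T u → IsSolution ρ k γ T u W0 W →
        ∃ (Z0 : H1 1 1) (Z : ℝ → H1 1 1),
          -- `Z⁰ = T̂⁻¹ W⁰` and `Z(·,t) = T̂⁻¹ W(·,t)`
          (⇑(valL Z0) =ᵐ[volume] opTinv ρ k γ (valL W0) ∧
            opT ρ k γ (valL Z0) =ᵐ[volume] (valL W0)) ∧
          (∀ t ∈ Icc 0 T, ⇑(valL (Z t)) =ᵐ[volume] opTinv ρ k γ (valL (W t)) ∧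
            opT ρ k γ (valL (Z t)) =ᵐ[volume] (valL (W t))) ∧
          -- `Z` solves the constant-coefficient system with the control `u¹¹⁰ ∈ L^∞(0,T)`
          MemLinf T (control110 ρ k γ u W) ∧
          IsSolution 1 1 0 T (control110 ρ k γ u W) Z0 Z ∧
          -- `u¹¹⁰` is the unique solution in `L^∞(0,T)` of the Volterra equation
          SolvesVolterra T (volF ρ k γ u (valL Z0)) (volP ρ k γ) (control110 ρ k γ u W) ∧
          (∀ v : ℝ → ℝ, MemLinf T v → SolvesVolterra T (volF ρ k γ u (valL Z0)) (volP ρ k γ) v →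
            v =ᵐ[volume.restrict (Ioo 0 T)] control110 ρ k γ u W) ∧
          -- the estimates
          (∀ t ∈ Icc 0 T, ‖Z t‖ ≤ E₂ * ‖W t‖) ∧
          linfNorm T (control110 ρ k γ u W) ≤
            G1 ρ k γ M₁ T * (linfNorm T u + E₃ * ‖W0‖) := by
  have hr := h.kerPot
  obtain ⟨K, K₁, K₂, L, L₁, L₂, C, hP⟩ := hr.exists_kernelPair
  obtain ⟨c, hM⟩ := exists_maj hr hP.regK.pos
  obtain ⟨B, hB⟩ := KernelPair.exists_transform h hP hM
  have hκ := hP.integrableOn_d1zero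
  have hb := opBound_nonneg hM
  have hc0 := h.c0_pos
  -- The norm bound for `1+L` on `H¹`; it depends on `r` only.
  obtain ⟨E₂, hE⟩ : ∃ E, E = √(2 + 8 * opBound (rFn ρ k γ) C c) := ⟨_, rfl⟩
  have hE0 : 0 < E₂ := hE ▸ Real.sqrt_pos.2 (by linarith)
  have hBn : ∀ φ, ‖B φ‖ ≤ E₂ * ‖φ‖ := fun φ => hE ▸ KernelPair.transform_norm_le h hP hM hB φ
  refine ⟨kernel_statement hr, E₂, hE0, fun M₁ hM₁ hD => ?_⟩
  have hA := hP.voltKer_const_le hM₁.le hD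
  refine ⟨fun t ht => (abs_voltKer_le hκ ht).trans
    (div_le_div_of_nonneg_right hA (Real.sqrt_nonneg _)), ?_⟩
  -- `A` bounds the part of the free term that involves `Z⁰` and is at most `σ₀(0) + 2M₁R`.
  obtain ⟨A, hAe⟩ : ∃ A, A = (∫ x in Ioi 0, |d1zero (kerK (rFn ρ k γ)) x|) +
    |1 / 2 * ∫ ξ in Ioi 0, rFn ρ k γ ξ| := ⟨_, rfl⟩
  have hA0 : 0 ≤ A := hAe ▸ add_nonneg (integral_nonneg fun _ => abs_nonneg _) (abs_nonneg _)
  obtain ⟨N, hN⟩ : ∃ N, N = sigma0 (rFn ρ k γ) 0 + 2 * M₁ * Rconst (rFn ρ k γ) := ⟨_, rfl⟩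
  rw [← hN, ← hAe] at hA
  have hE3 : 0 ≤ A * E₂ / c0 ρ k := by positivity
  -- `‖Z⁰‖ ≤ E₂‖W⁰‖` gives `A E₂`; the division by `c₀` compensates for the factor `c₀` in `G₁`, and
  -- the added one only ensures positivity.
  refine ⟨A * E₂ / c0 ρ k + 1, by positivity, fun T hT u W0 W hu hW => ?_⟩
  have hW0 : IsEven W0 := hW.init ▸ hW.even 0 ⟨le_rfl, hT.le⟩
  have hZ := KernelPair.transform_isSolution h hP hM hB hT.le hW
  have hS := control110_solvesVolterra h hP hM hB hT hW
  have hv := (intervalIntegrable_iff_integrableOn_Ioo_of_le hT.le).1 (hZ.intervalIntegrable hT.le)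
  have hF0 : 0 ≤ c0 ρ k * linfNorm T u + A * ‖B W0‖ :=
    add_nonneg (mul_nonneg hc0.le ENNReal.toReal_nonneg) (by positivity)
  have hF := abs_volF_le h hκ hu (B W0)
  rw [← hAe] at hF
  have hbd := SolvesVolterra.bound hκ (hAe ▸ hA) hT hv hF0 hF hS
  have hNn : 0 ≤ N := hA0.trans hA
  -- Boundedness of `u¹¹⁰` is a consequence of the Volterra inequality; up to this point the control
  -- is only known to be integrable.
  have hL : MemLinf T (control110 ρ k γ u W) :=
    memLp_top_of_bound hv.aestronglyMeasurable _ hbd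
  refine ⟨B W0, fun t => B (W t), ⟨KernelPair.transform_opTinv h hP hB W0,
    KernelPair.opT_transform h hP hM hB hW0⟩, fun t ht => ⟨KernelPair.transform_opTinv h hP hB (W t),
      KernelPair.opT_transform h hP hM hB (hW.even t ht)⟩, hL, hZ, hS,
    fun v hv' hSv => SolvesVolterra.unique hκ hT hv'.integrableOn hv hSv hS,
    fun t _ => hBn (W t), ?_⟩
  refine (linfNorm_le (by positivity) hbd).trans ?_
  have h1 : c0 ρ k * linfNorm T u + A * ‖B W0‖ ≤
      c0 ρ k * (linfNorm T u + (A * E₂ / c0 ρ k + 1) * ‖W0‖) := by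
    have e : c0 ρ k * (linfNorm T u + (A * E₂ / c0 ρ k + 1) * ‖W0‖) =
        c0 ρ k * linfNorm T u + A * (E₂ * ‖W0‖) + c0 ρ k * ‖W0‖ := by
      field_simp
      ring
    rw [e]
    have h2 := mul_le_mul_of_nonneg_left (hBn W0) hA0
    have h3 := mul_nonneg hc0.le (norm_nonneg W0)
    linarith
  rw [G1, ← hN]
  have h4 : 0 ≤ (1 + 2 * √(T / Real.pi) * N) * Real.exp (N ^ 2 * T) := by positivity
  have h5 := mul_le_mul_of_nonneg_right h1 h4
  linarith
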